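/- **Setting.** Let $P$ be a hyperbolic 3-holed sphere with geodesic boundary components $L_1,L_2,L_3$ (with the boundary orientation), glued from two copies of a right-angled hexagon along three alternate sides. Let $\Pi:\tilde P\to P$ be its universal covering, with $\tilde P\subset\mathbb H^2$ convex, let $\Pi_*$ be the derivative of $\Pi$, and let $S(\cdot)$ denote unit tangent bundles. Let $Q\subset\tilde P$ be a lift of one hexagon, with sides on complete geodesics $\tilde L_i$ (over $L_i$) and on $M_i^*$, the common perpendicular of $\tilde L_j$ and $\tilde L_k$ ($i,j,k$ distinct), where the cyclic order $\tilde L_1,\tilde L_2,\tilde L_3$ agrees with the orientation of $Q$. Let $R_i$ be the reflection in $M_i^*$. The deck transformation $\gamma_i=R_{i+2}R_{i+1}$ (indices mod 3) corresponds to the oriented loop $L_i$. Let $M_i$ be the image in $P$ of the side of $Q$ on $M_i^*$, that is, the shortest path joining $L_j$ and $L_k$, and let $B_i$ be the shortest essential path from $L_i$ to itself, that is, the image of the common perpendicular of $\tilde L_i$ and $R_i(\tilde L_i)$. Put $l=\operatorname{length}(L_2)$, $m=\operatorname{length}(M_3)$. In the upper half plane, normalize by an isometry so that $\tilde L_2$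 goes from $\infty$ to $0$, $\tilde L_3$ has end points $e<f$, $\tilde L_1$ has end points $c<d$, with $0<e<f<c<d$, and $\gamma_2(c)=1$; then $c=e^{l}$ and $d=e^{l}\coth^2(m/2)$. Let $\mu$ be the volume $dx\,dy\,d\theta/y^2$ on $S(\mathbb H^2)$, and the induced measure on $S(P)$. **The set $W(L_2,M_3)$.** For $v\in S(P)$ let the two geodesic rays in the directions $v$ and $-v$ grow at equal speed. The ray that first reaches $\partial P$, or hits what has been drawn so far, stops there; the other one continues until it reaches $\partial P$ or hits what has been drawn. (If the two tips meet each other, either ray may be taken as the one that stops.) The resulting geodesic path, directed by $v$, is $G_P(v)^\circ$. A geodesic path $\alpha:[T_1,T_2]\to P$ is a *positively oriented lasso* if $\alpha(T_1)\in\partial P$, $\alpha$ is injective on $(T_1,T_2)$, and $\alpha(T_3)=\alpha(T_2)$ for some $T_1\le T_3<T_2$; its base point is $\alpha(T_1)$ and its loop is $\alpha|_{[T_3,T_2]}$. For a path $\alpha$ in $P$ with end points in $\partial P$, let $H(\alpha)$ be the set of unit tangent vectors of geodesic paths in $P$ with end points in $\partial P$ that are homotopic to $\alpha$ as maps into $(P,\partial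 P)$. Then $W(L_2,M_3)$ is the set of all $v\in S(P)$ such that $G_P(v)^\circ$ is a positively oriented lasso with base point on $L_1$ and loop freely homotopic to $L_2$ in $P$, and $v\notin\bigcup_{n=1}^3\big(H(M_n)\cup H(M_n^{-1})\cup H(B_n)\cup H(B_n^{-1})\big)$. A vector $v\in S(P)$ is *generic* if its geodesic leaves $P$ in finite time in both directions. **The set $\Omega_{2,3}$.** For $0<x<1$ and $e^{l}<y<e^{l}\coth^2(m/2)$ let $G[y,x]$ be the oriented geodesic of $\mathbb H^2$ from $y$ to $x$, let $q$ be its intersection point with $\tilde L_1$, and let $p$ be the point of $G[y,x]$ at which the Euclidean ray from $0$ through $p$ is tangent to the semicircle $G[y,x]$. Then $\Omega_{2,3}\subset S(\mathbb H^2)$ is the set of all unit tangent vectors of the geodesics $G[y,x]$ at the points of the segment from $q$ to $p$, end points included. **Statement.** $\Omega_{2,3}\subset S(\tilde P)$, and $\Pi_*$ is injective on $\Omega_{2,3}$ and maps it into $W(L_2,M_3)$. It restricts to a bijection from the set of vectors of $\Omega_{2,3}$ with generic image onto the set of generic vectors of $W(L_2,M_3)$, and $\mu\big(W(L_2,M_3)\setminus\Pi_*(\Omega_{2,3})\big)=0$.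 In particular, $\mu(W(L_2,M_3))=\mu(\Omega_{2,3})$. -/

import Mathlib

open Set Filter Topology MeasureTheory UpperHalfPlane

noncomputable section

namespace LassoSet

/-! ### Unit tangent vectors of the hyperbolic plane -/

/-- A unit tangent vector of the upper half plane: a base point `z` and a vector `w`, seen as a
complex number, whose hyperbolic length `|w| / Im z` is `1`. -/
@[ext]
structure UnitTangent where
  pt : ℍ
  vec : ℂ
  norm_vec : ‖vec‖ = pt.im

/-- The derivative of the isometry `z ↦ g • z` applied to a unit tangent vector. If `det g > 0`, the
isometry is `z ↦ (a z + b) / (c z + d)`, with derivative `det g / (c z + d) ^ 2`; if `det g < 0`,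
it is the complex conjugate of this map (`σ g` is the identity, respectively conjugation). -/
instance : SMul (GL (Fin 2) ℝ) UnitTangent where
  smul g v :=
    { pt := g • v.pt
      vec := σ g ((g.det.val : ℂ) / denom g v.pt ^ 2 * v.vec)
      norm_vec := by
        rw [norm_σ, norm_mul, norm_div, norm_pow, v.norm_vec, im_smul_eq_div_normSq,
          Complex.norm_real, Real.norm_eq_abs, Complex.normSq_eq_norm_sq]
        ring }

theorem smul_pt (g : GL (Fin 2) ℝ) (v : UnitTangent) : (g • v).pt = g • v.pt := rfl

theorem smul_vec (g : GL (Fin 2) ℝ) (v : UnitTangent) :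
    (g • v).vec = σ g ((g.det.val : ℂ) / denom g v.pt ^ 2 * v.vec) := rfl

instance : MulAction (GL (Fin 2) ℝ) UnitTangent where
  one_smul v := by
    ext
    · simp [smul_pt]
    · simp [smul_vec, σ, denom]
  mul_smul g h v := by
    ext
    · simp [smul_pt, mul_smul]
    · have h3 : (σ h) ((σ h) (denom g ↑(h • v.pt))) = denom g ↑(h • v.pt) := σ_sq _ _
      rw [smul_vec, smul_vec, smul_vec, smul_pt, σ_mul, denom_cocycle_σ]
      congr 1
      simp only [map_mul, map_div₀, map_pow, σ_ofReal, h3, Units.val_mul, Complex.ofReal_mul]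
      field_simp

instance : MeasurableSpace UnitTangent :=
  MeasurableSpace.comap (fun v => (v.pt, v.vec)) inferInstance

/-- The unit tangent vector at `z` of Euclidean angle `θ`. -/
def ofAngle (p : ℍ × ℝ) : UnitTangent where
  pt := p.1
  vec := p.1.im * Complex.exp (p.2 * Complex.I)
  norm_vec := by
    rw [norm_mul, Complex.norm_exp_ofReal_mul_I, mul_one, Complex.norm_real, Real.norm_eq_abs,
      abs_of_pos p.1.im_pos]

/-- The volume `μ` on the unit tangent bundle of the hyperbolic plane, `dx dy dθ / y ^ 2`, with
`θ` in `(0, 2π]` (`volume` on `ℍ` is the hyperbolic area `dx dy / y ^ 2`). -/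
def liouville : Measure UnitTangent :=
  Measure.map ofAngle ((volume : Measure ℍ).prod (volume.restrict (Ioc 0 (2 * Real.pi))))

/-! ### Geodesics of the hyperbolic plane

A complete unit speed geodesic is an isometric embedding `g : ℝ → ℍ`. -/

/-- `v = g'(t)`. -/
def HasVelocity (g : ℝ → ℍ) (t : ℝ) (v : UnitTangent) : Prop :=
  g t = v.pt ∧ HasDerivAt (fun s => (g s : ℂ)) v.vec t

/-- The action on unit tangent vectors is the derivative of the action on points. -/
theorem hasVelocity_smul (g : GL (Fin 2) ℝ) (k : ℝ → ℍ) (t : ℝ) (v : UnitTangent) (h : HasVelocity k t v) :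
    HasVelocity (fun s => g • k s) t (g • v) := by
  obtain ⟨h1, h2⟩ := h
  refine ⟨by simp [h1, smul_pt], ?_⟩
  have hd : denom g (k t : ℂ) ≠ 0 := denom_ne_zero g _
  have hn : HasDerivAt (fun s => num g (k s : ℂ)) (g 0 0 * v.vec) t :=
    (h2.const_mul _).add_const _
  have hde : HasDerivAt (fun s => denom g (k s : ℂ)) (g 1 0 * v.vec) t :=
    (h2.const_mul _).add_const _
  have hq := hn.div hde hd
  have := (σ g).toContinuousLinearEquiv.hasFDerivAt.comp_hasDerivAt t hq
  refine HasDerivAt.congr_deriv (f := fun s => ((g • k s : ℍ) : ℂ)) this ?_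
  rw [smul_vec]
  change σ g _ = σ g _
  congr 1
  rw [← h1]
  simp only [num, denom] at hd ⊢
  rw [Matrix.GeneralLinearGroup.val_det_apply, Matrix.det_fin_two]
  push_cast
  field_simp
  ring

/-- `g` is a unit speed parametrization of the oriented geodesic `G[y, x]`, with `x, y` real points
of the circle at infinity. -/
def IsGeodesicFromTo (g : ℝ → ℍ) (y x : ℝ) : Prop :=
  Isometry g ∧ Tendsto (fun t => (g t : ℂ)) atBot (𝓝 (y : ℂ)) ∧
    Tendsto (fun t => (g t : ℂ)) atTop (𝓝 (x : ℂ))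

/-- The complete geodesic with the real end points `c < d`. -/
def semicircle (c d : ℝ) : Set ℍ :=
  {z | ‖(z : ℂ) - (((c + d) / 2 : ℝ) : ℂ)‖ = (d - c) / 2}

/-- The distance between two subsets of the hyperbolic plane. -/
def setDist (A B : Set ℍ) : ℝ := sInf {r | ∃ z ∈ A, ∃ w ∈ B, r = dist z w}

/-- The translation length of an isometry. -/
def translationLength (g : GL (Fin 2) ℝ) : ℝ := ⨅ z : ℍ, dist z (g • z)

/-! ### The set `Ω` -/

def coth (x : ℝ) : ℝ := Real.cosh x / Real.sinh x

/-- The set `Ω_{2,3}` with `l = l₂` and `m = m₃`: unit vectors tangent to a geodesic `G[y, x]`, with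
`0 < x < 1` and `c < y < d`, where `c = e ^ l` and `d = e ^ l coth² (m / 2)`, at a point of the
segment from `q` to `p`. Here `q` is the point where `G[y, x]` meets the geodesic with end points
`c, d`, and `p` is the point where the Euclidean ray from `0` is tangent to `G[y, x]`. -/
def Omega (l m : ℝ) : Set UnitTangent :=
  {v | ∃ x y : ℝ, 0 < x ∧ x < 1 ∧ Real.exp l < y ∧ y < Real.exp l * coth (m / 2) ^ 2 ∧
    ∃ g : ℝ → ℍ, IsGeodesicFromTo g y x ∧ ∃ tq tp t : ℝ,
      g tq ∈ semicircle (Real.exp l) (Real.exp l * coth (m / 2) ^ 2) ∧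
      (∃ r : ℝ, HasDerivAt (fun s => (g s : ℂ)) (r * (g tp : ℂ)) tp) ∧
      tq ≤ t ∧ t ≤ tp ∧ HasVelocity g t v}

/-! ### Geodesics as walls, and the reflections in them -/

/-- The geodesic `a |z|² - 2 b Re z + c = 0`, together with the side on which the left hand side
is nonnegative. -/
structure Wall where
  a : ℝ
  b : ℝ
  c : ℝ
  disc_pos : 0 < b ^ 2 - a * c

namespace Wall

def side (w : Wall) (z : ℍ) : ℝ := w.a * Complex.normSq z - 2 * w.b * z.re + w.c

def line (w : Wall) : Set ℍ := {z | w.side z = 0}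

/-- The hyperbolic reflection in the geodesic, `z ↦ (b z̄ - c) / (a z̄ - b)`. A matrix of negative
determinant acts on `ℍ` by its Möbius transformation applied to the complex conjugate. -/
def reflection (w : Wall) : GL (Fin 2) ℝ :=
  Matrix.GeneralLinearGroup.mkOfDetNeZero !![w.b, -w.c; w.a, -w.b] (by
    have h := w.disc_pos
    rw [Matrix.det_fin_two_of]
    intro h0
    nlinarith)

end Wall

/-! ### Hyperbolic 3-holed spheres -/

/-- A hyperbolic 3-holed sphere with geodesic boundary, given as the union of two copies of a
right-angled hexagon glued along three alternate sides. The hexagon `Q` is given by the three other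
sides, which lie on pairwise disjoint geodesics, none of which separates the other two. Up to an
orientation preserving isometry these are `L̃₂ = G[∞, 0]`, `L̃₃ = G[e, f]`, `L̃₁ = G[c, d]` with
`0 < e < f < c < d`. -/
structure ThreeHoledSphere where
  e : ℝ
  f : ℝ
  c : ℝ
  d : ℝ
  e_pos : 0 < e
  e_lt_f : e < f
  f_lt_c : f < c
  c_lt_d : c < d

namespace ThreeHoledSphere

variable (P : ThreeHoledSphere)

/-- The geodesics `L̃ᵢ`. The indices `1, 2, 3` are taken modulo `3`. The nonnegative side is the one
of the hexagon. -/
def L : ZMod 3 → Wall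
  | 1 => ⟨1, (P.c + P.d) / 2, P.c * P.d, by
      nlinarith [P.c_lt_d, mul_pos (sub_pos.2 P.c_lt_d) (sub_pos.2 P.c_lt_d)]⟩
  | 2 => ⟨0, -1, 0, by norm_num⟩
  | 0 => ⟨1, (P.e + P.f) / 2, P.e * P.f, by
      nlinarith [P.e_lt_f, mul_pos (sub_pos.2 P.e_lt_f) (sub_pos.2 P.e_lt_f)]⟩

/-- The geodesics `Mᵢ*`: the common perpendicular of `L̃ⱼ` and `L̃ₖ`, where `i, j, k` are distinct.
The nonnegative side is the one of the hexagon. -/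
def M : ZMod 3 → Wall
  | 1 => ⟨1, 0, -(P.e * P.f), by
      have := P.e_pos; have := P.e_lt_f
      have : 0 < P.e * P.f := mul_pos (by linarith) (by linarith)
      linarith⟩
  | 2 => ⟨P.c + P.d - P.e - P.f, P.c * P.d - P.e * P.f,
      P.c * P.d * (P.e + P.f) - P.e * P.f * (P.c + P.d), by
      have := P.e_pos; have := P.e_lt_f; have := P.f_lt_c; have := P.c_lt_d
      have h : 0 < (P.c - P.e) * (P.c - P.f) * ((P.d - P.e) * (P.d - P.f)) :=
        mul_pos (mul_pos (by linarith) (by linarith)) (mul_pos (by linarith) (by linarith))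
      nlinarith [h]⟩
  | 0 => ⟨-1, 0, P.c * P.d, by
      have := P.e_pos; have := P.e_lt_f; have := P.f_lt_c; have := P.c_lt_d
      have : 0 < P.c * P.d := mul_pos (by linarith) (by linarith)
      linarith⟩

/-- The reflection `Rᵢ` in `Mᵢ*`. -/
def R (i : ZMod 3) : GL (Fin 2) ℝ := (P.M i).reflection

/-- The deck transformation `γᵢ = Rᵢ₊₂ Rᵢ₊₁`, which corresponds to the oriented loop `Lᵢ`. -/
def deck (i : ZMod 3) : GL (Fin 2) ℝ := P.R (i + 2) * P.R (i + 1)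

/-- The group of deck transformations. -/
def Γ : Subgroup (GL (Fin 2) ℝ) := Subgroup.closure (range P.deck)

/-- The right-angled hexagon `Q`. -/
def Q : Set ℍ := {z | ∀ i, 0 ≤ (P.L i).side z ∧ 0 ≤ (P.M i).side z}

/-- The universal cover `P̃`, a convex subset of the hyperbolic plane: the union of all images of
the hexagon under the group generated by the reflections `Rᵢ`. -/
def cover : Set ℍ := {z | ∃ r ∈ Subgroup.closure (range P.R), r • z ∈ P.Q}

/-- The complete hyperbolic surface `ℍ / Γ`, which contains `P = P̃ / Γ`. -/
abbrev Surface : Type := MulAction.orbitRel.Quotient P.Γ ℍ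

/-- The unit tangent bundle of `ℍ / Γ`, which contains `S(P) = S(P̃) / Γ`. -/
abbrev UnitTangentBundle : Type := MulAction.orbitRel.Quotient P.Γ UnitTangent

/-- The covering map `Π`. -/
def proj (z : ℍ) : P.Surface := Quotient.mk _ z

/-- The derivative `Π_*` of the covering map. -/
def projTangent (v : UnitTangent) : P.UnitTangentBundle := Quotient.mk _ v

/-- The surface `P`, as a subset of `ℍ / Γ`. -/
def carrier : Set P.Surface := P.proj '' P.cover

/-- The boundary component `Lᵢ` of `P`. -/
def boundaryComponent (i : ZMod 3) : Set P.Surface := P.proj '' (P.L i).line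

def boundary : Set P.Surface := ⋃ i, P.boundaryComponent i

/-- The volume `μ` on `S(P)`. The hexagon `Q` and its image under the reflection `R₃` together form
a fundamental domain of `Γ` in `P̃`. -/
def volumeSP : Measure P.UnitTangentBundle :=
  Measure.map P.projTangent (liouville.restrict {v | v.pt ∈ P.Q ∨ P.R 3 • v.pt ∈ P.Q})

/-- The length `lᵢ` of `Lᵢ`. -/
def l (i : ZMod 3) : ℝ := translationLength (P.deck i)

/-- The length `mᵢ` of the shortest path `Mᵢ`, the side of the hexagon on `Mᵢ*`, which joins
`L̃ᵢ₊₁` to `L̃ᵢ₊₂`. -/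
def m (i : ZMod 3) : ℝ := setDist (P.L (i + 1)).line (P.L (i + 2)).line

/-! ### Homotopies in `P` -/

/-- The paths `α : [a, b] → P` and `β : [a', b'] → P` with end points in `∂P` are homotopic as maps
of pairs into `(P, ∂P)`. -/
def PathHomotopic (α : ℝ → P.Surface) (a b : ℝ) (β : ℝ → P.Surface) (a' b' : ℝ) : Prop :=
  ∃ H : unitInterval × unitInterval → P.Surface, Continuous H ∧ (∀ p, H p ∈ P.carrier) ∧
    (∀ s, H (0, s) ∈ P.boundary ∧ H (1, s) ∈ P.boundary) ∧
    (∀ t : unitInterval, H (t, 0) = α (a + t * (b - a))) ∧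
    (∀ t : unitInterval, H (t, 1) = β (a' + t * (b' - a')))

/-- The loops `α : [a, b] → P` and `β : [a', b'] → P` are freely homotopic in `P`. -/
def LoopHomotopic (α : ℝ → P.Surface) (a b : ℝ) (β : ℝ → P.Surface) (a' b' : ℝ) : Prop :=
  ∃ H : unitInterval × unitInterval → P.Surface, Continuous H ∧ (∀ p, H p ∈ P.carrier) ∧
    (∀ s, H (0, s) = H (1, s)) ∧
    (∀ t : unitInterval, H (t, 0) = α (a + t * (b - a))) ∧
    (∀ t : unitInterval, H (t, 1) = β (a' + t * (b' - a')))

/-- `Π ∘ h` on `[0, lᵢ]` is the boundary loop `Lᵢ` with the boundary orientation. -/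
def IsBoundaryLoop (i : ZMod 3) (h : ℝ → ℍ) : Prop :=
  Isometry h ∧ (∀ t, h t ∈ (P.L i).line) ∧ ∀ t, h (t + P.l i) = P.deck i • h t

/-! ### The sets `H(α)` -/

/-- The set `H(α)` for a path `α : [0, r] → P`: all vectors `s'(t)`, where `s : [0, b] → P` is a
geodesic path with end points in `∂P` that is homotopic to `α`. A geodesic path in `P` is the
projection of a geodesic path in `P̃`. -/
def bridgemanSet (α : ℝ → P.Surface) (r : ℝ) : Set P.UnitTangentBundle :=
  {ν | ∃ (g : ℝ → ℍ) (b : ℝ), Isometry g ∧ 0 ≤ b ∧ (∀ t ∈ Icc 0 b, g t ∈ P.cover) ∧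
    P.proj (g 0) ∈ P.boundary ∧ P.proj (g b) ∈ P.boundary ∧
    P.PathHomotopic (fun t => P.proj (g t)) 0 b α 0 r ∧
    ∃ t ∈ Icc 0 b, ∃ v, HasVelocity g t v ∧ P.projTangent v = ν}

/-- `H(α) ∪ H(α⁻¹)`, where `α` is the projection of the shortest geodesic path from `A` to `B`. -/
def bridgemanSetBetween (A B : Set ℍ) : Set P.UnitTangentBundle :=
  {ν | ∃ h : ℝ → ℍ, Isometry h ∧ h 0 ∈ A ∧ h (setDist A B) ∈ B ∧
    (ν ∈ P.bridgemanSet (fun t => P.proj (h t)) (setDist A B) ∨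
      ν ∈ P.bridgemanSet (fun t => P.proj (h (setDist A B - t))) (setDist A B))}

/-- `H(Mᵢ) ∪ H(Mᵢ⁻¹)`. -/
def HM (i : ZMod 3) : Set P.UnitTangentBundle :=
  P.bridgemanSetBetween (P.L (i + 1)).line (P.L (i + 2)).line

/-- `H(Bᵢ) ∪ H(Bᵢ⁻¹)`, where `Bᵢ` is the shortest essential path from `Lᵢ` to itself. It consists of
the altitude of the hexagon from `L̃ᵢ` to `Mᵢ*` and its mirror image, so it lifts to the common
perpendicular of `L̃ᵢ` and `Rᵢ(L̃ᵢ)`. -/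
def HB (i : ZMod 3) : Set P.UnitTangentBundle :=
  P.bridgemanSetBetween (P.L i).line ((fun z => P.R i • z) '' (P.L i).line)

/-! ### The graph of a unit tangent vector -/

/-- The path `γ` leaves `P` at the time `t`, through a boundary point. -/
def ExitsAt (γ : ℝ → P.Surface) (t : ℝ) : Prop :=
  γ t ∈ P.boundary ∧ ∀ ε > 0, ∃ s ∈ Ioo t (t + ε), γ s ∉ P.carrier

/-- The two rays `t ↦ γ t` and `t ↦ γ (-t)`, `t ≥ 0`, grow from `γ 0` at equal speed. The forward
ray is the first one to stop, at the time `a`, either at `∂P` or where it hits what is already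
drawn. The backward ray goes on growing and stops at the time `b`, either at `∂P` or where it hits
what is already drawn. If the two rays first meet in their tips, the forward ray is stopped and
the backward ray is not. -/
structure ForwardFirst (γ : ℝ → P.Surface) (a b : ℝ) : Prop where
  nonneg : 0 ≤ a
  le : a ≤ b
  simple : ∀ s, 0 ≤ s → s < a → InjOn γ (Icc (-s) s)
  inside : ∀ s, 0 ≤ s → s < a → ¬ P.ExitsAt γ s ∧ ¬ P.ExitsAt (fun t => γ (-t)) s
  halts : P.ExitsAt γ a ∨ γ a ∈ γ '' Ico (-a) a
  inside' : ∀ s, a ≤ s → s < b → ¬ P.ExitsAt (fun t => γ (-t)) s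
  simple' : ∀ s, a ≤ s → s < b → γ (-s) ∉ γ '' {τ | -s < τ ∧ τ ≤ a ∧ τ < s}
  halts' : P.ExitsAt (fun t => γ (-t)) b ∨ γ (-b) ∈ γ '' {τ | -b < τ ∧ τ ≤ a ∧ τ < b}

/-- `G_P(v)°` is the path `γ` on `[-b, a]`, where `γ` is the geodesic with `γ'(0) = v`. The path is
unique, unless the two rays first meet in their tips: then either ray may be the one that stops. -/
def IsGraph (γ : ℝ → P.Surface) (a b : ℝ) : Prop :=
  P.ForwardFirst γ a b ∨ P.ForwardFirst (fun t => γ (-t)) b a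

/-- `α : [T₁, T₂] → P` is a positively oriented lasso with base point `α T₁`, knot
`α T₃ = α T₂` and loop `α` on `[T₃, T₂]`. -/
structure IsPositiveLasso (α : ℝ → P.Surface) (T₁ T₃ T₂ : ℝ) : Prop where
  mem : ∀ t ∈ Icc T₁ T₂, α t ∈ P.carrier
  base : α T₁ ∈ P.boundary
  injOn : InjOn α (Ioo T₁ T₂)
  le : T₁ ≤ T₃
  lt : T₃ < T₂
  knot : α T₃ = α T₂

/-- The set `W(Lᵢ, Mⱼ)`, for `i ≠ j`, of all `v ∈ S(P)` such that `G_P(v)°` is a positively oriented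
lasso whose loop is homotopic to `Lᵢ` and whose base point is on `Lₖ`, where `i, j, k` are distinct
(so that `i + j + k = 0` modulo `3`), and such that `v` is in none of the sets `H(Mₙ^{±1})`,
`H(Bₙ^{±1})`. -/
def W (i j : ZMod 3) : Set P.UnitTangentBundle :=
  {ν | (∃ (v : UnitTangent) (g : ℝ → ℍ), v.pt ∈ P.cover ∧ P.projTangent v = ν ∧
      Isometry g ∧ HasVelocity g 0 v ∧
      ∃ a b T₃ : ℝ, P.IsGraph (fun t => P.proj (g t)) a b ∧
        P.IsPositiveLasso (fun t => P.proj (g t)) (-b) T₃ a ∧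
        P.proj (g (-b)) ∈ P.boundaryComponent (-(i + j)) ∧
        ∃ h : ℝ → ℍ, P.IsBoundaryLoop i h ∧
          P.LoopHomotopic (fun t => P.proj (g t)) T₃ a (fun t => P.proj (h t)) 0 (P.l i)) ∧
    ∀ n, ν ∉ P.HM n ∧ ν ∉ P.HB n}

/-- The generic vectors of `S(P)`: the geodesic leaves `P` in finite time in both directions. -/
def generic : Set P.UnitTangentBundle :=
  {ν | ∃ (v : UnitTangent) (g : ℝ → ℍ), v.pt ∈ P.cover ∧ P.projTangent v = ν ∧
    Isometry g ∧ HasVelocity g 0 v ∧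
    (∃ t > 0, P.proj (g t) ∉ P.carrier) ∧ ∃ t > 0, P.proj (g (-t)) ∉ P.carrier}

end ThreeHoledSphere

end LassoSet

end

noncomputable section

namespace LassoSet

/-! ### The action of `GL(2, ℝ)` in coordinates -/

/-! The normalization says `e * f = d`. Then `γ₂` is `z ↦ z / c`, the relevant real points are
ordered `1 < d/c < e < f < c < d`, and `R₁(L̃₁)` is the arc over `[1, d/c]`. The reflection group is
handled through reduced words, up to matrices that act trivially. Ping-pong makes the region between
the `Mᵢ*` a strict fundamental domain, shows that `P̃` is the intersection of the half planes
bounded by the lifts of `∂P` (`mem_cover_iff`), and makes `ℍ → ℍ / Γ` a covering, so that homotopies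
in `P` can be lifted.

From `Ω` to `W`: a geodesic `g = G[y, x]` meets its images under `z ↦ c z` and `z ↦ z / c` where
`|z|² = x y c` and `|z|² = x y / c`, at times `s < t` with `g t = γ₂ (g s)`. The tangency point `p`
has `|z|² = x y` and is the midpoint in time. So `g` projects on `[q, t]` to a lasso around `L₂`,
and the condition that a vector lies before `p` is exactly what makes its two growing rays draw this
lasso. The lasso is simple (`IsLassoArc.eq_of_smul_eq`): by `exists_decomposition` a deck
transformation is a power of `γ₂`, which is treated by computation; or `γ₂ⁱ γ₁ⁿ γ₂ʲ`, which pushes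
the segment into the wedge between `g` and `c g`, a region that the `γ₂`-translates avoid; or a
longer word, excluded by ping-pong. The lasso stays in `P̃` because its tangency point does
(`IsLassoArc.tangent_mem_cover`). It is in no `H(Mₙ)` or `H(Bₙ)`, because the end of `g` near `x <
1` is not cut off by any lift that such a path from `L̃₁` could reach
(`IsLassoArc.not_pathHomotopic`).

From `W` to `Ω`: lifting the homotopy of the loop, a vector of `W` comes from some `g` from `y` to
`x`, `0 < x < y`, with `g t = γ₂ (g s)`. The base point is on some lift of `L₁`; the essential step
is that this is a `γ₂`-translate of `L̃₁` (`IsSimpleLasso.exists_base`). For a simple lasso, a deck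
translate of its chain of `γ₂`-translates is either wholly in a wedge or wholly outside
(`IsSimpleLasso.mem_wedge`); a base point on any other lift would give a chain that is partly
inside, or that stays in a bounded part of the plane. Once the base is on `L̃₁`, one has `c < y <
d`, and `x` decides: `x < 1` gives `Ω`; `x > 1` means that `g` leaves through `R₁(L̃₁)`, which puts
the vector in `H(B₁)`; and `x = 1` gives geodesics that never leave `P̃` in the forward direction,
which are not generic and form a null set.

The volumes agree because `Q` and its mirror image form a fundamental domain for the deck group, the
Liouville measure is invariant, and `Π_*` is injective on `Ω`. -/

theorem normSq_coe (z : ℍ) : Complex.normSq (z : ℂ) = z.re ^ 2 + z.im ^ 2 := by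
  rw [Complex.normSq_apply]
  simp only [coe_re, coe_im]
  ring

/-- The squared norm of `denom g z`. -/
def denomSq (g : GL (Fin 2) ℝ) (z : ℍ) : ℝ := (g 1 0 * z.re + g 1 1) ^ 2 + (g 1 0 * z.im) ^ 2

theorem normSq_denom (g : GL (Fin 2) ℝ) (z : ℍ) :
    Complex.normSq (denom g z) = denomSq g z := by
  rw [Complex.normSq_apply, denom, denomSq]
  simp
  ring

theorem denomSq_pos (g : GL (Fin 2) ℝ) (z : ℍ) : 0 < denomSq g z := by
  rw [← normSq_denom]
  exact normSq_denom_pos g z.im_ne_zero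

theorem smul_re_mul (g : GL (Fin 2) ℝ) (z : ℍ) :
    (g • z).re * denomSq g z =
      (g 0 0 * z.re + g 0 1) * (g 1 0 * z.re + g 1 1) + g 0 0 * g 1 0 * z.im ^ 2 := by
  have h := (denomSq_pos g z).ne'
  rw [re_smul, Complex.div_re, normSq_denom]
  simp only [num, denom, Complex.add_re, Complex.mul_re, Complex.ofReal_re, Complex.ofReal_im,
    Complex.add_im, Complex.mul_im, coe_re, coe_im]
  field_simp
  ring

theorem smul_im_mul (g : GL (Fin 2) ℝ) (z : ℍ) :
    (g • z).im * denomSq g z = |g 0 0 * g 1 1 - g 0 1 * g 1 0| * z.im := by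
  have h := (denomSq_pos g z).ne'
  rw [im_smul_eq_div_normSq, normSq_denom, Matrix.GeneralLinearGroup.val_det_apply,
    Matrix.det_fin_two]
  field_simp

theorem det_entries (g : GL (Fin 2) ℝ) : g.det.val = g 0 0 * g 1 1 - g 0 1 * g 1 0 := by
  rw [Matrix.GeneralLinearGroup.val_det_apply, Matrix.det_fin_two]

theorem det_entries_ne (g : GL (Fin 2) ℝ) : g 0 0 * g 1 1 - g 0 1 * g 1 0 ≠ 0 := by
  rw [← det_entries]
  exact g.det.ne_zero

theorem smul_normSq_mul (g : GL (Fin 2) ℝ) (z : ℍ) :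
    ((g • z).re ^ 2 + (g • z).im ^ 2) * denomSq g z =
      (g 0 0 * z.re + g 0 1) ^ 2 + (g 0 0 * z.im) ^ 2 := by
  have h := (denomSq_pos g z)
  have h1 := smul_re_mul g z
  have h2 := smul_im_mul g z
  have h3 : |g 0 0 * g 1 1 - g 0 1 * g 1 0| ^ 2 = (g 0 0 * g 1 1 - g 0 1 * g 1 0) ^ 2 := sq_abs _
  have key : (((g • z).re ^ 2 + (g • z).im ^ 2) * denomSq g z) * denomSq g z =
      ((g 0 0 * z.re + g 0 1) ^ 2 + (g 0 0 * z.im) ^ 2) * denomSq g z := by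
    calc (((g • z).re ^ 2 + (g • z).im ^ 2) * denomSq g z) * denomSq g z
        = ((g • z).re * denomSq g z) ^ 2 + ((g • z).im * denomSq g z) ^ 2 := by ring
      _ = _ := by rw [h1, h2, mul_pow, h3, denomSq]; ring
  exact mul_right_cancel₀ h.ne' key

theorem dist_smul_smul (g : GL (Fin 2) ℝ) (z w : ℍ) : dist (g • z) (g • w) = dist z w := by
  have hc : Real.cosh (dist (g • z) (g • w)) = Real.cosh (dist z w) := by
    rw [cosh_dist', cosh_dist', div_eq_div_iff (by positivity) (by positivity)]
    have hz := denomSq_pos g z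
    have hw := denomSq_pos g w
    have z1 := smul_re_mul g z
    have z2 := smul_im_mul g z
    have z3 := smul_normSq_mul g z
    have w1 := smul_re_mul g w
    have w2 := smul_im_mul g w
    have w3 := smul_normSq_mul g w
    have h3 : |g 0 0 * g 1 1 - g 0 1 * g 1 0| ^ 2 = (g 0 0 * g 1 1 - g 0 1 * g 1 0) ^ 2 :=
      sq_abs _
    refine mul_right_cancel₀ (mul_pos hz hw).ne' ?_
    calc _ = (((g • z).re ^ 2 + (g • z).im ^ 2) * denomSq g z * denomSq g w
          + ((g • w).re ^ 2 + (g • w).im ^ 2) * denomSq g w * denomSq g z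
          - 2 * ((g • z).re * denomSq g z) * ((g • w).re * denomSq g w)) *
            (2 * z.im * w.im) := by ring
      _ = ((z.re - w.re) ^ 2 + z.im ^ 2 + w.im ^ 2) *
            |g 0 0 * g 1 1 - g 0 1 * g 1 0| ^ 2 * (2 * z.im * w.im) := by
          rw [z1, w1, z3, w3, h3, denomSq, denomSq]; ring
      _ = ((z.re - w.re) ^ 2 + z.im ^ 2 + w.im ^ 2) *
            (2 * ((g • z).im * denomSq g z) * ((g • w).im * denomSq g w)) := by
          rw [z2, w2]; ring
      _ = _ := by ring
  exact Real.cosh_injOn (mem_Ici.2 dist_nonneg) (mem_Ici.2 dist_nonneg) hc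

theorem isometry_smul_comp (k : GL (Fin 2) ℝ) {g : ℝ → ℍ} (hg : Isometry g) :
    Isometry fun t => k • g t :=
  Isometry.of_dist_eq fun s t => by rw [dist_smul_smul, hg.dist_eq]

theorem continuous_smul_gl (k : GL (Fin 2) ℝ) : Continuous fun z : ℍ => k • z :=
  (Isometry.of_dist_eq fun z w => dist_smul_smul k z w).continuous

/-! ### Classification of geodesics -/

/-- The point `i e ^ t`. -/
def expI (t : ℝ) : ℍ := ⟨⟨0, Real.exp t⟩, Real.exp_pos t⟩

@[simp] theorem expI_re (t : ℝ) : (expI t).re = 0 := rfl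
@[simp] theorem expI_im (t : ℝ) : (expI t).im = Real.exp t := rfl

theorem isometry_expI : Isometry expI := isometry_vertical_line 0

/-- The matrix with the given entries and nonzero determinant. -/
def glMk (a b c d : ℝ) (h : a * d - b * c ≠ 0) : GL (Fin 2) ℝ :=
  Matrix.GeneralLinearGroup.mkOfDetNeZero !![a, b; c, d] (by rwa [Matrix.det_fin_two_of])

section
variable {a b c d : ℝ} (h : a * d - b * c ≠ 0)
@[simp] theorem glMk_00 : glMk a b c d h 0 0 = a := rfl
@[simp] theorem glMk_01 : glMk a b c d h 0 1 = b := rfl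
@[simp] theorem glMk_10 : glMk a b c d h 1 0 = c := rfl
@[simp] theorem glMk_11 : glMk a b c d h 1 1 = d := rfl
theorem det_glMk : (glMk a b c d h).det.val = a * d - b * c := by rw [det_entries]; rfl
end

theorem eq_smul_expI_iff (A : GL (Fin 2) ℝ) (z : ℍ) (t : ℝ) :
    z = A • expI t ↔
      z.re * (A 1 1 ^ 2 + A 1 0 ^ 2 * Real.exp t ^ 2) =
        A 0 1 * A 1 1 + A 0 0 * A 1 0 * Real.exp t ^ 2 ∧
      z.im * (A 1 1 ^ 2 + A 1 0 ^ 2 * Real.exp t ^ 2) =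
        |A 0 0 * A 1 1 - A 0 1 * A 1 0| * Real.exp t := by
  have hN : denomSq A (expI t) = A 1 1 ^ 2 + A 1 0 ^ 2 * Real.exp t ^ 2 := by
    simp [denomSq]; ring
  have h0 := (denomSq_pos A (expI t)).ne'
  have h1 := smul_re_mul A (expI t)
  have h2 := smul_im_mul A (expI t)
  simp only [hN, expI_re, expI_im] at h0 h1 h2
  constructor
  · rintro rfl
    constructor
    · rw [h1]; ring
    · rw [h2]
  · rintro ⟨h3, h4⟩
    refine ext_re_im (mul_right_cancel₀ h0 ?_) (mul_right_cancel₀ h0 ?_)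
    · rw [h1, h3]; ring
    · rw [h2, h4]

theorem exists_gl_two_points (z w : ℍ) :
    ∃ A : GL (Fin 2) ℝ, 0 < A.det.val ∧ ∃ s t : ℝ, z = A • expI s ∧ w = A • expI t := by
  have hz := z.im_pos
  have hw := w.im_pos
  by_cases hr : z.re = w.re
  · refine ⟨glMk 1 z.re 0 1 (by norm_num), by rw [det_glMk]; norm_num, Real.log z.im,
      Real.log w.im, ?_, ?_⟩ <;> rw [eq_smul_expI_iff] <;>
      simp [Real.exp_log, hz, hw, hr]
  · -- the semicircle through both points, with centre `m` and radius `ρ`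
    set m : ℝ := (z.re ^ 2 + z.im ^ 2 - w.re ^ 2 - w.im ^ 2) / (2 * (z.re - w.re)) with hm
    have hzw : z.re - w.re ≠ 0 := sub_ne_zero.2 hr
    set ρ : ℝ := Real.sqrt ((z.re - m) ^ 2 + z.im ^ 2) with hρ
    have hρ0 : 0 < ρ := Real.sqrt_pos.2 (by positivity)
    have hρz : (z.re - m) ^ 2 + z.im ^ 2 = ρ ^ 2 := (Real.sq_sqrt (by positivity)).symm
    have hρw : (w.re - m) ^ 2 + w.im ^ 2 = ρ ^ 2 := by
      rw [← hρz]
      have : 2 * m * (z.re - w.re) = z.re ^ 2 + z.im ^ 2 - w.re ^ 2 - w.im ^ 2 := by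
        rw [hm]; field_simp
      nlinarith
    -- The matrix used below sends `0` and `∞` to the end points `m - ρ` and `m + ρ` of the
    -- semicircle.
    have hdet : (m + ρ) * 1 - (m - ρ) * 1 ≠ 0 := by linarith
    have key : ∀ u : ℍ, (u.re - m) ^ 2 + u.im ^ 2 = ρ ^ 2 →
        ∃ t : ℝ, u = glMk (m + ρ) (m - ρ) 1 1 hdet • expI t := by
      intro u hu
      have hup := u.im_pos
      have h1 : u.re - m < ρ := by nlinarith
      have h2 : 0 < m + ρ - u.re := by linarith
      refine ⟨Real.log (u.im / (m + ρ - u.re)), ?_⟩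
      rw [eq_smul_expI_iff, Real.exp_log (by positivity)]
      simp only [glMk_00, glMk_01, glMk_10, glMk_11]
      rw [abs_of_pos (by linarith)]
      have h2' := h2.ne'
      constructor
      · field_simp
        nlinarith
      · field_simp
        nlinarith
    obtain ⟨s, hs⟩ := key z hρz
    obtain ⟨t, ht⟩ := key w hρw
    exact ⟨_, by rw [det_glMk]; linarith, s, t, hs, ht⟩

theorem smul_expI_add (s t : ℝ) :
    expI (s + t) = glMk (Real.exp s) 0 0 1 (by simp) • expI t := by
  rw [eq_smul_expI_iff]
  simp [Real.exp_add]

theorem smul_expI_sub (s t : ℝ) :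
    expI (s - t) = glMk 0 (-Real.exp s) 1 0 (by simp) • expI t := by
  rw [eq_smul_expI_iff]
  simp [Real.exp_sub]
  field_simp

/-- Every unit speed geodesic is the image of `t ↦ i e ^ t` under an orientation preserving
isometry. -/
theorem exists_smul_expI {g : ℝ → ℍ} (hg : Isometry g) :
    ∃ A : GL (Fin 2) ℝ, 0 < A.det.val ∧ ∀ t, g t = A • expI t := by
  obtain ⟨A, hA, s, t, hs, ht⟩ := exists_gl_two_points (g 0) (g 1)
  have hd : dist s t = 1 := by
    have := hg.dist_eq 0 1
    rw [hs, ht, dist_smul_smul, isometry_expI.dist_eq] at this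
    rw [this]; simp
  -- normalize so that the two points are `i` and `i e`
  obtain ⟨B, hB, hB0, hB1⟩ : ∃ B : GL (Fin 2) ℝ, 0 < B.det.val ∧ g 0 = B • expI 0 ∧
      g 1 = B • expI 1 := by
    rw [Real.dist_eq] at hd
    rcases abs_eq (by norm_num : (0 : ℝ) ≤ 1) |>.1 hd with h | h
    · refine ⟨A * glMk 0 (-Real.exp s) 1 0 (by simp), ?_, ?_, ?_⟩
      · rw [map_mul, Units.val_mul, det_glMk]
        have := Real.exp_pos s
        exact mul_pos hA (by linarith)
      · rw [mul_smul, ← smul_expI_sub, hs, sub_zero]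
      · rw [mul_smul, ← smul_expI_sub, ht, show s - 1 = t by linarith]
    · refine ⟨A * glMk (Real.exp s) 0 0 1 (by simp), ?_, ?_, ?_⟩
      · rw [map_mul, Units.val_mul, det_glMk]
        have := Real.exp_pos s
        exact mul_pos hA (by linarith)
      · rw [mul_smul, ← smul_expI_add, hs, add_zero]
      · rw [mul_smul, ← smul_expI_add, ht, show s + 1 = t by linarith]
  refine ⟨B, hB, fun t => ?_⟩
  rw [← inv_smul_eq_iff]
  -- A point at the same distances from `i` and `e i` as `i e ^ t` is that point: the difference of
  -- the two circle equations gives the imaginary part, and then the real part vanishes.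
  set z := B⁻¹ • g t with hz
  have h0 : dist z (expI 0) = dist t 0 := by
    rw [hz, ← hg.dist_eq t 0, hB0, ← dist_smul_smul B⁻¹ (g t), inv_smul_smul]
  have h1 : dist z (expI 1) = dist t 1 := by
    rw [hz, ← hg.dist_eq t 1, hB1, ← dist_smul_smul B⁻¹ (g t), inv_smul_smul]
  rw [← isometry_expI.dist_eq t] at h0 h1
  have c0 := congrArg Real.cosh h0
  have c1 := congrArg Real.cosh h1
  rw [cosh_dist', cosh_dist'] at c0 c1
  simp only [expI_re, expI_im, Real.exp_zero, sub_zero] at c0 c1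
  have hzp := z.im_pos
  have ht := Real.exp_pos t
  have he : (1 : ℝ) < Real.exp 1 := by simp
  set E := Real.exp 1
  set T := Real.exp t
  rw [div_eq_div_iff (by positivity) (by positivity)] at c0 c1
  have e0 : (z.re ^ 2 + z.im ^ 2 + 1) * T = (T ^ 2 + 1) * z.im := by linarith
  have e1 : (z.re ^ 2 + z.im ^ 2 + E ^ 2) * T = (T ^ 2 + E ^ 2) * z.im := by
    have : ((z.re ^ 2 + z.im ^ 2 + E ^ 2) * T) * E = ((T ^ 2 + E ^ 2) * z.im) * E := by linarith
    exact mul_right_cancel₀ (by positivity) this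
  have e2 : (E ^ 2 - 1) * (T - z.im) = 0 := by linarith
  have e3 : z.im = T := by
    rcases mul_eq_zero.1 e2 with h | h
    · nlinarith
    · linarith
  have e4 : z.re = 0 := by
    rw [e3] at e0
    have : z.re ^ 2 * T = 0 := by linarith
    simpa [ht.ne'] using this
  exact ext_re_im e4 e3

theorem det_pos_of_eq {A : GL (Fin 2) ℝ} (h : 0 < A.det.val) :
    0 < A 0 0 * A 1 1 - A 0 1 * A 1 0 := by rwa [det_entries] at h

/-- The unit tangent vector of `t ↦ i e ^ t`. -/
def expITangent (t : ℝ) : UnitTangent where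
  pt := expI t
  vec := ⟨0, Real.exp t⟩
  norm_vec := by
    simp [Complex.norm_def, Complex.normSq_apply, Real.sqrt_mul_self (Real.exp_pos t).le]

theorem hasVelocity_expI (t : ℝ) : HasVelocity expI t (expITangent t) := by
  refine ⟨rfl, ?_⟩
  have h : HasDerivAt (fun s : ℝ => (Real.exp s : ℂ) * Complex.I) (Real.exp t * Complex.I) t :=
    ((Real.hasDerivAt_exp t).ofReal_comp).mul_const _
  convert h using 1
  · ext s
    apply Complex.ext <;> simp [expI, -Complex.ofReal_exp]
  · apply Complex.ext <;> simp [expITangent, -Complex.ofReal_exp]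

theorem HasVelocity.unique {g : ℝ → ℍ} {t : ℝ} {v w : UnitTangent} (hv : HasVelocity g t v)
    (hw : HasVelocity g t w) : v = w :=
  UnitTangent.ext (hv.1.symm.trans hw.1) (hv.2.unique hw.2)

theorem isometry_comp_add {g : ℝ → ℍ} (hg : Isometry g) (s : ℝ) : Isometry fun t => g (t + s) :=
  Isometry.of_dist_eq fun a b => by rw [hg.dist_eq]; simp

theorem isometry_comp_sub {g : ℝ → ℍ} (hg : Isometry g) (s : ℝ) : Isometry fun t => g (s - t) :=
  Isometry.of_dist_eq fun a b => by rw [hg.dist_eq, dist_sub_left]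

theorem HasVelocity.comp_add {g : ℝ → ℍ} {t s : ℝ} {v : UnitTangent}
    (h : HasVelocity g (t + s) v) : HasVelocity (fun r => g (r + s)) t v :=
  ⟨h.1, HasDerivAt.comp_add_const t s h.2⟩

/-- With lower row `c, d`, the derivative `det / (c i + d)²` being `1` gives `det = d² - c²`, while
fixing `i` gives `det = c² + d²`. Hence `c = 0`, and `B` is scalar. -/
theorem smul_expITangent_zero_eq {B : GL (Fin 2) ℝ} (hB : 0 < B.det.val)
    (h : B • expITangent 0 = expITangent 0) (t : ℝ) : B • expI t = expI t := by
  have h1 : expI 0 = B • expI 0 := by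
    have := congrArg UnitTangent.pt h
    rw [smul_pt] at this
    exact this.symm
  have h2 := congrArg UnitTangent.vec h
  have hB' := det_pos_of_eq hB
  rw [eq_smul_expI_iff, abs_of_pos hB'] at h1
  simp only [expI_re, expI_im, Real.exp_zero] at h1
  have hσ : σ B = ContinuousAlgEquiv.refl ℝ ℂ := by
    simp only [σ]
    rw [if_pos]
    simpa using hB
  rw [smul_vec, hσ, det_entries] at h2
  have hI : (expITangent 0).vec = Complex.I := by
    apply Complex.ext <;> simp [expITangent]
  have hd : denom B ((expITangent 0).pt : ℂ) = ⟨B 1 1, B 1 0⟩ := by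
    apply Complex.ext <;> simp [denom, expITangent, expI]
  have hd0 : denom B ((expITangent 0).pt : ℂ) ≠ 0 := denom_ne_zero B _
  rw [hI, hd] at h2
  rw [hd] at hd0
  have h3 : ((B 0 0 * B 1 1 - B 0 1 * B 1 0 : ℝ) : ℂ) = (⟨B 1 1, B 1 0⟩ : ℂ) ^ 2 := by
    have h4 : ((B 0 0 * B 1 1 - B 0 1 * B 1 0 : ℝ) : ℂ) / (⟨B 1 1, B 1 0⟩ : ℂ) ^ 2 = 1 :=
      mul_right_cancel₀ Complex.I_ne_zero (by rw [one_mul]; exact h2)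
    rwa [div_eq_one_iff_eq (pow_ne_zero 2 hd0)] at h4
  have h5 := congrArg Complex.re h3
  simp only [Complex.ofReal_re, sq, Complex.mul_re] at h5
  have h6 : B 1 0 = 0 := by
    have : B 1 0 ^ 2 = 0 := by nlinarith [h1.2]
    simpa using this
  symm
  rw [eq_smul_expI_iff, abs_of_pos hB', h6]
  rw [h6] at h1 h5 hB'
  have h7 : B 1 1 ≠ 0 := by rintro h; simp [h] at hB'
  have h8 : B 0 1 = 0 := by
    have : B 0 1 * B 1 1 = 0 := by linarith [h1.1]
    simpa [h7] using this
  rw [h8]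
  simp only [expI_re, expI_im]
  constructor
  · ring
  · have : B 0 0 * B 1 1 = B 1 1 ^ 2 := by nlinarith
    rw [this]; ring

/-- A geodesic is determined by its initial velocity. -/
theorem isometry_eq_of_hasVelocity {g g' : ℝ → ℍ} (hg : Isometry g) (hg' : Isometry g') {t : ℝ}
    {v : UnitTangent} (h : HasVelocity g t v) (h' : HasVelocity g' t v) : g = g' := by
  obtain ⟨A, hA, hA'⟩ := exists_smul_expI (isometry_comp_add hg t)
  obtain ⟨B, hB, hB'⟩ := exists_smul_expI (isometry_comp_add hg' t)
  have e1 : v = A • expITangent 0 := by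
    refine HasVelocity.unique (HasVelocity.comp_add (t := 0) (s := t) (by simpa using h)) ?_
    rw [funext hA']
    exact hasVelocity_smul A expI 0 _ (hasVelocity_expI 0)
  have e2 : v = B • expITangent 0 := by
    refine HasVelocity.unique (HasVelocity.comp_add (t := 0) (s := t) (by simpa using h')) ?_
    rw [funext hB']
    exact hasVelocity_smul B expI 0 _ (hasVelocity_expI 0)
  have e3 : (B⁻¹ * A) • expITangent 0 = expITangent 0 := by
    rw [mul_smul, ← e1, e2, inv_smul_smul]
  have hd : 0 < (B⁻¹ * A).det.val := by
    rw [map_mul, Units.val_mul, map_inv, Units.val_inv_eq_inv_val]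
    positivity
  funext s
  have := smul_expITangent_zero_eq hd e3 (s - t)
  rw [mul_smul, inv_smul_eq_iff] at this
  have a1 := hA' (s - t)
  have b1 := hB' (s - t)
  simp only [sub_add_cancel] at a1 b1
  rw [a1, b1, this]

/-! ### Walls -/

theorem Wall.side_eq (w : Wall) (z : ℍ) :
    w.side z = w.a * (z.re ^ 2 + z.im ^ 2) - 2 * w.b * z.re + w.c := by
  rw [Wall.side, normSq_coe]

/-- The value of the quadratic form of a wall at a real point. -/
def Wall.eval (w : Wall) (r : ℝ) : ℝ := w.a * r ^ 2 - 2 * w.b * r + w.c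

/-- The preimage of a wall under an isometry. -/
def Wall.pull (g : GL (Fin 2) ℝ) (w : Wall) : Wall where
  a := w.a * g 0 0 ^ 2 - 2 * w.b * (g 0 0 * g 1 0) + w.c * g 1 0 ^ 2
  b := -(w.a * (g 0 0 * g 0 1)) + w.b * (g 0 0 * g 1 1 + g 0 1 * g 1 0) - w.c * (g 1 0 * g 1 1)
  c := w.a * g 0 1 ^ 2 - 2 * w.b * (g 0 1 * g 1 1) + w.c * g 1 1 ^ 2
  disc_pos := by
    have h := mul_pos w.disc_pos (sq_pos_of_ne_zero (det_entries_ne g))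
    nlinarith [h]

theorem Wall.side_smul (g : GL (Fin 2) ℝ) (w : Wall) (z : ℍ) :
    w.side (g • z) * denomSq g z = (w.pull g).side z := by
  rw [Wall.side_eq, Wall.side_eq]
  have h1 := smul_re_mul g z
  have h2 := smul_normSq_mul g z
  calc _ = w.a * (((g • z).re ^ 2 + (g • z).im ^ 2) * denomSq g z)
        - 2 * w.b * ((g • z).re * denomSq g z) + w.c * denomSq g z := by ring
    _ = _ := by rw [h1, h2, denomSq]; simp only [Wall.pull]; ring

theorem Wall.side_smul_nonneg_iff (g : GL (Fin 2) ℝ) (w : Wall) (z : ℍ) :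
    0 ≤ w.side (g • z) ↔ 0 ≤ (w.pull g).side z := by
  rw [← w.side_smul g z, mul_nonneg_iff_of_pos_right (denomSq_pos g z)]

theorem Wall.side_smul_eq_zero_iff (g : GL (Fin 2) ℝ) (w : Wall) (z : ℍ) :
    w.side (g • z) = 0 ↔ (w.pull g).side z = 0 := by
  rw [← w.side_smul g z, mul_eq_zero, or_iff_left (denomSq_pos g z).ne']

theorem Wall.continuous_side (w : Wall) : Continuous w.side := by
  unfold Wall.side
  have := UpperHalfPlane.continuous_coe
  have h2 : Continuous fun z : ℍ => z.re := UpperHalfPlane.continuous_re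
  have h3 : Continuous fun z : ℍ => Complex.normSq (z : ℂ) :=
    Complex.continuous_normSq.comp this
  fun_prop

/-- Along a geodesic, the function defining a half plane is a combination of exponentials, up to
a positive factor. -/
theorem Wall.side_isometry (w : Wall) {g : ℝ → ℍ} (hg : Isometry g) :
    ∃ α β : ℝ, ∀ t, w.side (g t) = (g t).im * (α * Real.exp t + β * Real.exp (-t)) := by
  obtain ⟨A, hA, h⟩ := exists_smul_expI hg
  set D := |A 0 0 * A 1 1 - A 0 1 * A 1 0| with hD
  have hD0 : 0 < D := abs_pos.2 (det_entries_ne A)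
  refine ⟨(w.pull A).a / D, (w.pull A).c / D, fun t => ?_⟩
  have h1 := w.side_smul A (expI t)
  have h2 := smul_im_mul A (expI t)
  have h3 := denomSq_pos A (expI t)
  rw [h t]
  refine mul_right_cancel₀ h3.ne' ?_
  rw [h1, mul_right_comm, h2, Wall.side_eq, Real.exp_neg]
  have := (Real.exp_pos t).ne'
  rw [← hD]
  simp only [expI_re, expI_im]
  field_simp
  ring

/-- The function `(Re z - α) (Re z - β) + (Im z) ^ 2`, which is negative below the geodesic with
the end points `α, β`. -/
def arcSide (α β : ℝ) (z : ℍ) : ℝ := (z.re - α) * (z.re - β) + z.im ^ 2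

theorem mem_semicircle_iff {c d : ℝ} (h : c < d) (z : ℍ) :
    z ∈ semicircle c d ↔ arcSide c d z = 0 := by
  rw [semicircle, mem_ofPred_eq, arcSide]
  have h1 : ‖(z : ℂ) - (((c + d) / 2 : ℝ) : ℂ)‖ ^ 2 = (z.re - (c + d) / 2) ^ 2 + z.im ^ 2 := by
    rw [Complex.sq_norm, Complex.normSq_apply]
    simp
    ring
  rw [← sq_eq_sq₀ (norm_nonneg _) (by linarith), h1]
  constructor <;> intro h <;> nlinarith

/-- Half planes over nested intervals are nested; positions of points are compared through these
inclusions in all that follows. -/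
theorem arcSide_mono_le {α β α' β' : ℝ} {z : ℍ} (h : arcSide α β z ≤ 0) (hαβ : α ≤ β)
    (h1 : α' ≤ α) (h2 : β ≤ β') : arcSide α' β' z ≤ 0 := by
  have hz := z.im_pos
  unfold arcSide at *
  have h3 : (z.re - α) * (z.re - β) < 0 := by nlinarith
  have h4 : α < z.re ∧ z.re < β := by
    constructor <;> by_contra! h5 <;> nlinarith
  nlinarith [mul_nonneg (sub_nonneg.2 h1) (sub_nonneg.2 h2), h4.1, h4.2,
    mul_nonneg (sub_nonneg.2 h1) (sub_pos.2 h4.2).le,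
    mul_nonneg (sub_nonneg.2 h2) (sub_pos.2 h4.1).le]

theorem arcSide_re {α β : ℝ} {z : ℍ} (h : arcSide α β z ≤ 0) (hαβ : α ≤ β) :
    α < z.re ∧ z.re < β := by
  have hz := z.im_pos
  unfold arcSide at *
  have h3 : (z.re - α) * (z.re - β) < 0 := by nlinarith
  constructor <;> by_contra! h5 <;> nlinarith

theorem arcSide_mono_lt {α β α' β' : ℝ} {z : ℍ} (h : arcSide α β z ≤ 0) (hαβ : α ≤ β)
    (h1 : α' ≤ α) (h2 : β ≤ β') (h3 : α' < α ∨ β < β' ∨ arcSide α β z < 0) :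
    arcSide α' β' z < 0 := by
  obtain ⟨h4, h5⟩ := arcSide_re h hαβ
  unfold arcSide at *
  rcases h3 with h3 | h3 | h3
  all_goals nlinarith [mul_nonneg (sub_nonneg.2 h1) (sub_nonneg.2 h2),
    mul_nonneg (sub_nonneg.2 h1) (sub_pos.2 h5).le,
    mul_nonneg (sub_nonneg.2 h2) (sub_pos.2 h4).le]

theorem arcSide_pos_of_le_re {α β : ℝ} {z : ℍ} (h : β ≤ z.re) (hαβ : α ≤ β) :
    0 < arcSide α β z := by
  by_contra! h1
  exact absurd (arcSide_re h1 hαβ).2 (not_lt.2 h)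

theorem arcSide_pos_of_re_le {α β : ℝ} {z : ℍ} (h : z.re ≤ α) (hαβ : α ≤ β) :
    0 < arcSide α β z := by
  by_contra! h1
  exact absurd (arcSide_re h1 hαβ).1 (not_lt.2 h)

theorem continuous_arcSide (α β : ℝ) : Continuous (arcSide α β) := by
  unfold arcSide
  have h2 : Continuous fun z : ℍ => z.re := UpperHalfPlane.continuous_re
  have h3 : Continuous fun z : ℍ => z.im := UpperHalfPlane.continuous_im
  fun_prop

/-! ### Geodesics with real end points -/

/-- `g` runs through the semicircle from `y` to `x < y`; the number `κ e ^ t` is the parameter of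
the point `g t`. -/
structure IsArc (g : ℝ → ℍ) (y x κ : ℝ) : Prop where
  lt : x < y
  pos : 0 < κ
  re_eq : ∀ t, (g t).re = (y + x * (κ * Real.exp t) ^ 2) / (1 + (κ * Real.exp t) ^ 2)
  im_eq : ∀ t, (g t).im = κ * Real.exp t * (y - x) / (1 + (κ * Real.exp t) ^ 2)

theorem isArc_iff_smul {g : ℝ → ℍ} {y x κ : ℝ} (h : x < y) (hκ : 0 < κ)
    (hd : (-(x * κ)) * 1 - y * (-κ) ≠ 0) :
    IsArc g y x κ ↔ ∀ t, g t = glMk (-(x * κ)) y (-κ) 1 hd • expI t := by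
  have h1 : ∀ t, 0 < 1 + (κ * Real.exp t) ^ 2 := fun t => by positivity
  have h2 : |(-(x * κ)) * 1 - y * (-κ)| = κ * (y - x) := by
    rw [abs_of_pos] <;> nlinarith
  constructor
  · intro hg t
    rw [eq_smul_expI_iff, hg.re_eq, hg.im_eq]
    simp only [glMk_00, glMk_01, glMk_10, glMk_11, h2]
    have := (h1 t).ne'
    constructor <;> field_simp
  · intro hg
    have hg' := fun t => (eq_smul_expI_iff _ _ t).1 (hg t)
    simp only [glMk_00, glMk_01, glMk_10, glMk_11, h2] at hg'
    refine ⟨h, hκ, fun t => ?_, fun t => ?_⟩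
    · rw [eq_div_iff (h1 t).ne']; linarith [(hg' t).1]
    · rw [eq_div_iff (h1 t).ne']; linarith [(hg' t).2]

theorem exists_isArc {y x κ : ℝ} (h : x < y) (hκ : 0 < κ) : ∃ g, IsArc g y x κ := by
  have hd : (-(x * κ)) * 1 - y * (-κ) ≠ 0 := by nlinarith
  exact ⟨_, (isArc_iff_smul h hκ hd).2 fun t => rfl⟩

namespace IsArc

variable {g : ℝ → ℍ} {y x κ : ℝ}

theorem isometry (h : IsArc g y x κ) : Isometry g := by
  have hd : (-(x * κ)) * 1 - y * (-κ) ≠ 0 := by nlinarith [h.lt, h.pos]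
  rw [funext ((isArc_iff_smul h.lt h.pos hd).1 h)]
  exact isometry_smul_comp _ isometry_expI

theorem side_mul (h : IsArc g y x κ) (w : Wall) (t : ℝ) :
    w.side (g t) * (1 + (κ * Real.exp t) ^ 2) = w.eval y + w.eval x * (κ * Real.exp t) ^ 2 := by
  rw [Wall.side_eq, h.re_eq, h.im_eq, Wall.eval, Wall.eval]
  have : (1 + (κ * Real.exp t) ^ 2) ≠ 0 := by positivity
  field_simp
  ring

theorem arcSide_mul (h : IsArc g y x κ) (α β : ℝ) (t : ℝ) :
    arcSide α β (g t) * (1 + (κ * Real.exp t) ^ 2) =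
      (y - α) * (y - β) + (x - α) * (x - β) * (κ * Real.exp t) ^ 2 := by
  rw [arcSide, h.re_eq, h.im_eq]
  have : (1 + (κ * Real.exp t) ^ 2) ≠ 0 := by positivity
  field_simp
  ring

theorem normSq_mul (h : IsArc g y x κ) (t : ℝ) :
    ((g t).re ^ 2 + (g t).im ^ 2) * (1 + (κ * Real.exp t) ^ 2) =
      y ^ 2 + x ^ 2 * (κ * Real.exp t) ^ 2 := by
  rw [h.re_eq, h.im_eq]
  have : (1 + (κ * Real.exp t) ^ 2) ≠ 0 := by positivity
  field_simp
  ring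

theorem comp_add (h : IsArc g y x κ) (s : ℝ) :
    IsArc (fun t => g (t + s)) y x (κ * Real.exp s) where
  lt := h.lt
  pos := mul_pos h.pos (Real.exp_pos s)
  re_eq t := by rw [h.re_eq, Real.exp_add]; ring_nf
  im_eq t := by rw [h.im_eq, Real.exp_add]; ring_nf

theorem arcSide_self (h : IsArc g y x κ) (t : ℝ) : arcSide x y (g t) = 0 := by
  have := h.arcSide_mul x y t
  simp only [sub_self, mul_zero, zero_mul, add_zero, mul_eq_zero] at this
  exact this.resolve_right (by positivity)

/-- Every point of the semicircle is on the geodesic. -/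
theorem exists_eq (h : IsArc g y x κ) {z : ℍ} (hz : arcSide x y z = 0) : ∃ t, g t = z := by
  obtain ⟨h1, h2⟩ := arcSide_re hz.le h.lt.le
  have hi := z.im_pos
  have hp := h.pos
  have hl := h.lt
  have h1' : 0 < z.re - x := sub_pos.2 h1
  refine ⟨Real.log (z.im / (z.re - x) / κ), ?_⟩
  have e : κ * Real.exp (Real.log (z.im / (z.re - x) / κ)) = z.im / (z.re - x) := by
    rw [Real.exp_log (by positivity)]
    field_simp
  unfold arcSide at hz
  have h3 : 1 + (z.im / (z.re - x)) ^ 2 = (y - x) / (z.re - x) := by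
    field_simp
    nlinarith
  have hyx : y - x ≠ 0 := by linarith
  refine ext_re_im ?_ ?_
  · rw [h.re_eq, e, h3]
    field_simp
    linear_combination x * hz
  · rw [h.im_eq, e, h3]
    field_simp

theorem tendsto_coe (h : IsArc g y x κ) :
    Tendsto (fun t => (g t : ℂ)) atBot (𝓝 (y : ℂ)) ∧
      Tendsto (fun t => (g t : ℂ)) atTop (𝓝 (x : ℂ)) := by
  have e : ∀ t, (g t : ℂ) = ((g t).re : ℂ) + ((g t).im : ℂ) * Complex.I := fun t => by
    apply Complex.ext <;> simp
  have hκ := h.pos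
  constructor
  · have h0 : Tendsto (fun t => κ * Real.exp t) atBot (𝓝 0) := by
      simpa using Real.tendsto_exp_atBot.const_mul κ
    have hr : Tendsto (fun t => (g t).re) atBot (𝓝 y) := by
      simp_rw [h.re_eq]
      have : ContinuousAt (fun τ : ℝ => (y + x * τ ^ 2) / (1 + τ ^ 2)) 0 := by
        fun_prop (disch := norm_num)
      have := this.tendsto.comp h0
      simpa [Function.comp_def] using this
    have hi : Tendsto (fun t => (g t).im) atBot (𝓝 0) := by
      simp_rw [h.im_eq]
      have : ContinuousAt (fun τ : ℝ => τ * (y - x) / (1 + τ ^ 2)) 0 := by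
        fun_prop (disch := norm_num)
      have := this.tendsto.comp h0
      simpa [Function.comp_def] using this
    simp_rw [e]
    have := ((Complex.continuous_ofReal.tendsto _).comp hr).add
      (((Complex.continuous_ofReal.tendsto _).comp hi).mul_const Complex.I)
    simpa using this
  · have h0 : Tendsto (fun t => (κ * Real.exp t)⁻¹) atTop (𝓝 0) :=
      (Real.tendsto_exp_atTop.const_mul_atTop hκ).inv_tendsto_atTop
    have hr : Tendsto (fun t => (g t).re) atTop (𝓝 x) := by
      have : ContinuousAt (fun τ : ℝ => (y * τ ^ 2 + x) / (τ ^ 2 + 1)) 0 := by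
        fun_prop (disch := norm_num)
      have := this.tendsto.comp h0
      simp only [ne_eq, OfNat.ofNat_ne_zero, not_false_eq_true, zero_pow, mul_zero, zero_add,
        div_one] at this
      refine this.congr fun t => ?_
      simp only [Function.comp]
      rw [h.re_eq]
      have := (Real.exp_pos t).ne'
      field_simp
    have hi : Tendsto (fun t => (g t).im) atTop (𝓝 0) := by
      have : ContinuousAt (fun τ : ℝ => τ * (y - x) / (τ ^ 2 + 1)) 0 := by
        fun_prop (disch := norm_num)
      have := this.tendsto.comp h0
      simp only [zero_mul, ne_eq, OfNat.ofNat_ne_zero, not_false_eq_true, zero_pow, zero_add,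
        div_one] at this
      refine this.congr fun t => ?_
      simp only [Function.comp]
      rw [h.im_eq]
      have := (Real.exp_pos t).ne'
      field_simp
    simp_rw [e]
    have := ((Complex.continuous_ofReal.tendsto _).comp hr).add
      (((Complex.continuous_ofReal.tendsto _).comp hi).mul_const Complex.I)
    simpa using this

theorem isGeodesicFromTo (h : IsArc g y x κ) : IsGeodesicFromTo g y x :=
  ⟨h.isometry, h.tendsto_coe⟩

end IsArc

/-- The geodesic of a matrix whose rows have quotients of the same kind is a semicircle. -/
theorem isArc_of_smul {g : ℝ → ℍ} {A : GL (Fin 2) ℝ} (hA : 0 < A.det.val)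
    (hg : ∀ t, g t = A • expI t) (h : A 1 0 * A 1 1 < 0) :
    IsArc g (A 0 1 / A 1 1) (A 0 0 / A 1 0) (-(A 1 0 / A 1 1)) := by
  have hA' := det_pos_of_eq hA
  have hc : A 1 0 ≠ 0 := by rintro h0; simp [h0] at h
  have hd : A 1 1 ≠ 0 := by rintro h0; simp [h0] at h
  have hg' := fun t => (eq_smul_expI_iff _ _ t).1 (hg t)
  have hN : ∀ t, (A 1 1 ^ 2 + A 1 0 ^ 2 * Real.exp t ^ 2) ≠ 0 := fun t => by positivity
  have hyx : A 0 1 / A 1 1 - A 0 0 / A 1 0 =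
      (A 0 0 * A 1 1 - A 0 1 * A 1 0) / (-(A 1 0 * A 1 1)) := by field_simp; ring
  refine ⟨?_, ?_, fun t => ?_, fun t => ?_⟩
  · rw [← sub_pos, hyx]
    exact div_pos hA' (by linarith)
  · rw [neg_pos, div_eq_mul_inv]
    have : A 1 0 * (A 1 1)⁻¹ = A 1 0 * A 1 1 * ((A 1 1)⁻¹) ^ 2 := by field_simp
    rw [this]
    exact mul_neg_of_neg_of_pos h (by positivity)
  · have h3 := (hg' t).1
    rw [← eq_div_iff (hN t)] at h3
    rw [h3]
    have := hN t
    have h5 : 1 + (-(A 1 0 / A 1 1) * Real.exp t) ^ 2 =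
      (A 1 1 ^ 2 + A 1 0 ^ 2 * Real.exp t ^ 2) / A 1 1 ^ 2 := by field_simp
    rw [h5]
    field_simp
  · have h3 := (hg' t).2
    rw [← eq_div_iff (hN t), abs_of_pos hA'] at h3
    rw [h3, hyx]
    have := hN t
    have h5 : 1 + (-(A 1 0 / A 1 1) * Real.exp t) ^ 2 =
      (A 1 1 ^ 2 + A 1 0 ^ 2 * Real.exp t ^ 2) / A 1 1 ^ 2 := by field_simp
    rw [h5]
    field_simp


/-- Write `g t = A • i e ^ t` and pass to the limit in the coordinate equations after clearing
denominators. An end point at `∞` is excluded because a suitable multiple of `Im (g t)` would then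
be a nonzero constant tending to `0`. -/
theorem IsGeodesicFromTo.exists_isArc {g : ℝ → ℍ} {y x : ℝ} (h : IsGeodesicFromTo g y x)
    (hxy : x < y) : ∃ κ, IsArc g y x κ := by
  obtain ⟨hg, hy, hx⟩ := h
  obtain ⟨A, hA, hgA⟩ := exists_smul_expI hg
  have hA' := det_pos_of_eq hA
  have hg' := fun t => (eq_smul_expI_iff _ _ t).1 (hgA t)
  have hyr : Tendsto (fun t => (g t).re) atBot (𝓝 y) := by
    simpa [Function.comp_def] using (Complex.continuous_re.tendsto _).comp hy
  have hyi : Tendsto (fun t => (g t).im) atBot (𝓝 0) := by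
    simpa [Function.comp_def] using (Complex.continuous_im.tendsto _).comp hy
  have hxr : Tendsto (fun t => (g t).re) atTop (𝓝 x) := by
    simpa [Function.comp_def] using (Complex.continuous_re.tendsto _).comp hx
  have hxi : Tendsto (fun t => (g t).im) atTop (𝓝 0) := by
    simpa [Function.comp_def] using (Complex.continuous_im.tendsto _).comp hx
  have hexp : Tendsto (fun t : ℝ => Real.exp t ^ 2) atBot (𝓝 0) := by
    simpa using Real.tendsto_exp_atBot.pow 2
  have hexp' : Tendsto (fun t : ℝ => (Real.exp t)⁻¹) atTop (𝓝 0) :=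
    Real.tendsto_exp_atTop.inv_tendsto_atTop
  -- the limit at `-∞`
  have h1 : y * A 1 1 ^ 2 = A 0 1 * A 1 1 := by
    have l1 : Tendsto (fun t => (g t).re * (A 1 1 ^ 2 + A 1 0 ^ 2 * Real.exp t ^ 2)) atBot
        (𝓝 (y * (A 1 1 ^ 2 + A 1 0 ^ 2 * 0))) :=
      hyr.mul (tendsto_const_nhds.add (hexp.const_mul _))
    have l2 : Tendsto (fun t => (g t).re * (A 1 1 ^ 2 + A 1 0 ^ 2 * Real.exp t ^ 2)) atBot
        (𝓝 (A 0 1 * A 1 1 + A 0 0 * A 1 0 * 0)) := by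
      simp_rw [fun t => (hg' t).1]
      exact tendsto_const_nhds.add (hexp.const_mul _)
    simpa using tendsto_nhds_unique l1 l2
  have hd : A 1 1 ≠ 0 := by
    intro h0
    have l2 : Tendsto (fun t => (g t).im * (A 1 0 ^ 2 * Real.exp t)) atBot (𝓝 (0 * (A 1 0 ^ 2 * 0))) :=
      hyi.mul (Real.tendsto_exp_atBot.const_mul _)
    have l3 : (fun t => (g t).im * (A 1 0 ^ 2 * Real.exp t)) =
        fun _ => (A 0 0 * A 1 1 - A 0 1 * A 1 0) := by
      funext t
      have := (hg' t).2
      rw [abs_of_pos hA', h0] at this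
      refine mul_right_cancel₀ (Real.exp_pos t).ne' ?_
      rw [h0]
      linarith
    rw [l3] at l2
    have := tendsto_nhds_unique l2 tendsto_const_nhds
    simp only [mul_zero] at this
    linarith
  -- the limit at `∞`
  have hre : ∀ t, (g t).re * (A 1 1 ^ 2 * (Real.exp t)⁻¹ ^ 2 + A 1 0 ^ 2) =
      A 0 1 * A 1 1 * (Real.exp t)⁻¹ ^ 2 + A 0 0 * A 1 0 := fun t => by
    have := (hg' t).1
    have h0 := (Real.exp_pos t).ne'
    field_simp
    linarith
  have h2 : x * A 1 0 ^ 2 = A 0 0 * A 1 0 := by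
    have l1 : Tendsto (fun t => (g t).re * (A 1 1 ^ 2 * (Real.exp t)⁻¹ ^ 2 + A 1 0 ^ 2)) atTop
        (𝓝 (x * (A 1 1 ^ 2 * 0 ^ 2 + A 1 0 ^ 2))) :=
      hxr.mul (((hexp'.pow 2).const_mul _).add tendsto_const_nhds)
    have l2 : Tendsto (fun t => (g t).re * (A 1 1 ^ 2 * (Real.exp t)⁻¹ ^ 2 + A 1 0 ^ 2)) atTop
        (𝓝 (A 0 1 * A 1 1 * 0 ^ 2 + A 0 0 * A 1 0)) := by
      simp_rw [hre]
      exact ((hexp'.pow 2).const_mul _).add tendsto_const_nhds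
    simpa using tendsto_nhds_unique l1 l2
  have hc : A 1 0 ≠ 0 := by
    intro h0
    have l2 : Tendsto (fun t => (g t).im * (A 1 1 ^ 2 * (Real.exp t)⁻¹)) atTop
        (𝓝 (0 * (A 1 1 ^ 2 * 0))) :=
      hxi.mul (hexp'.const_mul _)
    have l3 : (fun t => (g t).im * (A 1 1 ^ 2 * (Real.exp t)⁻¹)) =
        fun _ => (A 0 0 * A 1 1 - A 0 1 * A 1 0) := by
      funext t
      have := (hg' t).2
      rw [abs_of_pos hA', h0] at this
      have h0' := (Real.exp_pos t).ne'
      rw [h0]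
      field_simp
      linarith
    rw [l3] at l2
    have := tendsto_nhds_unique l2 tendsto_const_nhds
    simp only [mul_zero] at this
    linarith
  have ey : A 0 1 / A 1 1 = y := by
    rw [div_eq_iff hd]
    refine mul_right_cancel₀ hd ?_
    linarith
  have ex : A 0 0 / A 1 0 = x := by
    rw [div_eq_iff hc]
    refine mul_right_cancel₀ hc ?_
    linarith
  have hcd : A 1 0 * A 1 1 < 0 := by
    have e : (y - x) * (A 1 0 * A 1 1) = -(A 0 0 * A 1 1 - A 0 1 * A 1 0) := by
      rw [← ey, ← ex]; field_simp; ring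
    by_contra! h0
    have := mul_nonneg (sub_pos.2 hxy).le h0
    linarith
  have := isArc_of_smul hA hgA hcd
  rw [ey, ex] at this
  exact ⟨_, this⟩

namespace IsArc

variable {g : ℝ → ℍ} {y x κ : ℝ}

theorem hasDerivAt_re (h : IsArc g y x κ) (t : ℝ) :
    HasDerivAt (fun s => (g s).re)
      (-(2 * (κ * Real.exp t) ^ 2 * (y - x)) / (1 + (κ * Real.exp t) ^ 2) ^ 2) t := by
  simp_rw [h.re_eq]
  have hτ : HasDerivAt (fun s => κ * Real.exp s) (κ * Real.exp t) t :=
    (Real.hasDerivAt_exp t).const_mul κ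
  have h0 : 1 + (κ * Real.exp t) ^ 2 ≠ 0 := by positivity
  refine HasDerivAt.congr_deriv
    ((((hτ.pow 2).const_mul x).const_add y).div ((hτ.pow 2).const_add 1) h0) ?_
  field_simp
  simp
  ring

theorem hasDerivAt_im (h : IsArc g y x κ) (t : ℝ) :
    HasDerivAt (fun s => (g s).im)
      (κ * Real.exp t * (y - x) * (1 - (κ * Real.exp t) ^ 2) / (1 + (κ * Real.exp t) ^ 2) ^ 2) t := by
  simp_rw [h.im_eq]
  have hτ : HasDerivAt (fun s => κ * Real.exp s) (κ * Real.exp t) t :=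
    (Real.hasDerivAt_exp t).const_mul κ
  have h0 : 1 + (κ * Real.exp t) ^ 2 ≠ 0 := by positivity
  refine HasDerivAt.congr_deriv
    ((hτ.mul_const (y - x)).div ((hτ.pow 2).const_add 1) h0) ?_
  field_simp
  simp
  left
  ring

theorem hasDerivAt_coe (h : IsArc g y x κ) (t : ℝ) :
    HasDerivAt (fun s => (g s : ℂ))
      ⟨-(2 * (κ * Real.exp t) ^ 2 * (y - x)) / (1 + (κ * Real.exp t) ^ 2) ^ 2,
        κ * Real.exp t * (y - x) * (1 - (κ * Real.exp t) ^ 2) / (1 + (κ * Real.exp t) ^ 2) ^ 2⟩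
      t := by
  have h1 := ((h.hasDerivAt_re t).ofReal_comp).add
    (((h.hasDerivAt_im t).ofReal_comp).mul_const Complex.I)
  refine HasDerivAt.congr_deriv (HasDerivAt.congr_of_eventuallyEq h1 ?_) ?_
  · refine Eventually.of_forall fun s => ?_
    apply Complex.ext <;> simp
  · apply Complex.ext <;> simp [-Complex.ofReal_div, -Complex.ofReal_exp, -Complex.ofReal_neg,
      -Complex.ofReal_mul]

/-- The ray from `0` is tangent to the geodesic exactly at the parameter `√(y / x)`. -/
theorem tangent_iff (h : IsArc g y x κ) (hx : 0 < x) (t : ℝ) :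
    (∃ r : ℝ, HasDerivAt (fun s => (g s : ℂ)) (r * (g t : ℂ)) t) ↔
      x * (κ * Real.exp t) ^ 2 = y := by
  have hκ := h.pos
  have hxy := h.lt
  set τ := κ * Real.exp t with hτ
  have hτ0 : 0 < τ := by positivity
  have hN : 1 + τ ^ 2 ≠ 0 := by positivity
  have hd := h.hasDerivAt_coe t
  have hre := h.re_eq t
  have him := h.im_eq t
  rw [← hτ] at hd hre him
  constructor
  · rintro ⟨r, hr⟩
    have e := hr.unique hd
    have e1 := congrArg Complex.re e
    have e2 := congrArg Complex.im e
    simp only [Complex.mul_re, Complex.mul_im, Complex.ofReal_re, Complex.ofReal_im, zero_mul,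
      sub_zero, add_zero, coe_re, coe_im, hre, him] at e1 e2
    field_simp at e1 e2
    have hyx : 0 < y - x := sub_pos.2 hxy
    have e3 : r * (1 + τ ^ 2) = 1 - τ ^ 2 := by
      refine mul_right_cancel₀ hyx.ne' ?_
      linarith
    have e4 : (1 - τ ^ 2) * (y + x * τ ^ 2) = -(2 * τ ^ 2 * (y - x)) := by
      rw [← e3]; linarith
    have e5 : (y - x * τ ^ 2) * (1 + τ ^ 2) = 0 := by linarith
    rcases mul_eq_zero.1 e5 with h6 | h6
    · linarith
    · exact absurd h6 hN
  · intro hy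
    refine ⟨(1 - τ ^ 2) / (1 + τ ^ 2), hd.congr_deriv ?_⟩
    apply Complex.ext
    · simp only [Complex.mul_re, Complex.ofReal_re, Complex.ofReal_im, zero_mul,
      sub_zero, coe_re, coe_im, hre, him]
      rw [← hy]
      field_simp
      ring
    · simp only [Complex.mul_im, Complex.ofReal_re, Complex.ofReal_im, zero_mul,
      add_zero, coe_re, coe_im, hre, him]
      field_simp

theorem param_lt_iff (h : IsArc g y x κ) {s t : ℝ} :
    (κ * Real.exp s) ^ 2 < (κ * Real.exp t) ^ 2 ↔ s < t := by
  have := h.pos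
  rw [sq_lt_sq₀ (by positivity) (by positivity), mul_lt_mul_iff_right₀ this, Real.exp_lt_exp]

theorem param_le_iff (h : IsArc g y x κ) {s t : ℝ} :
    (κ * Real.exp s) ^ 2 ≤ (κ * Real.exp t) ^ 2 ↔ s ≤ t := by
  have := h.pos
  rw [sq_le_sq₀ (by positivity) (by positivity), mul_le_mul_iff_right₀ this, Real.exp_le_exp]

theorem exists_param (h : IsArc g y x κ) {s : ℝ} (hs : 0 < s) :
    ∃ t, (κ * Real.exp t) ^ 2 = s := by
  have := h.pos
  refine ⟨Real.log (Real.sqrt s / κ), ?_⟩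
  have h1 := Real.sqrt_pos.2 hs
  rw [Real.exp_log (by positivity), mul_div_cancel₀ _ this.ne', Real.sq_sqrt hs.le]

end IsArc

/-! ### Signs of exponential sums -/

/-- If `α e ^ t + β e ^ -t` is nonnegative at `t₁` and `t₂`, it is nonnegative between. -/
theorem exp_sum_nonneg {α β t₁ t₂ t : ℝ} (h1 : 0 ≤ α * Real.exp t₁ + β * Real.exp (-t₁))
    (h2 : 0 ≤ α * Real.exp t₂ + β * Real.exp (-t₂)) (ht1 : t₁ ≤ t) (ht2 : t ≤ t₂) :
    0 ≤ α * Real.exp t + β * Real.exp (-t) := by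
  have key : ∀ s : ℝ, α * Real.exp s + β * Real.exp (-s) =
      Real.exp (-s) * (α * Real.exp s ^ 2 + β) := fun s => by
    rw [Real.exp_neg]; have := (Real.exp_pos s).ne'; field_simp
  rw [key] at h1 h2 ⊢
  have p1 := nonneg_of_mul_nonneg_right h1 (Real.exp_pos _)
  have p2 := nonneg_of_mul_nonneg_right h2 (Real.exp_pos _)
  refine mul_nonneg (Real.exp_pos _).le ?_
  have q1 : Real.exp t₁ ^ 2 ≤ Real.exp t ^ 2 := by gcongr
  have q2 : Real.exp t ^ 2 ≤ Real.exp t₂ ^ 2 := by gcongr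
  rcases le_total 0 α with h | h <;> nlinarith

theorem exp_sum_pos {α β t₁ t₂ t : ℝ} (h1 : 0 < α * Real.exp t₁ + β * Real.exp (-t₁))
    (h2 : 0 ≤ α * Real.exp t₂ + β * Real.exp (-t₂)) (ht1 : t₁ ≤ t) (ht2 : t < t₂) :
    0 < α * Real.exp t + β * Real.exp (-t) := by
  have key : ∀ s : ℝ, α * Real.exp s + β * Real.exp (-s) =
      Real.exp (-s) * (α * Real.exp s ^ 2 + β) := fun s => by
    rw [Real.exp_neg]; have := (Real.exp_pos s).ne'; field_simp
  rw [key] at h1 h2 ⊢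
  have p1 := pos_of_mul_pos_right h1 (Real.exp_pos _).le
  have p2 := nonneg_of_mul_nonneg_right h2 (Real.exp_pos _)
  refine mul_pos (Real.exp_pos _) ?_
  have q1 : Real.exp t₁ ^ 2 ≤ Real.exp t ^ 2 := by gcongr
  have q2 : Real.exp t ^ 2 < Real.exp t₂ ^ 2 := by gcongr
  rcases le_total 0 α with h | h
  · nlinarith
  · rcases h.lt_or_eq with h | h
    · nlinarith
    · rw [h] at p1 ⊢; linarith

/-! ### Geodesics crossing a wall. -/

section Geodesic

variable {g : ℝ → ℍ}

theorem Wall.side_nonneg_between (hg : Isometry g) (w : Wall) {t₁ t₂ t : ℝ}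
    (h1 : 0 ≤ w.side (g t₁)) (h2 : 0 ≤ w.side (g t₂)) (ht1 : t₁ ≤ t) (ht2 : t ≤ t₂) : 0 ≤ w.side (g t) := by
  obtain ⟨α, β, h⟩ := w.side_isometry hg
  rw [h] at h1 h2 ⊢
  exact mul_nonneg (g t).im_pos.le (exp_sum_nonneg (nonneg_of_mul_nonneg_right h1 (im_pos _))
    (nonneg_of_mul_nonneg_right h2 (im_pos _)) ht1 ht2)

theorem Wall.side_pos_between (hg : Isometry g) (w : Wall) {t₁ t₂ t : ℝ}
    (h1 : 0 < w.side (g t₁)) (h2 : 0 ≤ w.side (g t₂)) (ht1 : t₁ ≤ t) (ht2 : t < t₂) : 0 < w.side (g t) := by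
  obtain ⟨α, β, h⟩ := w.side_isometry hg
  rw [h] at h1 h2 ⊢
  exact mul_pos (g t).im_pos (exp_sum_pos (pos_of_mul_pos_right h1 (im_pos _).le)
    (nonneg_of_mul_nonneg_right h2 (im_pos _)) ht1 ht2)

/-- A geodesic that meets a wall at `t₀`, and is nonnegative earlier, is either contained in the
wall or negative later. -/
theorem Wall.side_neg_or_zero (hg : Isometry g) (w : Wall) {t₀ t₁ t₂ : ℝ}
    (h0 : w.side (g t₀) = 0) (h1 : 0 ≤ w.side (g t₁)) (ht1 : t₁ < t₀) (ht2 : t₀ < t₂) :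
    w.side (g t₂) < 0 ∨ ∀ t, w.side (g t) = 0 := by
  obtain ⟨α, β, h⟩ := w.side_isometry hg
  have key : ∀ s : ℝ, w.side (g s) = (g s).im * Real.exp (-s) * (α * Real.exp s ^ 2 + β) :=
    fun s => by
      rw [h, Real.exp_neg]; have := (Real.exp_pos s).ne'; field_simp
  have e0 : α * Real.exp t₀ ^ 2 + β = 0 := by
    rw [key] at h0
    rcases mul_eq_zero.1 h0 with h3 | h3
    · exact absurd h3 (mul_pos (im_pos _) (Real.exp_pos _)).ne'
    · exact h3
  have e1 : 0 ≤ α * Real.exp t₁ ^ 2 + β := by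
    rw [key] at h1
    exact nonneg_of_mul_nonneg_right h1 (mul_pos (im_pos _) (Real.exp_pos _))
  have q1 : Real.exp t₁ ^ 2 < Real.exp t₀ ^ 2 := by gcongr
  have q2 : Real.exp t₀ ^ 2 < Real.exp t₂ ^ 2 := by gcongr
  have hα : α ≤ 0 := by by_contra! h3; nlinarith
  rcases hα.lt_or_eq with h3 | h3
  · left
    rw [key]
    exact mul_neg_of_pos_of_neg (mul_pos (im_pos _) (Real.exp_pos _)) (by nlinarith)
  · right
    intro t
    rw [key, h3]
    have : β = 0 := by rw [h3] at e0; linarith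
    rw [this]; ring

/-- The mirror image of `Wall.side_neg_or_zero`. -/
theorem Wall.side_neg_or_zero_left (hg : Isometry g) (w : Wall) {t₀ t₁ t₂ : ℝ}
    (h0 : w.side (g t₀) = 0) (h1 : 0 ≤ w.side (g t₁)) (ht1 : t₀ < t₁) (ht2 : t₂ < t₀) :
    w.side (g t₂) < 0 ∨ ∀ t, w.side (g t) = 0 := by
  have := Wall.side_neg_or_zero (isometry_comp_sub hg 0) w (t₀ := -t₀) (t₁ := -t₁) (t₂ := -t₂)
    (by simpa using h0) (by simpa using h1) (by linarith) (by linarith)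
  simp only [zero_sub, neg_neg] at this
  refine this.imp id fun h t => ?_
  simpa using h (-t)

end Geodesic


theorem zmod3_cases (i : ZMod 3) : i = 0 ∨ i = 1 ∨ i = 2 := by revert i; decide

/-! ### Reflections -/

namespace Wall

/-- The discriminant of a wall. -/
def disc (w : Wall) : ℝ := w.b ^ 2 - w.a * w.c

/-- The polar form of the discriminant. -/
def polar (w w' : Wall) : ℝ := w.a * w'.c + w.c * w'.a - 2 * w.b * w'.b

@[simp] theorem reflection_00 (w : Wall) : w.reflection 0 0 = w.b := rfl
@[simp] theorem reflection_01 (w : Wall) : w.reflection 0 1 = -w.c := rfl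
@[simp] theorem reflection_10 (w : Wall) : w.reflection 1 0 = w.a := rfl
@[simp] theorem reflection_11 (w : Wall) : w.reflection 1 1 = -w.b := rfl

theorem det_reflection (w : Wall) : w.reflection.det.val = -w.disc := by
  rw [det_entries, disc]; simp; ring

theorem side_reflection (w w' : Wall) (z : ℍ) :
    w'.side (w.reflection • z) * denomSq w.reflection z =
      w.disc * w'.side z + w.polar w' * w.side z := by
  rw [side_smul, side_eq, side_eq, side_eq, pull, disc, polar]
  simp only [reflection_00, reflection_01, reflection_10, reflection_11]
  ring

theorem im_reflection (w : Wall) (z : ℍ) :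
    (w.reflection • z).im * denomSq w.reflection z = w.disc * z.im := by
  have h := w.disc_pos
  rw [smul_im_mul]
  simp only [reflection_00, reflection_01, reflection_10, reflection_11, disc]
  rw [show w.b * -w.b - -w.c * w.a = -(w.b ^ 2 - w.a * w.c) by ring, abs_neg, abs_of_pos h]

theorem side_reflection_self (w : Wall) (z : ℍ) :
    w.side (w.reflection • z) * denomSq w.reflection z = -(w.disc * w.side z) := by
  rw [side_reflection]
  have : w.polar w = -2 * w.disc := by rw [polar, disc]; ring
  rw [this]; ring

end Wall

/-- Two isometries act in the same way on unit tangent vectors. -/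
def ActEq (g h : GL (Fin 2) ℝ) : Prop := ∀ v : UnitTangent, g • v = h • v

namespace ActEq

variable {g h g' h' : GL (Fin 2) ℝ}

theorem refl (g : GL (Fin 2) ℝ) : ActEq g g := fun _ => rfl
theorem symm (H : ActEq g h) : ActEq h g := fun v => (H v).symm
theorem trans {k : GL (Fin 2) ℝ} (H : ActEq g h) (H' : ActEq h k) : ActEq g k :=
  fun v => (H v).trans (H' v)
theorem mul (H : ActEq g h) (H' : ActEq g' h') : ActEq (g * g') (h * h') := fun v => by
  rw [mul_smul, mul_smul, H', H]
theorem inv (H : ActEq g h) : ActEq g⁻¹ h⁻¹ := fun v => by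
  rw [inv_smul_eq_iff, H, smul_inv_smul]
theorem pt (H : ActEq g h) (z : ℍ) : g • z = h • z :=
  congrArg UnitTangent.pt (H (ofAngle (z, 0)))

end ActEq

/-- The square of a reflection matrix is a scalar matrix, not `1`; this is why group identities are
used in the form `ActEq`. -/
theorem actEq_one_of_scalar {g : GL (Fin 2) ℝ} (h1 : g 0 1 = 0) (h2 : g 1 0 = 0)
    (h3 : g 0 0 = g 1 1) : ActEq g 1 := by
  intro v
  have hd := det_entries_ne g
  rw [h1, h2, h3] at hd
  have h4 : g 1 1 ≠ 0 := by rintro h; simp [h] at hd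
  have hdet : 0 < g.det.val := by
    rw [det_entries, h1, h2, h3]
    simp only [zero_mul, sub_zero]
    exact mul_self_pos.2 h4
  have hσ : σ g = ContinuousAlgEquiv.refl ℝ ℂ := by
    simp only [σ]
    rw [if_pos]
    simpa using hdet
  have h4' : (g 1 1 : ℂ) ≠ 0 := by exact_mod_cast h4
  rw [one_smul]
  refine UnitTangent.ext ?_ ?_
  · rw [smul_pt]
    apply UpperHalfPlane.ext
    rw [coe_smul, hσ]
    simp [num, denom, h1, h2, h3, h4']
  · rw [smul_vec, hσ, det_entries]
    simp [denom, h1, h2, h3]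
    field_simp

theorem Wall.actEq_reflection_mul_self (w : Wall) : ActEq (w.reflection * w.reflection) 1 := by
  have e : ∀ i j, (w.reflection * w.reflection) i j =
      w.reflection i 0 * w.reflection 0 j + w.reflection i 1 * w.reflection 1 j := fun i j => by
    simp [Matrix.mul_apply, Fin.sum_univ_two]
  apply actEq_one_of_scalar
  · rw [e]; simp; ring
  · rw [e]; simp; ring
  · rw [e, e]; simp; ring

/-- A positive definite form is bounded below by a multiple of `Im z`. -/
theorem exists_bound_of_definite {a b c : ℝ} (ha : 0 < a) (h : 0 < a * c - b ^ 2) :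
    ∃ δ > 0, ∀ z : ℍ, δ * z.im ≤ a * (z.re ^ 2 + z.im ^ 2) - 2 * b * z.re + c := by
  refine ⟨2 * Real.sqrt (a * c - b ^ 2), by positivity, fun z => ?_⟩
  have hs := Real.sq_sqrt h.le
  set s := Real.sqrt (a * c - b ^ 2)
  have : 0 ≤ a * (a * (z.re ^ 2 + z.im ^ 2) - 2 * b * z.re + c - 2 * s * z.im) := by
    have e : a * (a * (z.re ^ 2 + z.im ^ 2) - 2 * b * z.re + c - 2 * s * z.im) =
      (a * z.re - b) ^ 2 + (a * z.im - s) ^ 2 := by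
      rw [show a * (a * (z.re ^ 2 + z.im ^ 2) - 2 * b * z.re + c - 2 * s * z.im) =
        (a * z.re - b) ^ 2 + (a * z.im - s) ^ 2 + ((a * c - b ^ 2) - s ^ 2) by ring, hs]
      ring
    rw [e]; positivity
  have := nonneg_of_mul_nonneg_right this ha
  linarith

/-- If `w + r w'` is a positive definite form for some `r > 0`, it exceeds a multiple of `Im z`, so
the two nonpositive sides are disjoint, with a margin that is uniform in `z`. -/
theorem Wall.exists_gap (w w' : Wall) {r : ℝ} (hr : 0 < r) (ha : 0 < w.a + r * w'.a)
    (h : 0 < (w.a + r * w'.a) * (w.c + r * w'.c) - (w.b + r * w'.b) ^ 2) :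
    ∃ δ > 0, ∀ z : ℍ, (w'.side z ≤ 0 → δ * z.im ≤ w.side z) ∧
      (w.side z ≤ 0 → δ * z.im ≤ w'.side z) := by
  obtain ⟨δ, hδ, H⟩ := exists_bound_of_definite ha h
  have e : ∀ z : ℍ, (w.a + r * w'.a) * (z.re ^ 2 + z.im ^ 2) - 2 * (w.b + r * w'.b) * z.re +
      (w.c + r * w'.c) = w.side z + r * w'.side z := fun z => by
    rw [side_eq, side_eq]; ring
  refine ⟨min δ (δ / r), by positivity, fun z => ⟨fun h1 => ?_, fun h1 => ?_⟩⟩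
  · have h2 := H z
    rw [e] at h2
    have h3 : min δ (δ / r) * z.im ≤ δ * z.im :=
      mul_le_mul_of_nonneg_right (min_le_left _ _) z.im_pos.le
    nlinarith
  · have h2 := H z
    rw [e] at h2
    have h3 : min δ (δ / r) * z.im ≤ δ / r * z.im :=
      mul_le_mul_of_nonneg_right (min_le_right _ _) z.im_pos.le
    have h4 : δ / r * z.im ≤ w'.side z := by
      rw [div_mul_eq_mul_div, div_le_iff₀ hr]
      linarith
    linarith

namespace ThreeHoledSphere

variable (P : ThreeHoledSphere)

theorem f_pos : 0 < P.f := P.e_pos.trans P.e_lt_f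
theorem c_pos : 0 < P.c := P.f_pos.trans P.f_lt_c
theorem d_pos : 0 < P.d := P.c_pos.trans P.c_lt_d

theorem L_one_side (z : ℍ) : (P.L 1).side z = arcSide P.c P.d z := by
  rw [Wall.side_eq, arcSide]; change 1 * _ - 2 * ((P.c + P.d) / 2) * _ + P.c * P.d = _; ring
theorem L_zero_side (z : ℍ) : (P.L 0).side z = arcSide P.e P.f z := by
  rw [Wall.side_eq, arcSide]; change 1 * _ - 2 * ((P.e + P.f) / 2) * _ + P.e * P.f = _; ring
theorem L_two_side (z : ℍ) : (P.L 2).side z = 2 * z.re := by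
  rw [Wall.side_eq]; change 0 * _ - 2 * (-1) * _ + 0 = _; ring
theorem M_one_side (z : ℍ) : (P.M 1).side z = z.re ^ 2 + z.im ^ 2 - P.e * P.f := by
  rw [Wall.side_eq]; change 1 * _ - 2 * 0 * _ + -(P.e * P.f) = _; ring
theorem M_zero_side (z : ℍ) : (P.M 0).side z = P.c * P.d - (z.re ^ 2 + z.im ^ 2) := by
  rw [Wall.side_eq]; change (-1) * _ - 2 * 0 * _ + (P.c * P.d) = _; ring

theorem M_two_a : (P.M 2).a = P.c + P.d - P.e - P.f := rfl
theorem M_two_b : (P.M 2).b = P.c * P.d - P.e * P.f := rfl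
theorem M_two_c : (P.M 2).c = P.c * P.d * (P.e + P.f) - P.e * P.f * (P.c + P.d) := rfl

theorem M_two_a_pos : 0 < (P.M 2).a := by
  rw [M_two_a]; linarith [P.e_lt_f, P.f_lt_c, P.c_lt_d]
theorem M_two_b_pos : 0 < (P.M 2).b := by
  rw [M_two_b]
  nlinarith [P.e_lt_f, P.f_lt_c, P.c_lt_d, P.e_pos, P.c_pos, P.f_pos]
theorem M_two_c_pos : 0 < (P.M 2).c := by
  rw [M_two_c]
  have h1 : 0 < P.c * P.e * (P.d - P.f) :=
    mul_pos (mul_pos P.c_pos P.e_pos) (by linarith [P.f_lt_c, P.c_lt_d])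
  have h2 : 0 < P.d * P.f * (P.c - P.e) :=
    mul_pos (mul_pos P.d_pos P.f_pos) (by linarith [P.f_lt_c, P.e_lt_f])
  nlinarith

theorem disc_M_pos (i : ZMod 3) : 0 < (P.M i).disc := (P.M i).disc_pos

theorem polar_M_L {i j : ZMod 3} (h : i ≠ j) : (P.M i).polar (P.L j) = 0 := by
  rcases zmod3_cases i with rfl | rfl | rfl <;> rcases zmod3_cases j with rfl | rfl | rfl <;>
    first
    | exact absurd rfl h
    | (simp only [Wall.polar, M, L]; ring)

/-- Reflections in `Mᵢ*` preserve the geodesics `L̃ⱼ`, for `j ≠ i`. -/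
theorem side_L_R {i j : ZMod 3} (h : i ≠ j) (z : ℍ) :
    (P.L j).side (P.R i • z) * denomSq (P.R i) z = (P.M i).disc * (P.L j).side z := by
  have := (P.M i).side_reflection (P.L j) z
  rw [P.polar_M_L h, zero_mul, add_zero] at this
  exact this

theorem side_L_R_nonneg {i j : ZMod 3} (h : i ≠ j) (z : ℍ) :
    0 ≤ (P.L j).side (P.R i • z) ↔ 0 ≤ (P.L j).side z := by
  have h1 := P.side_L_R h z
  rw [← mul_nonneg_iff_of_pos_right (denomSq_pos (P.R i) z), h1,
    mul_nonneg_iff_of_pos_left (P.disc_M_pos i)]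

theorem side_L_R_eq_zero {i j : ZMod 3} (h : i ≠ j) (z : ℍ) :
    (P.L j).side (P.R i • z) = 0 ↔ (P.L j).side z = 0 := by
  have h1 := P.side_L_R h z
  have h2 := (denomSq_pos (P.R i) z).ne'
  have h3 := (P.disc_M_pos i).ne'
  rw [← mul_eq_zero_iff_right h2, h1, mul_eq_zero_iff_left h3]

theorem side_M_R_self (i : ZMod 3) (z : ℍ) :
    (P.M i).side (P.R i • z) * denomSq (P.R i) z = -((P.M i).disc * (P.M i).side z) :=
  (P.M i).side_reflection_self z

theorem side_M_R_nonpos (i : ZMod 3) (z : ℍ) :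
    (P.M i).side (P.R i • z) ≤ 0 ↔ 0 ≤ (P.M i).side z := by
  have h1 := P.side_M_R_self i z
  have h2 := denomSq_pos (P.R i) z
  have h3 := P.disc_M_pos i
  constructor <;> intro h <;> by_contra! h4 <;> nlinarith

theorem side_M_R_neg (i : ZMod 3) (z : ℍ) :
    (P.M i).side (P.R i • z) < 0 ↔ 0 < (P.M i).side z := by
  have h1 := P.side_M_R_self i z
  have h2 := denomSq_pos (P.R i) z
  have h3 := P.disc_M_pos i
  constructor <;> intro h <;> by_contra! h4 <;> nlinarith

theorem side_M_R_pos (i : ZMod 3) (z : ℍ) :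
    0 < (P.M i).side (P.R i • z) ↔ (P.M i).side z < 0 := by
  have h1 := P.side_M_R_self i z
  have h2 := denomSq_pos (P.R i) z
  have h3 := P.disc_M_pos i
  constructor <;> intro h <;> by_contra! h4 <;> nlinarith

/-- The geodesics `Mᵢ*` are pairwise at positive distance, and none separates the other two. -/
theorem exists_gap_M : ∃ δ > 0, ∀ i j, i ≠ j → ∀ z : ℍ, (P.M j).side z ≤ 0 →
    δ * z.im ≤ (P.M i).side z := by
  have he := P.e_pos
  have hf := P.f_pos
  have hc := P.c_pos
  have hd := P.d_pos
  have hef := P.e_lt_f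
  have hfc := P.f_lt_c
  have hcd := P.c_lt_d
  have hq : P.e * P.f < P.c * P.d := by nlinarith
  have p1 : 0 < P.c - P.e := by linarith
  have p2 : 0 < P.c - P.f := by linarith
  have p3 : 0 < P.d - P.e := by linarith
  have p4 : 0 < P.d - P.f := by linarith
  obtain ⟨δ₁, h₁, H₁⟩ : ∃ δ > 0, ∀ z : ℍ, ((P.M 0).side z ≤ 0 → δ * z.im ≤ (P.M 1).side z) ∧
      ((P.M 1).side z ≤ 0 → δ * z.im ≤ (P.M 0).side z) := by
    have hr : P.e * P.f / (P.c * P.d) < 1 := by rw [div_lt_one (by positivity)]; exact hq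
    have hr0 : 0 < P.e * P.f / (P.c * P.d) := by positivity
    -- The determinant of the combined form is a concave quadratic polynomial in `r` with the roots
    -- `1` and `e f / (c d)`; the midpoint makes it positive. The other two pairs of walls are
    -- treated with the midpoints of their roots.
    refine (P.M 1).exists_gap (P.M 0) (r := (1 + P.e * P.f / (P.c * P.d)) / 2) (by positivity) ?_ ?_
    · change 0 < 1 + _ * (-1); linarith
    · change 0 < (1 + _ * (-1)) * (-(P.e * P.f) + _ * (P.c * P.d)) - (0 + _ * 0) ^ 2
      have e : -(P.e * P.f) + (1 + P.e * P.f / (P.c * P.d)) / 2 * (P.c * P.d) =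
        (P.c * P.d - P.e * P.f) / 2 := by field_simp; ring
      rw [e]
      have := mul_pos (show 0 < 1 + (1 + P.e * P.f / (P.c * P.d)) / 2 * -1 by linarith)
        (show 0 < (P.c * P.d - P.e * P.f) / 2 by linarith)
      linarith
  obtain ⟨δ₂, h₂, H₂⟩ : ∃ δ > 0, ∀ z : ℍ, ((P.M 2).side z ≤ 0 → δ * z.im ≤ (P.M 1).side z) ∧
      ((P.M 1).side z ≤ 0 → δ * z.im ≤ (P.M 2).side z) := by
    refine (P.M 1).exists_gap (P.M 2) (r := (P.e / ((P.c - P.e) * (P.d - P.e)) +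
      P.f / ((P.c - P.f) * (P.d - P.f))) / 2) (by positivity) ?_ ?_
    · have := P.M_two_a_pos
      change 0 < 1 + _ * _; positivity
    · change 0 < (1 + _ * (P.c + P.d - P.e - P.f)) * (-(P.e * P.f) +
        _ * (P.c * P.d * (P.e + P.f) - P.e * P.f * (P.c + P.d))) -
        (0 + _ * (P.c * P.d - P.e * P.f)) ^ 2
      have e : ∀ r : ℝ, (1 + r * (P.c + P.d - P.e - P.f)) * (-(P.e * P.f) +
        r * (P.c * P.d * (P.e + P.f) - P.e * P.f * (P.c + P.d))) -
        (0 + r * (P.c * P.d - P.e * P.f)) ^ 2 =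
        -((P.c - P.e) * (P.d - P.e) * (P.c - P.f) * (P.d - P.f)) *
          ((r - P.e / ((P.c - P.e) * (P.d - P.e))) * (r - P.f / ((P.c - P.f) * (P.d - P.f)))) :=
          fun r => by field_simp; ring
      rw [e]
      set u := P.e / ((P.c - P.e) * (P.d - P.e)) with hu
      set v := P.f / ((P.c - P.f) * (P.d - P.f)) with hv
      have huv : u ≠ v := by
        rw [hu, hv, Ne, div_eq_div_iff (by positivity) (by positivity)]
        intro h
        have : (P.f - P.e) * (P.c * P.d - P.e * P.f) = 0 := by linarith
        have := mul_pos (sub_pos.2 hef) (sub_pos.2 hq)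
        linarith
      have h3 : 0 < (u - v) ^ 2 := by have := sub_ne_zero.2 huv; positivity
      have h4 : 0 < (P.c - P.e) * (P.d - P.e) * (P.c - P.f) * (P.d - P.f) := by positivity
      nlinarith [mul_pos h3 h4]
  obtain ⟨δ₃, h₃, H₃⟩ : ∃ δ > 0, ∀ z : ℍ, ((P.M 2).side z ≤ 0 → δ * z.im ≤ (P.M 0).side z) ∧
      ((P.M 0).side z ≤ 0 → δ * z.im ≤ (P.M 2).side z) := by
    refine (P.M 0).exists_gap (P.M 2) (r := (P.c / ((P.c - P.e) * (P.c - P.f)) +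
      P.d / ((P.d - P.e) * (P.d - P.f))) / 2) (by positivity) ?_ ?_
    · change 0 < -1 + _ * (P.c + P.d - P.e - P.f)
      have k1 : 1 < P.c / ((P.c - P.e) * (P.c - P.f)) * (P.c + P.d - P.e - P.f) := by
        rw [div_mul_eq_mul_div, one_lt_div (by positivity)]
        nlinarith
      have k2 : 1 < P.d / ((P.d - P.e) * (P.d - P.f)) * (P.c + P.d - P.e - P.f) := by
        rw [div_mul_eq_mul_div, one_lt_div (by positivity)]
        nlinarith
      linarith
    · change 0 < (-1 + _ * (P.c + P.d - P.e - P.f)) * ((P.c * P.d) +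
        _ * (P.c * P.d * (P.e + P.f) - P.e * P.f * (P.c + P.d))) -
        (0 + _ * (P.c * P.d - P.e * P.f)) ^ 2
      have e : ∀ r : ℝ, (-1 + r * (P.c + P.d - P.e - P.f)) * ((P.c * P.d) +
        r * (P.c * P.d * (P.e + P.f) - P.e * P.f * (P.c + P.d))) -
        (0 + r * (P.c * P.d - P.e * P.f)) ^ 2 =
        -((P.c - P.e) * (P.d - P.e) * (P.c - P.f) * (P.d - P.f)) *
          ((r - P.c / ((P.c - P.e) * (P.c - P.f))) * (r - P.d / ((P.d - P.e) * (P.d - P.f)))) :=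
          fun r => by field_simp; ring
      rw [e]
      set u := P.c / ((P.c - P.e) * (P.c - P.f)) with hu
      set v := P.d / ((P.d - P.e) * (P.d - P.f)) with hv
      have huv : u ≠ v := by
        rw [hu, hv, Ne, div_eq_div_iff (by positivity) (by positivity)]
        intro h
        have : (P.d - P.c) * (P.c * P.d - P.e * P.f) = 0 := by linarith
        have := mul_pos (sub_pos.2 hcd) (sub_pos.2 hq)
        linarith
      have h3 : 0 < (u - v) ^ 2 := by have := sub_ne_zero.2 huv; positivity
      have h4 : 0 < (P.c - P.e) * (P.d - P.e) * (P.c - P.f) * (P.d - P.f) := by positivity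
      nlinarith [mul_pos h3 h4]
  refine ⟨min δ₁ (min δ₂ δ₃), by positivity, fun i j hij z hz => ?_⟩
  have hi := z.im_pos
  have m1 : min δ₁ (min δ₂ δ₃) * z.im ≤ δ₁ * z.im := by gcongr; exact min_le_left _ _
  have m2 : min δ₁ (min δ₂ δ₃) * z.im ≤ δ₂ * z.im := by
    gcongr; exact (min_le_right _ _).trans (min_le_left _ _)
  have m3 : min δ₁ (min δ₂ δ₃) * z.im ≤ δ₃ * z.im := by
    gcongr; exact (min_le_right _ _).trans (min_le_right _ _)
  rcases zmod3_cases i with rfl | rfl | rfl <;> rcases zmod3_cases j with rfl | rfl | rfl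
  · exact absurd rfl hij
  · exact m1.trans ((H₁ z).2 hz)
  · exact m3.trans ((H₃ z).1 hz)
  · exact m1.trans ((H₁ z).1 hz)
  · exact absurd rfl hij
  · exact m2.trans ((H₂ z).1 hz)
  · exact m3.trans ((H₃ z).2 hz)
  · exact m2.trans ((H₂ z).2 hz)
  · exact absurd rfl hij

theorem side_M_pos {i j : ZMod 3} (h : i ≠ j) {z : ℍ} (hz : (P.M j).side z ≤ 0) :
    0 < (P.M i).side z := by
  obtain ⟨δ, hδ, H⟩ := P.exists_gap_M
  exact (mul_pos hδ z.im_pos).trans_le (H i j h z hz)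

/-- The opposite sides `L̃ᵢ` and `Mᵢ*` of the hexagon lie on disjoint geodesics, and the half planes
beyond them are disjoint. A letter `i` at the front of a reduced word therefore puts a point on the
good side of `L̃ᵢ`. -/
theorem side_L_pos_of_M {i : ZMod 3} {z : ℍ} (hz : (P.M i).side z ≤ 0) : 0 < (P.L i).side z := by
  have he := P.e_pos
  have hf := P.f_pos
  have hc := P.c_pos
  have hef := P.e_lt_f
  have hfc := P.f_lt_c
  have hcd := P.c_lt_d
  have hi := z.im_pos
  rcases zmod3_cases i with rfl | rfl | rfl
  · rw [M_zero_side] at hz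
    rw [L_zero_side, arcSide]
    have h1 : P.c ^ 2 < z.re ^ 2 + z.im ^ 2 := by nlinarith
    set s := Real.sqrt (z.re ^ 2 + z.im ^ 2) with hs
    have hs2 : s ^ 2 = z.re ^ 2 + z.im ^ 2 := Real.sq_sqrt (by positivity)
    have hs0 : P.c < s := by
      rw [hs]; exact Real.lt_sqrt_of_sq_lt h1
    have hsr : z.re ≤ s := Real.le_sqrt_of_sq_le (by nlinarith)
    nlinarith [mul_pos (show 0 < s - P.e by linarith) (show 0 < s - P.f by linarith)]
  · rw [M_one_side] at hz
    rw [L_one_side, arcSide]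
    have : z.re < P.c := by
      by_contra! h; nlinarith
    nlinarith [mul_pos (sub_pos.2 this) (show 0 < P.d - z.re by linarith)]
  · rw [Wall.side_eq] at hz
    rw [L_two_side]
    have h1 := P.M_two_a_pos
    have h2 := P.M_two_b_pos
    have h3 := P.M_two_c_pos
    by_contra! h
    have : 0 < (P.M 2).a * (z.re ^ 2 + z.im ^ 2) := by positivity
    nlinarith

theorem side_L_pos {i j : ZMod 3} (h : i ≠ j) {z : ℍ} (hz : (P.L j).side z ≤ 0) :
    0 < (P.L i).side z := by
  have he := P.e_pos
  have hef := P.e_lt_f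
  have hfc := P.f_lt_c
  have hcd := P.c_lt_d
  rcases zmod3_cases i with rfl | rfl | rfl <;> rcases zmod3_cases j with rfl | rfl | rfl <;>
    first
    | exact absurd rfl h
    | skip
  · rw [L_one_side] at hz
    rw [L_zero_side]
    exact arcSide_pos_of_le_re (by linarith [(arcSide_re hz hcd.le).1]) hef.le
  · rw [L_two_side] at hz
    rw [L_zero_side]
    exact arcSide_pos_of_re_le (by linarith) hef.le
  · rw [L_zero_side] at hz
    rw [L_one_side]
    exact arcSide_pos_of_re_le (by linarith [(arcSide_re hz hef.le).2]) hcd.le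
  · rw [L_two_side] at hz
    rw [L_one_side]
    exact arcSide_pos_of_re_le (by linarith) hcd.le
  · rw [L_zero_side] at hz
    rw [L_two_side]
    linarith [(arcSide_re hz hef.le).1]
  · rw [L_one_side] at hz
    rw [L_two_side]
    linarith [(arcSide_re hz hcd.le).1]

end ThreeHoledSphere


namespace ThreeHoledSphere

variable (P : ThreeHoledSphere)

/-! ### Words in the reflections -/

/-- The product of the reflections with the given indices. -/
def word (l : List (ZMod 3)) : GL (Fin 2) ℝ := (l.map P.R).prod

@[simp] theorem word_nil : P.word [] = 1 := rfl
@[simp] theorem word_cons (i : ZMod 3) (l : List (ZMod 3)) :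
    P.word (i :: l) = P.R i * P.word l := by simp [word]
@[simp] theorem word_append (l l' : List (ZMod 3)) :
    P.word (l ++ l') = P.word l * P.word l' := by simp [word]

theorem R_smul_R_smul (i : ZMod 3) (v : UnitTangent) : P.R i • P.R i • v = v := by
  rw [← mul_smul]
  exact ((P.M i).actEq_reflection_mul_self v).trans (one_smul _ v)

theorem actEq_R_mul_R (i : ZMod 3) : ActEq (P.R i * P.R i) 1 :=
  (P.M i).actEq_reflection_mul_self

theorem actEq_R_inv (i : ZMod 3) : ActEq (P.R i)⁻¹ (P.R i) := fun v => by
  rw [inv_smul_eq_iff, R_smul_R_smul]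

theorem R_smul_R_smul_pt (i : ZMod 3) (z : ℍ) : P.R i • P.R i • z = z := by
  rw [← mul_smul, (P.actEq_R_mul_R i).pt, one_smul]

theorem actEq_word_reverse (l : List (ZMod 3)) : ActEq (P.word l.reverse) (P.word l)⁻¹ := by
  induction l with
  | nil => intro v; simp
  | cons i l ih =>
    rw [List.reverse_cons, word_append, word_cons, word_nil, mul_one, word_cons, mul_inv_rev]
    exact ih.mul (P.actEq_R_inv i).symm

theorem word_reverse_smul_word_smul (l : List (ZMod 3)) (z : ℍ) :
    P.word l.reverse • P.word l • z = z := by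
  rw [(P.actEq_word_reverse l).pt, inv_smul_smul]

theorem word_mem_closure (l : List (ZMod 3)) : P.word l ∈ Subgroup.closure (range P.R) := by
  induction l with
  | nil => exact one_mem _
  | cons i l ih =>
    rw [word_cons]
    exact mul_mem (Subgroup.subset_closure ⟨i, rfl⟩) ih

theorem det_word_pos_iff (l : List (ZMod 3)) : 0 < (P.word l).det.val ↔ Even l.length := by
  have key : 0 < (-1) ^ l.length * (P.word l).det.val := by
    induction l with
    | nil => simp
    | cons i l ih =>
      rw [word_cons, map_mul, Units.val_mul, List.length_cons, pow_succ]
      have h1 : (P.R i).det.val = -(P.M i).disc := (P.M i).det_reflection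
      rw [h1]
      have := mul_pos ih (P.disc_M_pos i)
      linarith
  constructor
  · intro h
    by_contra h1
    rw [Nat.not_even_iff_odd] at h1
    rw [h1.neg_one_pow] at key
    linarith
  · intro h
    rw [h.neg_one_pow] at key
    linarith

/-- A word without repetition of adjacent letters. -/
def Reduced (l : List (ZMod 3)) : Prop := l.IsChain (· ≠ ·)

variable {P}

theorem exists_reduced (P : ThreeHoledSphere) (l : List (ZMod 3)) :
    ∃ l', Reduced l' ∧ ActEq (P.word l) (P.word l') ∧ (Even l'.length ↔ Even l.length) ∧
      ∀ i ∈ l', i ∈ l := by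
  induction l with
  | nil => exact ⟨[], List.IsChain.nil, ActEq.refl _, Iff.rfl, fun i h => h⟩
  | cons i l ih =>
    obtain ⟨l', h1, h2, h3, h4⟩ := ih
    cases l' with
    | nil =>
      refine ⟨[i], List.IsChain.singleton i, ?_, ?_, ?_⟩
      · rw [word_cons, word_cons]; exact (ActEq.refl _).mul h2
      · simp only [List.length_cons, List.length_nil, Nat.even_add_one] at h3 ⊢
        rw [h3]
      · simp
    | cons j l'' =>
      by_cases hij : i = j
      · subst hij
        refine ⟨l'', List.IsChain.tail h1, ?_, ?_, ?_⟩
        · rw [word_cons]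
          refine ((ActEq.refl _).mul h2).trans ?_
          rw [word_cons, ← mul_assoc]
          have := (P.actEq_R_mul_R i).mul (ActEq.refl (P.word l''))
          rwa [one_mul] at this
        · simp only [List.length_cons, Nat.even_add_one] at h3 ⊢
          rw [← h3, not_not]
        · intro k hk
          exact List.mem_cons_of_mem _ (h4 k (List.mem_cons_of_mem _ hk))
      · refine ⟨i :: j :: l'', List.isChain_cons_cons.2 ⟨hij, h1⟩, ?_, ?_, ?_⟩
        · rw [word_cons, word_cons P i]; exact (ActEq.refl _).mul h2
        · simp only [List.length_cons, Nat.even_add_one] at h3 ⊢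
          rw [h3]
        · intro k hk
          rcases List.mem_cons.1 hk with rfl | hk
          · exact List.mem_cons_self
          · exact List.mem_cons_of_mem _ (h4 k hk)

/-- The parity is recorded since deck transformations preserve the orientation, so that only even
words occur for them. -/
theorem exists_word_of_mem_closure {g : GL (Fin 2) ℝ}
    (hg : g ∈ Subgroup.closure (range P.R)) :
    ∃ l, ActEq g (P.word l) ∧ (0 < g.det.val ↔ Even l.length) := by
  suffices h : ∃ l, ActEq g (P.word l) ∧ (0 < g.det.val ↔ 0 < (P.word l).det.val) by
    obtain ⟨l, h1, h2⟩ := h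
    exact ⟨l, h1, h2.trans (P.det_word_pos_iff l)⟩
  induction hg using Subgroup.closure_induction with
  | mem x hx =>
    obtain ⟨i, rfl⟩ := hx
    exact ⟨[i], by rw [word_cons, word_nil, mul_one]; exact ActEq.refl _,
      by rw [word_cons, word_nil, mul_one]⟩
  | one => exact ⟨[], ActEq.refl _, Iff.rfl⟩
  | mul x y _ _ hx hy =>
    obtain ⟨l, h1, h2⟩ := hx
    obtain ⟨l', h3, h4⟩ := hy
    refine ⟨l ++ l', by rw [word_append]; exact h1.mul h3, ?_⟩
    rw [word_append, map_mul, map_mul, Units.val_mul, Units.val_mul]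
    have n1 := x.det.ne_zero
    have n2 := y.det.ne_zero
    have n3 := (P.word l).det.ne_zero
    have n4 := (P.word l').det.ne_zero
    have key : ∀ {a b : ℝ}, a ≠ 0 → b ≠ 0 → (0 < a * b ↔ (0 < a ↔ 0 < b)) := by
      intro a b ha hb
      rw [mul_pos_iff]
      rcases ha.lt_or_gt with h | h <;> rcases hb.lt_or_gt with h' | h' <;>
        simp [h, h', h.not_gt, h'.not_gt]
    rw [key n1 n2, key n3 n4, h2, h4]
  | inv x _ hx =>
    obtain ⟨l, h1, h2⟩ := hx
    refine ⟨l.reverse, h1.inv.trans (P.actEq_word_reverse l).symm, ?_⟩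
    rw [P.det_word_pos_iff, List.length_reverse, ← P.det_word_pos_iff, ← h2, map_inv,
      Units.val_inv_eq_inv_val, inv_pos]

theorem deck_mem_closure (P : ThreeHoledSphere) (i : ZMod 3) :
    P.deck i ∈ Subgroup.closure (range P.R) :=
  mul_mem (Subgroup.subset_closure ⟨_, rfl⟩) (Subgroup.subset_closure ⟨_, rfl⟩)

theorem Γ_le_closure (P : ThreeHoledSphere) : P.Γ ≤ Subgroup.closure (range P.R) := by
  rw [Γ, Subgroup.closure_le]
  rintro _ ⟨i, rfl⟩
  exact P.deck_mem_closure i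

theorem det_pos_of_mem_Γ {k : GL (Fin 2) ℝ} (hk : k ∈ P.Γ) : 0 < k.det.val := by
  induction hk using Subgroup.closure_induction with
  | mem x hx =>
    obtain ⟨i, rfl⟩ := hx
    rw [deck, map_mul, Units.val_mul]
    have h1 : ∀ j, (P.R j).det.val = -(P.M j).disc := fun j => (P.M j).det_reflection
    rw [h1, h1]
    have := mul_pos (P.disc_M_pos (i + 2)) (P.disc_M_pos (i + 1))
    linarith
  | one => simp
  | mul x y _ _ hx hy => rw [map_mul, Units.val_mul]; positivity
  | inv x _ hx => rw [map_inv, Units.val_inv_eq_inv_val]; positivity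

/-- Every deck transformation acts as a reduced word of even length. -/
theorem exists_word_of_mem_Γ {k : GL (Fin 2) ℝ} (hk : k ∈ P.Γ) :
    ∃ l, Reduced l ∧ Even l.length ∧ ActEq k (P.word l) := by
  obtain ⟨l, h1, h2⟩ := exists_word_of_mem_closure (P.Γ_le_closure hk)
  obtain ⟨l', h3, h4, h5, -⟩ := P.exists_reduced l
  exact ⟨l', h3, h5.2 (h2.1 (det_pos_of_mem_Γ hk)), h1.trans h4⟩

theorem deck_mem_Γ (P : ThreeHoledSphere) (i : ZMod 3) : P.deck i ∈ P.Γ :=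
  Subgroup.subset_closure ⟨i, rfl⟩

/-- Two distinct indices modulo `3` are consecutive in one of the two orders, so the product is some
`γₖ` or its inverse. -/
theorem exists_mem_Γ_of_pair (P : ThreeHoledSphere) (i j : ZMod 3) :
    ∃ k ∈ P.Γ, ActEq k (P.R i * P.R j) := by
  have h : j = i ∨ i = j + 1 ∨ j = i + 1 := by revert i j; decide
  rcases h with rfl | rfl | rfl
  · exact ⟨1, one_mem _, (P.actEq_R_mul_R j).symm⟩
  · have e : P.deck (j - 1) = P.R (j + 1) * P.R j := by
      rw [deck]
      congr 2 <;> ring_nf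
    exact ⟨P.deck (j - 1), P.deck_mem_Γ _, by rw [e]; exact ActEq.refl _⟩
  · have e : P.deck (i - 1) = P.R (i + 1) * P.R i := by
      rw [deck]
      congr 2 <;> ring_nf
    refine ⟨(P.deck (i - 1))⁻¹, inv_mem (P.deck_mem_Γ _), ?_⟩
    rw [e, mul_inv_rev]
    exact (P.actEq_R_inv i).mul (P.actEq_R_inv (i + 1))

/-- Every word of even length acts as a deck transformation. -/
theorem exists_mem_Γ_of_even (P : ThreeHoledSphere) :
    ∀ {l : List (ZMod 3)}, Even l.length → ∃ k ∈ P.Γ, ActEq k (P.word l)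
  | [], _ => ⟨1, one_mem _, ActEq.refl _⟩
  | [_], h => by simp at h
  | i :: j :: l, h => by
    have h' : Even l.length := by
      simpa [Nat.even_add_one] using h
    obtain ⟨k, hk, h1⟩ := exists_mem_Γ_of_even P h'
    obtain ⟨k', hk', h2⟩ := P.exists_mem_Γ_of_pair i j
    refine ⟨k' * k, mul_mem hk' hk, ?_⟩
    rw [word_cons, word_cons, ← mul_assoc]
    exact h2.mul h1

/-! ### The ping-pong lemma -/

theorem Reduced.tail {i : ZMod 3} {l : List (ZMod 3)} (h : Reduced (i :: l)) : Reduced l :=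
  List.IsChain.tail h

theorem Reduced.ne {i j : ZMod 3} {l : List (ZMod 3)} (h : Reduced (i :: j :: l)) : i ≠ j :=
  (List.isChain_cons_cons.1 h).1

/-- The ping-pong lemma. -/
theorem pingpong (U : ZMod 3 → Set ℍ) {l : List (ZMod 3)} {j : ZMod 3} {z : ℍ}
    (hU : ∀ i ∈ l, ∀ j, i ≠ j → ∀ z ∈ U j, P.R i • z ∈ U i)
    (hl : Reduced (l ++ [j])) (hz : z ∈ U j) : P.word l • z ∈ U (l.headD j) := by
  induction l with
  | nil => simpa using hz
  | cons i l ih =>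
    rw [word_cons, mul_smul]
    have h1 := ih (fun k hk => hU k (List.mem_cons_of_mem _ hk)) (Reduced.tail hl)
    cases l with
    | nil => exact hU i List.mem_cons_self j (Reduced.ne hl) _ (by simpa using h1)
    | cons k l => exact hU i List.mem_cons_self k (Reduced.ne hl) _ h1

/-- The region bounded by the geodesics `Mᵢ*`. -/
def E (P : ThreeHoledSphere) : Set ℍ := {z | ∀ i, 0 ≤ (P.M i).side z}

theorem mem_E {z : ℍ} : z ∈ P.E ↔ ∀ i, 0 ≤ (P.M i).side z := Iff.rfl

/-- Ping-pong on the closed half planes beyond the `Mᵢ*`: the last letter takes `E` beyond its own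
wall, and each further letter maps the half plane of the preceding one into its own. -/
theorem side_M_word_nonpos {i : ZMod 3} {l : List (ZMod 3)} (hl : Reduced (i :: l)) {z : ℍ}
    (hz : z ∈ P.E) : (P.M i).side (P.word (i :: l) • z) ≤ 0 := by
  have key : ∀ (l : List (ZMod 3)) (j : ZMod 3), Reduced (l ++ [j]) →
      (P.M (l.headD j)).side (P.word (l ++ [j]) • z) ≤ 0 := by
    intro l j hl
    rw [word_append, mul_smul]
    refine pingpong (P := P) (fun i => {z | (P.M i).side z ≤ 0}) ?_ hl ?_
    · intro i _ j hij z hz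
      exact (P.side_M_R_nonpos i z).2 (P.side_M_pos hij hz).le
    · rw [word_cons, word_nil, mul_one]
      exact (P.side_M_R_nonpos j z).2 (hz j)
  rcases List.eq_nil_or_concat l with rfl | ⟨l', j, rfl⟩
  · simpa using key [] i hl
  · have := key (i :: l') j (by simpa using hl)
    simpa using this

/-- The region `E` is a strict fundamental domain. -/
theorem word_eq_of_mem_E {l : List (ZMod 3)} (hl : Reduced l) {z : ℍ} (hz : z ∈ P.E)
    (hz' : P.word l • z ∈ P.E) : l = [] ∨ ∃ i, l = [i] ∧ (P.M i).side z = 0 := by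
  cases l with
  | nil => exact Or.inl rfl
  | cons i l =>
    right
    have h1 : (P.M i).side (P.word (i :: l) • z) = 0 :=
      le_antisymm (side_M_word_nonpos hl hz) (hz' i)
    have h2 : (P.M i).side (P.word l • z) = 0 := by
      have := P.side_M_R_self i (P.word l • z)
      rw [← mul_smul, ← word_cons, h1, zero_mul] at this
      have h3 := (P.disc_M_pos i).ne'
      have : (P.M i).disc * (P.M i).side (P.word l • z) = 0 := by linarith
      exact (mul_eq_zero.1 this).resolve_left h3
    cases l with
    | nil => exact ⟨i, rfl, by simpa using h2⟩
    | cons j l =>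
      exfalso
      have h3 := side_M_word_nonpos hl.tail hz
      have := P.side_M_pos hl.ne h3
      linarith

theorem R_smul_eq_of_side_eq_zero {i : ZMod 3} {z : ℍ} (h : (P.M i).side z = 0) :
    P.R i • z = z := by
  have hd := P.disc_M_pos i
  have hN := denomSq_pos (P.R i) z
  have e : denomSq (P.R i) z = (P.M i).disc := by
    have h1 := Wall.side_eq (P.M i) z
    rw [h] at h1
    rw [denomSq, Wall.disc]
    change ((P.M i).a * z.re + -(P.M i).b) ^ 2 + ((P.M i).a * z.im) ^ 2 = _
    linear_combination -(P.M i).a * h1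
  refine ext_re_im ?_ ?_
  · have h1 := smul_re_mul (P.R i) z
    rw [e] at h1
    refine mul_right_cancel₀ hd.ne' ?_
    rw [h1]
    change ((P.M i).b * z.re + -(P.M i).c) * ((P.M i).a * z.re + -(P.M i).b) +
      (P.M i).b * (P.M i).a * z.im ^ 2 = _
    have h2 := Wall.side_eq (P.M i) z
    rw [h] at h2
    rw [Wall.disc]
    linear_combination -(P.M i).b * h2
  · have h1 := (P.M i).im_reflection z
    change (P.R i • z).im * denomSq (P.R i) z = _ at h1
    rw [e] at h1
    exact mul_left_cancel₀ hd.ne' (by linarith)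

theorem word_smul_eq_of_mem_E {l : List (ZMod 3)} {z : ℍ} (hz : z ∈ P.E)
    (hz' : P.word l • z ∈ P.E) : P.word l • z = z := by
  obtain ⟨l', h1, h2, -, -⟩ := P.exists_reduced l
  rw [h2.pt] at hz' ⊢
  rcases word_eq_of_mem_E h1 hz hz' with rfl | ⟨i, rfl, h⟩
  · simp
  · rw [word_cons, word_nil, mul_one]
    exact R_smul_eq_of_side_eq_zero h

/-! ### Every point can be moved into `E` -/

/-- `F` is a multiple of the hyperbolic cosine of the distance to `i √T`, an interior point of `E`.
Reflecting in a wall that separates the point from `i √T` decreases `F`, and the gap between the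
walls bounds the decrease from below as long as the reflected point is still outside `E`. -/
theorem exists_decrease (P : ThreeHoledSphere) : ∃ η > 0, ∃ F : ℍ → ℝ, (∀ z, 0 ≤ F z) ∧
    ∀ i j z, (P.M i).side z < 0 → (P.M j).side (P.R i • z) < 0 → F (P.R i • z) ≤ F z - η := by
  obtain ⟨δ, hδ, H⟩ := P.exists_gap_M
  have he := P.e_pos
  have hf := P.f_pos
  have hc := P.c_pos
  have hd := P.d_pos
  have hq : P.e * P.f < P.c * P.d := by
    nlinarith [P.e_lt_f, P.f_lt_c, P.c_lt_d]
  -- Any value between `e f` and `c d` puts `i √T` inside `E`. The number `κ i` is the value of the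
  -- form of `Mᵢ*` at this point.
  set T : ℝ := (P.e * P.f + P.c * P.d) / 2 with hT
  have hT0 : 0 < T := by positivity
  set κ : ZMod 3 → ℝ := fun i => (P.M i).a * T + (P.M i).c with hκ
  have hκ0 : ∀ i, 0 < κ i := by
    intro i
    rcases zmod3_cases i with rfl | rfl | rfl
    · change 0 < -1 * T + P.c * P.d
      linarith
    · change 0 < 1 * T + -(P.e * P.f)
      linarith
    · have := P.M_two_a_pos
      have := P.M_two_c_pos
      change 0 < (P.M 2).a * T + (P.M 2).c
      positivity
  have hdi := P.disc_M_pos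
  set η : ℝ := min (κ 0 * δ / (P.M 0).disc) (min (κ 1 * δ / (P.M 1).disc)
    (κ 2 * δ / (P.M 2).disc)) with hη
  have hηi : ∀ i, η ≤ κ i * δ / (P.M i).disc := by
    intro i
    rcases zmod3_cases i with rfl | rfl | rfl
    · exact min_le_left _ _
    · exact (min_le_right _ _).trans (min_le_left _ _)
    · exact (min_le_right _ _).trans (min_le_right _ _)
  refine ⟨η, ?_, fun z => (z.re ^ 2 + z.im ^ 2 + T) / z.im, fun z => ?_, fun i j z hi hj => ?_⟩
  · have h0 := hκ0 0; have h1 := hκ0 1; have h2 := hκ0 2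
    have d0 := hdi 0; have d1 := hdi 1; have d2 := hdi 2
    positivity
  · have := z.im_pos
    positivity
  · have hij : i ≠ j := by
      rintro rfl
      have := (P.side_M_R_pos i z).2 hi
      linarith
    have h1 := H i j hij _ hj.le
    have h2 := P.side_M_R_self i z
    have h3 : (P.R i • z).im * denomSq (P.R i) z = (P.M i).disc * z.im :=
      (P.M i).im_reflection z
    have hN := denomSq_pos (P.R i) z
    have hz := z.im_pos
    have hz' := (P.R i • z).im_pos
    -- the value at the image
    have h4 : ((P.R i • z).re ^ 2 + (P.R i • z).im ^ 2 + T) * denomSq (P.R i) z =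
        (P.M i).disc * (z.re ^ 2 + z.im ^ 2 + T) + κ i * (P.M i).side z := by
      have e1 := smul_normSq_mul (P.R i) z
      rw [add_mul, e1, Wall.side_eq, Wall.disc, denomSq, hκ]
      change ((P.M i).b * z.re + -(P.M i).c) ^ 2 + ((P.M i).b * z.im) ^ 2 +
        T * (((P.M i).a * z.re + -(P.M i).b) ^ 2 + ((P.M i).a * z.im) ^ 2) = _
      ring
    have h5 : ((P.R i • z).re ^ 2 + (P.R i • z).im ^ 2 + T) / (P.R i • z).im =
        (z.re ^ 2 + z.im ^ 2 + T) / z.im + κ i * (P.M i).side z / ((P.M i).disc * z.im) := by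
      have d0 := (hdi i).ne'
      rw [← mul_div_mul_right _ _ hN.ne', h4, h3]
      field_simp
    have h6 : (P.M i).side z ≤ -(δ * z.im) := by
      have h7 : δ * ((P.R i • z).im * denomSq (P.R i) z) ≤
          (P.M i).side (P.R i • z) * denomSq (P.R i) z := by
        have := mul_le_mul_of_nonneg_right h1 hN.le
        linarith
      rw [h3, h2] at h7
      have d0 := hdi i
      by_contra! h8
      nlinarith
    have h7 : κ i * (P.M i).side z / ((P.M i).disc * z.im) ≤ -η := by
      have d0 := hdi i
      have k0 := hκ0 i
      have h8 := hηi i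
      rw [div_le_iff₀ (by positivity)]
      rw [le_div_iff₀ d0] at h8
      nlinarith
    change ((P.R i • z).re ^ 2 + (P.R i • z).im ^ 2 + T) / (P.R i • z).im ≤ _
    rw [h5]
    linarith

/-- Every point can be moved into `E` by a word in the reflections; a property `C` that is
preserved by the reflections with letters in `A` that are needed is kept. -/
theorem exists_word_mem_E (C : ℍ → Prop) (A : ZMod 3 → Prop)
    (hC : ∀ z i, C z → (P.M i).side z < 0 → A i ∧ C (P.R i • z)) (z : ℍ) (hz : C z) :
    ∃ l, (∀ i ∈ l, A i) ∧ C (P.word l • z) ∧ P.word l • z ∈ P.E := by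
  obtain ⟨η, hη, F, hF, H⟩ := P.exists_decrease
  have key : ∀ n : ℕ, ∀ z, C z → F z < n * η →
      ∃ l, (∀ i ∈ l, A i) ∧ C (P.word l • z) ∧ P.word l • z ∈ P.E := by
    intro n
    induction n with
    | zero =>
      intro z _ h
      have := hF z
      simp at h
      linarith
    | succ n ih =>
      intro z hz h
      by_cases h1 : z ∈ P.E
      · exact ⟨[], by simp, by simpa using hz, by simpa using h1⟩
      · rw [mem_E] at h1
        push Not at h1
        obtain ⟨i, hi⟩ := h1
        obtain ⟨hA, hC'⟩ := hC z i hz hi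
        by_cases h2 : P.R i • z ∈ P.E
        · exact ⟨[i], by simpa using hA, by simpa using hC', by simpa using h2⟩
        · rw [mem_E] at h2
          push Not at h2
          obtain ⟨j, hj⟩ := h2
          have h3 := H i j z hi hj
          obtain ⟨l, hl, hl1, hl2⟩ := ih (P.R i • z) hC' (by push_cast at h; linarith)
          refine ⟨l ++ [i], ?_, ?_, ?_⟩
          · intro k hk
            rcases List.mem_append.1 hk with hk | hk
            · exact hl k hk
            · rw [List.mem_singleton.1 hk]; exact hA
          · simpa [mul_smul] using hl1
          · simpa [mul_smul] using hl2
  obtain ⟨n, hn⟩ := exists_nat_gt (F z / η)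
  rw [div_lt_iff₀ hη] at hn
  exact key n z hz hn

/-! ### The universal cover as an intersection of half planes -/

/-- Letters other than `i` preserve the half plane of `L̃ᵢ`. A front letter `i` of a reduced word
moves the point beyond `Mᵢ*`, where the form of `L̃ᵢ` is positive. -/
theorem side_L_word_nonneg {z : ℍ} (hz : z ∈ P.Q) (i : ZMod 3) (l : List (ZMod 3)) :
    0 ≤ (P.L i).side (P.word l • z) := by
  obtain ⟨l', h1, h2, -, -⟩ := P.exists_reduced l
  rw [h2.pt]
  clear h2
  induction l' with
  | nil => simpa using (hz i).1
  | cons j l' ih =>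
    by_cases hij : j = i
    · subst hij
      exact (P.side_L_pos_of_M (side_M_word_nonpos h1 fun k => (hz k).2)).le
    · rw [word_cons, mul_smul, P.side_L_R_nonneg hij]
      exact ih h1.tail

/-- The universal cover is the intersection of the half planes bounded by the lifts of the
boundary components. -/
theorem mem_cover_iff {z : ℍ} :
    z ∈ P.cover ↔ ∀ (l : List (ZMod 3)) (i : ZMod 3), 0 ≤ (P.L i).side (P.word l • z) := by
  constructor
  · rintro ⟨r, hr, hrz⟩ l i
    obtain ⟨l', h1, -⟩ := exists_word_of_mem_closure hr
    rw [h1.pt] at hrz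
    have := side_L_word_nonneg hrz i (l ++ l'.reverse)
    rwa [word_append, mul_smul, word_reverse_smul_word_smul] at this
  · intro h
    obtain ⟨l, -, -, hl⟩ := exists_word_mem_E (P := P) (fun _ => True) (fun _ => True)
      (fun _ _ _ _ => ⟨trivial, trivial⟩) z trivial
    exact ⟨P.word l, P.word_mem_closure l, fun i => ⟨h l i, hl i⟩⟩

theorem word_smul_mem_cover {z : ℍ} (hz : z ∈ P.cover) (l : List (ZMod 3)) :
    P.word l • z ∈ P.cover := by
  rw [mem_cover_iff] at hz ⊢
  intro l' i
  have := hz (l' ++ l) i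
  rwa [word_append, mul_smul] at this

theorem smul_mem_cover_iff {k : GL (Fin 2) ℝ} (hk : k ∈ P.Γ) {z : ℍ} :
    k • z ∈ P.cover ↔ z ∈ P.cover := by
  have key : ∀ k ∈ P.Γ, ∀ z ∈ P.cover, k • z ∈ P.cover := by
    intro k hk z hz
    obtain ⟨l, -, -, h⟩ := exists_word_of_mem_Γ hk
    rw [h.pt]
    exact word_smul_mem_cover hz l
  refine ⟨fun h => ?_, key k hk z⟩
  have := key k⁻¹ (inv_mem hk) _ h
  rwa [inv_smul_smul] at this

theorem mem_Q_of_mem_cover {z : ℍ} (hz : z ∈ P.cover) (hE : z ∈ P.E) : z ∈ P.Q := fun i =>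
  ⟨by simpa using (mem_cover_iff.1 hz) [] i, hE i⟩

/-- A point of `L̃ᵢ` can be moved into the hexagon by the reflections that preserve `L̃ᵢ`. -/
theorem exists_word_line_mem_Q {z : ℍ} {i : ZMod 3} (hz : (P.L i).side z = 0) :
    ∃ l, (∀ j ∈ l, j ≠ i) ∧ (P.L i).side (P.word l • z) = 0 ∧ P.word l • z ∈ P.Q := by
  obtain ⟨l, h1, h2, h3⟩ := exists_word_mem_E (P := P) (fun z => (P.L i).side z = 0)
    (fun j => j ≠ i) (fun z j hz hj => by
      have hji : j ≠ i := by
        rintro rfl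
        have := P.side_L_pos_of_M hj.le
        linarith
      exact ⟨hji, (P.side_L_R_eq_zero hji z).2 hz⟩) z hz
  refine ⟨l, h1, h2, fun j => ⟨?_, h3 j⟩⟩
  by_cases hj : j = i
  · rw [hj, h2]
  · exact (P.side_L_pos hj h2.le).le

theorem mem_cover_of_line {z : ℍ} {i : ZMod 3} (hz : (P.L i).side z = 0) : z ∈ P.cover := by
  obtain ⟨l, -, -, h⟩ := exists_word_line_mem_Q hz
  exact ⟨P.word l, P.word_mem_closure l, h⟩

theorem mem_cover_of_word_line {z : ℍ} {i : ZMod 3} {l : List (ZMod 3)}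
    (hz : (P.L i).side (P.word l • z) = 0) : z ∈ P.cover := by
  have := word_smul_mem_cover (mem_cover_of_line hz) l.reverse
  rwa [word_reverse_smul_word_smul] at this

theorem side_L_word_eq_zero {i : ZMod 3} {l : List (ZMod 3)} (hl : ∀ j ∈ l, j ≠ i) (z : ℍ) :
    (P.L i).side (P.word l • z) = 0 ↔ (P.L i).side z = 0 := by
  induction l with
  | nil => simp
  | cons j l ih =>
    rw [word_cons, mul_smul, P.side_L_R_eq_zero (hl j List.mem_cons_self),
      ih fun k hk => hl k (List.mem_cons_of_mem _ hk)]

/-- If a word maps a point of the hexagon on a lift of `L̃ᵢ`, the point is on `L̃ᵢ`. -/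
theorem side_eq_zero_of_mem_Q {z : ℍ} (hz : z ∈ P.Q) {i : ZMod 3} {l : List (ZMod 3)}
    (h : (P.L i).side (P.word l • z) = 0) : (P.L i).side z = 0 := by
  obtain ⟨a, -, h2, h3⟩ := exists_word_line_mem_Q h
  rw [← mul_smul, ← word_append] at h2 h3
  rwa [word_smul_eq_of_mem_E (fun k => (hz k).2) (fun k => (h3 k).2)] at h2

/-- Lifts of different boundary components are disjoint. -/
theorem eq_of_lines {z : ℍ} {i j : ZMod 3} {l : List (ZMod 3)} (h1 : (P.L i).side z = 0)
    (h2 : (P.L j).side (P.word l • z) = 0) : i = j := by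
  obtain ⟨a, ha, h3, h4⟩ := exists_word_line_mem_Q h1
  have h5 : (P.L j).side (P.word (l ++ a.reverse) • P.word a • z) = 0 := by
    rwa [word_append, mul_smul, word_reverse_smul_word_smul]
  have h6 := side_eq_zero_of_mem_Q h4 h5
  by_contra hij
  have := P.side_L_pos hij h6.le
  linarith

/-- A word that maps a point of `L̃ᵢ` to a point of `L̃ᵢ` acts as a word in the reflections that
preserve `L̃ᵢ`. -/
theorem exists_stabilizer_word {z : ℍ} {i : ZMod 3} {l : List (ZMod 3)}
    (h1 : (P.L i).side z = 0) (h2 : (P.L i).side (P.word l • z) = 0) :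
    ∃ l', Reduced l' ∧ (∀ j ∈ l', j ≠ i) ∧ ActEq (P.word l) (P.word l') ∧
      (Even l'.length ↔ Even l.length) := by
  obtain ⟨a, ha, h3, h4⟩ := exists_word_line_mem_Q h1
  obtain ⟨b, hb, h5, h6⟩ := exists_word_line_mem_Q h2
  -- This word maps one point of the hexagon to another, hence it is trivial or one reflection whose
  -- wall contains the point; that wall meets `L̃ᵢ`, so it is not `Mᵢ*`.
  obtain ⟨m, m1, m2, m3, -⟩ := P.exists_reduced (b ++ l ++ a.reverse)
  have e1 : P.word (b ++ l ++ a.reverse) • P.word a • z = P.word b • P.word l • z := by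
    rw [word_append, mul_smul, word_reverse_smul_word_smul, word_append, mul_smul]
  rw [← e1, m2.pt] at h6
  have hm : ∀ j ∈ m, j ≠ i := by
    rcases word_eq_of_mem_E m1 (fun k => (h4 k).2) (fun k => (h6 k).2) with rfl | ⟨k, rfl, hk⟩
    · simp
    · intro j hj
      rw [List.mem_singleton.1 hj]
      rintro rfl
      have := P.side_L_pos_of_M hk.le
      linarith
  obtain ⟨l', l1, l2, l3, l4⟩ := P.exists_reduced (b.reverse ++ m ++ a)
  refine ⟨l', l1, fun j hj => ?_, ?_, ?_⟩
  · have := l4 j hj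
    simp only [List.mem_append, List.mem_reverse] at this
    rcases this with (h | h) | h
    · exact hb j h
    · exact hm j h
    · exact ha j h
  · refine ActEq.trans ?_ l2
    rw [word_append, word_append]
    have q1 := (((P.actEq_word_reverse b).mul m2.symm).mul (ActEq.refl (P.word a))).symm
    refine ActEq.trans ?_ q1
    rw [word_append, word_append]
    have q2 := (ActEq.refl ((P.word b)⁻¹ * (P.word b * P.word l))).mul
      ((P.actEq_word_reverse a).mul (ActEq.refl (P.word a)))
    rw [inv_mul_cancel_left, inv_mul_cancel, mul_one] at q2
    rw [mul_assoc, mul_assoc (P.word b)]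
    intro v
    have := q2 v
    simp only [mul_smul, inv_smul_smul] at this ⊢
    exact this.symm
  · rw [l3]
    simp only [List.length_append, List.length_reverse] at m3 ⊢
    simp only [Nat.even_add] at m3 ⊢
    rw [m3]
    tauto

/-- Deck transformations act freely. -/
theorem actEq_one_of_smul_eq {k : GL (Fin 2) ℝ} (hk : k ∈ P.Γ) {z : ℍ} (h : k • z = z) :
    ActEq k 1 := by
  obtain ⟨l, -, l2, l3⟩ := exists_word_of_mem_Γ hk
  obtain ⟨a, -, -, ha⟩ := exists_word_mem_E (P := P) (fun _ => True) (fun _ => True)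
    (fun _ _ _ _ => ⟨trivial, trivial⟩) z trivial
  obtain ⟨m, m1, m2, m3, -⟩ := P.exists_reduced (a ++ l ++ a.reverse)
  have e1 : P.word m • P.word a • z = P.word a • z := by
    rw [← m2.pt, word_append, mul_smul, word_reverse_smul_word_smul, word_append, mul_smul,
      ← l3.pt, h]
  have hm : m = [] := by
    -- A single reflection is excluded, since conjugation keeps the parity even.
    rcases word_eq_of_mem_E m1 ha (by rwa [e1]) with h | ⟨i, rfl, -⟩
    · exact h
    · exfalso
      simp only [List.length_append, List.length_reverse, Nat.even_add] at m3
      simp at m3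
      tauto
  subst hm
  have e2 : ∀ v : UnitTangent, P.word a • k • (P.word a)⁻¹ • v = v := by
    intro v
    have := m2 v
    rw [word_append, word_append, mul_smul, mul_smul, P.actEq_word_reverse, ← l3] at this
    simpa using this
  intro v
  have := e2 (P.word a • v)
  rw [inv_smul_smul] at this
  rw [one_smul]
  exact smul_left_cancel _ this

end ThreeHoledSphere


namespace ThreeHoledSphere

variable {P : ThreeHoledSphere}

/-! ### Discreteness -/

/-- A point close to `z₀` can be outside `E` only across a wall through `z₀`. There is at most one
such wall, and its reflection, which fixes `z₀`, brings the point back; strict inequalities at `z₀`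
persist nearby. -/
theorem exists_nhds_word_mem_E {z₀ : ℍ} (hz₀ : z₀ ∈ P.E) : ∃ U ∈ 𝓝 z₀, ∀ u ∈ U,
    ∃ ρ : List (ZMod 3), (∀ i ∈ ρ, (P.M i).side z₀ = 0) ∧ P.word ρ • u ∈ P.E ∧
      (∀ i, 0 < (P.M i).side z₀ → 0 < (P.M i).side (P.word ρ • u)) ∧
      ∀ i, 0 < (P.L i).side z₀ → 0 < (P.L i).side (P.word ρ • u) := by
  have key : ∀ ρ : List (ZMod 3), P.word ρ • z₀ = z₀ → ∀ᶠ u in 𝓝 z₀,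
      (∀ i, 0 < (P.M i).side z₀ → 0 < (P.M i).side (P.word ρ • u)) ∧
      ∀ i, 0 < (P.L i).side z₀ → 0 < (P.L i).side (P.word ρ • u) := by
    intro ρ hρ
    have h : ∀ w : Wall, 0 < w.side z₀ → ∀ᶠ u in 𝓝 z₀, 0 < w.side (P.word ρ • u) := by
      intro w hw
      have hc : Continuous fun u => w.side (P.word ρ • u) :=
        w.continuous_side.comp (continuous_smul_gl _)
      exact hc.continuousAt.eventually_const_lt (by simpa only [hρ] using hw)
    have h' : ∀ w : Wall, ∀ᶠ u in 𝓝 z₀, 0 < w.side z₀ → 0 < w.side (P.word ρ • u) := by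
      intro w
      by_cases hw : 0 < w.side z₀
      · exact (h w hw).mono fun _ h _ => h
      · exact Eventually.of_forall fun _ h => absurd h hw
    exact (eventually_all.2 fun i => h' (P.M i)).and (eventually_all.2 fun i => h' (P.L i))
  by_cases hj : ∃ j, (P.M j).side z₀ = 0
  · obtain ⟨j, hj⟩ := hj
    have e1 : P.word [j] • z₀ = z₀ := by simpa using R_smul_eq_of_side_eq_zero hj
    have hpos : ∀ i, i ≠ j → 0 < (P.M i).side z₀ := fun i hi => P.side_M_pos hi hj.le
    refine ⟨_, (key [] (by simp)).and (key [j] e1), fun u hu => ?_⟩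
    obtain ⟨h1, h2⟩ := hu
    rcases le_or_gt 0 ((P.M j).side u) with h | h
    · refine ⟨[], by simp, fun i => ?_, h1⟩
      by_cases hi : i = j
      · simpa [hi] using h
      · exact (h1.1 i (hpos i hi)).le
    · refine ⟨[j], by simpa using hj, fun i => ?_, h2⟩
      by_cases hi : i = j
      · subst hi
        simpa using ((P.side_M_R_pos i u).2 h).le
      · exact (h2.1 i (hpos i hi)).le
  · push Not at hj
    refine ⟨_, key [] (by simp), fun u hu => ⟨[], by simp, fun i => ?_, hu⟩⟩
    exact (hu.1 i (lt_of_le_of_ne (hz₀ i) (hj i).symm)).le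

theorem word_smul_eq_self {z : ℍ} : ∀ {ρ : List (ZMod 3)}, (∀ i ∈ ρ, (P.M i).side z = 0) →
    P.word ρ • z = z
  | [], _ => by simp
  | i :: ρ, h => by
    rw [word_cons, mul_smul, word_smul_eq_self fun j hj => h j (List.mem_cons_of_mem _ hj),
      R_smul_eq_of_side_eq_zero (h i List.mem_cons_self)]

theorem exists_word_smul_mem_E (z : ℍ) : ∃ l, P.word l • z ∈ P.E := by
  obtain ⟨l, -, -, h⟩ := exists_word_mem_E (P := P) (fun _ => True) (fun _ => True)
    (fun _ _ _ _ => ⟨trivial, trivial⟩) z trivial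
  exact ⟨l, h⟩

/-- The reflection group acts properly discontinuously. -/
theorem exists_nhds_word_smul_eq (z₀ : ℍ) : ∃ U ∈ 𝓝 z₀, ∀ u ∈ U, ∀ l : List (ZMod 3),
    P.word l • u ∈ U → P.word l • z₀ = z₀ := by
  obtain ⟨a, ha⟩ := exists_word_smul_mem_E (P := P) z₀
  obtain ⟨U, hU, H⟩ := exists_nhds_word_mem_E ha
  refine ⟨(fun z => P.word a • z) ⁻¹' U,
    (continuous_smul_gl (P.word a)).continuousAt.preimage_mem_nhds hU, fun u hu l hl => ?_⟩
  obtain ⟨ρ, r1, r2, r3, -⟩ := H _ hu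
  obtain ⟨ρ', s1, s2, -, -⟩ := H _ hl
  have e1 : P.word (ρ' ++ (a ++ (l ++ (a.reverse ++ ρ.reverse)))) • P.word ρ • P.word a • u =
      P.word ρ' • P.word a • P.word l • u := by
    simp only [word_append, mul_smul, word_reverse_smul_word_smul]
  obtain ⟨m, m1, m2, -, -⟩ := P.exists_reduced (ρ' ++ (a ++ (l ++ (a.reverse ++ ρ.reverse))))
  have hm : ∀ i ∈ m, (P.M i).side (P.word a • z₀) = 0 := by
    have s2' := s2
    rw [← e1, m2.pt] at s2'
    rcases word_eq_of_mem_E m1 r2 s2' with rfl | ⟨i, rfl, hi⟩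
    · simp
    · intro j hj
      rw [List.mem_singleton.1 hj]
      by_contra h0
      have := r3 i (lt_of_le_of_ne (ha i) (Ne.symm h0))
      linarith
  have e2 : P.word ρ' • P.word a • P.word l • z₀ = P.word a • z₀ := by
    have h1 : P.word (ρ' ++ (a ++ (l ++ (a.reverse ++ ρ.reverse)))) • P.word ρ • P.word a • z₀ =
        P.word ρ' • P.word a • P.word l • z₀ := by
      simp only [word_append, mul_smul, word_reverse_smul_word_smul]
    rw [← h1, m2.pt, word_smul_eq_self r1, word_smul_eq_self hm]
  have e3 : P.word a • P.word l • z₀ = P.word a • z₀ := by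
    have := word_smul_eq_self s1
    rw [← this] at e2
    have := smul_left_cancel _ e2
    exact this
  exact smul_left_cancel _ e3

/-- Lifts of boundary components are isolated from each other. -/
theorem exists_nhds_side_L_eq_zero {z₀ : ℍ} {i : ZMod 3} {l : List (ZMod 3)}
    (h₀ : (P.L i).side (P.word l • z₀) = 0) : ∃ U ∈ 𝓝 z₀, ∀ u ∈ U, ∀ (j : ZMod 3)
      (l' : List (ZMod 3)), (P.L j).side (P.word l' • u) = 0 → (P.L i).side (P.word l • u) = 0 := by
  obtain ⟨a, ha, ha', haQ⟩ := exists_word_line_mem_Q h₀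
  obtain ⟨U, hU, H⟩ := exists_nhds_word_mem_E (P := P) (z₀ := P.word (a ++ l) • z₀)
    (by rw [word_append, mul_smul]; exact fun k => (haQ k).2)
  rw [← mul_smul, ← word_append] at ha' haQ
  refine ⟨(fun z => P.word (a ++ l) • z) ⁻¹' U,
    (continuous_smul_gl _).continuousAt.preimage_mem_nhds hU, fun u hu j l' hl' => ?_⟩
  obtain ⟨ρ, r1, r2, -, r4⟩ := H _ hu
  have hcov : P.word ρ • P.word (a ++ l) • u ∈ P.cover :=
    word_smul_mem_cover (word_smul_mem_cover (mem_cover_of_word_line hl') _) _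
  have hQ := mem_Q_of_mem_cover hcov r2
  have h1 : (P.L j).side (P.word (l' ++ ((a ++ l).reverse ++ ρ.reverse)) •
      P.word ρ • P.word (a ++ l) • u) = 0 := by
    rw [word_append, word_append, mul_smul, mul_smul, word_reverse_smul_word_smul,
      word_reverse_smul_word_smul]
    exact hl'
  have h2 := side_eq_zero_of_mem_Q hQ h1
  have hji : j = i := by
    by_contra hji
    have := r4 j (P.side_L_pos hji ha'.le)
    linarith
  subst hji
  have hρ : ∀ k ∈ ρ, k ≠ j := by
    rintro k hk rfl
    have := P.side_L_pos_of_M (r1 k hk).le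
    linarith
  rw [side_L_word_eq_zero hρ, word_append, mul_smul, side_L_word_eq_zero ha] at h2
  exact h2

/-! ### The covering map -/

theorem proj_eq_iff {z w : ℍ} : P.proj z = P.proj w ↔ ∃ k ∈ P.Γ, k • w = z := by
  rw [proj, proj, Quotient.eq]
  change z ∈ MulAction.orbit P.Γ w ↔ _
  rw [MulAction.mem_orbit_iff]
  exact ⟨fun ⟨k, hk⟩ => ⟨k.1, k.2, hk⟩, fun ⟨k, hk, h⟩ => ⟨⟨k, hk⟩, h⟩⟩

theorem projTangent_eq_iff {z w : UnitTangent} :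
    P.projTangent z = P.projTangent w ↔ ∃ k ∈ P.Γ, k • w = z := by
  rw [projTangent, projTangent, Quotient.eq]
  change z ∈ MulAction.orbit P.Γ w ↔ _
  rw [MulAction.mem_orbit_iff]
  exact ⟨fun ⟨k, hk⟩ => ⟨k.1, k.2, hk⟩, fun ⟨k, hk, h⟩ => ⟨⟨k, hk⟩, h⟩⟩

theorem proj_smul {k : GL (Fin 2) ℝ} (hk : k ∈ P.Γ) (z : ℍ) : P.proj (k • z) = P.proj z :=
  proj_eq_iff.2 ⟨k, hk, rfl⟩

theorem projTangent_smul {k : GL (Fin 2) ℝ} (hk : k ∈ P.Γ) (v : UnitTangent) :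
    P.projTangent (k • v) = P.projTangent v :=
  projTangent_eq_iff.2 ⟨k, hk, rfl⟩

theorem continuous_proj : Continuous P.proj := continuous_quotient_mk'

/-- `Γ` acts properly discontinuously and freely once it is replaced by its image in the
permutations of `ℍ`, which removes the matrices that act trivially. -/
theorem isCoveringMap_proj : IsCoveringMap P.proj := by
  have h : IsQuotientCoveringMap P.proj (MulAction.toPermHom P.Γ ℍ).range :=
    { toIsQuotientMap := isQuotientMap_quotient_mk'
      continuous_const_smul := by
        rintro ⟨_, ⟨k, rfl⟩⟩
        exact continuous_smul_gl k.1
      apply_eq_iff_mem_orbit := by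
        intro z w
        rw [proj_eq_iff, MulAction.mem_orbit_iff]
        constructor
        · rintro ⟨k, hk, h⟩
          exact ⟨⟨_, ⟨⟨k, hk⟩, rfl⟩⟩, h⟩
        · rintro ⟨⟨_, ⟨⟨k, hk⟩, rfl⟩⟩, h⟩
          exact ⟨k, hk, h⟩
      disjoint := by
        intro z
        obtain ⟨U, hU, H⟩ := exists_nhds_word_smul_eq (P := P) z
        refine ⟨U, hU, ?_⟩
        rintro ⟨_, ⟨⟨k, hk⟩, rfl⟩⟩ ⟨_, ⟨u, hu, rfl⟩, hu'⟩
        obtain ⟨l, -, -, hl⟩ := exists_word_of_mem_Γ hk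
        have hu'' : k • u ∈ U := hu'
        rw [hl.pt] at hu''
        have h1 := H u hu l hu''
        rw [← hl.pt] at h1
        have h2 := actEq_one_of_smul_eq hk h1
        refine Subtype.ext (Equiv.ext fun w => ?_)
        change k • w = w
        rw [h2.pt, one_smul] }
  exact h.isCoveringMap

theorem mem_carrier_iff {z : ℍ} : P.proj z ∈ P.carrier ↔ z ∈ P.cover := by
  constructor
  · rintro ⟨w, hw, h⟩
    obtain ⟨k, hk, rfl⟩ := proj_eq_iff.1 h
    exact (smul_mem_cover_iff hk).1 hw
  · exact fun h => ⟨z, h, rfl⟩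

theorem mem_boundaryComponent_iff {z : ℍ} {i : ZMod 3} :
    P.proj z ∈ P.boundaryComponent i ↔ ∃ l, (P.L i).side (P.word l • z) = 0 := by
  constructor
  · rintro ⟨w, hw, h⟩
    obtain ⟨k, hk, rfl⟩ := proj_eq_iff.1 h
    obtain ⟨l, -, -, hl⟩ := exists_word_of_mem_Γ hk
    exact ⟨l, by rw [← hl.pt]; exact hw⟩
  · rintro ⟨l, hl⟩
    have key : ∀ l : List (ZMod 3), Even l.length → (P.L i).side (P.word l • z) = 0 →
        P.proj z ∈ P.boundaryComponent i := by
      intro l h1 h2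
      obtain ⟨k, hk, h3⟩ := P.exists_mem_Γ_of_even h1
      rw [← h3.pt] at h2
      exact ⟨k • z, h2, proj_smul hk z⟩
    rcases Nat.even_or_odd l.length with h | h
    · exact key l h hl
    -- An odd word is made even by a reflection that preserves `L̃ᵢ`.
    · refine key ((i + 1) :: l) (by rw [List.length_cons]; exact h.add_one) ?_
      rw [word_cons, mul_smul, P.side_L_R_eq_zero (by simp)]
      exact hl

theorem mem_boundary_iff {z : ℍ} :
    P.proj z ∈ P.boundary ↔ ∃ i l, (P.L i).side (P.word l • z) = 0 := by
  rw [boundary, mem_iUnion]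
  exact exists_congr fun i => mem_boundaryComponent_iff

theorem mem_cover_of_boundary {z : ℍ} (h : P.proj z ∈ P.boundary) : z ∈ P.cover := by
  obtain ⟨i, l, h⟩ := mem_boundary_iff.1 h
  exact mem_cover_of_word_line h

/-- Lifts of the same path differ by a deck transformation. -/
theorem smul_eq_of_proj_eq {f g : unitInterval → ℍ} (hf : Continuous f) (hg : Continuous g)
    (h : ∀ t, P.proj (f t) = P.proj (g t)) {k : GL (Fin 2) ℝ} (hk : k ∈ P.Γ) {t₀ : unitInterval}
    (h₀ : f t₀ = k • g t₀) (t : unitInterval) : f t = k • g t := by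
  have := (isCoveringMap_proj (P := P)).eq_of_comp_eq hf ((continuous_smul_gl k).comp hg)
    (by ext t; simp only [Function.comp_apply, proj_smul hk, h]) t₀ h₀
  exact congrFun this t

/-- The lifts of the boundary are isolated from each other, so the times spent on a given one form a
clopen set. -/
theorem side_L_eq_zero_of_path {f : unitInterval → ℍ} (hf : Continuous f)
    (h : ∀ t, P.proj (f t) ∈ P.boundary) {i : ZMod 3} {l : List (ZMod 3)} {t₀ : unitInterval}
    (h₀ : (P.L i).side (P.word l • f t₀) = 0) (t : unitInterval) :
    (P.L i).side (P.word l • f t) = 0 := by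
  have hc : IsClopen {t | (P.L i).side (P.word l • f t) = 0} := by
    constructor
    · exact isClosed_singleton.preimage
        ((P.L i).continuous_side.comp ((continuous_smul_gl _).comp hf))
    · rw [isOpen_iff_mem_nhds]
      intro s hs
      obtain ⟨U, hU, H⟩ := exists_nhds_side_L_eq_zero hs
      filter_upwards [hf.continuousAt.preimage_mem_nhds hU] with u hu
      obtain ⟨j, l', hl'⟩ := mem_boundary_iff.1 (h u)
      exact H _ hu j l' hl'
  have := (isClopen_iff.1 hc).resolve_left (by rintro h; exact (h ▸ h₀ : t₀ ∈ (∅ : Set _)))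
  exact (this ▸ mem_univ t : t ∈ {t | (P.L i).side (P.word l • f t) = 0})

/-- The lift of a homotopy. -/
theorem exists_lift_homotopy {H : unitInterval × unitInterval → P.Surface} (hH : Continuous H)
    {f g : unitInterval → ℍ} (hf : Continuous f) (hg : Continuous g)
    (h0 : ∀ t, H (t, 0) = P.proj (f t)) (h1 : ∀ t, H (t, 1) = P.proj (g t)) :
    ∃ F : unitInterval × unitInterval → ℍ, Continuous F ∧ (∀ p, P.proj (F p) = H p) ∧
      (∀ t, F (t, 0) = f t) ∧ ∃ κ ∈ P.Γ, ∀ t, F (t, 1) = κ • g t := by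
  let H' : C(unitInterval × unitInterval, P.Surface) := ⟨fun p => H (p.2, p.1), by fun_prop⟩
  have e0 : ∀ a, H' (0, a) = P.proj ((⟨f, hf⟩ : C(unitInterval, ℍ)) a) := h0
  set G := isCoveringMap_proj.liftHomotopy H' ⟨f, hf⟩ e0 with hG
  have hl : ∀ p, P.proj (G p) = H' p := congrFun (isCoveringMap_proj.liftHomotopy_lifts H' ⟨f, hf⟩ e0)
  have hz : ∀ a, G (0, a) = f a := isCoveringMap_proj.liftHomotopy_zero H' ⟨f, hf⟩ e0
  refine ⟨fun p => G (p.2, p.1), by fun_prop, fun p => hl _, hz, ?_⟩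
  have e1 : ∀ t, P.proj (G (1, t)) = P.proj (g t) := fun t => (hl _).trans (h1 t)
  obtain ⟨κ, hκ, hk⟩ := proj_eq_iff.1 (e1 0)
  exact ⟨κ, hκ, smul_eq_of_proj_eq (by fun_prop) hg e1 hκ hk.symm⟩

/-- In a lift of the homotopy the two vertical sides differ by one deck transformation. Its value is
read off at the end where the loop is `h`, up to the conjugator `κ`; freeness then transfers it to
`g`. -/
theorem LoopHomotopic.exists_conj {g h : ℝ → ℍ} (hg : Continuous g) (hh : Continuous h)
    {a b a' b' : ℝ} (H : P.LoopHomotopic (fun t => P.proj (g t)) a b (fun t => P.proj (h t)) a' b')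
    {δ : GL (Fin 2) ℝ} (hδ : δ ∈ P.Γ) (hh' : h b' = δ • h a') :
    ∃ κ ∈ P.Γ, g b = κ • δ • κ⁻¹ • g a := by
  obtain ⟨H, h1, -, h3, h4, h5⟩ := H
  obtain ⟨F, F1, F2, F3, κ, hκ, F4⟩ := exists_lift_homotopy h1
    (f := fun t => g (a + t * (b - a))) (g := fun t => h (a' + t * (b' - a')))
    (by fun_prop) (by fun_prop) h4 h5
  obtain ⟨k, hk, e1⟩ := proj_eq_iff.1 (show P.proj (F (1, 0)) = P.proj (F (0, 0)) by
    rw [F2, F2, h3])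
  have e2 := smul_eq_of_proj_eq (P := P) (f := fun s => F (1, s)) (g := fun s => F (0, s))
    (by fun_prop) (by fun_prop) (fun s => by rw [F2, F2, h3]) hk e1.symm 1
  rw [F4, F4] at e2
  simp only [Set.Icc.coe_one, Set.Icc.coe_zero, one_mul, zero_mul, add_zero,
    add_sub_cancel, hh'] at e2
  have e3 : (κ * δ * κ⁻¹)⁻¹ * k ∈ P.Γ :=
    mul_mem (inv_mem (mul_mem (mul_mem hκ hδ) (inv_mem hκ))) hk
  have e4 : ((κ * δ * κ⁻¹)⁻¹ * k) • (κ • h a') = κ • h a' := by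
    rw [mul_smul, inv_smul_eq_iff, ← e2]
    simp only [mul_smul, inv_smul_smul]
  have e5 := actEq_one_of_smul_eq e3 e4
  refine ⟨κ, hκ, ?_⟩
  have e6 := e5.pt (g a)
  rw [mul_smul, inv_smul_eq_iff, one_smul] at e6
  have e7 : F (1, 0) = g b := by rw [F3]; simp
  have e8 : F (0, 0) = g a := by rw [F3]; simp
  rw [e7, e8, e6] at e1
  rw [← e1]
  simp only [mul_smul]

/-- During a lifted homotopy of pairs each end point slides along one lift of the boundary. -/
theorem PathHomotopic.exists_common_lines {g h : ℝ → ℍ} (hg : Continuous g) (hh : Continuous h)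
    {a b a' b' : ℝ}
    (H : P.PathHomotopic (fun t => P.proj (g t)) a b (fun t => P.proj (h t)) a' b') :
    ∃ κ ∈ P.Γ, (∀ i l, (P.L i).side (P.word l • g a) = 0 →
      (P.L i).side (P.word l • κ • h a') = 0) ∧ ∀ i l, (P.L i).side (P.word l • g b) = 0 →
      (P.L i).side (P.word l • κ • h b') = 0 := by
  obtain ⟨H, h1, -, h3, h4, h5⟩ := H
  obtain ⟨F, F1, F2, F3, κ, hκ, F4⟩ := exists_lift_homotopy h1
    (f := fun t => g (a + t * (b - a))) (g := fun t => h (a' + t * (b' - a')))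
    (by fun_prop) (by fun_prop) h4 h5
  refine ⟨κ, hκ, fun i l h0 => ?_, fun i l h0 => ?_⟩
  · have := side_L_eq_zero_of_path (P := P) (f := fun s => F (0, s)) (by fun_prop)
      (fun s => by rw [F2]; exact (h3 s).1) (i := i) (l := l) (t₀ := 0)
      (by rw [F3]; simpa using h0) 1
    rw [F4] at this
    simpa using this
  · have := side_L_eq_zero_of_path (P := P) (f := fun s => F (1, s)) (by fun_prop)
      (fun s => by rw [F2]; exact (h3 s).2) (i := i) (l := l) (t₀ := 0)
      (by rw [F3]; simpa using h0) 1
    rw [F4] at this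
    simpa using this

end ThreeHoledSphere


/-! ### Convex combinations in the projective model -/

/-- The convex combination of two points in the coordinates `(Re z, |z|²)`, in which the geodesics
are straight. -/
def mix (s : unitInterval) (z w : ℍ) : ℍ :=
  ⟨⟨(1 - s) * z.re + s * w.re, Real.sqrt ((1 - s) * (z.re ^ 2 + z.im ^ 2) +
    s * (w.re ^ 2 + w.im ^ 2) - ((1 - s) * z.re + s * w.re) ^ 2)⟩, by
    refine Real.sqrt_pos.2 ?_
    have h1 := s.2.1
    have h2 := s.2.2
    have hz := pow_pos z.im_pos 2
    have hw := pow_pos w.im_pos 2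
    have h3 : 0 ≤ (s : ℝ) * (1 - s) * (z.re - w.re) ^ 2 :=
      mul_nonneg (mul_nonneg h1 (by linarith)) (sq_nonneg _)
    rcases eq_or_lt_of_le h1 with h | h
    · rw [← h]; nlinarith
    · nlinarith [mul_nonneg (sub_nonneg.2 h2) hz.le, mul_pos h hw]⟩

theorem mix_re (s : unitInterval) (z w : ℍ) : (mix s z w).re = (1 - s) * z.re + s * w.re := rfl

theorem mix_normSq (s : unitInterval) (z w : ℍ) : (mix s z w).re ^ 2 + (mix s z w).im ^ 2 =
    (1 - s) * (z.re ^ 2 + z.im ^ 2) + s * (w.re ^ 2 + w.im ^ 2) := by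
  have h := (mix s z w).im_pos
  have e : (mix s z w).im = Real.sqrt ((1 - s) * (z.re ^ 2 + z.im ^ 2) +
    s * (w.re ^ 2 + w.im ^ 2) - ((1 - s) * z.re + s * w.re) ^ 2) := rfl
  rw [e] at h ⊢
  rw [Real.sq_sqrt (Real.sqrt_pos.1 h).le, mix_re]
  ring

theorem Wall.side_mix (W : Wall) (s : unitInterval) (z w : ℍ) :
    W.side (mix s z w) = (1 - s) * W.side z + s * W.side w := by
  have := mix_normSq s z w
  rw [Wall.side_eq, this, mix_re, Wall.side_eq, Wall.side_eq]
  ring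

theorem ext_re_normSq {z w : ℍ} (h1 : z.re = w.re)
    (h2 : z.re ^ 2 + z.im ^ 2 = w.re ^ 2 + w.im ^ 2) : z = w := by
  refine ext_re_im h1 ?_
  rw [h1] at h2
  have := (sq_eq_sq₀ z.im_pos.le w.im_pos.le).1 (by linarith)
  exact this

theorem mix_zero (z w : ℍ) : mix 0 z w = z :=
  ext_re_normSq (by rw [mix_re]; simp) (by rw [mix_normSq]; simp)

theorem mix_one (z w : ℍ) : mix 1 z w = w :=
  ext_re_normSq (by rw [mix_re]; simp) (by rw [mix_normSq]; simp)

theorem continuous_mix : Continuous fun p : unitInterval × ℍ × ℍ => mix p.1 p.2.1 p.2.2 := by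
  rw [UpperHalfPlane.isEmbedding_coe.continuous_iff]
  have e : ((↑) : ℍ → ℂ) ∘ (fun p : unitInterval × ℍ × ℍ => mix p.1 p.2.1 p.2.2) = fun p =>
      Complex.equivRealProdCLM.symm ((1 - (p.1 : ℝ)) * p.2.1.re + p.1 * p.2.2.re,
        Real.sqrt ((1 - p.1) * (p.2.1.re ^ 2 + p.2.1.im ^ 2) +
      p.1 * (p.2.2.re ^ 2 + p.2.2.im ^ 2) - ((1 - p.1) * p.2.1.re + p.1 * p.2.2.re) ^ 2)) := by
    ext p
    apply Complex.ext <;> rfl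
  rw [e]
  have h1 : Continuous UpperHalfPlane.re := UpperHalfPlane.continuous_re
  have h2 : Continuous UpperHalfPlane.im := UpperHalfPlane.continuous_im
  refine Complex.equivRealProdCLM.symm.continuous.comp ?_
  fun_prop

namespace ThreeHoledSphere

variable {P : ThreeHoledSphere}

theorem mix_mem_cover {z w : ℍ} (hz : z ∈ P.cover) (hw : w ∈ P.cover) (s : unitInterval) :
    mix s z w ∈ P.cover := by
  rw [mem_cover_iff] at *
  intro l i
  have h1 := hz l i
  have h2 := hw l i
  rw [Wall.side_smul_nonneg_iff] at *
  rw [Wall.side_mix]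
  exact add_nonneg (mul_nonneg (by linarith [s.2.2]) h1) (mul_nonneg s.2.1 h2)

theorem side_L_word_mix_eq_zero {z w : ℍ} {i : ZMod 3} {l : List (ZMod 3)}
    (hz : (P.L i).side (P.word l • z) = 0) (hw : (P.L i).side (P.word l • w) = 0)
    (s : unitInterval) : (P.L i).side (P.word l • mix s z w) = 0 := by
  rw [Wall.side_smul_eq_zero_iff] at *
  rw [Wall.side_mix, hz, hw]
  ring

/-! ### The normalization -/

theorem deck_two_entries (P : ThreeHoledSphere) : P.deck 2 0 0 = -(P.e * P.f) ∧
    P.deck 2 0 1 = 0 ∧ P.deck 2 1 0 = 0 ∧ P.deck 2 1 1 = -(P.c * P.d) := by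
  have e : ∀ i j, P.deck 2 i j =
      P.R 1 i 0 * P.R 0 0 j + P.R 1 i 1 * P.R 0 1 j := fun i j => by
    change (P.R 1 * P.R 0) i j = _
    simp [Matrix.mul_apply, Fin.sum_univ_two]
  have a0 : (P.M 0).a = -1 := rfl
  have b0 : (P.M 0).b = 0 := rfl
  have c0 : (P.M 0).c = P.c * P.d := rfl
  have a1 : (P.M 1).a = 1 := rfl
  have b1 : (P.M 1).b = 0 := rfl
  have c1 : (P.M 1).c = -(P.e * P.f) := rfl
  refine ⟨?_, ?_, ?_, ?_⟩ <;> rw [e] <;> simp [R, a0, b0, c0, a1, b1, c1]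

/-- `γ₂` is multiplication by `e f / (c d)`, so it takes `c` to `e f / d`. This is how the
normalization enters the whole argument. -/
theorem mul_eq_d_of_deck
    (hP : P.deck 2 • ((P.c : ℝ) : OnePoint ℝ) = ((1 : ℝ) : OnePoint ℝ)) : P.e * P.f = P.d := by
  obtain ⟨h1, h2, h3, h4⟩ := P.deck_two_entries
  have hc := P.c_pos
  have hd := P.d_pos
  rw [OnePoint.smul_some_eq_ite, h1, h2, h3, h4] at hP
  have h0 : (0 : ℝ) * P.c + -(P.c * P.d) ≠ 0 := by
    have := mul_pos hc hd
    linarith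
  rw [if_neg h0, OnePoint.coe_eq_coe, div_eq_iff h0] at hP
  refine mul_right_cancel₀ hc.ne' ?_
  linarith

theorem one_lt_c (hd : P.e * P.f = P.d) : 1 < P.c := by
  nlinarith [P.e_pos, P.e_lt_f, P.f_lt_c, P.c_lt_d]

/-- This places `[1, d/c]`, the interval under `R₁(L̃₁)`, to the left of `[e, f]`. -/
theorem d_div_c_lt_e (hd : P.e * P.f = P.d) : P.d / P.c < P.e := by
  rw [div_lt_iff₀ P.c_pos, ← hd]
  exact mul_lt_mul_of_pos_left P.f_lt_c P.e_pos

theorem one_lt_d_div_c (P : ThreeHoledSphere) : 1 < P.d / P.c := by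
  rw [lt_div_iff₀ P.c_pos, one_mul]; exact P.c_lt_d

theorem one_lt_e (hd : P.e * P.f = P.d) : 1 < P.e :=
  P.one_lt_d_div_c.trans (d_div_c_lt_e hd)

theorem deck_two_smul_re (hd : P.e * P.f = P.d) (z : ℍ) : (P.deck 2 • z).re = z.re / P.c := by
  obtain ⟨h1, h2, h3, h4⟩ := P.deck_two_entries
  have h := smul_re_mul (P.deck 2) z
  have hc := P.c_pos
  have hd0 := P.d_pos
  rw [denomSq, h1, h2, h3, h4, hd] at h
  rw [eq_div_iff hc.ne']
  have : (P.c * P.d * P.d) ≠ 0 := by positivity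
  apply mul_right_cancel₀ this
  linear_combination h

theorem deck_two_smul_im (hd : P.e * P.f = P.d) (z : ℍ) : (P.deck 2 • z).im = z.im / P.c := by
  obtain ⟨h1, h2, h3, h4⟩ := P.deck_two_entries
  have h := smul_im_mul (P.deck 2) z
  have hc := P.c_pos
  have hd0 := P.d_pos
  rw [denomSq, h1, h2, h3, h4, hd, abs_of_pos (by ring_nf; positivity)] at h
  rw [eq_div_iff hc.ne']
  have : (P.c * P.d * P.d) ≠ 0 := by positivity
  apply mul_right_cancel₀ this
  linear_combination h

theorem deck_two_zpow_smul (hd : P.e * P.f = P.d) (j : ℤ) (z : ℍ) :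
    (P.deck 2 ^ j • z).re = z.re * P.c ^ (-j) ∧ (P.deck 2 ^ j • z).im = z.im * P.c ^ (-j) := by
  have hc := P.c_pos.ne'
  induction j with
  | zero => simp
  | succ n ih =>
    rw [zpow_add_one, (Commute.self_zpow _ _).eq.symm, mul_smul, deck_two_smul_re hd,
      deck_two_smul_im hd, ih.1, ih.2, neg_add, zpow_add₀ hc, zpow_neg_one]
    exact ⟨by ring, by ring⟩
  | pred n ih =>
    have e : P.deck 2 • P.deck 2 ^ (-(n : ℤ) - 1) • z = P.deck 2 ^ (-(n : ℤ)) • z := by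
      rw [← mul_smul, ← zpow_one_add]
      congr 2
      ring
    have h1 := deck_two_smul_re hd (P.deck 2 ^ (-(n : ℤ) - 1) • z)
    have h2 := deck_two_smul_im hd (P.deck 2 ^ (-(n : ℤ) - 1) • z)
    rw [e, ih.1, eq_div_iff hc] at h1
    rw [e, ih.2, eq_div_iff hc] at h2
    rw [← h1, ← h2, neg_sub, sub_eq_add_neg, add_comm, zpow_add₀ hc, zpow_one]
    exact ⟨by ring, by ring⟩

/-- The distance is at least the difference of the logarithms of the heights, with equality on the
axis of the dilation. -/
theorem l_two (hd : P.e * P.f = P.d) : P.l 2 = Real.log P.c := by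
  have hc := P.c_pos
  have hlb : ∀ z : ℍ, Real.log P.c ≤ dist z (P.deck 2 • z) := by
    intro z
    refine le_trans ?_ (dist_log_im_le _ _)
    rw [deck_two_smul_im hd, Real.log_div z.im_pos.ne' hc.ne', Real.dist_eq]
    refine le_trans (le_of_eq ?_) (le_abs_self _)
    ring
  rw [l, translationLength]
  refine le_antisymm ?_ (le_ciInf hlb)
  refine (ciInf_le ⟨_, by rintro _ ⟨z, rfl⟩; exact hlb z⟩ I).trans ?_
  rw [dist_of_re_eq (by rw [deck_two_smul_re hd]; simp), deck_two_smul_im hd,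
    Real.log_div (by simp) hc.ne', Real.dist_eq]
  simp [abs_of_pos (Real.log_pos (one_lt_c hd))]

theorem exp_l_two (hd : P.e * P.f = P.d) : Real.exp (P.l 2) = P.c := by
  rw [l_two hd, Real.exp_log P.c_pos]

/-- The lower bound for the distance combines `(c + d) Im z ≤ (d - c) |z|` on `L̃₁` with the
inequality of the means for `|z|` and the height on `L̃₂`. Equality holds at the ends of the common
perpendicular. -/
theorem cosh_m_three (P : ThreeHoledSphere) :
    0 < P.m 3 ∧ Real.cosh (P.m 3) = (P.c + P.d) / (P.d - P.c) := by
  have hc := P.c_pos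
  have hd := P.d_pos
  have hcd := P.c_lt_d
  have hcd' : 0 < P.d - P.c := by linarith
  have e : P.m 3 = setDist (P.L 1).line (P.L 2).line := rfl
  have hlb : ∀ z ∈ (P.L 1).line, ∀ w ∈ (P.L 2).line,
      (P.c + P.d) / (P.d - P.c) ≤ Real.cosh (dist z w) := by
    intro z hz w hw
    have hz' : arcSide P.c P.d z = 0 := by rw [← P.L_one_side]; exact hz
    have hw' : w.re = 0 := by
      have : (P.L 2).side w = 0 := hw
      rw [P.L_two_side] at this
      linarith
    rw [cosh_dist', hw', sub_zero]
    have h1 := z.im_pos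
    have h2 := w.im_pos
    rw [div_le_div_iff₀ hcd' (by positivity)]
    rw [arcSide] at hz'
    set X := z.re
    set Y := z.im
    set v := w.im
    -- `(c + d)² Y² ≤ (d - c)² (X² + Y²)`
    have h3 : (P.c + P.d) ^ 2 * Y ^ 2 ≤ (P.d - P.c) ^ 2 * (X ^ 2 + Y ^ 2) := by
      have : (X ^ 2 + Y ^ 2) = (P.c + P.d) * X - P.c * P.d := by linarith
      nlinarith [sq_nonneg ((P.c + P.d) * X - 2 * P.c * P.d)]
    have h4 : (P.c + P.d) * Y ≤ (P.d - P.c) * Real.sqrt (X ^ 2 + Y ^ 2) := by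
      rw [← sq_le_sq₀ (by positivity) (by positivity)]
      rw [mul_pow, mul_pow, Real.sq_sqrt (by positivity)]
      exact h3
    have h5 : 2 * v * Real.sqrt (X ^ 2 + Y ^ 2) ≤ X ^ 2 + Y ^ 2 + v ^ 2 := by
      have := Real.sq_sqrt (show 0 ≤ X ^ 2 + Y ^ 2 by positivity)
      nlinarith [sq_nonneg (v - Real.sqrt (X ^ 2 + Y ^ 2))]
    nlinarith [mul_le_mul_of_nonneg_left h4 (by linarith : 0 ≤ 2 * v),
      mul_le_mul_of_nonneg_left h5 hcd'.le]
  set s := Real.sqrt (P.c * P.d) with hs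
  have hs0 : 0 < s := Real.sqrt_pos.2 (by positivity)
  have hs2 : s ^ 2 = P.c * P.d := Real.sq_sqrt (by positivity)
  -- The intersections of `L̃₁` and `L̃₂` with their common perpendicular `|z|² = c d`.
  set z₀ : ℍ := ⟨⟨2 * s ^ 2 / (P.c + P.d), s * (P.d - P.c) / (P.c + P.d)⟩, by
    change 0 < s * (P.d - P.c) / (P.c + P.d); positivity⟩ with hz₀
  set w₀ : ℍ := ⟨⟨0, s⟩, hs0⟩ with hw₀
  have hzr : z₀.re = 2 * s ^ 2 / (P.c + P.d) := rfl
  have hzi : z₀.im = s * (P.d - P.c) / (P.c + P.d) := rfl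
  have hwr : w₀.re = 0 := rfl
  have hwi : w₀.im = s := rfl
  have hz1 : z₀ ∈ (P.L 1).line := by
    change (P.L 1).side z₀ = 0
    rw [P.L_one_side, arcSide, hzr, hzi]
    have : P.c + P.d ≠ 0 := by positivity
    field_simp
    linear_combination (4 * s ^ 2 + (P.d - P.c) ^ 2 - 2 * (P.c + P.d) ^ 2) * hs2 +
      4 * P.c * P.d * hs2
  have hw1 : w₀ ∈ (P.L 2).line := by
    change (P.L 2).side w₀ = 0
    rw [P.L_two_side, hwr]; ring
  have hch : Real.cosh (dist z₀ w₀) = (P.c + P.d) / (P.d - P.c) := by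
    rw [cosh_dist', hzr, hzi, hwr, hwi]
    field_simp
    linear_combination 4 * s ^ 2 * hs2
  have hm : P.m 3 = dist z₀ w₀ := by
    rw [e, setDist]
    refine IsLeast.csInf_eq ⟨⟨z₀, hz1, w₀, hw1, rfl⟩, ?_⟩
    rintro _ ⟨z, hz, w, hw, rfl⟩
    have := hlb z hz w hw
    rw [← hch, Real.cosh_le_cosh, abs_of_nonneg dist_nonneg, abs_of_nonneg dist_nonneg] at this
    exact this
  refine ⟨?_, hm ▸ hch⟩
  rw [hm, dist_pos]
  intro h
  have h1 := congrArg UpperHalfPlane.re h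
  rw [hzr, hwr] at h1
  have : 0 < 2 * s ^ 2 / (P.c + P.d) := by positivity
  linarith

/-- Half angle formula: `coth² (m / 2) = (cosh m + 1) / (cosh m - 1) = d / c`. -/
theorem exp_l_mul_coth_sq (hd : P.e * P.f = P.d) :
    Real.exp (P.l 2) * coth (P.m 3 / 2) ^ 2 = P.d := by
  obtain ⟨h0, h1⟩ := P.cosh_m_three
  have hc := P.c_pos
  have hcd := P.c_lt_d
  have hcd' : 0 < P.d - P.c := by linarith
  rw [exp_l_two hd, coth, div_pow]
  have e : P.m 3 = 2 * (P.m 3 / 2) := by ring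
  rw [e, Real.cosh_two_mul] at h1
  have h2 := Real.cosh_sq (P.m 3 / 2)
  have h3 : 0 < Real.sinh (P.m 3 / 2) := Real.sinh_pos_iff.2 (by linarith)
  set S := Real.sinh (P.m 3 / 2)
  rw [h2] at h1 ⊢
  rw [eq_div_iff hcd'.ne'] at h1
  field_simp
  linarith

theorem omega_eq (hd : P.e * P.f = P.d) : Omega (P.l 2) (P.m 3) =
    {v | ∃ x y κ : ℝ, 0 < x ∧ x < 1 ∧ P.c < y ∧ y < P.d ∧ ∃ g : ℝ → ℍ, IsArc g y x κ ∧
      ∃ t tq tp : ℝ, arcSide P.c P.d (g tq) = 0 ∧ x * (κ * Real.exp tp) ^ 2 = y ∧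
      tq ≤ t ∧ t ≤ tp ∧ HasVelocity g t v} := by
  have h1 := one_lt_c hd
  ext v
  rw [Omega, exp_l_mul_coth_sq hd, exp_l_two hd]
  constructor
  · rintro ⟨x, y, hx, hx1, hy, hy1, g, hg, tq, tp, t, hq, hp, ht1, ht2, hv⟩
    obtain ⟨κ, hκ⟩ := hg.exists_isArc (by linarith)
    exact ⟨x, y, κ, hx, hx1, hy, hy1, g, hκ, t, tq, tp, (mem_semicircle_iff P.c_lt_d _).1 hq,
      (hκ.tangent_iff hx tp).1 hp, ht1, ht2, hv⟩
  · rintro ⟨x, y, κ, hx, hx1, hy, hy1, g, hκ, t, tq, tp, hq, hp, ht1, ht2, hv⟩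
    exact ⟨x, y, hx, hx1, hy, hy1, g, hκ.isGeodesicFromTo, tq, tp, t,
      (mem_semicircle_iff P.c_lt_d _).2 hq, (hκ.tangent_iff hx tp).2 hp, ht1, ht2, hv⟩

end ThreeHoledSphere


/-! ### Walls as arcs over their real roots. -/

theorem arcSide_eq (α β : ℝ) (z : ℍ) :
    arcSide α β z = z.re ^ 2 + z.im ^ 2 - (α + β) * z.re + α * β := by
  rw [arcSide]; ring

theorem normSq_pos (z : ℍ) : 0 < z.re ^ 2 + z.im ^ 2 := by
  have := z.im_pos
  positivity

theorem Wall.exists_roots (w : Wall) (ha : 0 < w.a) : ∃ α β, α < β ∧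
    (∀ z, w.side z = w.a * arcSide α β z) ∧ ∀ r, w.eval r = w.a * ((r - α) * (r - β)) := by
  have h := w.disc_pos
  set s := Real.sqrt (w.b ^ 2 - w.a * w.c)
  have hs : s ^ 2 = w.b ^ 2 - w.a * w.c := Real.sq_sqrt h.le
  have hs0 : 0 < s := Real.sqrt_pos.2 h
  refine ⟨(w.b - s) / w.a, (w.b + s) / w.a, ?_, fun z => ?_, fun r => ?_⟩
  · rw [div_lt_div_iff_of_pos_right ha]; linarith
  · rw [Wall.side_eq, arcSide]
    field_simp
    linear_combination hs
  · rw [Wall.eval]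
    field_simp
    linear_combination hs

namespace ThreeHoledSphere

variable {P : ThreeHoledSphere}

/-! ### End points of lifts -/

/-- A geodesic contained in `P̃` is on the nonnegative side of every lift, and so are its ideal end
points. Along the arc the form is a positive multiple of `eval β + eval α * s` with arbitrary `s >
0`; letting `s` be large or small isolates each value. -/
theorem eval_pull_nonneg {α β : ℝ} (h : α < β) (hc : ∀ z, arcSide α β z = 0 → z ∈ P.cover)
    (i : ZMod 3) (l : List (ZMod 3)) : 0 ≤ ((P.L i).pull (P.word l)).eval α ∧
      0 ≤ ((P.L i).pull (P.word l)).eval β := by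
  obtain ⟨g, hg⟩ := exists_isArc h one_pos
  set w := (P.L i).pull (P.word l)
  have key : ∀ s, 0 < s → 0 ≤ w.eval β + w.eval α * s := by
    intro s hs
    obtain ⟨t, ht⟩ := hg.exists_param hs
    have h1 := hg.side_mul w t
    rw [ht] at h1
    rw [← h1]
    refine mul_nonneg ?_ (by positivity)
    rw [← Wall.side_smul_nonneg_iff]
    exact mem_cover_iff.1 (hc _ (hg.arcSide_self t)) l i
  constructor
  · by_contra! h1
    have h2 := key ((|w.eval β| + 1) / -w.eval α) (div_pos (by positivity) (by linarith))
    have h3 : w.eval α * ((|w.eval β| + 1) / -w.eval α) = -(|w.eval β| + 1) := by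
      have := h1.ne
      field_simp
    have := le_abs_self (w.eval β)
    linarith
  · by_contra! h1
    have h2 := key (-w.eval β / (2 * (|w.eval α| + 1))) (div_pos (by linarith) (by positivity))
    have h3 : w.eval α * (-w.eval β / (2 * (|w.eval α| + 1))) ≤ -w.eval β / 2 := by
      have h4 := le_abs_self (w.eval α)
      have h5 : 0 < |w.eval α| + 1 := by positivity
      rw [mul_div_assoc', div_le_div_iff₀ (by positivity) (by norm_num)]
      nlinarith
    linarith

/-- The same statement for the end points `∞` and `0` of `L̃₂`. -/
theorem pull_coeff_nonneg (P : ThreeHoledSphere) (i : ZMod 3) (l : List (ZMod 3)) :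
    0 ≤ ((P.L i).pull (P.word l)).a ∧ 0 ≤ ((P.L i).pull (P.word l)).c := by
  set w := (P.L i).pull (P.word l)
  have key : ∀ s, 0 < s → 0 ≤ w.a * s ^ 2 + w.c := by
    intro s hs
    have h1 : (⟨⟨0, s⟩, hs⟩ : ℍ) ∈ P.cover := by
      refine mem_cover_of_line (i := 2) ?_
      rw [P.L_two_side]
      exact mul_zero _
    have h2 := mem_cover_iff.1 h1 l i
    rw [Wall.side_smul_nonneg_iff, Wall.side_eq] at h2
    change 0 ≤ w.a * ((0 : ℝ) ^ 2 + s ^ 2) - 2 * w.b * 0 + w.c at h2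
    linarith
  constructor
  · by_contra! h1
    have h2 := key (Real.sqrt ((|w.c| + 1) / -w.a))
      (Real.sqrt_pos.2 (div_pos (by positivity) (by linarith)))
    rw [Real.sq_sqrt (div_pos (by positivity) (by linarith)).le] at h2
    have h3 : w.a * ((|w.c| + 1) / -w.a) = -(|w.c| + 1) := by
      have := h1.ne
      field_simp
    have := le_abs_self w.c
    linarith
  · by_contra! h1
    have h0 : 0 < -w.c / (2 * (|w.a| + 1)) := div_pos (by linarith) (by positivity)
    have h2 := key (Real.sqrt (-w.c / (2 * (|w.a| + 1)))) (Real.sqrt_pos.2 h0)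
    rw [Real.sq_sqrt h0.le] at h2
    have h3 : w.a * (-w.c / (2 * (|w.a| + 1))) ≤ -w.c / 2 := by
      have h4 := le_abs_self w.a
      have h5 : 0 < |w.a| + 1 := by positivity
      rw [mul_div_assoc', div_le_div_iff₀ (by positivity) (by norm_num)]
      nlinarith
    linarith

/-! ### The reflections on half planes -/

theorem R_zero_re (z : ℍ) :
    (P.R 0 • z).re * (z.re ^ 2 + z.im ^ 2) = P.c * P.d * z.re := by
  have h := smul_re_mul (P.R 0) z
  rw [denomSq] at h
  change _ * ((-1 * z.re + -0) ^ 2 + (-1 * z.im) ^ 2) =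
    (0 * z.re + -(P.c * P.d)) * (-1 * z.re + -0) + 0 * (-1) * z.im ^ 2 at h
  linear_combination h

theorem R_zero_normSq (z : ℍ) : ((P.R 0 • z).re ^ 2 + (P.R 0 • z).im ^ 2) *
    (z.re ^ 2 + z.im ^ 2) = (P.c * P.d) ^ 2 := by
  have h := smul_normSq_mul (P.R 0) z
  rw [denomSq] at h
  change _ * ((-1 * z.re + -0) ^ 2 + (-1 * z.im) ^ 2) =
    (0 * z.re + -(P.c * P.d)) ^ 2 + (0 * z.im) ^ 2 at h
  linear_combination h

theorem R_one_re (hd : P.e * P.f = P.d) (z : ℍ) :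
    (P.R 1 • z).re * (z.re ^ 2 + z.im ^ 2) = P.d * z.re := by
  have h := smul_re_mul (P.R 1) z
  rw [denomSq] at h
  change _ * ((1 * z.re + -0) ^ 2 + (1 * z.im) ^ 2) =
    (0 * z.re + - -(P.e * P.f)) * (1 * z.re + -0) + 0 * 1 * z.im ^ 2 at h
  linear_combination h + z.re * hd

theorem R_one_normSq (hd : P.e * P.f = P.d) (z : ℍ) :
    ((P.R 1 • z).re ^ 2 + (P.R 1 • z).im ^ 2) * (z.re ^ 2 + z.im ^ 2) = P.d ^ 2 := by
  have h := smul_normSq_mul (P.R 1) z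
  rw [denomSq] at h
  change _ * ((1 * z.re + -0) ^ 2 + (1 * z.im) ^ 2) =
    (0 * z.re + - -(P.e * P.f)) ^ 2 + (0 * z.im) ^ 2 at h
  rw [← hd]
  linear_combination h

/-- `R₀` is the inversion in the circle `|z|² = c d`, so it exchanges `α` with `α'` and `β` with
`β'`. When the end points are positive, interiors of arcs correspond. -/
theorem arcSide_R_zero {α β α' β' : ℝ} (h1 : α * α' = P.c * P.d) (h2 : β * β' = P.c * P.d)
    (z : ℍ) : arcSide α β (P.R 0 • z) * (z.re ^ 2 + z.im ^ 2) = α * β * arcSide α' β' z := by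
  rw [arcSide_eq, arcSide_eq, add_mul, sub_mul, R_zero_normSq, mul_assoc, R_zero_re]
  linear_combination (-α * z.re + P.c * P.d) * h2.symm +
    (-β * z.re + β * β') * h1.symm

theorem arcSide_R_one (hd : P.e * P.f = P.d) {α β α' β' : ℝ} (h1 : α * α' = P.d)
    (h2 : β * β' = P.d) (z : ℍ) :
    arcSide α β (P.R 1 • z) * (z.re ^ 2 + z.im ^ 2) = α * β * arcSide α' β' z := by
  rw [arcSide_eq, arcSide_eq, add_mul, sub_mul, R_one_normSq hd, mul_assoc, R_one_re hd]
  linear_combination (-α * z.re + P.d) * h2.symm + (-β * z.re + β * β') * h1.symm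

/-- `R₂` preserves `L̃₃` and `L̃₁`, so it exchanges `e` with `f` and `c` with `d`. The sign is
negative because the center of the inversion is under these arcs: interiors correspond to exteriors.
-/
theorem arcSide_R_two_fc (z : ℍ) : arcSide P.f P.c (P.R 2 • z) * denomSq (P.R 2) z =
    -((P.c - P.f) ^ 2 * (P.d - P.f) * (P.c - P.e)) * arcSide P.e P.d z := by
  have h1 := smul_re_mul (P.R 2) z
  have h2 := smul_normSq_mul (P.R 2) z
  have e00 : P.R 2 0 0 = P.c * P.d - P.e * P.f := rfl
  have e01 : P.R 2 0 1 = -(P.c * P.d * (P.e + P.f) - P.e * P.f * (P.c + P.d)) := rfl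
  have e10 : P.R 2 1 0 = P.c + P.d - P.e - P.f := rfl
  have e11 : P.R 2 1 1 = -(P.c * P.d - P.e * P.f) := rfl
  rw [arcSide_eq, arcSide_eq, add_mul, sub_mul, h2, mul_assoc, h1, denomSq, e00, e01, e10, e11]
  ring

theorem arcSide_R_two_fd (z : ℍ) : arcSide P.f P.d (P.R 2 • z) * denomSq (P.R 2) z =
    -((P.c - P.f) * (P.d - P.f) ^ 2 * (P.d - P.e)) * arcSide P.e P.c z := by
  have h1 := smul_re_mul (P.R 2) z
  have h2 := smul_normSq_mul (P.R 2) z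
  have e00 : P.R 2 0 0 = P.c * P.d - P.e * P.f := rfl
  have e01 : P.R 2 0 1 = -(P.c * P.d * (P.e + P.f) - P.e * P.f * (P.c + P.d)) := rfl
  have e10 : P.R 2 1 0 = P.c + P.d - P.e - P.f := rfl
  have e11 : P.R 2 1 1 = -(P.c * P.d - P.e * P.f) := rfl
  rw [arcSide_eq, arcSide_eq, add_mul, sub_mul, h2, mul_assoc, h1, denomSq, e00, e01, e10, e11]
  ring

theorem arcSide_R_two_fc_neg {z : ℍ} :
    arcSide P.f P.c (P.R 2 • z) < 0 ↔ 0 < arcSide P.e P.d z := by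
  have h := P.arcSide_R_two_fc z
  have hN := denomSq_pos (P.R 2) z
  have h1 := P.e_lt_f
  have h2 := P.f_lt_c
  have h3 := P.c_lt_d
  have hK : 0 < (P.c - P.f) ^ 2 * (P.d - P.f) * (P.c - P.e) :=
    mul_pos (mul_pos (pow_pos (by linarith) 2) (by linarith)) (by linarith)
  constructor <;> intro h4 <;> by_contra! h5 <;> nlinarith

theorem arcSide_R_two_fd_neg {z : ℍ} :
    arcSide P.f P.d (P.R 2 • z) < 0 ↔ 0 < arcSide P.e P.c z := by
  have h := P.arcSide_R_two_fd z
  have hN := denomSq_pos (P.R 2) z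
  have h1 := P.e_lt_f
  have h2 := P.f_lt_c
  have h3 := P.c_lt_d
  have hK : 0 < (P.c - P.f) * (P.d - P.f) ^ 2 * (P.d - P.e) :=
    mul_pos (mul_pos (by linarith) (pow_pos (by linarith) 2)) (by linarith)
  constructor <;> intro h4 <;> by_contra! h5 <;> nlinarith

theorem arcSide_R_zero_neg {α β α' β' : ℝ} (hα : 0 < α) (hβ : 0 < β) (h1 : α * α' = P.c * P.d)
    (h2 : β * β' = P.c * P.d) {z : ℍ} :
    arcSide α β (P.R 0 • z) < 0 ↔ arcSide β' α' z < 0 := by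
  have h := P.arcSide_R_zero h1 h2 z
  have hN := normSq_pos z
  have hK := mul_pos hα hβ
  have e : arcSide β' α' z = arcSide α' β' z := by rw [arcSide, arcSide]; ring
  rw [e]
  constructor <;> intro h4 <;> by_contra! h5 <;> nlinarith

theorem arcSide_R_one_neg (hd : P.e * P.f = P.d) {α β α' β' : ℝ} (hα : 0 < α) (hβ : 0 < β)
    (h1 : α * α' = P.d) (h2 : β * β' = P.d) {z : ℍ} :
    arcSide α β (P.R 1 • z) < 0 ↔ arcSide β' α' z < 0 := by
  have h := arcSide_R_one hd h1 h2 z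
  have hN := normSq_pos z
  have hK := mul_pos hα hβ
  have e : arcSide β' α' z = arcSide α' β' z := by rw [arcSide, arcSide]; ring
  rw [e]
  constructor <;> intro h4 <;> by_contra! h5 <;> nlinarith

theorem side_M_two_pos {z : ℍ} (hz : z.re ≤ P.e) : 0 < (P.M 2).side z := by
  have h1 := P.e_lt_f
  have h2 := P.f_lt_c
  have h3 := P.c_lt_d
  have ha := P.M_two_a_pos
  have h4 : 0 < (P.f - P.e) * ((P.c - P.e) * (P.d - P.e)) :=
    mul_pos (by linarith) (mul_pos (by linarith) (by linarith))
  have h5 : 0 < (P.c - P.e) * (P.d - P.e) := mul_pos (by linarith) (by linarith)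
  have hY := z.im_pos
  have e : (P.M 2).side z = (P.M 2).a * z.im ^ 2 + (P.f - P.e) * ((P.c - P.e) * (P.d - P.e)) +
      2 * ((P.c - P.e) * (P.d - P.e)) * (P.e - z.re) + (P.M 2).a * (P.e - z.re) ^ 2 := by
    rw [Wall.side_eq, M_two_b, M_two_c, M_two_a]
    ring
  rw [e]
  have : 0 ≤ 2 * ((P.c - P.e) * (P.d - P.e)) * (P.e - z.re) :=
    mul_nonneg (by linarith) (by linarith)
  positivity

/-! ### Ping-pong on half planes -/

/-- Half planes that are permuted by the reflections. -/
def playground (P : ThreeHoledSphere) : ZMod 3 → Set ℍ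
  | 0 => {z | P.d < z.re}
  | 1 => {z | arcSide 0 P.e z < 0}
  | 2 => {z | arcSide P.f P.c z < 0}

/-- On the real line, `R₀` is `r ↦ c d / r`, `R₁` is `r ↦ d / r`, and `R₂` takes the exterior of
`[e, d]` to the interior of `[f, c]`. For example `R₀` takes `(f, c)` to `(d, e c)` and `R₁` takes
it to `(d/c, e)`. -/
theorem R_smul_mem_playground (hd : P.e * P.f = P.d) {i j : ZMod 3} (hij : i ≠ j) {z : ℍ}
    (hz : z ∈ P.playground j) : P.R i • z ∈ P.playground i := by
  have he := P.e_pos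
  have hf := P.f_pos
  have hc := P.c_pos
  have hd0 := P.d_pos
  have h1 := P.e_lt_f
  have h2 := P.f_lt_c
  have h3 := P.c_lt_d
  have hS := normSq_pos z
  rcases zmod3_cases i with rfl | rfl | rfl <;> rcases zmod3_cases j with rfl | rfl | rfl
  · exact absurd rfl hij
  · change arcSide 0 P.e z < 0 at hz
    change P.d < _
    obtain ⟨h4, -⟩ := arcSide_re hz.le he.le
    rw [arcSide_eq] at hz
    have h5 := P.R_zero_re z
    by_contra! h6
    have h7 : z.re ^ 2 + z.im ^ 2 < P.c * z.re := by nlinarith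
    nlinarith [mul_le_mul_of_nonneg_right h6 hS.le]
  · change arcSide P.f P.c z < 0 at hz
    change P.d < _
    have h4 : arcSide P.d (P.e * P.c) (P.R 0 • z) < 0 :=
      (arcSide_R_zero_neg hd0 (by positivity) (mul_comm _ _)
        (by rw [← hd]; ring)).2 hz
    exact (arcSide_re h4.le (by rw [← hd]; nlinarith)).1
  · change P.d < z.re at hz
    change arcSide 0 P.e _ < 0
    have h4 := R_one_re hd z
    have h5 := R_one_normSq hd z
    have h6 := one_lt_e hd
    rw [arcSide_eq]
    by_contra! h7
    nlinarith [mul_nonneg h7 hS.le, mul_lt_mul'' hz h6 hd0.le zero_le_one]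
  · exact absurd rfl hij
  · change arcSide P.f P.c z < 0 at hz
    change arcSide 0 P.e _ < 0
    have h4 : arcSide (P.d / P.c) P.e (P.R 1 • z) < 0 :=
      (arcSide_R_one_neg hd (by positivity) he (div_mul_cancel₀ _ hc.ne') hd).2 hz
    exact arcSide_mono_lt h4.le (d_div_c_lt_e hd).le (by positivity) le_rfl (Or.inr (Or.inr h4))
  · change P.d < z.re at hz
    exact arcSide_R_two_fc_neg.2 (arcSide_pos_of_le_re hz.le (by linarith))
  · change arcSide 0 P.e z < 0 at hz
    exact arcSide_R_two_fc_neg.2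
      (arcSide_pos_of_re_le (arcSide_re hz.le he.le).2.le (by linarith))
  · exact absurd rfl hij

theorem word_smul_mem_playground (hd : P.e * P.f = P.d) {l : List (ZMod 3)} {j : ZMod 3} {z : ℍ}
    (hl : Reduced (l ++ [j])) (hz : z ∈ P.playground j) :
    P.word l • z ∈ P.playground (l.headD j) :=
  pingpong (P := P) P.playground (fun _ _ _ hij _ hz => R_smul_mem_playground hd hij hz) hl hz

/-- Words in `R₀` and `R₂` that end with `R₂`. -/
theorem word_smul_mem_of_last_two (hd : P.e * P.f = P.d) {l : List (ZMod 3)} {z : ℍ}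
    (hl : Reduced (l ++ [2])) (h1 : ∀ i ∈ l, i ≠ 1) (hz : 0 < arcSide P.e P.c z) :
    (l.headD 2 = 0 → arcSide P.c (P.e * P.c) (P.word (l ++ [2]) • z) < 0) ∧
      (l.headD 2 = 2 → arcSide P.f P.d (P.word (l ++ [2]) • z) < 0) := by
  have he := P.e_pos
  have hf := P.f_pos
  have hc := P.c_pos
  have hd0 := P.d_pos
  have hfc := P.f_lt_c
  have hec : P.c < P.e * P.c := by nlinarith [one_lt_e hd]
  induction l with
  | nil =>
    refine ⟨fun h => absurd h (by decide), fun _ => ?_⟩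
    simp only [List.nil_append, word_cons, word_nil, mul_one]
    exact arcSide_R_two_fd_neg.2 hz
  | cons i l ih =>
    have ih' := ih hl.tail fun k hk => h1 k (List.mem_cons_of_mem _ hk)
    rw [List.cons_append, word_cons, mul_smul, List.headD_cons]
    constructor
    · rintro rfl
      have hn : l.headD 2 = 2 := by
        cases l with
        | nil => rfl
        | cons k l =>
          have h3 := h1 k (by simp)
          rcases zmod3_cases k with rfl | rfl | rfl
          · exact absurd rfl hl.ne
          · exact absurd rfl h3
          · rfl
      refine (arcSide_R_zero_neg hc (by positivity) rfl ?_).2 (ih'.2 hn)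
      rw [← hd]; ring
    · rintro rfl
      have hn : l.headD 2 = 0 := by
        cases l with
        | nil => exact absurd rfl hl.ne
        | cons k l =>
          have h3 := h1 k (by simp)
          rcases zmod3_cases k with rfl | rfl | rfl
          · rfl
          · exact absurd rfl h3
          · exact absurd rfl hl.ne
      refine arcSide_R_two_fd_neg.2 ?_
      exact arcSide_pos_of_le_re (arcSide_re (ih'.1 hn).le hec.le).1.le
        (by linarith [P.e_lt_f])

/-- A word that starts and ends with `R₂` and contains `R₁` maps the exterior of the half plane over
`[e, c]` into the half plane over `[f, c]`. -/
theorem arcSide_word_neg (hd : P.e * P.f = P.d) {p w : List (ZMod 3)} {z : ℍ}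
    (hl : Reduced ((2 :: p) ++ [1] ++ (w ++ [2]))) (hw : ∀ i ∈ w, i ≠ 1)
    (hz : 0 < arcSide P.e P.c z) :
    arcSide P.f P.c (P.word ((2 :: p) ++ [1] ++ (w ++ [2])) • z) < 0 := by
  have he := P.e_pos
  have hf := P.f_pos
  have hc := P.c_pos
  have hd0 := P.d_pos
  have hef := P.e_lt_f
  have hfc := P.f_lt_c
  have hcd := P.c_lt_d
  have he1 := one_lt_e hd
  have r1 : Reduced ((2 :: p) ++ [1]) := (List.isChain_append.1 hl).1
  have r2 : Reduced (w ++ [2]) := (List.isChain_append.1 hl).2.1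
  have h1 := word_smul_mem_of_last_two hd r2 hw hz
  rw [word_append, mul_smul]
  rw [word_append P (2 :: p), mul_smul]
  refine word_smul_mem_playground hd (j := 1) (l := 2 :: p) r1 ?_
  change arcSide 0 P.e (P.word [1] • _) < 0
  rw [word_cons, word_nil, mul_one]
  have hh : w.headD 2 = 0 ∨ w.headD 2 = 2 := by
    cases w with
    | nil => exact Or.inr rfl
    | cons k w =>
      have h3 := hw k (by simp)
      rcases zmod3_cases k with rfl | rfl | rfl
      · exact Or.inl rfl
      · exact absurd rfl h3
      · exact Or.inr rfl
  rcases hh with hh | hh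
  · have h2 : arcSide (P.f / P.c) (P.d / P.c) (P.R 1 • P.word (w ++ [2]) • z) < 0 :=
      (arcSide_R_one_neg hd (by positivity) (by positivity)
        (by rw [← hd]; field_simp) (by field_simp)).2 (h1.1 hh)
    refine arcSide_mono_lt h2.le ?_ (by positivity) (d_div_c_lt_e hd).le (Or.inr (Or.inr h2))
    rw [div_le_div_iff_of_pos_right hc]; linarith
  · have h2 : arcSide 1 P.e (P.R 1 • P.word (w ++ [2]) • z) < 0 :=
      (arcSide_R_one_neg hd one_pos he (one_mul _) hd).2 (h1.2 hh)
    exact arcSide_mono_lt h2.le he1.le zero_le_one le_rfl (Or.inr (Or.inr h2))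

end ThreeHoledSphere


/-! ### The action as a permutation -/

/-- In the permutation group the reflections are genuine involutions, so that identities can be
proved by group algebra. -/
theorem actEq_iff {g h : GL (Fin 2) ℝ} : ActEq g h ↔
    MulAction.toPermHom (GL (Fin 2) ℝ) UnitTangent g =
      MulAction.toPermHom (GL (Fin 2) ℝ) UnitTangent h :=
  ⟨fun H => Equiv.ext H, fun H v => congrArg (fun e : Equiv.Perm UnitTangent => e v) H⟩

/-- The dihedral relation; it serves to move all letters `R₀` to the right, where an even number of
them cancels. -/
theorem exists_pow_mul_zpow {G : Type*} [Group G] {r x : G} (h : r * x * r⁻¹ = x⁻¹) (N : ℕ)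
    (n : ℤ) : ∃ n' : ℤ, r ^ N * x ^ n = x ^ n' * r ^ N := by
  induction N with
  | zero => exact ⟨n, by simp⟩
  | succ N ih =>
    obtain ⟨n', hn'⟩ := ih
    refine ⟨-n', ?_⟩
    have h1 : r * x ^ n' * r⁻¹ = x ^ (-n') := by rw [← conj_zpow, h, inv_zpow']
    rw [pow_succ', mul_assoc, hn', ← mul_assoc, ← mul_assoc, ← h1]
    group

namespace ThreeHoledSphere

variable {P : ThreeHoledSphere}

theorem deck_two_eq (P : ThreeHoledSphere) : P.deck 2 = P.R 1 * P.R 0 := rfl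
theorem deck_one_eq (P : ThreeHoledSphere) : P.deck 1 = P.R 0 * P.R 2 := rfl

theorem toPerm_R_sq (P : ThreeHoledSphere) (i : ZMod 3) :
    MulAction.toPermHom (GL (Fin 2) ℝ) UnitTangent (P.R i) *
      MulAction.toPermHom (GL (Fin 2) ℝ) UnitTangent (P.R i) = 1 := by
  rw [← map_mul, ← map_one (MulAction.toPermHom (GL (Fin 2) ℝ) UnitTangent)]
  exact actEq_iff.1 (P.actEq_R_mul_R i)

/-- Words in `R₀` and `R₁`. -/
theorem exists_actEq_zpow_two {l : List (ZMod 3)} (hl : ∀ i ∈ l, i ≠ 2) :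
    ∃ n : ℤ, ActEq (P.word l) (P.deck 2 ^ n * P.R 0 ^ l.length) := by
  have r0 := P.toPerm_R_sq 0
  have r1 := P.toPerm_R_sq 1
  simp_rw [actEq_iff, map_mul, map_zpow, map_pow, deck_two_eq, map_mul]
  set φ := MulAction.toPermHom (GL (Fin 2) ℝ) UnitTangent
  have i0 : (φ (P.R 0))⁻¹ = φ (P.R 0) := inv_eq_of_mul_eq_one_right r0
  have i1 : (φ (P.R 1))⁻¹ = φ (P.R 1) := inv_eq_of_mul_eq_one_right r1
  have hx : φ (P.R 0) * (φ (P.R 1) * φ (P.R 0)) * (φ (P.R 0))⁻¹ =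
      (φ (P.R 1) * φ (P.R 0))⁻¹ := by
    rw [mul_inv_rev, i0, i1, mul_assoc, mul_assoc, r0, mul_one]
  induction l with
  | nil => exact ⟨0, by simp⟩
  | cons i l ih =>
    obtain ⟨n, hn⟩ := ih fun j hj => hl j (List.mem_cons_of_mem _ hj)
    obtain ⟨n', hn'⟩ := exists_pow_mul_zpow hx 1 n
    rw [pow_one] at hn'
    rw [word_cons, map_mul, hn, List.length_cons]
    rcases zmod3_cases i with rfl | rfl | rfl
    · exact ⟨n', by rw [← mul_assoc, hn', pow_succ', mul_assoc]⟩
    · refine ⟨1 + n', ?_⟩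
      rw [zpow_add, zpow_one, mul_assoc _ (_ ^ n'), pow_succ', ← mul_assoc _ (φ (P.R 0)), ← hn',
        mul_assoc (φ (P.R 1)), mul_assoc (φ (P.R 0)), ← mul_assoc (φ (P.R 0)), r0, one_mul]
    · exact absurd rfl (hl 2 List.mem_cons_self)

/-- Words in `R₀` and `R₂`. -/
theorem exists_actEq_zpow_one {l : List (ZMod 3)} (hl : ∀ i ∈ l, i ≠ 1) :
    ∃ n : ℤ, ActEq (P.word l) (P.deck 1 ^ n * P.R 0 ^ l.length) := by
  have r0 := P.toPerm_R_sq 0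
  have r2 := P.toPerm_R_sq 2
  simp_rw [actEq_iff, map_mul, map_zpow, map_pow, deck_one_eq, map_mul]
  set φ := MulAction.toPermHom (GL (Fin 2) ℝ) UnitTangent
  have i0 : (φ (P.R 0))⁻¹ = φ (P.R 0) := inv_eq_of_mul_eq_one_right r0
  have i2 : (φ (P.R 2))⁻¹ = φ (P.R 2) := inv_eq_of_mul_eq_one_right r2
  have hx : φ (P.R 0) * (φ (P.R 0) * φ (P.R 2)) * (φ (P.R 0))⁻¹ =
      (φ (P.R 0) * φ (P.R 2))⁻¹ := by
    rw [mul_inv_rev, i0, i2, ← mul_assoc, r0, one_mul]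
  induction l with
  | nil => exact ⟨0, by simp⟩
  | cons i l ih =>
    obtain ⟨n, hn⟩ := ih fun j hj => hl j (List.mem_cons_of_mem _ hj)
    rw [word_cons, map_mul, hn, List.length_cons]
    rcases zmod3_cases i with rfl | rfl | rfl
    · obtain ⟨n', hn'⟩ := exists_pow_mul_zpow hx 1 n
      rw [pow_one] at hn'
      exact ⟨n', by rw [← mul_assoc, hn', pow_succ', mul_assoc]⟩
    · exact absurd rfl (hl 1 List.mem_cons_self)
    · obtain ⟨n', hn'⟩ := exists_pow_mul_zpow hx 1 (1 + n)
      rw [pow_one] at hn'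
      refine ⟨n', ?_⟩
      rw [pow_succ', ← mul_assoc, ← mul_assoc, ← hn', zpow_add, zpow_one, ← mul_assoc,
        ← mul_assoc, r0, one_mul]

theorem exists_append_cons_not_mem {α : Type*} {x : α} {l : List α} (h : x ∈ l) :
    ∃ s t, l = s ++ x :: t ∧ x ∉ t := by
  obtain ⟨s, t, h1, h2⟩ := List.eq_append_cons_of_mem (List.mem_reverse.2 h)
  refine ⟨t.reverse, s.reverse, ?_, by simpa using h2⟩
  rw [← List.reverse_reverse l, h1]
  simp

/-- The three kinds of deck transformations. -/
theorem exists_decomposition {k : GL (Fin 2) ℝ} (hk : k ∈ P.Γ) :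
    (∃ i : ℤ, ActEq k (P.deck 2 ^ i)) ∨
    (∃ i n j : ℤ, n ≠ 0 ∧ ActEq k (P.deck 2 ^ i * P.deck 1 ^ n * P.deck 2 ^ j)) ∨
    ∃ a p w b : List (ZMod 3), (∀ i ∈ a, i ≠ 2) ∧ (∀ i ∈ b, i ≠ 2) ∧ (∀ i ∈ w, i ≠ 1) ∧
      Reduced ((2 :: p) ++ [1] ++ (w ++ [2])) ∧
      ActEq k (P.word a * P.word ((2 :: p) ++ [1] ++ (w ++ [2])) * P.word b) := by
  obtain ⟨l, l1, l2, l3⟩ := exists_word_of_mem_Γ hk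
  have r0 := P.toPerm_R_sq 0
  have heven : ∀ N : ℕ, Even N →
      MulAction.toPermHom (GL (Fin 2) ℝ) UnitTangent (P.R 0) ^ N = 1 := by
    rintro N ⟨m, rfl⟩
    rw [← two_mul, pow_mul, pow_two, r0, one_pow]
  by_cases h2 : (2 : ZMod 3) ∈ l
  swap
  · obtain ⟨n, hn⟩ := exists_actEq_zpow_two (P := P) (l := l) fun i hi h => h2 (h ▸ hi)
    refine Or.inl ⟨n, l3.trans ?_⟩
    rw [actEq_iff] at hn ⊢
    rw [hn, map_mul, map_pow, heven _ l2, mul_one]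
  -- The word is cut at its first and its last letter `2`. Whether the part between them contains a
  -- `1` decides between the second and the third kind.
  obtain ⟨a, t, rfl, ha⟩ := List.eq_append_cons_of_mem h2
  obtain ⟨m, b, hm, hb⟩ := exists_append_cons_not_mem (show (2 : ZMod 3) ∈ 2 :: t by simp)
  have ha' : ∀ i ∈ a, i ≠ 2 := fun i hi h => ha (h ▸ hi)
  have hb' : ∀ i ∈ b, i ≠ 2 := fun i hi h => hb (h ▸ hi)
  rw [hm] at l1 l2 l3
  have e : m ++ 2 :: b = (m ++ [2]) ++ b := by simp
  rw [e] at l1 l2 l3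
  by_cases h1 : (1 : ZMod 3) ∈ m
  · right; right
    obtain ⟨p', w, rfl, hw⟩ := exists_append_cons_not_mem h1
    obtain ⟨p, rfl⟩ : ∃ p, p' = 2 :: p := by
      cases p' with
      | nil =>
        rw [List.nil_append, List.cons_append, List.cons.injEq] at hm
        exact absurd hm.1 (by decide)
      | cons j p =>
        rw [List.cons_append, List.cons_append, List.cons.injEq] at hm
        exact ⟨p, by rw [hm.1]⟩
    have e2 : ((2 :: p) ++ 1 :: w) ++ [2] = (2 :: p) ++ [1] ++ (w ++ [2]) := by simp
    rw [e2] at l1 l3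
    refine ⟨a, p, w, b, ha', hb', fun i hi h => hw (h ▸ hi), ?_, ?_⟩
    · exact (List.isChain_append.1 (List.isChain_append.1 l1).2.1).1
    · rw [word_append, word_append P _ b, ← mul_assoc] at l3
      exact l3
  · obtain ⟨p, hp⟩ := exists_actEq_zpow_two (P := P) ha'
    obtain ⟨q, hq⟩ := exists_actEq_zpow_two (P := P) hb'
    obtain ⟨n, hn⟩ := exists_actEq_zpow_one (P := P) (l := m ++ [2]) fun i hi h => by
      rw [List.mem_append, h] at hi
      rcases hi with hi | hi
      · exact h1 hi
      · simp at hi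
        exact absurd hi (by decide)
    rw [List.length_append, List.length_append] at l2
    set M := (m ++ [2]).length
    have r1 := P.toPerm_R_sq 1
    have r2 := P.toPerm_R_sq 2
    have key : ∃ n' q' : ℤ, ActEq k (P.deck 2 ^ p * P.deck 1 ^ n' * P.deck 2 ^ q') := by
      rw [actEq_iff] at hp hq hn l3
      simp_rw [actEq_iff]
      rw [l3, word_append, word_append, map_mul, map_mul, hp, hq, hn]
      simp_rw [map_mul, map_zpow, map_pow, deck_one_eq, deck_two_eq, map_mul]
      set φ := MulAction.toPermHom (GL (Fin 2) ℝ) UnitTangent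
      have i0 : (φ (P.R 0))⁻¹ = φ (P.R 0) := inv_eq_of_mul_eq_one_right r0
      have i1 : (φ (P.R 1))⁻¹ = φ (P.R 1) := inv_eq_of_mul_eq_one_right r1
      have i2 : (φ (P.R 2))⁻¹ = φ (P.R 2) := inv_eq_of_mul_eq_one_right r2
      have hx1 : φ (P.R 0) * (φ (P.R 0) * φ (P.R 2)) * (φ (P.R 0))⁻¹ =
          (φ (P.R 0) * φ (P.R 2))⁻¹ := by
        rw [mul_inv_rev, i0, i2, ← mul_assoc, r0, one_mul]
      have hx2 : φ (P.R 0) * (φ (P.R 1) * φ (P.R 0)) * (φ (P.R 0))⁻¹ =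
          (φ (P.R 1) * φ (P.R 0))⁻¹ := by
        rw [mul_inv_rev, i0, i1, mul_assoc, mul_assoc, r0, mul_one]
      obtain ⟨n', hn'⟩ := exists_pow_mul_zpow hx1 a.length n
      obtain ⟨q', hq'⟩ := exists_pow_mul_zpow hx2 (a.length + M) q
      refine ⟨n', q', ?_⟩
      calc _ = (φ (P.R 1) * φ (P.R 0)) ^ p * (φ (P.R 0) ^ a.length *
            (φ (P.R 0) * φ (P.R 2)) ^ n) * φ (P.R 0) ^ M * (φ (P.R 1) * φ (P.R 0)) ^ q *
            φ (P.R 0) ^ b.length := by simp only [mul_assoc]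
        _ = (φ (P.R 1) * φ (P.R 0)) ^ p * (φ (P.R 0) * φ (P.R 2)) ^ n' *
            (φ (P.R 0) ^ (a.length + M) * (φ (P.R 1) * φ (P.R 0)) ^ q) *
            φ (P.R 0) ^ b.length := by rw [hn', pow_add]; simp only [mul_assoc]
        _ = (φ (P.R 1) * φ (P.R 0)) ^ p * (φ (P.R 0) * φ (P.R 2)) ^ n' *
            (φ (P.R 1) * φ (P.R 0)) ^ q' * φ (P.R 0) ^ (a.length + (M + b.length)) := by
          rw [hq', ← add_assoc, pow_add _ (a.length + M)]; simp only [mul_assoc]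
        _ = _ := by rw [heven _ l2, mul_one]
    obtain ⟨n', q', h⟩ := key
    -- If the exponent of `γ₁` vanishes, the two powers of `γ₂` merge and the element is of the
    -- first kind.
    by_cases h0 : n' = 0
    · left
      refine ⟨p + q', ?_⟩
      rw [h0, zpow_zero, mul_one, ← zpow_add] at h
      exact h
    · exact Or.inr (Or.inl ⟨p, n', q', h0, h⟩)

/-! ### The deck transformation along `L₁` -/

/-- `R₂` takes the exterior of the arc over `[e, d]` under the arc over `[f, c]`, and `R₀` takes
that under the arc over `[d, e c]`. The image is again exterior to `[e, d]`, so this can be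
iterated. -/
theorem arcSide_deck_one_neg (hd : P.e * P.f = P.d) {z : ℍ} (hz : 0 < arcSide P.e P.d z) :
    arcSide P.d (P.e * P.c) (P.deck 1 • z) < 0 := by
  have := P.d_pos
  have := P.c_pos
  have := P.e_pos
  rw [deck_one_eq, mul_smul]
  exact (arcSide_R_zero_neg P.d_pos (by positivity) (mul_comm _ _)
    (by rw [← hd]; ring)).2 (arcSide_R_two_fc_neg.2 hz)

theorem arcSide_deck_one_pow_neg (hd : P.e * P.f = P.d) {z : ℍ} (hz : 0 < arcSide P.e P.d z)
    (n : ℕ) : arcSide P.d (P.e * P.c) (P.deck 1 ^ (n + 1) • z) < 0 := by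
  have h1 : P.d ≤ P.e * P.c := by
    rw [← hd]; exact mul_le_mul_of_nonneg_left P.f_lt_c.le P.e_pos.le
  induction n with
  | zero => rw [zero_add, pow_one]; exact arcSide_deck_one_neg hd hz
  | succ n ih =>
    rw [pow_succ', mul_smul]
    refine arcSide_deck_one_neg hd (arcSide_pos_of_le_re (arcSide_re ih.le h1).1.le ?_)
    linarith [P.e_lt_f, P.f_lt_c, P.c_lt_d]

/-- `γ₁` translates along `L̃₁` towards `d`; the reflections `R₂` and `R₀` both preserve `L̃₁` and
exchange its ends. -/
theorem re_deck_one (P : ThreeHoledSphere) {z : ℍ} (hz : arcSide P.c P.d z = 0) :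
    arcSide P.c P.d (P.deck 1 • z) = 0 ∧ z.re < (P.deck 1 • z).re := by
  have hef := P.e_lt_f
  have hfc := P.f_lt_c
  have hcd := P.c_lt_d
  have he := P.e_pos
  have hf := P.f_pos
  have hc := P.c_pos
  have hd0 := P.d_pos
  have h2 : arcSide P.c P.d (P.R 2 • z) = 0 := by
    rw [← P.L_one_side] at hz ⊢
    exact (P.side_L_R_eq_zero (by decide) z).2 hz
  have h0 : arcSide P.c P.d (P.deck 1 • z) = 0 := by
    rw [deck_one_eq, mul_smul, ← P.L_one_side]
    rw [← P.L_one_side] at h2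
    exact (P.side_L_R_eq_zero (by decide) _).2 h2
  refine ⟨h0, ?_⟩
  obtain ⟨z1, z2⟩ := arcSide_re hz.le hcd.le
  obtain ⟨u1, u2⟩ := arcSide_re h2.le hcd.le
  have e1 : ((P.R 2 • z).re - P.c) * denomSq (P.R 2) z =
      ((P.c - P.e) * (P.c - P.f)) ^ 2 * (P.d - z.re) := by
    have h1 := smul_re_mul (P.R 2) z
    have e00 : P.R 2 0 0 = P.c * P.d - P.e * P.f := rfl
    have e01 : P.R 2 0 1 = -(P.c * P.d * (P.e + P.f) - P.e * P.f * (P.c + P.d)) := rfl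
    have e10 : P.R 2 1 0 = P.c + P.d - P.e - P.f := rfl
    have e11 : P.R 2 1 1 = -(P.c * P.d - P.e * P.f) := rfl
    rw [sub_mul, h1, denomSq, e00, e01, e10, e11]
    rw [arcSide] at hz
    linear_combination ((P.c * P.d - P.e * P.f) * (P.c + P.d - P.e - P.f) -
      P.c * (P.c + P.d - P.e - P.f) ^ 2) * hz
  have e2 : (P.d - (P.R 2 • z).re) * denomSq (P.R 2) z =
      ((P.d - P.e) * (P.d - P.f)) ^ 2 * (z.re - P.c) := by
    have h1 := smul_re_mul (P.R 2) z
    have e00 : P.R 2 0 0 = P.c * P.d - P.e * P.f := rfl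
    have e01 : P.R 2 0 1 = -(P.c * P.d * (P.e + P.f) - P.e * P.f * (P.c + P.d)) := rfl
    have e10 : P.R 2 1 0 = P.c + P.d - P.e - P.f := rfl
    have e11 : P.R 2 1 1 = -(P.c * P.d - P.e * P.f) := rfl
    rw [sub_mul, h1, denomSq, e00, e01, e10, e11]
    rw [arcSide] at hz
    linear_combination -((P.c * P.d - P.e * P.f) * (P.c + P.d - P.e - P.f) -
      P.d * (P.c + P.d - P.e - P.f) ^ 2) * hz
  have e3 := P.R_zero_re (P.R 2 • z)
  rw [deck_one_eq, mul_smul]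
  set u := P.R 2 • z
  set X := z.re
  set X' := (P.R 0 • u).re
  have hN := denomSq_pos (P.R 2) z
  have hS := normSq_pos u
  rw [arcSide_eq] at h2
  -- the two reflections invert the ratio `(X - c) / (d - X)`
  have f1 : (X' - P.c) * (u.re ^ 2 + u.im ^ 2) = P.c ^ 2 * (P.d - u.re) := by
    linear_combination e3 - P.c * h2
  have f2 : (P.d - X') * (u.re ^ 2 + u.im ^ 2) = P.d ^ 2 * (u.re - P.c) := by
    linear_combination -e3 + P.d * h2
  -- The ratio `(X - c) / (d - X)` gets multiplied by the square of the quotient of these two sides;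
  -- the difference of the sides is `(d - c) (c d - e f)`.
  have hk : P.d * ((P.c - P.e) * (P.c - P.f)) < P.c * ((P.d - P.e) * (P.d - P.f)) := by
    have : 0 < (P.d - P.c) * (P.c * P.d - P.e * P.f) := by
      have : P.e * P.f < P.c * P.d := by nlinarith
      exact mul_pos (by linarith) (by linarith)
    nlinarith
  have hk0 : 0 < P.d * ((P.c - P.e) * (P.c - P.f)) :=
    mul_pos hd0 (mul_pos (by linarith) (by linarith))
  have hk2 : (P.d * ((P.c - P.e) * (P.c - P.f))) ^ 2 <
      (P.c * ((P.d - P.e) * (P.d - P.f))) ^ 2 := pow_lt_pow_left₀ hk hk0.le (by norm_num)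
  have f3 : ((X' - P.c) * (P.d - X) - (P.d - X') * (X - P.c)) * ((u.re ^ 2 + u.im ^ 2) *
      denomSq (P.R 2) z) = ((P.c * ((P.d - P.e) * (P.d - P.f))) ^ 2 -
      (P.d * ((P.c - P.e) * (P.c - P.f))) ^ 2) * ((X - P.c) * (P.d - X)) := by
    linear_combination (P.d - X) * denomSq (P.R 2) z * f1 - (X - P.c) * denomSq (P.R 2) z * f2 +
      P.c ^ 2 * (P.d - X) * e2 - P.d ^ 2 * (X - P.c) * e1
  have f4 : 0 < ((X' - P.c) * (P.d - X) - (P.d - X') * (X - P.c)) * ((u.re ^ 2 + u.im ^ 2) *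
      denomSq (P.R 2) z) := by
    rw [f3]
    exact mul_pos (by linarith) (mul_pos (by linarith) (by linarith))
  have f5 := pos_of_mul_pos_left f4 (by positivity)
  have f6 : 0 < (X' - X) * (P.d - P.c) := by linarith
  linarith [pos_of_mul_pos_left f6 (by linarith)]

theorem re_deck_one_pow (P : ThreeHoledSphere) {z : ℍ} (hz : arcSide P.c P.d z = 0) (n : ℕ) :
    arcSide P.c P.d (P.deck 1 ^ (n + 1) • z) = 0 ∧ z.re < (P.deck 1 ^ (n + 1) • z).re := by
  induction n with
  | zero => rw [zero_add, pow_one]; exact P.re_deck_one hz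
  | succ n ih =>
    rw [pow_succ', mul_smul]
    obtain ⟨h1, h2⟩ := P.re_deck_one ih.1
    exact ⟨h1, ih.2.trans h2⟩

end ThreeHoledSphere


/-! ### Rescaled arcs, knots and wedges. -/

theorem arcSide_comm (α β : ℝ) (z : ℍ) : arcSide α β z = arcSide β α z := by
  rw [arcSide, arcSide]; ring

/-- The wall with the end points `α, β`. -/
def arcWall (α β : ℝ) (h : α ≠ β) : Wall :=
  ⟨1, (α + β) / 2, α * β, by
    have : 0 < (α - β) ^ 2 := by
      have := sub_ne_zero.2 h
      positivity
    nlinarith⟩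

theorem arcWall_side {α β : ℝ} (h : α ≠ β) (z : ℍ) : (arcWall α β h).side z = arcSide α β z := by
  rw [Wall.side_eq, arcSide]
  change 1 * _ - 2 * ((α + β) / 2) * _ + α * β = _
  ring

theorem arcSide_pos_between {g : ℝ → ℍ} (hg : Isometry g) {α β : ℝ} (h : α ≠ β) {t₁ t₂ t : ℝ}
    (h1 : 0 < arcSide α β (g t₁)) (h2 : 0 < arcSide α β (g t₂)) (ht1 : t₁ ≤ t) (ht2 : t ≤ t₂) :
    0 < arcSide α β (g t) := by
  rcases ht2.eq_or_lt with rfl | ht2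
  · exact h2
  · rw [← arcWall_side h] at *
    exact Wall.side_pos_between hg _ h1 h2.le ht1 ht2

theorem arcSide_neg_between {g : ℝ → ℍ} (hg : Isometry g) {α β : ℝ} (h : α ≠ β) {t₁ t₂ t : ℝ}
    (h1 : arcSide α β (g t₁) < 0) (h2 : arcSide α β (g t₂) < 0) (ht1 : t₁ ≤ t) (ht2 : t ≤ t₂) :
    arcSide α β (g t) < 0 := by
  have hn : ∃ w : Wall, ∀ z, w.side z = -arcSide α β z := by
    refine ⟨⟨-1, -((α + β) / 2), -(α * β), ?_⟩, fun z => ?_⟩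
    · have := (arcWall α β h).disc_pos
      change 0 < ((α + β) / 2) ^ 2 - 1 * (α * β) at this
      linarith
    rw [Wall.side_eq, arcSide]
    change -1 * _ - 2 * (-((α + β) / 2)) * _ + -(α * β) = _
    ring
  obtain ⟨w, hw⟩ := hn
  rcases ht2.eq_or_lt with rfl | ht2
  · exact h2
  · have := Wall.side_pos_between hg w (t₁ := t₁) (t₂ := t₂) (t := t) (by rw [hw]; linarith)
      (by rw [hw]; linarith) ht1 ht2
    rw [hw] at this
    linarith

/-- The position of a point of a geodesic relative to the geodesic rescaled by `r` depends only on
`|z|²`; for `r ≠ 1` they meet where `|z|² = r x y`. With `r` a power of `c` this governs the action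
of the powers of `γ₂`. -/
theorem arcSide_scale_self {x y : ℝ} {z : ℍ} (h : arcSide x y z = 0) (r : ℝ) :
    arcSide (r * x) (r * y) z = (1 - r) * (z.re ^ 2 + z.im ^ 2 - r * (x * y)) := by
  rw [arcSide_eq] at *
  linear_combination r * h

namespace IsArc

variable {g : ℝ → ℍ} {y x κ : ℝ}

/-- `|z|²` decreases from `y²` to `x²`, so it serves as a reversed time. -/
theorem normSq_lt_iff (h : IsArc g y x κ) (hx : 0 < x) {s t : ℝ} :
    (g s).re ^ 2 + (g s).im ^ 2 < (g t).re ^ 2 + (g t).im ^ 2 ↔ t < s := by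
  have h1 := h.normSq_mul s
  have h2 := h.normSq_mul t
  have hxy := h.lt
  rw [← h.param_lt_iff (s := t) (t := s)]
  set u := (κ * Real.exp s) ^ 2
  set w := (κ * Real.exp t) ^ 2
  have hu : 0 ≤ u := sq_nonneg _
  have hw : 0 ≤ w := sq_nonneg _
  rw [← eq_div_iff (by positivity)] at h1 h2
  rw [h1, h2, div_lt_div_iff₀ (by positivity) (by positivity)]
  have h3 : 0 < y ^ 2 - x ^ 2 := by nlinarith
  constructor <;> intro h4
  · by_contra! h5
    nlinarith
  · nlinarith

theorem normSq_le_iff (h : IsArc g y x κ) (hx : 0 < x) {s t : ℝ} :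
    (g s).re ^ 2 + (g s).im ^ 2 ≤ (g t).re ^ 2 + (g t).im ^ 2 ↔ t ≤ s := by
  rw [← not_lt, h.normSq_lt_iff hx, not_lt]

theorem exists_crossing (h : IsArc g y x κ) {c d : ℝ} (h1 : x < c) (h2 : c < y) (h3 : y < d) :
    ∃ t, arcSide c d (g t) = 0 ∧ ∀ s, 0 ≤ arcSide c d (g s) ↔ t ≤ s := by
  have hA : 0 < (c - x) * (d - x) := mul_pos (by linarith) (by linarith)
  have hB : 0 < (y - c) * (d - y) := mul_pos (by linarith) (by linarith)
  obtain ⟨t, ht⟩ := h.exists_param (div_pos hB hA)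
  have key : ∀ s, 0 ≤ arcSide c d (g s) ↔ t ≤ s := by
    intro s
    have e := h.arcSide_mul c d s
    rw [← h.param_le_iff (s := t) (t := s), ht, div_le_iff₀ hA]
    have hp : 0 < 1 + (κ * Real.exp s) ^ 2 := by positivity
    rw [← mul_nonneg_iff_of_pos_right hp, e]
    constructor <;> intro h4 <;> nlinarith
  refine ⟨t, ?_, key⟩
  have e := h.arcSide_mul c d t
  have hp : 0 < 1 + (κ * Real.exp t) ^ 2 := by positivity
  rw [eq_div_iff hA.ne'] at ht
  refine (mul_eq_zero.1 (e.trans ?_)).resolve_right hp.ne'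
  linear_combination ht

theorem eq_of_normSq (h : IsArc g y x κ) {t : ℝ} :
    (x + y) * (g t).re = (g t).re ^ 2 + (g t).im ^ 2 + x * y := by
  have := h.arcSide_self t
  rw [arcSide_eq] at this
  linarith

/-- The times at which the geodesic meets its images under `z ↦ z / c`. -/
theorem exists_knots (h : IsArc g y x κ) (hx : 0 < x) {c : ℝ} (hc : 1 < c) (hcx : c * x < y) :
    ∃ s t, s < t ∧ (g s).re ^ 2 + (g s).im ^ 2 = x * y * c ∧
      (g t).re ^ 2 + (g t).im ^ 2 = x * y / c ∧ (g t).re = (g s).re / c ∧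
      (g t).im = (g s).im / c ∧ ∀ r, x * (κ * Real.exp r) ^ 2 = y → s + t = 2 * r := by
  have hy : 0 < y := by nlinarith
  have hκ := h.pos
  have h1 : 0 < y - c * x := by linarith
  have h2 : 0 < c * y - x := by nlinarith
  have c0 : 0 < c := by linarith
  -- The solutions of `|z|² = x y c` and `|z|² = x y / c` in terms of the squared parameter; `c x <
  -- y` makes them positive.
  obtain ⟨s, hs⟩ := h.exists_param (s := y * (y - c * x) / (x * (c * y - x))) (by positivity)
  obtain ⟨t, ht⟩ := h.exists_param (s := y * (c * y - x) / (x * (y - c * x))) (by positivity)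
  rw [eq_div_iff (by positivity)] at hs ht
  have es : (g s).re ^ 2 + (g s).im ^ 2 = x * y * c := by
    have e := h.normSq_mul s
    have hp : 0 < 1 + (κ * Real.exp s) ^ 2 := by positivity
    apply mul_right_cancel₀ hp.ne'
    linear_combination e - hs
  have et : (g t).re ^ 2 + (g t).im ^ 2 = x * y / c := by
    have e := h.normSq_mul t
    rw [eq_div_iff c0.ne']
    have hp : 0 < (1 + (κ * Real.exp t) ^ 2) := by positivity
    apply mul_right_cancel₀ hp.ne'
    linear_combination c * e - ht
  have hst : s < t := by
    rw [← h.normSq_lt_iff hx, es, et, div_lt_iff₀ c0]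
    have : 0 < x * y := by positivity
    nlinarith
  have hre : (g t).re = (g s).re / c := by
    have e1 := h.eq_of_normSq (t := s)
    have e2 := h.eq_of_normSq (t := t)
    rw [es] at e1
    rw [et] at e2
    have hxy : x + y ≠ 0 := by positivity
    apply mul_left_cancel₀ hxy
    rw [e2, mul_div_assoc', e1]
    field_simp
    ring
  refine ⟨s, t, hst, es, et, hre, ?_, fun r hr => ?_⟩
  · rw [← sq_eq_sq₀ (im_pos _).le (div_pos (im_pos _) c0).le]
    have : (g t).im ^ 2 = x * y / c - (g t).re ^ 2 := by linarith
    rw [this, hre, div_pow, div_pow]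
    have : (g s).im ^ 2 = x * y * c - (g s).re ^ 2 := by linarith
    rw [this]
    field_simp
  -- The squared parameters of the two knots have the product `(y / x)²`, and `y / x` is the squared
  -- parameter of the tangency point.
  · have e1 : (κ * Real.exp s) ^ 2 * (κ * Real.exp t) ^ 2 = ((κ * Real.exp r) ^ 2) ^ 2 := by
      have : (κ * Real.exp r) ^ 2 = y / x := by field_simp; linarith
      rw [this]
      have hk : x * (c * y - x) * (x * (y - c * x)) ≠ 0 := by positivity
      apply mul_right_cancel₀ hk
      have e3 : (y / x) ^ 2 * (x * (c * y - x) * (x * (y - c * x))) =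
          y * (y - c * x) * (y * (c * y - x)) := by
        rw [div_pow]
        field_simp
      rw [e3, ← hs, ← ht]
      ring
    have e2 : κ ^ 4 * Real.exp (2 * (s + t)) = κ ^ 4 * Real.exp (2 * (2 * r)) := by
      have a1 : Real.exp (2 * (s + t)) = Real.exp s ^ 2 * Real.exp t ^ 2 := by
        rw [← Real.exp_nat_mul, ← Real.exp_nat_mul, ← Real.exp_add]; congr 1; push_cast; ring
      have a2 : Real.exp (2 * (2 * r)) = Real.exp r ^ 4 := by
        rw [← Real.exp_nat_mul]; congr 1; push_cast; ring
      rw [a1, a2]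
      linear_combination e1
    have e3 := Real.exp_injective (mul_left_cancel₀ (by positivity) e2)
    linarith

end IsArc

namespace ThreeHoledSphere

variable {P : ThreeHoledSphere}

theorem arcSide_deck_two_zpow (hd : P.e * P.f = P.d) (j : ℤ) (α β : ℝ) (z : ℍ) :
    arcSide α β (P.deck 2 ^ j • z) =
      (P.c ^ (-j)) ^ 2 * arcSide (P.c ^ j * α) (P.c ^ j * β) z := by
  obtain ⟨h1, h2⟩ := deck_two_zpow_smul hd j z
  have hc : P.c ^ (-j) * P.c ^ j = 1 := by
    rw [← zpow_add₀ P.c_pos.ne']; simp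
  rw [arcSide, arcSide, h1, h2]
  linear_combination (z.re * P.c ^ (-j) * (α + β) - α * β * (P.c ^ (-j) * P.c ^ j + 1)) * hc

/-- The parameters of the set `Ω`. -/
structure IsParam (P : ThreeHoledSphere) (x y : ℝ) : Prop where
  d_eq : P.e * P.f = P.d
  x_pos : 0 < x
  x_lt : x < 1
  c_lt : P.c < y
  lt_d : y < P.d

/-- The lasso: the part of the geodesic from `y` to `x` between `L̃₁` and the second lift of the
knot. -/
def lassoSegment (P : ThreeHoledSphere) (x y : ℝ) : Set ℍ :=
  {z | arcSide x y z = 0 ∧ 0 ≤ arcSide P.c P.d z ∧ x * y / P.c ≤ z.re ^ 2 + z.im ^ 2}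

/-- The region between a geodesic and its image under `z ↦ c z`. -/
def wedge (P : ThreeHoledSphere) (x y : ℝ) : Set ℍ :=
  {z | 0 < arcSide x y z ∧ arcSide (P.c * x) (P.c * y) z < 0}

/-- By `arcSide_scale_self`, being in the wedge is a pair of inequalities between `|z|²` and `cⁱ x
y`, `cⁱ⁺¹ x y`. They contradict each other for `i ≥ 1`, contradict `x y / c ≤ |z|²` for `i ≤ -2`,
and for `i = -1, 0` the point is on the boundary of the wedge. -/
theorem deck_two_zpow_not_mem_wedge (hd : P.e * P.f = P.d) {x y : ℝ} (hx : 0 < x) (hy : 0 < y)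
    {z : ℍ} (h1 : arcSide x y z = 0) (h3 : x * y / P.c ≤ z.re ^ 2 + z.im ^ 2) (i : ℤ) :
    P.deck 2 ^ i • z ∉ P.wedge x y := by
  rintro ⟨w1, w2⟩
  have hc := P.c_pos
  have hc1 := one_lt_c hd
  have hxy : 0 < x * y := by positivity
  have hr : 0 < P.c ^ (-i) := zpow_pos hc _
  rw [arcSide_deck_two_zpow hd, arcSide_scale_self h1] at w1
  rw [arcSide_deck_two_zpow hd, ← mul_assoc, ← mul_assoc, arcSide_scale_self h1,
    ← zpow_add_one₀ hc.ne'] at w2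
  have w1' := pos_of_mul_pos_right w1 (by positivity)
  have w2' : (1 - P.c ^ (i + 1)) * (z.re ^ 2 + z.im ^ 2 - P.c ^ (i + 1) * (x * y)) < 0 := by
    by_contra! h4
    have := mul_nonneg (sq_nonneg (P.c ^ (-i))) h4
    linarith
  set S := z.re ^ 2 + z.im ^ 2
  rcases lt_trichotomy i (-1) with hi | rfl | hi
  · have h5 : P.c ^ (i + 1) ≤ P.c ^ (-1 : ℤ) := zpow_le_zpow_right₀ hc1.le (by omega)
    rw [zpow_neg_one] at h5
    have h6 : P.c⁻¹ < 1 := inv_lt_one_of_one_lt₀ hc1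
    rw [div_eq_inv_mul] at h3
    have h7 := mul_le_mul_of_nonneg_right h5 hxy.le
    have : 0 ≤ (1 - P.c ^ (i + 1)) * (S - P.c ^ (i + 1) * (x * y)) :=
      mul_nonneg (by linarith) (by linarith)
    linarith
  · simp at w2'
  · rcases eq_or_lt_of_le (show 0 ≤ i by omega) with rfl | hi
    · simp at w1'
    · have h5 : 1 < P.c ^ i := one_lt_zpow₀ hc1 hi
      have h6 : P.c ^ i < P.c ^ (i + 1) := zpow_lt_zpow_right₀ hc1 (by omega)
      have h7 : S < P.c ^ i * (x * y) := by by_contra! h7; nlinarith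
      have h8 : P.c ^ (i + 1) * (x * y) < S := by by_contra! h8; nlinarith
      nlinarith

namespace IsParam

variable {x y : ℝ}

theorem y_pos (h : P.IsParam x y) : 0 < y := P.c_pos.trans h.c_lt

theorem lt (h : P.IsParam x y) : x < y := by
  linarith [h.x_lt, one_lt_c h.d_eq, h.c_lt]

theorem mul_lt (h : P.IsParam x y) : P.c * x < y := by
  nlinarith [h.x_lt, P.c_pos, h.c_lt]

/-- For `j ≤ 0` the segment is not under the rescaled geodesic over `cʲ [x, y]`, which encloses this
arc because `x < d/c` and `c < y`. For `j > 0` the arc is to the right of `d`, hence of `y`. -/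
theorem arcSide_gap_pos (h : P.IsParam x y) {z : ℍ} (hz : z ∈ P.lassoSegment x y) (j : ℤ) :
    0 < arcSide (P.c ^ j * (P.d / P.c)) (P.c ^ j * P.c) z := by
  obtain ⟨h1, h2, h3⟩ := hz
  have hc := P.c_pos
  have hc1 := one_lt_c h.d_eq
  have hx := h.x_pos
  have hy := h.y_pos
  have hr : 0 < P.c ^ j := zpow_pos hc j
  have hdc : P.d / P.c ≤ P.c := by
    have := d_div_c_lt_e h.d_eq
    linarith [P.e_lt_f, P.f_lt_c]
  rcases le_or_gt j 0 with hj | hj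
  · have h4 : 0 ≤ arcSide (P.c ^ j * x) (P.c ^ j * y) z := by
      rw [arcSide_scale_self h1]
      rcases eq_or_lt_of_le hj with rfl | hj
      · simp
      · have h5 : P.c ^ j ≤ P.c ^ (-1 : ℤ) := zpow_le_zpow_right₀ hc1.le (by omega)
        rw [zpow_neg_one] at h5
        have h6 : P.c⁻¹ < 1 := inv_lt_one_of_one_lt₀ hc1
        refine mul_nonneg (by linarith) (sub_nonneg.2 (le_trans ?_ h3))
        rw [div_eq_inv_mul]
        exact mul_le_mul_of_nonneg_right h5 (by positivity)
    by_contra! h5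
    have h6 := arcSide_mono_lt h5 (mul_le_mul_of_nonneg_left hdc hr.le)
      (mul_le_mul_of_nonneg_left (show x ≤ P.d / P.c by linarith [h.x_lt, P.one_lt_d_div_c]) hr.le)
      (mul_le_mul_of_nonneg_left h.c_lt.le hr.le)
      (Or.inr (Or.inl (mul_lt_mul_of_pos_left h.c_lt hr)))
    linarith
  · have h4 : P.c ≤ P.c ^ j := by
      have := zpow_le_zpow_right₀ hc1.le (show (1 : ℤ) ≤ j by omega)
      rwa [zpow_one] at this
    refine arcSide_pos_of_re_le ?_ (mul_le_mul_of_nonneg_left hdc hr.le)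
    have h5 := (arcSide_re h1.le h.lt.le).2
    have h6 : P.d ≤ P.c ^ j * (P.d / P.c) := by
      have := mul_le_mul_of_nonneg_right h4 (div_pos P.d_pos hc).le
      rwa [mul_div_cancel₀ _ hc.ne'] at this
    linarith [h.lt_d]

theorem not_mem_wedge (h : P.IsParam x y) {z : ℍ} (hz : z ∈ P.lassoSegment x y) (i : ℤ) :
    P.deck 2 ^ i • z ∉ P.wedge x y :=
  deck_two_zpow_not_mem_wedge h.d_eq h.x_pos h.y_pos hz.1 hz.2.2 i

end IsParam

/-- The inversions `R₀` and `R₁` permute the arcs over `cʲ [d/c, c]`, with `j ↦ 1 - j` and `j ↦ -j`.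
-/
theorem arcSide_gap_word_pos (hd : P.e * P.f = P.d) {z : ℍ}
    (hz : ∀ j : ℤ, 0 < arcSide (P.c ^ j * (P.d / P.c)) (P.c ^ j * P.c) z) {l : List (ZMod 3)}
    (hl : ∀ i ∈ l, i ≠ 2) (j : ℤ) :
    0 < arcSide (P.c ^ j * (P.d / P.c)) (P.c ^ j * P.c) (P.word l • z) := by
  have hc := P.c_pos
  have hd0 := P.d_pos
  induction l generalizing j with
  | nil => simpa using hz j
  | cons i l ih =>
    have ih' := ih fun k hk => hl k (List.mem_cons_of_mem _ hk)
    rw [word_cons, mul_smul]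
    have hr : 0 < P.c ^ j := zpow_pos hc j
    have hS := normSq_pos (P.word l • z)
    have hK : 0 < P.c ^ j * (P.d / P.c) * (P.c ^ j * P.c) := by positivity
    rcases zmod3_cases i with rfl | rfl | rfl
    · have e := P.arcSide_R_zero (α := P.c ^ j * (P.d / P.c)) (β := P.c ^ j * P.c)
        (α' := P.c ^ (1 - j) * P.c) (β' := P.c ^ (1 - j) * (P.d / P.c))
        (by rw [zpow_sub₀ hc.ne', zpow_one]; field_simp)
        (by rw [zpow_sub₀ hc.ne', zpow_one]; field_simp) (P.word l • z)
      rw [arcSide_comm (P.c ^ (1 - j) * P.c)] at e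
      have := mul_pos hK (ih' (1 - j))
      rw [← e] at this
      exact pos_of_mul_pos_left this hS.le
    · have e := P.arcSide_R_one hd (α := P.c ^ j * (P.d / P.c)) (β := P.c ^ j * P.c)
        (α' := P.c ^ (-j) * P.c) (β' := P.c ^ (-j) * (P.d / P.c))
        (by rw [zpow_neg]; field_simp)
        (by rw [zpow_neg]; field_simp) (P.word l • z)
      rw [arcSide_comm (P.c ^ (-j) * P.c)] at e
      have := mul_pos hK (ih' (-j))
      rw [← e] at this
      exact pos_of_mul_pos_left this hS.le
    · exact absurd rfl (hl 2 List.mem_cons_self)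

/-- Points whose images under words in `R₀` and `R₁` are not under the geodesic from `d / c` to `c`
are not related by words of the third kind. -/
theorem not_actEq_of_gap (hd : P.e * P.f = P.d) {z : ℍ}
    (hz : ∀ j : ℤ, 0 < arcSide (P.c ^ j * (P.d / P.c)) (P.c ^ j * P.c) z)
    {a p w b : List (ZMod 3)} (ha : ∀ i ∈ a, i ≠ 2) (hb : ∀ i ∈ b, i ≠ 2) (hw : ∀ i ∈ w, i ≠ 1)
    (hl : Reduced ((2 :: p) ++ [1] ++ (w ++ [2])))
    (hz' : ∀ j : ℤ, 0 < arcSide (P.c ^ j * (P.d / P.c)) (P.c ^ j * P.c)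
      (P.word a • P.word ((2 :: p) ++ [1] ++ (w ++ [2])) • P.word b • z)) : False := by
  have h1 := arcSide_gap_word_pos hd hz hb 0
  have h2 := arcSide_gap_word_pos hd hz' (l := a.reverse)
    (fun i hi => ha i (List.mem_reverse.1 hi)) 0
  rw [word_reverse_smul_word_smul] at h2
  rw [zpow_zero, one_mul, one_mul] at h1 h2
  have hdc := d_div_c_lt_e hd
  have h3 : 0 < arcSide P.e P.c (P.word b • z) := by
    by_contra! h3
    have := arcSide_mono_le h3 (by linarith [P.e_lt_f, P.f_lt_c]) hdc.le le_rfl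
    linarith
  have h4 := arcSide_word_neg hd hl hw h3
  have := arcSide_mono_le h4.le P.f_lt_c.le (show P.d / P.c ≤ P.f by linarith [P.e_lt_f]) le_rfl
  linarith

end ThreeHoledSphere


namespace ThreeHoledSphere

variable {P : ThreeHoledSphere}

/-! ### Lassos of the geodesics of `Ω`, and their simplicity. -/

theorem deck_two_mem_cover_iff (j : ℤ) {z : ℍ} : P.deck 2 ^ j • z ∈ P.cover ↔ z ∈ P.cover :=
  smul_mem_cover_iff (zpow_mem (P.deck_mem_Γ 2) j)

/-- A geodesic `g` from `y` to `x`, which crosses `L̃₁` at the time `q`, and which has the lifts of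
the knot of the lasso at the times `s < t`. -/
structure IsLassoArc (P : ThreeHoledSphere) (x y κ : ℝ) (g : ℝ → ℍ) (q s t : ℝ) : Prop where
  param : P.IsParam x y
  arc : IsArc g y x κ
  cross : arcSide P.c P.d (g q) = 0
  cross_iff : ∀ r, 0 ≤ arcSide P.c P.d (g r) ↔ q ≤ r
  q_lt : q < s
  lt : s < t
  normSq_s : (g s).re ^ 2 + (g s).im ^ 2 = x * y * P.c
  normSq_t : (g t).re ^ 2 + (g t).im ^ 2 = x * y / P.c
  knot : g t = P.deck 2 • g s
  mid : ∀ r, x * (κ * Real.exp r) ^ 2 = y → s + t = 2 * r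

theorem IsParam.d_lt_mul {x y : ℝ} (h : P.IsParam x y) : P.d < P.c * y := by
  have h1 := d_div_c_lt_e h.d_eq
  rw [div_lt_iff₀ P.c_pos] at h1
  nlinarith [h.c_lt, P.e_lt_f, P.f_lt_c, P.c_pos]

theorem IsParam.exists_isLassoArc {x y κ : ℝ} (h : P.IsParam x y) {g : ℝ → ℍ}
    (hg : IsArc g y x κ) : ∃ q s t, P.IsLassoArc x y κ g q s t := by
  have hc1 := one_lt_c h.d_eq
  have hc := P.c_pos
  obtain ⟨q, q1, q2⟩ := hg.exists_crossing (show x < P.c by linarith [h.x_lt]) h.c_lt h.lt_d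
  obtain ⟨s, t, hst, hs, ht, hre, him, hmid⟩ := hg.exists_knots h.x_pos hc1 h.mul_lt
  refine ⟨q, s, t, h, hg, q1, q2, ?_, hst, hs, ht, ?_, hmid⟩
  -- `g s` is on the geodesic rescaled by `c`, whose end points `c x < c` and `c y > d` enclose
  -- `L̃₁`. So `g s` is strictly past `L̃₁`.
  · have h1 := arcSide_scale_self (hg.arcSide_self s) P.c
    rw [hs] at h1
    have h2 : 0 < arcSide P.c P.d (g s) := by
      by_contra! h2
      have := arcSide_mono_lt h2 P.c_lt_d.le (show P.c * x ≤ P.c by nlinarith [h.x_lt])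
        h.d_lt_mul.le (Or.inr (Or.inl h.d_lt_mul))
      linarith
    refine lt_of_le_of_ne ((q2 s).1 h2.le) ?_
    rintro rfl
    linarith
  · exact ext_re_im (by rw [hre, deck_two_smul_re h.d_eq]) (by rw [him, deck_two_smul_im h.d_eq])

namespace IsLassoArc

variable {x y κ : ℝ} {g : ℝ → ℍ} {q s t : ℝ}

theorem mem_lassoSegment_iff (h : P.IsLassoArc x y κ g q s t) {r : ℝ} :
    g r ∈ P.lassoSegment x y ↔ q ≤ r ∧ r ≤ t := by
  rw [lassoSegment, Set.mem_ofPred_eq, ← h.normSq_t, h.arc.normSq_le_iff h.param.x_pos, h.cross_iff]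
  simp [h.arc.arcSide_self r]

/-- The images are under the arc over `[d, e c]`, which is to the right of `y` and inside `[c x, c
y]`. -/
theorem deck_one_pow_mem_wedge_of_pos (h : P.IsParam x y) {z : ℍ}
    (hz : 0 < arcSide P.e P.d z) (n : ℕ) : P.deck 1 ^ (n + 1) • z ∈ P.wedge x y := by
  have h1 := arcSide_deck_one_pow_neg h.d_eq hz n
  have hc1 := one_lt_c h.d_eq
  have hc := P.c_pos
  have h2 : P.d ≤ P.e * P.c := by
    rw [← h.d_eq]; exact mul_le_mul_of_nonneg_left P.f_lt_c.le P.e_pos.le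
  have h3 := (arcSide_re h1.le h2).1
  refine ⟨arcSide_pos_of_le_re (by linarith [h.lt_d]) h.lt.le, ?_⟩
  refine arcSide_mono_lt h1.le h2 ?_ ?_ (Or.inr (Or.inr h1))
  · nlinarith [h.x_lt, P.c_lt_d]
  · nlinarith [h.c_lt, P.e_lt_f, P.f_lt_c]

/-- The wedge is an intersection of two half planes, so it is enough to treat two points of the
geodesic around the segment. For `j ≤ 0` one uses induction on `-j`: the end `t` of a translate is
the point `s` of the next one. -/
theorem deck_one_pow_mem_wedge (h : P.IsLassoArc x y κ g q s t) (n : ℕ) (j : ℤ) {r : ℝ}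
    (h1 : q ≤ r) (h2 : r ≤ t) : P.deck 1 ^ (n + 1) • P.deck 2 ^ j • g r ∈ P.wedge x y := by
  have hp := h.param
  have hd := hp.d_eq
  have hc1 := one_lt_c hd
  have hc := P.c_pos
  have hxy := hp.lt
  have hx := hp.x_pos
  have hcd := P.c_lt_d
  have hec : P.e < P.c := P.e_lt_f.trans P.f_lt_c
  have hed : P.e ≤ P.d := by linarith
  have hmul : P.c * x ≠ P.c * y := by
    intro h3
    have := mul_left_cancel₀ hc.ne' h3
    linarith
  have hgr : ∀ r, (g r).re < P.d := fun r => by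
    have := (arcSide_re (h.arc.arcSide_self r).le hxy.le).2
    linarith [hp.lt_d]
  -- For `j > 0` the translate is to the left of `d/c`, hence of `e`.
  rcases lt_or_ge 0 j with hj | hj
  · refine deck_one_pow_mem_wedge_of_pos hp (arcSide_pos_of_re_le ?_ hed) n
    rw [(deck_two_zpow_smul hd j _).1]
    have h3 : P.c ^ (-j) ≤ P.c ^ (-1 : ℤ) := zpow_le_zpow_right₀ hc1.le (by omega)
    rw [zpow_neg_one] at h3
    have h4 : 0 < (g r).re := by
      have := (arcSide_re (h.arc.arcSide_self r).le hxy.le).1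
      linarith
    have h5 : (g r).re * P.c ^ (-j) ≤ P.d * P.c⁻¹ :=
      mul_le_mul (hgr r).le h3 (zpow_pos hc _).le P.d_pos.le
    rw [← div_eq_mul_inv] at h5
    linarith [d_div_c_lt_e hd]
  · obtain ⟨m, rfl⟩ : ∃ m : ℕ, j = -m := ⟨j.natAbs, by omega⟩
    clear hj
    have hiso : ∀ m : ℕ, Isometry fun r => P.deck 1 ^ (n + 1) • P.deck 2 ^ (-(m : ℤ)) • g r :=
      fun m => isometry_smul_comp _ (isometry_smul_comp _ h.arc.isometry)
    induction m generalizing r with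
    | zero =>
      simp only [CharP.cast_eq_zero, neg_zero, zpow_zero, one_smul]
      -- The start of the segment moves along `L̃₁` away from `g q`, to the outer side of `g`; a
      -- late point of `g` has real part at most `1 < e`, so `γ₁` takes it far to the right.
      obtain ⟨e1, e2⟩ := P.re_deck_one_pow h.cross n
      have w1 : 0 < arcSide x y (P.deck 1 ^ (n + 1) • g q) := by
        have e3 := h.arc.arcSide_self q
        have e4 := h.cross
        rw [arcSide_eq] at e1 e3 e4 ⊢
        nlinarith [hp.lt_d, hp.x_lt]
      have w2 : arcSide (P.c * x) (P.c * y) (P.deck 1 ^ (n + 1) • g q) < 0 :=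
        arcSide_mono_lt e1.le hcd.le (by nlinarith [hp.x_lt]) hp.d_lt_mul.le
          (Or.inr (Or.inl hp.d_lt_mul))
      obtain ⟨T, hT⟩ := h.arc.exists_param (s := (y - 1) / (1 - x))
        (div_pos (by linarith [hp.c_lt]) (by linarith [hp.x_lt]))
      have hre : ∀ r, T ≤ r → (g r).re ≤ 1 := by
        intro r hr
        rw [← h.arc.param_le_iff, hT, div_le_iff₀ (by linarith [hp.x_lt])] at hr
        rw [h.arc.re_eq, div_le_one (by positivity)]
        linarith
      have w3 := deck_one_pow_mem_wedge_of_pos hp (arcSide_pos_of_re_le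
        (z := g (max T r)) ((hre _ (le_max_left _ _)).trans (one_lt_e hd).le) hed) n
      have hi := isometry_smul_comp (P.deck 1 ^ (n + 1)) h.arc.isometry
      exact ⟨arcSide_pos_between hi hxy.ne w1 w3.1 h1 (le_max_right _ _),
        arcSide_neg_between hi hmul w2 w3.2 h1 (le_max_right _ _)⟩
    | succ m ih =>
      have w1 : P.deck 1 ^ (n + 1) • P.deck 2 ^ (-((m + 1 : ℕ) : ℤ)) • g q ∈ P.wedge x y := by
        refine deck_one_pow_mem_wedge_of_pos hp (arcSide_pos_of_le_re ?_ hed) n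
        rw [(deck_two_zpow_smul hd _ _).1, neg_neg]
        have h3 : P.c ≤ P.c ^ ((m + 1 : ℕ) : ℤ) := by
          have := zpow_le_zpow_right₀ hc1.le (show (1 : ℤ) ≤ ((m + 1 : ℕ) : ℤ) by omega)
          rwa [zpow_one] at this
        have h4 := (arcSide_re h.cross.le hcd.le).1
        have h5 : P.d < P.c * P.c := by
          rw [← hd]; nlinarith [P.e_pos, P.f_lt_c]
        have := mul_le_mul h4.le h3 hc.le (by linarith)
        linarith
      have w2 : P.deck 1 ^ (n + 1) • P.deck 2 ^ (-((m + 1 : ℕ) : ℤ)) • g t ∈ P.wedge x y := by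
        have e : P.deck 2 ^ (-((m + 1 : ℕ) : ℤ)) • g t = P.deck 2 ^ (-(m : ℤ)) • g s := by
          rw [h.knot, ← mul_smul, ← zpow_add_one]
          congr 2
          push_cast
          ring
        rw [e]
        exact ih h.q_lt.le h.lt.le
      exact ⟨arcSide_pos_between (hiso (m + 1)) hxy.ne w1.1 w2.1 h1 h2,
        arcSide_neg_between (hiso (m + 1)) hmul w1.2 w2.2 h1 h2⟩

/-- The lasso is simple. -/
theorem eq_of_smul_eq (h : P.IsLassoArc x y κ g q s t) {r r' : ℝ} (h1 : q ≤ r) (h2 : r < r')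
    (h3 : r' ≤ t) {k : GL (Fin 2) ℝ} (hk : k ∈ P.Γ) (hkr : k • g r' = g r) : r = s ∧ r' = t := by
  have hp := h.param
  have hd := hp.d_eq
  have hc1 := one_lt_c hd
  have hc := P.c_pos
  have hx := hp.x_pos
  have hy := hp.y_pos
  have hxy : 0 < x * y := mul_pos hx hy
  have m1 : g r ∈ P.lassoSegment x y := h.mem_lassoSegment_iff.2 ⟨h1, by linarith⟩
  have m2 : g r' ∈ P.lassoSegment x y := h.mem_lassoSegment_iff.2 ⟨by linarith, h3⟩
  rcases exists_decomposition hk with ⟨i, hi⟩ | ⟨i, n, j, hn, hi⟩ |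
    ⟨a, p, w, b, ha, hb, hw, hl, hi⟩
  -- A power of `γ₂`: `g r'` is on `g` and on its image under `z ↦ cⁱ z`, so `|g r'|² = cⁱ x y`. The
  -- order of `r` and `r'` forces `i < 0`, and `r' ≤ t` forces `i = -1`.
  · rw [hi.pt] at hkr
    obtain ⟨e1, e2⟩ := deck_two_zpow_smul hd i (g r')
    have e3 := arcSide_deck_two_zpow hd i x y (g r')
    rw [hkr] at e1 e2 e3
    rw [h.arc.arcSide_self, arcSide_scale_self (h.arc.arcSide_self r')] at e3
    have hlt := (h.arc.normSq_lt_iff hx).2 h2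
    have e4 : (g r).re ^ 2 + (g r).im ^ 2 = (P.c ^ (-i)) ^ 2 * ((g r').re ^ 2 + (g r').im ^ 2) := by
      rw [e1, e2]; ring
    have hci : 0 < P.c ^ i := zpow_pos hc i
    have hci' : 0 < P.c ^ (-i) := zpow_pos hc _
    have hcc : P.c ^ (-i) * P.c ^ i = 1 := by rw [← zpow_add₀ hc.ne']; simp
    have hi0 : i < 0 := by
      by_contra! hi0
      have : P.c ^ (-i) ≤ 1 := zpow_le_one_of_nonpos₀ hc1.le (by omega)
      have : (P.c ^ (-i)) ^ 2 ≤ 1 := pow_le_one₀ hci'.le this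
      nlinarith [normSq_pos (g r')]
    have hci1 : P.c ^ i < 1 := zpow_lt_one_of_neg₀ hc1 hi0
    have e5 : (g r').re ^ 2 + (g r').im ^ 2 = P.c ^ i * (x * y) := by
      rcases mul_eq_zero.1 e3.symm with h4 | h4
      · exact absurd h4 (by positivity)
      · rcases mul_eq_zero.1 h4 with h5 | h5
        · linarith
        · linarith
    have hi1 : i = -1 := by
      by_contra hi1
      have h4 : P.c ^ i < P.c ^ (-1 : ℤ) := zpow_lt_zpow_right₀ hc1 (by omega)
      have h5 := m2.2.2
      rw [e5, zpow_neg_one, div_eq_inv_mul] at *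
      nlinarith
    subst hi1
    rw [zpow_neg_one, ← div_eq_inv_mul, ← h.normSq_t] at e5
    have f1 : r' = t := le_antisymm h3 ((h.arc.normSq_le_iff hx).1 e5.le)
    rw [neg_neg, zpow_one, e5, h.normSq_t] at e4
    have e6 : (g r).re ^ 2 + (g r).im ^ 2 = (g s).re ^ 2 + (g s).im ^ 2 := by
      rw [e4, h.normSq_s]; field_simp
    exact ⟨le_antisymm ((h.arc.normSq_le_iff hx).1 e6.ge) ((h.arc.normSq_le_iff hx).1 e6.le), f1⟩
  · exfalso
    rw [hi.pt, mul_smul, mul_smul] at hkr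
    -- For `n < 0` the inverse equation is used, with the roles of the two points exchanged.
    rcases lt_or_gt_of_ne hn with hn | hn
    · obtain ⟨m, rfl⟩ : ∃ m : ℕ, n = -((m + 1 : ℕ) : ℤ) := ⟨n.natAbs - 1, by omega⟩
      have e1 : P.deck 1 ^ (m + 1) • P.deck 2 ^ (-i) • g r = P.deck 2 ^ j • g r' := by
        rw [← hkr, zpow_neg, inv_smul_smul, zpow_neg, zpow_natCast, smul_inv_smul]
      have w := h.deck_one_pow_mem_wedge m (-i) h1 (by linarith : r ≤ t)
      rw [e1] at w
      exact hp.not_mem_wedge m2 j w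
    · obtain ⟨m, rfl⟩ : ∃ m : ℕ, n = ((m + 1 : ℕ) : ℤ) := ⟨n.natAbs - 1, by omega⟩
      have w := h.deck_one_pow_mem_wedge m j (by linarith : q ≤ r') h3
      rw [zpow_natCast, ← eq_inv_smul_iff, ← zpow_neg] at hkr
      rw [hkr] at w
      exact hp.not_mem_wedge m1 (-i) w
  · exfalso
    rw [hi.pt, mul_smul, mul_smul] at hkr
    refine not_actEq_of_gap hd (hp.arcSide_gap_pos m2) ha hb hw hl ?_
    rw [hkr]
    exact hp.arcSide_gap_pos m1

end IsLassoArc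

/-! ### The lasso is in the universal cover -/

/-- The lift over `[α, β]` and its `γ₂`-image over `[α/c, β/c]` cannot overlap: the second one lies
in `P̃`, so its right end point is on the nonnegative side of the first. -/
theorem roots_le_mul (hd : P.e * P.f = P.d) {i : ZMod 3} {l : List (ZMod 3)}
    (ha : 0 < ((P.L i).pull (P.word l)).a) {α β : ℝ} (hαβ : α < β)
    (hs : ∀ z, ((P.L i).pull (P.word l)).side z = ((P.L i).pull (P.word l)).a * arcSide α β z)
    (he : ∀ r, ((P.L i).pull (P.word l)).eval r =
      ((P.L i).pull (P.word l)).a * ((r - α) * (r - β))) (hα : 0 ≤ α) : β ≤ P.c * α := by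
  have hc := P.c_pos
  have h2 : α / P.c < β / P.c := by rwa [div_lt_div_iff_of_pos_right hc]
  have h3 := (eval_pull_nonneg h2 (P := P) (fun z hz => ?_) i l).2
  · rw [he] at h3
    have h4 := nonneg_of_mul_nonneg_right h3 ha
    have h5 : β / P.c < β := div_lt_self (by linarith) (one_lt_c hd)
    have h6 : β / P.c ≤ α := by by_contra! h6; nlinarith
    rw [div_le_iff₀ hc] at h6
    linarith
  · rw [← deck_two_mem_cover_iff (-1)]
    refine mem_cover_of_word_line (l := l) (i := i) ?_
    rw [Wall.side_smul_eq_zero_iff, hs, arcSide_deck_two_zpow hd, zpow_neg_one,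
      inv_mul_eq_div, inv_mul_eq_div, hz, mul_zero, mul_zero]

theorem mem_cover_of_arcSide_one {z : ℍ} (hd : P.e * P.f = P.d)
    (hz : arcSide 1 (P.d / P.c) z = 0) : z ∈ P.cover := by
  refine mem_cover_of_word_line (l := [1]) (i := 1) ?_
  rw [word_cons, word_nil, mul_one, P.L_one_side]
  have := arcSide_R_one hd (α := P.c) (β := P.d) (α' := P.d / P.c) (β' := 1)
    (mul_div_cancel₀ _ P.c_pos.ne') (mul_one _) z
  rw [arcSide_comm (P.d / P.c), hz, mul_zero] at this
  exact (mul_eq_zero.1 this).resolve_right (normSq_pos z).ne'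

namespace IsLassoArc

variable {x y κ : ℝ} {g : ℝ → ℍ} {q s t : ℝ}

theorem exists_tangent_time (h : P.IsLassoArc x y κ g q s t) :
    ∃ p, x * (κ * Real.exp p) ^ 2 = y ∧ s + t = 2 * p := by
  have hx := h.param.x_pos
  obtain ⟨p, hp⟩ := h.arc.exists_param (div_pos h.param.y_pos hx)
  have e : x * (κ * Real.exp p) ^ 2 = y := by rw [hp]; field_simp
  exact ⟨p, e, h.mid p e⟩

theorem normSq_tangent (h : P.IsLassoArc x y κ g q s t) {p : ℝ}
    (hp : x * (κ * Real.exp p) ^ 2 = y) : (g p).re ^ 2 + (g p).im ^ 2 = x * y := by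
  have hx := h.param.x_pos
  have e1 := h.arc.normSq_mul p
  have hy0 := h.param.y_pos
  have hpp : (κ * Real.exp p) ^ 2 = y / x := by field_simp; linarith
  rw [hpp] at e1
  have : x + y ≠ 0 := by positivity
  field_simp at e1
  nlinarith

/-- A lift that cuts off `g p` but not `g q` has `x` strictly between its end points `α < β`. As `1`
is an end point of `R₁(L̃₁)`, `β ≤ 1`, and `β ≤ c α` by `roots_le_mul`. Being under this arc gives
`x y = |g p|² < β² ≤ β ≤ c α < c x < x y`, a contradiction. -/
theorem tangent_mem_cover (h : P.IsLassoArc x y κ g q s t) {p : ℝ}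
    (hp : x * (κ * Real.exp p) ^ 2 = y) : g p ∈ P.cover := by
  have hd := h.param.d_eq
  have hx := h.param.x_pos
  have hx1 := h.param.x_lt
  have hy := h.param.c_lt
  have hc := P.c_pos
  have hqp : q < p := by
    have h1 := h.mid p hp
    have h2 := h.q_lt
    have h3 := h.lt
    linarith
  have hcq : g q ∈ P.cover := mem_cover_of_line (i := 1) (by rw [P.L_one_side]; exact h.cross)
  rw [mem_cover_iff]
  intro l i
  rw [Wall.side_smul_nonneg_iff]
  by_contra! hneg
  set w := (P.L i).pull (P.word l) with hw
  have hq0 : 0 ≤ w.side (g q) := by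
    rw [hw, ← Wall.side_smul_nonneg_iff]
    exact mem_cover_iff.1 hcq l i
  obtain ⟨ha, hc0⟩ := P.pull_coeff_nonneg i l
  rw [← hw] at ha hc0
  have h1 : 0 ≤ w.eval 1 := (eval_pull_nonneg P.one_lt_d_div_c
    (fun z hz => mem_cover_of_arcSide_one hd hz) i l).1
  have hev : w.eval x < 0 := by
    have e1 := h.arc.side_mul w q
    have e2 := h.arc.side_mul w p
    have e3 := h.arc.param_lt_iff.2 hqp
    have e4 : 0 ≤ w.side (g q) * (1 + (κ * Real.exp q) ^ 2) := mul_nonneg hq0 (by positivity)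
    have e5 : w.side (g p) * (1 + (κ * Real.exp p) ^ 2) < 0 :=
      mul_neg_of_neg_of_pos hneg (by positivity)
    rw [e1] at e4
    rw [e2] at e5
    by_contra! h6
    nlinarith
  rcases ha.eq_or_lt with ha | ha
  · rw [Wall.eval, ← ha] at hev h1
    nlinarith
  · obtain ⟨α, β, hαβ, hs, he⟩ := w.exists_roots ha
    have k1 : (x - α) * (x - β) < 0 := by
      rw [he] at hev
      by_contra! h2
      have := mul_nonneg ha.le h2
      linarith
    have hαx : α < x := by by_contra! h2; nlinarith
    have hxβ : x < β := by by_contra! h2; nlinarith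
    have k0 : 0 ≤ α * β := by
      have : w.eval 0 = w.c := by rw [Wall.eval]; ring
      rw [← this, he] at hc0
      have := nonneg_of_mul_nonneg_right hc0 ha
      linarith
    have hα : 0 ≤ α := nonneg_of_mul_nonneg_left k0 (by linarith)
    have hβ : β ≤ 1 := by
      rw [he] at h1
      have := nonneg_of_mul_nonneg_right h1 ha
      by_contra! h2
      nlinarith
    have hcβ : β ≤ P.c * α := roots_le_mul hd ha hαβ hs he hα
    have hlt : arcSide α β (g p) < 0 := by
      rw [hs] at hneg
      by_contra! h2
      have := mul_nonneg ha.le h2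
      linarith
    have hre := (arcSide_re hlt.le hαβ.le).2
    rw [arcSide_eq] at hlt
    have hS := h.normSq_tangent hp
    nlinarith

/-- By convexity the segment from `q` to the tangency point is in `P̃`, so `g s` is; hence `g t = γ₂
(g s)` is, and by convexity again everything between `q` and `t`. -/
theorem mem_cover (h : P.IsLassoArc x y κ g q s t) {r : ℝ} (h1 : q ≤ r) (h2 : r ≤ t) :
    g r ∈ P.cover := by
  have hcq : g q ∈ P.cover := mem_cover_of_line (i := 1) (by rw [P.L_one_side]; exact h.cross)
  have key : ∀ r₁ r₂, g r₁ ∈ P.cover → g r₂ ∈ P.cover → ∀ r, r₁ ≤ r → r ≤ r₂ → g r ∈ P.cover := by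
    intro r₁ r₂ m1 m2 r l1 l2
    rw [mem_cover_iff] at *
    intro l i
    have n1 := m1 l i
    have n2 := m2 l i
    rw [Wall.side_smul_nonneg_iff] at *
    exact Wall.side_nonneg_between h.arc.isometry _ n1 n2 l1 l2
  obtain ⟨p, hp, hst⟩ := h.exists_tangent_time
  have hcp := h.tangent_mem_cover hp
  have hcs := key q p hcq hcp s h.q_lt.le (by linarith [h.lt])
  have hct : g t ∈ P.cover := by
    rw [h.knot]
    exact (smul_mem_cover_iff (P.deck_mem_Γ 2)).2 hcs
  exact key q t hcq hct r h1 h2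

theorem not_mem_cover (h : P.IsLassoArc x y κ g q s t) {r : ℝ} (h1 : r < q) : g r ∉ P.cover := by
  intro h2
  have := mem_cover_iff.1 h2 [] 1
  rw [word_nil, one_smul, P.L_one_side, h.cross_iff] at this
  linarith

end IsLassoArc

end ThreeHoledSphere


namespace ThreeHoledSphere

variable {P : ThreeHoledSphere}

/-! ### Signs along words -/

theorem side_M_word_neg {i : ZMod 3} {l : List (ZMod 3)} (hl : Reduced (i :: l)) {z : ℍ}
    (hz : ∀ j ∈ i :: l, 0 < (P.M j).side z) : (P.M i).side (P.word (i :: l) • z) < 0 := by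
  induction l generalizing i with
  | nil => simpa using (P.side_M_R_neg i z).2 (hz i (by simp))
  | cons j l ih =>
    have h1 := ih hl.tail fun k hk => hz k (List.mem_cons_of_mem _ hk)
    rw [word_cons, mul_smul]
    exact (P.side_M_R_neg i _).2 (P.side_M_pos hl.ne h1.le)

theorem side_L_word_nonneg_iff {i : ZMod 3} {l : List (ZMod 3)} (hl : ∀ j ∈ l, j ≠ i) (z : ℍ) :
    0 ≤ (P.L i).side (P.word l • z) ↔ 0 ≤ (P.L i).side z := by
  induction l with
  | nil => simp
  | cons j l ih =>
    rw [word_cons, mul_smul, P.side_L_R_nonneg (hl j List.mem_cons_self),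
      ih fun k hk => hl k (List.mem_cons_of_mem _ hk)]

/-- The points close to the interval `(0, 1)`. -/
structure IsLow (P : ThreeHoledSphere) (z : ℍ) : Prop where
  pos : 0 < z.re
  le : z.re ≤ 1
  lt : z.re ^ 2 + z.im ^ 2 < P.c * P.d

theorem IsLow.side_M_pos {z : ℍ} (hd : P.e * P.f = P.d) (hz : P.IsLow z) {i : ZMod 3}
    (hi : i ≠ 1) : 0 < (P.M i).side z := by
  rcases zmod3_cases i with rfl | rfl | rfl
  · rw [P.M_zero_side]; linarith [hz.lt]
  · exact absurd rfl hi
  · exact side_M_two_pos (hz.le.trans (one_lt_e hd).le)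

/-- A low point is on the inner side of `M₀*` and `M₂*`, so ping-pong applies to words in `R₀` and
`R₂`, even though the point may be outside `P̃`. -/
theorem IsLow.side_L_word_nonneg {z : ℍ} (hd : P.e * P.f = P.d) (hz : P.IsLow z)
    {m : List (ZMod 3)} (hm : Reduced m) (hm1 : ∀ i ∈ m, i ≠ 1) {k : ZMod 3} (hk : k ≠ 1) :
    0 ≤ (P.L k).side (P.word m • z) := by
  induction m with
  | nil =>
    rw [word_nil, one_smul]
    rcases zmod3_cases k with rfl | rfl | rfl
    · rw [P.L_zero_side]
      exact (arcSide_pos_of_re_le (hz.le.trans (one_lt_e hd).le) P.e_lt_f.le).le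
    · exact absurd rfl hk
    · rw [P.L_two_side]; linarith [hz.pos]
  | cons i m ih =>
    by_cases hik : i = k
    · subst hik
      exact (P.side_L_pos_of_M
        (side_M_word_neg hm fun j hj => hz.side_M_pos hd (hm1 j hj)).le).le
    · rw [word_cons, mul_smul, P.side_L_R_nonneg hik]
      exact ih hm.tail fun j hj => hm1 j (List.mem_cons_of_mem _ hj)

theorem IsLow.side_L_one_word_nonneg {z : ℍ} (hd : P.e * P.f = P.d) (hz : P.IsLow z)
    {m : List (ZMod 3)} (hm : Reduced m) (hm1 : ∀ i ∈ m, i ≠ 1) :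
    0 ≤ (P.L 1).side (P.R 1 • P.word m • z) := by
  cases m with
  | nil =>
    rw [word_nil, one_smul, P.L_one_side]
    have e := arcSide_R_one hd (α := P.c) (β := P.d) (α' := P.d / P.c) (β' := 1)
      (mul_div_cancel₀ _ P.c_pos.ne') (mul_one _) z
    rw [arcSide_comm (P.d / P.c)] at e
    have h1 := mul_pos (mul_pos P.c_pos P.d_pos)
      (arcSide_pos_of_re_le hz.le P.one_lt_d_div_c.le)
    rw [← e] at h1
    exact (pos_of_mul_pos_left h1 (normSq_pos z).le).le
  | cons i m =>
    have h1 := side_M_word_neg hm fun j hj => hz.side_M_pos hd (hm1 j hj)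
    have h2 := P.side_M_pos (hm1 i List.mem_cons_self).symm h1.le
    exact (P.side_L_pos_of_M ((P.side_M_R_neg 1 _).2 h2).le).le

/-! ### The graph of a vector of the lasso. -/

namespace IsLassoArc

variable {x y κ : ℝ} {g : ℝ → ℍ} {q s t : ℝ}

theorem exists_isLow (h : P.IsLassoArc x y κ g q s t) : ∃ T, ∀ r, T ≤ r → P.IsLow (g r) := by
  have hp := h.param
  have hx := hp.x_pos
  have hx1 := hp.x_lt
  have hc1 := one_lt_c hp.d_eq
  -- The squared parameter at which the real part is `1`; it is positive because `x < 1 < y`.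
  obtain ⟨T, hT⟩ := h.arc.exists_param (s := (y - 1) / (1 - x))
    (div_pos (by linarith [hp.c_lt]) (by linarith))
  refine ⟨T, fun r hr => ?_⟩
  have h1 : (g r).re ≤ 1 := by
    rw [← h.arc.param_le_iff, hT, div_le_iff₀ (by linarith)] at hr
    rw [h.arc.re_eq, div_le_one (by positivity)]
    linarith
  have h2 := (arcSide_re (h.arc.arcSide_self r).le hp.lt.le).1
  refine ⟨by linarith, h1, ?_⟩
  have h3 := h.arc.arcSide_self r
  rw [arcSide_eq] at h3
  nlinarith [hp.lt_d, hp.y_pos, P.c_lt_d, hp.c_lt]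

theorem comp_add (h : P.IsLassoArc x y κ g q s t) (r : ℝ) :
    P.IsLassoArc x y (κ * Real.exp r) (fun u => g (u + r)) (q - r) (s - r) (t - r) where
  param := h.param
  arc := h.arc.comp_add r
  cross := by simpa using h.cross
  cross_iff u := by rw [h.cross_iff]; constructor <;> intro <;> linarith
  q_lt := by linarith [h.q_lt]
  lt := by linarith [h.lt]
  normSq_s := by simpa using h.normSq_s
  normSq_t := by simpa using h.normSq_t
  knot := by simpa using h.knot
  mid u hu := by
    have := h.mid (u + r) (by rw [Real.exp_add, ← hu]; ring)
    linarith

theorem proj_eq (h : P.IsLassoArc x y κ g q s t) {r r' : ℝ} (h1 : q ≤ r) (h2 : r < r')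
    (h3 : r' ≤ t) (h4 : P.proj (g r) = P.proj (g r')) : r = s ∧ r' = t := by
  obtain ⟨k, hk, h5⟩ := proj_eq_iff.1 h4
  exact h.eq_of_smul_eq h1 h2 h3 hk h5

theorem proj_knot (h : P.IsLassoArc x y κ g q s t) : P.proj (g t) = P.proj (g s) := by
  rw [h.knot, proj_smul (P.deck_mem_Γ 2)]

theorem injOn (h : P.IsLassoArc x y κ g q s t) : InjOn (fun r => P.proj (g r)) (Ico q t) := by
  intro r hr r' hr' e
  rcases lt_trichotomy r r' with h1 | h1 | h1
  · have := h.proj_eq hr.1 h1 hr'.2.le e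
    exact absurd this.2 hr'.2.ne
  · exact h1
  · have := h.proj_eq hr'.1 h1 hr.2.le e.symm
    exact absurd this.2 hr.2.ne

theorem base_mem (h : P.IsLassoArc x y κ g q s t) : P.proj (g q) ∈ P.boundaryComponent 1 :=
  mem_boundaryComponent_iff.2 ⟨[], by rw [word_nil, one_smul, P.L_one_side]; exact h.cross⟩

theorem base_mem_boundary (h : P.IsLassoArc x y κ g q s t) : P.proj (g q) ∈ P.boundary :=
  mem_iUnion.2 ⟨1, h.base_mem⟩

theorem not_exitsAt (h : P.IsLassoArc x y κ g q s t) {r : ℝ} (h1 : q ≤ r) (h2 : r < t) :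
    ¬ P.ExitsAt (fun u => P.proj (g u)) r := by
  rintro ⟨-, h3⟩
  obtain ⟨u, hu, hu'⟩ := h3 (t - r) (by linarith)
  exact hu' (mem_carrier_iff.2 (h.mem_cover (by linarith [hu.1]) (by linarith [hu.2])))

theorem not_exitsAt_neg (h : P.IsLassoArc x y κ g q s t) {r : ℝ} (h1 : -r ≤ t) (h2 : q < -r) :
    ¬ P.ExitsAt (fun u => P.proj (g (-u))) r := by
  rintro ⟨-, h3⟩
  obtain ⟨u, hu, hu'⟩ := h3 (-q - r) (by linarith)
  exact hu' (mem_carrier_iff.2 (h.mem_cover (by linarith [hu.2]) (by linarith [hu.1])))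

theorem exitsAt_neg (h : P.IsLassoArc x y κ g q s t) :
    P.ExitsAt (fun u => P.proj (g (-u))) (-q) := by
  refine ⟨by simpa using h.base_mem_boundary, fun ε hε => ⟨-q + ε / 2, ⟨by linarith, by linarith⟩,
    ?_⟩⟩
  rw [mem_carrier_iff]
  exact h.not_mem_cover (by linarith)

/-- Either the forward ray stops first, at the time `t`, on the point `g s`, which has been drawn
because `-t ≤ s`; or the backward ray reaches `L₁` first, at the time `-q`, and the forward ray goes
on to the knot. -/
theorem isGraph (h : P.IsLassoArc x y κ g q s t) (h0 : q ≤ 0) (h1 : 0 ≤ s + t) :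
    P.IsGraph (fun u => P.proj (g u)) t (-q) := by
  have hst := h.lt
  have hqs := h.q_lt
  rcases le_or_gt t (-q) with hb | hb
  · left
    refine ⟨by linarith, hb, fun r r0 rt => ?_, fun r r0 rt => ⟨?_, ?_⟩, Or.inr ?_,
      fun r r0 rt => ?_, fun r r0 rt => ?_, Or.inl h.exitsAt_neg⟩
    · exact h.injOn.mono (show Icc (-r) r ⊆ Ico q t from
        fun u hu => ⟨by linarith [hu.1], by linarith [hu.2]⟩)
    · exact h.not_exitsAt (by linarith) (by linarith)
    · exact h.not_exitsAt_neg (by linarith) (by linarith)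
    · exact ⟨s, ⟨by linarith, hst⟩, h.proj_knot.symm⟩
    · exact h.not_exitsAt_neg (by linarith) (by linarith)
    · rintro ⟨u, ⟨u1, u2, u3⟩, hu⟩
      have := h.proj_eq (r := -r) (r' := u) (by linarith) u1 u2 hu.symm
      linarith [this.1, this.2]
  · right
    refine ⟨by linarith, hb.le, fun r r0 rt => ?_, fun r r0 rt => ⟨?_, ?_⟩, Or.inl h.exitsAt_neg,
      fun r r0 rt => ?_, fun r r0 rt => ?_, Or.inr ?_⟩
    · intro u hu u' hu' e
      have := h.injOn (show -u ∈ Ico q t from ⟨by linarith [hu.2], by linarith [hu.1]⟩)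
        (show -u' ∈ Ico q t from ⟨by linarith [hu'.2], by linarith [hu'.1]⟩) e
      linarith
    · exact h.not_exitsAt_neg (by linarith) (by linarith)
    · simp only [neg_neg]
      exact h.not_exitsAt (by linarith) (by linarith)
    · simp only [neg_neg]
      exact h.not_exitsAt (by linarith) (by linarith)
    · rintro ⟨u, ⟨u1, u2, u3⟩, hu⟩
      simp only [neg_neg] at hu
      have := h.proj_eq (r := -u) (r' := r) (by linarith) (by linarith) rt.le hu
      linarith [this.1, this.2]
    · refine ⟨-s, ⟨by linarith, by linarith, by linarith⟩, ?_⟩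
      simp only [neg_neg]
      exact h.proj_knot.symm

theorem isPositiveLasso (h : P.IsLassoArc x y κ g q s t) :
    P.IsPositiveLasso (fun u => P.proj (g u)) q s t where
  mem _ hu := mem_carrier_iff.2 (h.mem_cover hu.1 hu.2)
  base := h.base_mem_boundary
  injOn := h.injOn.mono Ioo_subset_Ico_self
  le := h.q_lt.le
  lt := h.lt
  knot := h.proj_knot.symm

end IsLassoArc

/-! ### The homotopy of the loop to the boundary -/

/-- A dilation acts linearly on the coordinates `(Re z, |z|²)`, so the straight homotopy is
equivariant and descends to closed loops. -/
theorem mix_deck_two (hd : P.e * P.f = P.d) (r : unitInterval) (z w : ℍ) :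
    mix r (P.deck 2 • z) (P.deck 2 • w) = P.deck 2 • mix r z w := by
  have hc := P.c_pos.ne'
  refine ext_re_normSq ?_ ?_
  · rw [mix_re, deck_two_smul_re hd, deck_two_smul_re hd, deck_two_smul_re hd, mix_re]
    field_simp
  · have e : ∀ z : ℍ, (P.deck 2 • z).re ^ 2 + (P.deck 2 • z).im ^ 2 =
        (z.re ^ 2 + z.im ^ 2) / P.c ^ 2 := fun z => by
      rw [deck_two_smul_re hd, deck_two_smul_im hd]; field_simp
    rw [mix_normSq, e, e, e, mix_normSq]
    field_simp

theorem isBoundaryLoop_two (hd : P.e * P.f = P.d) :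
    P.IsBoundaryLoop 2 fun t => expI (0 - t) := by
  refine ⟨isometry_comp_sub isometry_expI 0, fun t => ?_, fun t => ?_⟩
  · change (P.L 2).side _ = 0
    rw [P.L_two_side, expI_re, mul_zero]
  · refine ext_re_im ?_ ?_
    · rw [deck_two_smul_re hd]; simp
    · rw [deck_two_smul_im hd, expI_im, expI_im, l_two hd,
        show 0 - (t + Real.log P.c) = (0 - t) - Real.log P.c by ring, Real.exp_sub,
        Real.exp_log P.c_pos]

theorem loopHomotopic_of_deck_two (hd : P.e * P.f = P.d) {g h : ℝ → ℍ} (hg : Continuous g)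
    (hh : Continuous h) {a b a' b' : ℝ} (hab : ∀ u ∈ Icc a b, g u ∈ P.cover) (hle : a ≤ b)
    (hh' : ∀ u, h u ∈ P.cover) (h1 : g b = P.deck 2 • g a) (h2 : h b' = P.deck 2 • h a') :
    P.LoopHomotopic (fun t => P.proj (g t)) a b (fun t => P.proj (h t)) a' b' := by
  refine ⟨fun p => P.proj (mix p.2 (g (a + p.1 * (b - a))) (h (a' + p.1 * (b' - a')))),
    ?_, fun p => ?_, fun r => ?_, fun u => ?_, fun u => ?_⟩
  · have hc : Continuous fun p : unitInterval × unitInterval =>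
        (p.2, g (a + p.1 * (b - a)), h (a' + p.1 * (b' - a'))) := by fun_prop
    exact continuous_proj.comp (continuous_mix.comp hc)
  · refine mem_carrier_iff.2 (mix_mem_cover (hab _ ?_) (hh' _) _)
    have h3 := p.1.2.1
    have h4 := p.1.2.2
    constructor <;> nlinarith
  · simp only [Set.Icc.coe_zero, Set.Icc.coe_one, zero_mul, add_zero, one_mul, add_sub_cancel]
    rw [h1, h2, mix_deck_two hd, proj_smul (P.deck_mem_Γ 2)]
  · simp only [mix_zero]
  · simp only [mix_one]

/-! ### Geodesic paths between boundary components -/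

theorem side_eq_zero_of_common {z : ℍ} {i j : ZMod 3} {l : List (ZMod 3)}
    (h1 : (P.L j).side z = 0) (h2 : (P.L i).side (P.word l • z) = 0) :
    i = j ∧ ∀ w, (P.L i).side (P.word l • w) = 0 ↔ (P.L j).side w = 0 := by
  obtain rfl := eq_of_lines h1 h2
  obtain ⟨l', -, h4, h5, -⟩ := exists_stabilizer_word h1 h2
  exact ⟨rfl, fun w => by rw [h5.pt, side_L_word_eq_zero h4]⟩

/-- A word that takes a point of `L̃ⱼ` back to `L̃ⱼ` acts through reflections that preserve both
sides of `L̃ⱼ`. -/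
theorem nonneg_of_common {z : ℍ} {j : ZMod 3} {l : List (ZMod 3)}
    (h1 : (P.L j).side z = 0) (h2 : (P.L j).side (P.word l • z) = 0) (w : ℍ) :
    0 ≤ (P.L j).side (P.word l • w) ↔ 0 ≤ (P.L j).side w := by
  obtain ⟨l', -, h4, h5, -⟩ := exists_stabilizer_word h1 h2
  rw [h5.pt, side_L_word_nonneg_iff h4]

theorem side_L_one_R_one_pos {z : ℍ} (hz : (P.L 1).side z = 0) :
    0 < (P.L 1).side (P.R 1 • z) := by
  refine P.side_L_pos_of_M ((P.side_M_R_neg 1 z).2 ?_).le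
  by_contra! h
  have := P.side_L_pos_of_M h
  linarith

/-- A point on a lift of a boundary component that can be reached from `L̃₁` by one of the paths
`Mₙ` and `Bₙ`. -/
def IsNearPoint (P : ThreeHoledSphere) (w : ℍ) : Prop :=
  ∃ (m : List (ZMod 3)) (z : ℍ), (∀ i ∈ m, i ≠ 1) ∧
    ((∃ k, k ≠ 1 ∧ (P.L k).side z = 0 ∧ w = P.word m • z) ∨
      ((P.L 1).side z = 0 ∧ w = P.word m • P.R 1 • z))

theorem IsNearPoint.side_ne_zero {w : ℍ} (hw : P.IsNearPoint w) : (P.L 1).side w ≠ 0 := by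
  obtain ⟨m, z, hm, ⟨k, hk, hz, rfl⟩ | ⟨hz, rfl⟩⟩ := hw
  · intro h
    rw [side_L_word_eq_zero hm] at h
    have := P.side_L_pos hk.symm hz.le
    linarith
  · rw [Ne, side_L_word_eq_zero hm]
    exact (side_L_one_R_one_pos hz).ne'

/-- Up to the stabilizer of its line, a word taking `w` to `L̃ᵢ` undoes the word in `R₀, R₂` that
defines `w` (and `R₁` in the second case). The claim becomes one of the two ping-pong estimates for
low points. -/
theorem IsNearPoint.side_nonneg (hd : P.e * P.f = P.d) {w : ℍ} (hw : P.IsNearPoint w)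
    {i : ZMod 3} {l : List (ZMod 3)} (hi : (P.L i).side (P.word l • w) = 0) {u : ℍ}
    (hu : P.IsLow u) : 0 ≤ (P.L i).side (P.word l • u) := by
  obtain ⟨m, z, hm, hw⟩ := hw
  obtain ⟨m', m1, m2, -, m4⟩ := P.exists_reduced m.reverse
  have m5 : ∀ i ∈ m', i ≠ 1 := fun i hi => hm i (List.mem_reverse.1 (m4 i hi))
  have e0 : P.word m • P.word m' • u = u := by
    rw [← m2.pt]
    have := P.word_reverse_smul_word_smul m.reverse u
    rwa [List.reverse_reverse] at this
  rcases hw with ⟨k, hk, hz, rfl⟩ | ⟨hz, rfl⟩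
  · rw [← mul_smul, ← word_append] at hi
    obtain rfl := eq_of_lines hz hi
    have h1 := (nonneg_of_common hz hi (P.word m' • u)).2 (hu.side_L_word_nonneg hd m1 m5 hk)
    rw [word_append, mul_smul, e0] at h1
    exact h1
  · have e1 : P.word l • P.word m • P.R 1 • z = P.word (l ++ (m ++ [1])) • z := by
      simp [mul_smul]
    rw [e1] at hi
    obtain rfl := eq_of_lines hz hi
    have h1 := (nonneg_of_common hz hi (P.R 1 • P.word m' • u)).2
      (hu.side_L_one_word_nonneg hd m1 m5)
    have e2 : P.word (l ++ (m ++ [1])) • P.R 1 • P.word m' • u =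
        P.word l • P.word m • P.word m' • u := by
      simp [mul_smul, R_smul_R_smul_pt]
    rw [e2, e0] at h1
    exact h1

namespace IsLassoArc

variable {x y κ : ℝ} {g : ℝ → ℍ} {q s t : ℝ}

theorem side_ne_zero (h : P.IsLassoArc x y κ g q s t) {i : ZMod 3} {l : List (ZMod 3)} :
    ¬ ∀ r, (P.L i).side (P.word l • g r) = 0 := by
  intro h0
  have hq : (P.L 1).side (g q) = 0 := by rw [P.L_one_side]; exact h.cross
  have h1 := (side_eq_zero_of_common hq (h0 q)).2 (g (q - 1))
  have h2 := h1.1 (h0 _)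
  rw [P.L_one_side] at h2
  have := (h.cross_iff (q - 1)).1 h2.ge
  linarith

/-- A geodesic path that contains a vector of the lasso is not homotopic to a path from `L̃₁` to a
near point. -/
theorem not_pathHomotopic (h : P.IsLassoArc x y κ g q s t) (h0 : q ≤ 0) (h00 : 0 ≤ s + t)
    {v : UnitTangent} (hv : HasVelocity g 0 v) {α : ℝ → ℍ} (hα : Continuous α) {r : ℝ}
    (hnear : ∀ k ∈ P.Γ, (P.L 1).side (k • α 0) = 0 → P.IsNearPoint (k • α r)) :
    P.projTangent v ∉ P.bridgemanSet (fun u => P.proj (α u)) r := by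
  rintro ⟨g₁, b, hg₁, hb, hcov, hb0, hb1, hH, t₁, ht₁, v₁, hv₁, hvv⟩
  obtain ⟨k, hk, hkv⟩ := projTangent_eq_iff.1 hvv
  have hd := h.param.d_eq
  have hg := h.arc.isometry
  have e1 : (fun u => g₁ (u + t₁)) = fun u => k • g u := by
    refine isometry_eq_of_hasVelocity (isometry_comp_add hg₁ t₁) (isometry_smul_comp k hg)
      (t := 0) (v := v₁) (HasVelocity.comp_add (by simpa using hv₁)) ?_
    rw [← hkv]
    exact hasVelocity_smul k g 0 v hv
  have e2 : ∀ u, g₁ u = k • g (u - t₁) := fun u => by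
    have := congrFun e1 (u - t₁)
    simpa using this
  have hq0 : (P.L 1).side (g q) = 0 := by rw [P.L_one_side]; exact h.cross
  have hqc : g q ∈ P.cover := mem_cover_of_line hq0
  have hside : ∀ {u i l}, g u ∈ P.cover → 0 ≤ ((P.L i).pull (P.word l)).side (g u) := by
    intro u i l hu
    rw [← Wall.side_smul_nonneg_iff]
    exact mem_cover_iff.1 hu l i
  have ht0 : 0 < t := by linarith [h.lt]
  -- the first end point
  have c0 : g (-t₁) ∈ P.cover := by
    have := mem_cover_of_boundary hb0
    rw [e2, smul_mem_cover_iff hk, zero_sub] at this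
    exact this
  -- Before `q` the geodesic is outside `P̃`. If it met a lift of the boundary strictly between `q`
  -- and `t`, it would be beyond this lift at the time `t`, or contained in it.
  have hqt : -t₁ = q := by
    have h1 : q ≤ -t₁ := by
      by_contra! h1
      exact h.not_mem_cover h1 c0
    rcases h1.eq_or_lt with h1 | h1
    · exact h1.symm
    · exfalso
      rw [e2, proj_smul hk, zero_sub] at hb0
      obtain ⟨i, l, hil⟩ := mem_boundary_iff.1 hb0
      rw [Wall.side_smul_eq_zero_iff] at hil
      rcases Wall.side_neg_or_zero hg _ hil (hside hqc) h1
        (show -t₁ < t by linarith [ht₁.1]) with h2 | h2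
      · have := hside (i := i) (l := l) (h.mem_cover (by linarith [h.q_lt, h.lt]) le_rfl)
        linarith
      · refine h.side_ne_zero (i := i) (l := l) fun u => ?_
        rw [Wall.side_smul_eq_zero_iff]
        exact h2 u
  obtain ⟨κ₁, hκ₁, l0, l1⟩ := PathHomotopic.exists_common_lines hg₁.continuous hα hH
  obtain ⟨lk, -, -, hlk⟩ := exists_word_of_mem_Γ (inv_mem hk)
  have n0 : (P.L 1).side ((k⁻¹ * κ₁) • α 0) = 0 := by
    have := l0 1 lk (by rw [← hlk.pt, e2, inv_smul_smul, zero_sub, hqt]; exact hq0)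
    rwa [← hlk.pt, ← mul_smul] at this
  have hnr := hnear _ (mul_mem (inv_mem hk) hκ₁) n0
  -- the second end point
  have hT : q ≤ b - t₁ := by linarith [ht₁.2]
  have l1' : ∀ i l, (P.L i).side (P.word l • g (b - t₁)) = 0 →
      (P.L i).side (P.word l • (k⁻¹ * κ₁) • α r) = 0 := by
    intro i l hil
    have := l1 i (l ++ lk) (by
      rw [word_append, mul_smul, ← hlk.pt, e2, inv_smul_smul]; exact hil)
    rwa [word_append, mul_smul, ← hlk.pt, ← mul_smul k⁻¹] at this
  rcases hT.eq_or_lt with hT | hT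
  · have := l1' 1 [] (by rw [← hT]; simpa using hq0)
    rw [word_nil, one_smul] at this
    exact hnr.side_ne_zero this
  · rw [e2, proj_smul hk] at hb1
    obtain ⟨i, l, hil⟩ := mem_boundary_iff.1 hb1
    have h2 := l1' i l hil
    obtain ⟨T, hlow⟩ := h.exists_isLow
    have h3 := hnr.side_nonneg hd h2 (hlow (max T (b - t₁ + 1)) (le_max_left _ _))
    rw [Wall.side_smul_eq_zero_iff] at hil
    -- The lift reached at the end contains a near point, so late, low points of `g` are on its
    -- inner side; but `g` has already crossed it.
    rcases Wall.side_neg_or_zero hg _ hil (hside hqc) hT (show b - t₁ < max T (b - t₁ + 1) from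
      lt_of_lt_of_le (by linarith) (le_max_right _ _)) with h4 | h4
    · rw [Wall.side_smul_nonneg_iff] at h3
      linarith
    · refine h.side_ne_zero (i := i) (l := l) fun u => ?_
      rw [Wall.side_smul_eq_zero_iff]
      exact h4 u

/-- A translate of a path from `L̃ᵢ` to `L̃ⱼ` that starts on `L̃₁` has `i = 1`, and it is obtained
by a word in `R₀` and `R₂`; hence it ends at a near point. -/
theorem not_mem_HM (h : P.IsLassoArc x y κ g q s t) (h0 : q ≤ 0) (h00 : 0 ≤ s + t)
    {v : UnitTangent} (hv : HasVelocity g 0 v) (n : ZMod 3) : P.projTangent v ∉ P.HM n := by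
  have key : ∀ (α : ℝ → ℍ) (r : ℝ) (i j : ZMod 3), Continuous α → i ≠ j →
      (P.L i).side (α 0) = 0 → (P.L j).side (α r) = 0 →
      P.projTangent v ∉ P.bridgemanSet (fun u => P.proj (α u)) r := by
    intro α r i j hα hij hi hj
    refine h.not_pathHomotopic h0 h00 hv hα fun k hk hk1 => ?_
    obtain ⟨l, -, -, hl⟩ := exists_word_of_mem_Γ hk
    rw [hl.pt] at hk1 ⊢
    obtain rfl := eq_of_lines hi hk1
    obtain ⟨m, -, m2, m3, -⟩ := exists_stabilizer_word hi hk1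
    exact ⟨m, α r, m2, Or.inl ⟨j, hij.symm, hj, by rw [m3.pt]⟩⟩
  have hne : n + 1 ≠ n + 2 := by revert n; decide
  rintro ⟨α, hα, a0, a1, h1 | h1⟩
  · exact key α _ _ _ hα.continuous hne a0 a1 h1
  · refine key (fun u => α (_ - u)) _ _ _ (isometry_comp_sub hα _).continuous hne.symm ?_ ?_ h1
    · rw [sub_zero]; exact a1
    · rw [sub_self]; exact a0

/-- A translate starting on `L̃₁` forces `n = 1`. For the reversed path, the reflection `Rₙ` is
absorbed into the word, so that its other end again has the form of a near point. -/
theorem not_mem_HB (h : P.IsLassoArc x y κ g q s t) (h0 : q ≤ 0) (h00 : 0 ≤ s + t)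
    {v : UnitTangent} (hv : HasVelocity g 0 v) (n : ZMod 3) : P.projTangent v ∉ P.HB n := by
  rintro ⟨α, hα, a0, ⟨z, hz, a1⟩, h1 | h1⟩
  · refine h.not_pathHomotopic h0 h00 hv hα.continuous (fun k hk hk1 => ?_) h1
    obtain ⟨l, -, -, hl⟩ := exists_word_of_mem_Γ hk
    rw [hl.pt] at hk1 ⊢
    obtain rfl := eq_of_lines a0 hk1
    obtain ⟨m, -, m2, m3, -⟩ := exists_stabilizer_word a0 hk1
    exact ⟨m, z, m2, Or.inr ⟨hz, by rw [m3.pt, ← a1]⟩⟩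
  · refine h.not_pathHomotopic h0 h00 hv (isometry_comp_sub hα _).continuous
      (fun k hk hk1 => ?_) h1
    obtain ⟨l, -, -, hl⟩ := exists_word_of_mem_Γ hk
    rw [sub_zero, ← a1, hl.pt] at hk1
    have e : P.word l • P.R n • z = P.word (l ++ [n]) • z := by simp [mul_smul]
    simp only [e] at hk1
    obtain rfl := eq_of_lines hz hk1
    obtain ⟨m, -, m2, m3, -⟩ := exists_stabilizer_word hz hk1
    refine ⟨m, α 0, m2, Or.inr ⟨a0, ?_⟩⟩
    rw [sub_self, ← m3.pt, word_append, mul_smul, hl.pt]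
    simp [R_smul_R_smul_pt]

theorem projTangent_mem_W (h : P.IsLassoArc x y κ g q s t) (h0 : q ≤ 0) (h00 : 0 ≤ s + t)
    {v : UnitTangent} (hv : HasVelocity g 0 v) : P.projTangent v ∈ P.W 2 3 := by
  have hd := h.param.d_eq
  have hst := h.lt
  refine ⟨⟨v, g, ?_, rfl, h.arc.isometry, hv, t, -q, s, h.isGraph h0 h00, ?_, ?_,
    _, isBoundaryLoop_two hd, ?_⟩, fun n => ⟨h.not_mem_HM h0 h00 hv n, h.not_mem_HB h0 h00 hv n⟩⟩
  · rw [← hv.1]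
    exact h.mem_cover h0 (by linarith)
  · rw [neg_neg]; exact h.isPositiveLasso
  · rw [neg_neg]; exact h.base_mem
  · refine loopHomotopic_of_deck_two hd h.arc.isometry.continuous
      (isometry_comp_sub isometry_expI 0).continuous
      (fun u hu => h.mem_cover (by linarith [hu.1, h.q_lt]) hu.2) hst.le
      (fun u => mem_cover_of_line (i := 2) ((isBoundaryLoop_two hd).2.1 u)) h.knot ?_
    have := (isBoundaryLoop_two hd).2.2 0
    rw [zero_add] at this
    exact this

end IsLassoArc

/-! ### The set `Ω` -/

/-- Time is shifted so that the vector sits at `0`; lying before the tangency point `(s + t) / 2`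
becomes `0 ≤ s + t`. -/
theorem mem_omega_iff (hd : P.e * P.f = P.d) {v : UnitTangent} : v ∈ Omega (P.l 2) (P.m 3) ↔
    ∃ x y κ g q s t, P.IsLassoArc x y κ g q s t ∧ q ≤ 0 ∧ 0 ≤ s + t ∧ HasVelocity g 0 v := by
  rw [omega_eq hd]
  constructor
  · rintro ⟨x, y, κ, hx, hx1, hy, hy1, g, hκ, r, tq, tp, hq, hp, h1, h2, hv⟩
    obtain ⟨q, s, t, h⟩ := IsParam.exists_isLassoArc ⟨hd, hx, hx1, hy, hy1⟩ hκ
    refine ⟨x, y, _, _, _, _, _, h.comp_add r, ?_, ?_,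
      HasVelocity.comp_add (by simpa using hv)⟩
    · linarith [(h.cross_iff tq).1 hq.ge]
    · linarith [h.mid tp hp]
  · rintro ⟨x, y, κ, g, q, s, t, h, h1, h2, hv⟩
    obtain ⟨p, hp, hst⟩ := h.exists_tangent_time
    exact ⟨x, y, κ, h.param.x_pos, h.param.x_lt, h.param.c_lt, h.param.lt_d, g, h.arc, 0, q, p,
      h.cross, hp, h1, by linarith, hv⟩

theorem omega_mem_cover (hd : P.e * P.f = P.d) {v : UnitTangent}
    (hv : v ∈ Omega (P.l 2) (P.m 3)) : v.pt ∈ P.cover := by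
  obtain ⟨x, y, κ, g, q, s, t, h, h1, h2, hv⟩ := (mem_omega_iff hd).1 hv
  rw [← hv.1]
  exact h.mem_cover h1 (by linarith [h.lt])

theorem mapsTo_omega (hd : P.e * P.f = P.d) :
    MapsTo P.projTangent (Omega (P.l 2) (P.m 3)) (P.W 2 3) := by
  intro v hv
  obtain ⟨x, y, κ, g, q, s, t, h, h1, h2, hv⟩ := (mem_omega_iff hd).1 hv
  exact h.projTangent_mem_W h1 h2 hv

theorem injOn_omega (hd : P.e * P.f = P.d) :
    InjOn P.projTangent (Omega (P.l 2) (P.m 3)) := by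
  intro v hv v' hv' e
  obtain ⟨x, y, κ, g, q, s, t, h, h1, h2, hgv⟩ := (mem_omega_iff hd).1 hv
  obtain ⟨x', y', κ', g', q', s', t', h', h1', h2', hgv'⟩ := (mem_omega_iff hd).1 hv'
  obtain ⟨k, hk, hkv⟩ := projTangent_eq_iff.1 e
  have e1 : (fun u => k • g' u) = g := by
    refine isometry_eq_of_hasVelocity (isometry_smul_comp k h'.arc.isometry) h.arc.isometry
      (t := 0) (v := v) ?_ hgv
    rw [← hkv]
    exact hasVelocity_smul k g' 0 v' hgv'
  have e2 : ∀ u, k • g' u = g u := fun u => congrFun e1 u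
  -- `q` is the time at which the geodesic enters `P̃`, which deck transformations respect.
  have hqq : q' = q := by
    have c1 := h.mem_cover le_rfl (by linarith [h.q_lt, h.lt] : q ≤ t)
    have c2 := h'.mem_cover le_rfl (by linarith [h'.q_lt, h'.lt] : q' ≤ t')
    rw [← e2, smul_mem_cover_iff hk] at c1
    rw [← smul_mem_cover_iff hk, e2] at c2
    refine le_antisymm ?_ ?_ <;> by_contra! h3
    · exact h'.not_mem_cover h3 c1
    · exact h.not_mem_cover h3 c2
  obtain ⟨l, -, -, hl⟩ := exists_word_of_mem_Γ hk
  have a1 : (P.L 1).side (g' q) = 0 := by rw [P.L_one_side, ← hqq]; exact h'.cross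
  have a2 : (P.L 1).side (P.word l • g' q) = 0 := by
    rw [← hl.pt, e2, P.L_one_side]; exact h.cross
  obtain ⟨m, m1, m2, m3, -⟩ := exists_stabilizer_word a1 a2
  cases m with
  | nil =>
    rw [← hkv, hl, m3, word_nil, one_smul]
  | cons i m =>
    exfalso
    obtain ⟨T, hT⟩ := h.exists_isLow
    obtain ⟨T', hT'⟩ := h'.exists_isLow
    have b1 := hT (max T T') (le_max_left _ _)
    have b2 := hT' (max T T') (le_max_right _ _)
    -- A nonempty word in `R₀, R₂` throws low points beyond its first wall, but `k` takes a low
    -- point of `g'` to a low point of `g`.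
    have b3 := side_M_word_neg m1 fun j hj => b2.side_M_pos hd (m2 j hj)
    rw [← m3.pt, ← hl.pt, e2] at b3
    have := b1.side_M_pos hd (m2 i List.mem_cons_self)
    linarith

end ThreeHoledSphere


namespace ThreeHoledSphere

variable {P : ThreeHoledSphere}

/-! ### Simple lassos around `L₂` based on `L₁` -/

/-- A geodesic `g` from `y` to `x` such that `Π ∘ g` on `[q, t]` is a lasso in `P` with base point
on `L₁` and a loop on `[s, t]` that corresponds to the deck transformation `γ₂`. -/
structure IsSimpleLasso (P : ThreeHoledSphere) (x y κ : ℝ) (g : ℝ → ℍ) (q s t : ℝ) : Prop where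
  d_eq : P.e * P.f = P.d
  x_pos : 0 < x
  arc : IsArc g y x κ
  q_le : q ≤ s
  lt : s < t
  knot : g t = P.deck 2 • g s
  mem : ∀ r ∈ Icc q t, g r ∈ P.cover
  base : ∃ l, (P.L 1).side (P.word l • g q) = 0
  injOn : InjOn (fun r => P.proj (g r)) (Ioo q t)

namespace IsSimpleLasso

variable {x y κ : ℝ} {g : ℝ → ℍ} {q s t : ℝ}

theorem y_pos (h : P.IsSimpleLasso x y κ g q s t) : 0 < y := h.x_pos.trans h.arc.lt

/-- Both `g s` and `g s / c` are on the circle over `[x, y]`; subtracting the two equations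
determines `|g s|²`. -/
theorem normSq_s (h : P.IsSimpleLasso x y κ g q s t) :
    (g s).re ^ 2 + (g s).im ^ 2 = x * y * P.c := by
  have hc1 := one_lt_c h.d_eq
  have hc := P.c_pos
  have e1 := h.arc.eq_of_normSq (t := s)
  have e2 := h.arc.eq_of_normSq (t := t)
  rw [h.knot, deck_two_smul_re h.d_eq, deck_two_smul_im h.d_eq] at e2
  field_simp at e2
  have e3 : (P.c - 1) * ((g s).re ^ 2 + (g s).im ^ 2 - x * y * P.c) = 0 := by
    linear_combination e2 - P.c * e1
  have := (mul_eq_zero.1 e3).resolve_left (by linarith)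
  linarith

theorem normSq_t (h : P.IsSimpleLasso x y κ g q s t) :
    (g t).re ^ 2 + (g t).im ^ 2 = x * y / P.c := by
  have hc := P.c_pos
  have e1 := h.normSq_s
  rw [h.knot, deck_two_smul_re h.d_eq, deck_two_smul_im h.d_eq, div_pow, div_pow, ← add_div, e1]
  field_simp

/-- The real part of `g s` is known from the circle equation. Its square being less than `|g s|²`
amounts to `0 < (y - c x) (c y - x)`. -/
theorem mul_lt (h : P.IsSimpleLasso x y κ g q s t) : P.c * x < y := by
  have hc1 := one_lt_c h.d_eq
  have hc := P.c_pos
  have hx := h.x_pos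
  have hy := h.y_pos
  have e1 := h.arc.eq_of_normSq (t := s)
  have e2 := h.normSq_s
  have e3 : (g s).re ^ 2 < x * y * P.c := by
    have := sq_pos_of_pos (g s).im_pos
    linarith
  rw [e2] at e1
  have e4 : ((x + y) * (g s).re) ^ 2 < (x + y) ^ 2 * (x * y * P.c) := by
    rw [mul_pow]
    exact mul_lt_mul_of_pos_left e3 (by positivity)
  rw [e1] at e4
  have e5 : 0 < x * y * ((y - P.c * x) * (P.c * y - x)) := by nlinarith
  have e6 := pos_of_mul_pos_right e5 (by positivity)
  have e7 : 0 < P.c * y - x := by nlinarith [h.arc.lt]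
  have := pos_of_mul_pos_left e6 e7.le
  linarith

/-- A geodesic that contains such a lasso is not a lift of a boundary component. -/
theorem side_ne_zero (h : P.IsSimpleLasso x y κ g q s t) {i : ZMod 3} {l : List (ZMod 3)} :
    ¬ ∀ r, (P.L i).side (P.word l • g r) = 0 := by
  intro H
  have hc1 := one_lt_c h.d_eq
  have hx := h.x_pos
  have hxy := h.arc.lt
  obtain ⟨l', -, -, h2⟩ := exists_word_of_mem_Γ (P.deck_mem_Γ 2)
  have h3 : (P.L i).side (P.word (l ++ l') • g s) = 0 := by
    rw [word_append, mul_smul, ← h2.pt, ← h.knot]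
    exact H t
  set w := (P.L i).pull (P.word l) with hw
  have hw0 : ∀ r, w.side (g r) = 0 := fun r => by
    rw [hw, ← Wall.side_smul_eq_zero_iff]; exact H r
  have hw1 : ∀ r, w.side (P.deck 2 • g r) = 0 := fun r => by
    rw [hw, ← Wall.side_smul_eq_zero_iff, h2.pt]
    have h4 : (P.L i).side (P.word ((l ++ l') ++ l.reverse) • P.word l • g s) = 0 := by
      rw [word_append, mul_smul, word_reverse_smul_word_smul]
      exact h3
    obtain ⟨-, h5⟩ := side_eq_zero_of_common (H s) h4
    have h6 := (h5 (P.word l • g r)).2 (H r)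
    rwa [word_append, mul_smul, word_reverse_smul_word_smul, word_append, mul_smul] at h6
  have e : ∀ r, w.eval y + w.eval x * (κ * Real.exp r) ^ 2 = 0 := fun r => by
    rw [← h.arc.side_mul w r, hw0, zero_mul]
  have harc : IsArc (fun r => P.deck 2 • g r) (y / P.c) (x / P.c) κ :=
    ⟨by have := P.c_pos; gcongr, h.arc.pos,
      fun r => by rw [deck_two_smul_re h.d_eq, h.arc.re_eq]; ring,
      fun r => by rw [deck_two_smul_im h.d_eq, h.arc.im_eq]; ring⟩
  have e' : ∀ r, w.eval (y / P.c) + w.eval (x / P.c) * (κ * Real.exp r) ^ 2 = 0 := fun r => by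
    rw [← harc.side_mul w r, hw1, zero_mul]
  -- The form of such a lift would vanish at the end points of `g` and of `γ₂ g`. These include the
  -- three distinct numbers `y`, `x` and `x / c`, too many roots for a quadratic form.
  have key : ∀ A B : ℝ, (∀ r : ℝ, A + B * (κ * Real.exp r) ^ 2 = 0) → A = 0 ∧ B = 0 := by
    intro A B H
    have h01 := h.arc.param_lt_iff.2 (zero_lt_one (α := ℝ))
    have h0 := H 0
    have h1 := H 1
    have : B * ((κ * Real.exp 1) ^ 2 - (κ * Real.exp 0) ^ 2) = 0 := by linear_combination h1 - h0
    have hB := (mul_eq_zero.1 this).resolve_right (by linarith)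
    subst hB
    exact ⟨by linarith, rfl⟩
  obtain ⟨f1, f2⟩ := key _ _ e
  obtain ⟨-, f3⟩ := key _ _ e'
  have hd := w.disc_pos
  rw [Wall.eval] at f1 f2 f3
  set u := x / P.c with hu
  have hux : u < x := div_lt_self hx hc1
  have g1 : w.a * (x + y) - 2 * w.b = 0 := by
    have : (y - x) * (w.a * (x + y) - 2 * w.b) = 0 := by linear_combination f1 - f2
    exact (mul_eq_zero.1 this).resolve_left (by linarith)
  have g2 : w.a * (x + u) - 2 * w.b = 0 := by
    have : (x - u) * (w.a * (x + u) - 2 * w.b) = 0 := by linear_combination f2 - f3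
    exact (mul_eq_zero.1 this).resolve_left (by linarith)
  have g3 : w.a = 0 := by
    have : (y - u) * w.a = 0 := by linear_combination g1 - g2
    exact (mul_eq_zero.1 this).resolve_left (by linarith)
  have g4 : w.b = 0 := by rw [g3] at g2; linarith
  rw [g3, g4] at hd
  simp at hd

theorem side_base_neg (h : P.IsSimpleLasso x y κ g q s t) {l : List (ZMod 3)}
    (hl : (P.L 1).side (P.word l • g q) = 0) {r : ℝ} (hr : r < q) :
    (P.L 1).side (P.word l • g r) < 0 := by
  have ht : 0 ≤ (P.L 1).side (P.word l • g t) :=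
    mem_cover_iff.1 (h.mem t ⟨by linarith [h.q_le, h.lt], le_rfl⟩) l 1
  have hg := isometry_smul_comp (P.word l) h.arc.isometry
  exact (Wall.side_neg_or_zero_left hg (P.L 1) hl ht (by linarith [h.q_le, h.lt]) hr).resolve_right
    h.side_ne_zero

theorem le_of_mem_cover (h : P.IsSimpleLasso x y κ g q s t) {r : ℝ} (hr : g r ∈ P.cover) :
    q ≤ r := by
  by_contra! hrq
  obtain ⟨l, hl⟩ := h.base
  have := mem_cover_iff.1 hr l 1
  linarith [h.side_base_neg hl hrq]

/-- The base point is not in the interior of the lasso. -/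
theorem proj_base_ne (h : P.IsSimpleLasso x y κ g q s t) {r : ℝ} (hr : r ∈ Ioo q t) :
    P.proj (g r) ≠ P.proj (g q) := by
  intro e
  obtain ⟨l, hl⟩ := h.base
  have h1 : P.proj (g r) ∈ P.boundaryComponent 1 := e ▸ mem_boundaryComponent_iff.2 ⟨l, hl⟩
  obtain ⟨l', hl'⟩ := mem_boundaryComponent_iff.1 h1
  have hqt : q < t := hr.1.trans hr.2
  have hg := isometry_smul_comp (P.word l') h.arc.isometry
  have h2 : 0 ≤ (P.L 1).side (P.word l' • g q) :=
    mem_cover_iff.1 (h.mem q ⟨le_rfl, hqt.le⟩) l' 1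
  have h3 : 0 ≤ (P.L 1).side (P.word l' • g t) :=
    mem_cover_iff.1 (h.mem t ⟨hqt.le, le_rfl⟩) l' 1
  rcases Wall.side_neg_or_zero hg (P.L 1) hl' h2 hr.1 hr.2 with h4 | h4
  · linarith
  · exact h.side_ne_zero h4

theorem eq_of_proj_eq (h : P.IsSimpleLasso x y κ g q s t) {r r' : ℝ} (hr : r ∈ Ico q t)
    (hr' : r' ∈ Ico q t) (e : P.proj (g r) = P.proj (g r')) : r = r' := by
  rcases hr.1.eq_or_lt with rfl | h1
  · rcases hr'.1.eq_or_lt with rfl | h2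
    · rfl
    · exact absurd e.symm (h.proj_base_ne ⟨h2, hr'.2⟩)
  · rcases hr'.1.eq_or_lt with rfl | h2
    · exact absurd e (h.proj_base_ne ⟨h1, hr.2⟩)
    · exact h.injOn ⟨h1, hr.2⟩ ⟨h2, hr'.2⟩ e

/-- The lasso is injective on `[q, t)`, and its end `t` is a `γ₂`-translate of `s`. So two points of
the chain of translates that are related by `k` come from the same time, and freeness identifies
`k`. -/
theorem exists_actEq_zpow (h : P.IsSimpleLasso x y κ g q s t) {k : GL (Fin 2) ℝ} (hk : k ∈ P.Γ)
    {r r' : ℝ} (hr : r ∈ Icc q t) (hr' : r' ∈ Icc q t) {i j : ℤ}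
    (e : k • P.deck 2 ^ i • g r = P.deck 2 ^ j • g r') : ∃ n : ℤ, ActEq k (P.deck 2 ^ n) := by
  have red : ∀ r ∈ Icc q t, ∀ i : ℤ, ∃ r₀ ∈ Ico q t, ∃ i₀ : ℤ,
      P.deck 2 ^ i • g r = P.deck 2 ^ i₀ • g r₀ := by
    intro r hr i
    rcases hr.2.eq_or_lt with rfl | h1
    · refine ⟨s, ⟨h.q_le, h.lt⟩, i + 1, ?_⟩
      rw [h.knot, zpow_add_one, mul_smul]
    · exact ⟨r, ⟨hr.1, h1⟩, i, rfl⟩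
  obtain ⟨r₀, h1, i₀, h2⟩ := red r hr i
  obtain ⟨r₁, h3, j₀, h4⟩ := red r' hr' j
  rw [h2, h4] at e
  have hz : ∀ i : ℤ, P.deck 2 ^ i ∈ P.Γ := fun i => zpow_mem (P.deck_mem_Γ 2) i
  have e1 : P.proj (g r₀) = P.proj (g r₁) := by
    have := congrArg P.proj e
    rwa [proj_smul hk, proj_smul (hz _), proj_smul (hz _)] at this
  obtain rfl := h.eq_of_proj_eq h1 h3 e1
  have hm : (P.deck 2 ^ j₀)⁻¹ * k * P.deck 2 ^ i₀ ∈ P.Γ :=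
    mul_mem (mul_mem (inv_mem (hz _)) hk) (hz _)
  have h5 := actEq_one_of_smul_eq hm (z := g r₀) (by
    rw [mul_smul, mul_smul, e, inv_smul_smul])
  refine ⟨j₀ - i₀, ?_⟩
  rw [actEq_iff] at h5 ⊢
  rw [map_mul, map_mul, map_inv, map_one] at h5
  rw [zpow_sub, map_mul, map_inv, eq_mul_inv_iff_mul_eq]
  rw [mul_assoc, inv_mul_eq_one] at h5
  exact h5.symm

theorem not_mem_wedge (h : P.IsSimpleLasso x y κ g q s t) {r : ℝ} (hr : r ≤ t) (i : ℤ) :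
    P.deck 2 ^ i • g r ∉ P.wedge x y := by
  refine deck_two_zpow_not_mem_wedge h.d_eq h.x_pos h.y_pos (h.arc.arcSide_self r) ?_ i
  rw [← h.normSq_t, h.arc.normSq_le_iff h.x_pos]
  exact hr

/-- In `P̃`, the relevant part of `g` begins at `q`, and the inequality for the other boundary curve
ends it no later than `t`; the curve `c g` is the image of `g` under `γ₂⁻¹`. -/
theorem not_frontier (h : P.IsSimpleLasso x y κ g q s t) {w : ℍ} (hw : w ∈ P.cover)
    (h1 : 0 ≤ arcSide x y w) (h2 : arcSide (P.c * x) (P.c * y) w ≤ 0)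
    (h3 : arcSide x y w = 0 ∨ arcSide (P.c * x) (P.c * y) w = 0) :
    ∃ (j : ℤ) (r : ℝ), r ∈ Icc q t ∧ w = P.deck 2 ^ j • g r := by
  have hc1 := one_lt_c h.d_eq
  have hc := P.c_pos
  rcases h3 with h3 | h3
  · obtain ⟨τ, rfl⟩ := h.arc.exists_eq h3
    rw [arcSide_scale_self h3] at h2
    have h4 : (g s).re ^ 2 + (g s).im ^ 2 ≤ (g τ).re ^ 2 + (g τ).im ^ 2 := by
      rw [h.normSq_s]
      by_contra! h5
      nlinarith
    rw [h.arc.normSq_le_iff h.x_pos] at h4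
    exact ⟨0, τ, ⟨h.le_of_mem_cover hw, by linarith [h.lt]⟩, by simp⟩
  · have h4 : arcSide x y (P.deck 2 ^ (1 : ℤ) • w) = 0 := by
      rw [arcSide_deck_two_zpow h.d_eq, zpow_one, h3, mul_zero]
    obtain ⟨τ, hτ⟩ := h.arc.exists_eq h4
    have hw' : w = P.deck 2 ^ (-1 : ℤ) • g τ := by rw [hτ, ← mul_smul, ← zpow_add]; simp
    refine ⟨-1, τ, ⟨h.le_of_mem_cover ?_, ?_⟩, hw'⟩
    · rw [hτ]
      exact (deck_two_mem_cover_iff 1).2 hw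
    · rw [hw', arcSide_deck_two_zpow h.d_eq, arcSide_scale_self (h.arc.arcSide_self τ),
        neg_neg, zpow_one, zpow_neg_one] at h1
      have h5 := nonneg_of_mul_nonneg_right h1 (by positivity)
      have h6 : P.c⁻¹ < 1 := inv_lt_one_of_one_lt₀ hc1
      have h7 := nonneg_of_mul_nonneg_right h5 (by linarith)
      have h8 : (g t).re ^ 2 + (g t).im ^ 2 ≤ (g τ).re ^ 2 + (g τ).im ^ 2 := by
        rw [h.normSq_t, div_eq_inv_mul]
        linarith
      rwa [h.arc.normSq_le_iff h.x_pos] at h8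

/-- A path that leaves the wedge has a point on its frontier, which belongs to the chain of
translates by `not_frontier`. Then `k` acts as a power of `γ₂`, but such translates never meet the
wedge. -/
theorem mem_wedge_of_mem (h : P.IsSimpleLasso x y κ g q s t) {k : GL (Fin 2) ℝ} (hk : k ∈ P.Γ)
    {r r' : ℝ} (hr : r ∈ Icc q t) (hr' : r' ∈ Icc q t) {i : ℤ}
    (hw : k • P.deck 2 ^ i • g r ∈ P.wedge x y) : k • P.deck 2 ^ i • g r' ∈ P.wedge x y := by
  set φ : ℝ → ℍ := fun u => k • P.deck 2 ^ i • g u with hφ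
  have hφc : Continuous φ := (isometry_smul_comp k
    (isometry_smul_comp _ h.arc.isometry)).continuous
  set m : ℝ → ℝ := fun u => min (arcSide x y (φ u)) (-arcSide (P.c * x) (P.c * y) (φ u)) with hm
  have hmc : Continuous m := ((continuous_arcSide _ _).comp hφc).min
    ((continuous_arcSide _ _).comp hφc).neg
  have hmw : ∀ u, 0 < m u ↔ φ u ∈ P.wedge x y := fun u => by
    rw [hm, lt_min_iff, neg_pos]; rfl
  change φ r' ∈ _
  rw [← hmw]
  by_contra! hneg
  obtain ⟨u, hu, hu0⟩ := intermediate_value_uIcc (hmc.continuousOn (s := uIcc r' r))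
    (show (0 : ℝ) ∈ uIcc (m r') (m r) from Icc_subset_uIcc ⟨hneg, ((hmw r).2 hw).le⟩)
  have hu' : u ∈ Icc q t := (uIcc_subset_Icc hr' hr) hu
  have hcov : φ u ∈ P.cover := (smul_mem_cover_iff hk).2 ((deck_two_mem_cover_iff i).2 (h.mem u hu'))
  have h1 : 0 ≤ arcSide x y (φ u) := hu0 ▸ min_le_left _ _
  have h2 : 0 ≤ -arcSide (P.c * x) (P.c * y) (φ u) := hu0 ▸ min_le_right _ _
  have h3 : arcSide x y (φ u) = 0 ∨ arcSide (P.c * x) (P.c * y) (φ u) = 0 := by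
    rcases min_choice (arcSide x y (φ u)) (-arcSide (P.c * x) (P.c * y) (φ u)) with h3 | h3
    · left; rw [← h3]; exact hu0
    · right; rw [← neg_eq_zero, ← h3]; exact hu0
  obtain ⟨j, τ, hτ, e⟩ := h.not_frontier hcov h1 (by linarith) h3
  obtain ⟨n, hn⟩ := h.exists_actEq_zpow hk hu' hτ e
  rw [hn.pt, ← mul_smul, ← zpow_add] at hw
  exact h.not_mem_wedge hr.2 _ hw

/-- The images of the lifted lasso do not meet the boundary of a wedge. -/
theorem mem_wedge (h : P.IsSimpleLasso x y κ g q s t) {k : GL (Fin 2) ℝ} (hk : k ∈ P.Γ)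
    {r r' : ℝ} (hr : r ∈ Icc q t) (hr' : r' ∈ Icc q t) {i : ℤ}
    (hw : k • P.deck 2 ^ i • g r ∈ P.wedge x y) (j : ℤ) :
    k • P.deck 2 ^ j • g r' ∈ P.wedge x y := by
  have hs : s ∈ Icc q t := ⟨h.q_le, h.lt.le⟩
  have ht : t ∈ Icc q t := ⟨by linarith [h.q_le, h.lt], le_rfl⟩
  -- Consecutive translates share a point, so membership propagates along the chain.
  have e : ∀ j : ℤ, P.deck 2 ^ j • g t = P.deck 2 ^ (j + 1) • g s := fun j => by
    rw [h.knot, zpow_add_one, mul_smul]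
  suffices H : ∀ n : ℤ, k • P.deck 2 ^ (i + n) • g s ∈ P.wedge x y by
    have := H (j - i)
    rw [add_sub_cancel] at this
    exact h.mem_wedge_of_mem hk hs hr' this
  intro n
  induction n with
  | zero => rw [add_zero]; exact h.mem_wedge_of_mem hk hr hs hw
  | succ n ih =>
    have := h.mem_wedge_of_mem hk hs ht ih
    rwa [e, add_assoc] at this
  | pred n ih =>
    have h1 : i + -(n : ℤ) = (i + (-(n : ℤ) - 1)) + 1 := by ring
    rw [h1, ← e] at ih
    exact h.mem_wedge_of_mem hk ht hs ih

/-- The translates of the lasso by powers of `γ₂`. -/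
theorem zpow_smul (h : P.IsSimpleLasso x y κ g q s t) (n : ℤ) :
    P.IsSimpleLasso (x * P.c ^ (-n)) (y * P.c ^ (-n)) κ (fun r => P.deck 2 ^ n • g r) q s t where
  d_eq := h.d_eq
  x_pos := mul_pos h.x_pos (zpow_pos P.c_pos _)
  arc := by
    have hr : 0 < P.c ^ (-n) := zpow_pos P.c_pos _
    refine ⟨mul_lt_mul_of_pos_right h.arc.lt hr, h.arc.pos, fun r => ?_, fun r => ?_⟩
    · rw [(deck_two_zpow_smul h.d_eq n _).1, h.arc.re_eq]; ring
    · rw [(deck_two_zpow_smul h.d_eq n _).2, h.arc.im_eq]; ring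
  q_le := h.q_le
  lt := h.lt
  knot := by
    rw [h.knot, ← mul_smul, ← mul_smul, (Commute.self_zpow _ _).eq]
  mem r hr := (deck_two_mem_cover_iff n).2 (h.mem r hr)
  base := by
    obtain ⟨l, hl⟩ := h.base
    have hz : P.deck 2 ^ n ∈ P.Γ := zpow_mem (P.deck_mem_Γ 2) n
    refine mem_boundaryComponent_iff.1 ?_
    rw [proj_smul hz]
    exact mem_boundaryComponent_iff.2 ⟨l, hl⟩
  injOn := by
    have hz : P.deck 2 ^ n ∈ P.Γ := zpow_mem (P.deck_mem_Γ 2) n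
    simp only [proj_smul hz]
    exact h.injOn

end IsSimpleLasso

end ThreeHoledSphere


theorem IsArc.tendsto_re {g : ℝ → ℍ} {y x κ : ℝ} (h : IsArc g y x κ) :
    Tendsto (fun t => (g t).re) atBot (𝓝 y) := by
  have := (Complex.continuous_re.tendsto _).comp h.tendsto_coe.1
  rwa [Complex.ofReal_re] at this

theorem IsArc.tendsto_normSq {g : ℝ → ℍ} {y x κ : ℝ} (h : IsArc g y x κ) :
    Tendsto (fun t => (g t).re ^ 2 + (g t).im ^ 2) atBot (𝓝 (y ^ 2)) := by
  have := (Complex.continuous_normSq.tendsto _).comp h.tendsto_coe.1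
  simp only [Complex.normSq_ofReal, ← pow_two] at this
  exact this.congr fun t => normSq_coe _

namespace ThreeHoledSphere

variable {P : ThreeHoledSphere}

/-! ### The reflection `R₂` and the center of `M₂*` -/

/-- The Euclidean center of `M₂*`. -/
def center (P : ThreeHoledSphere) : ℝ := (P.M 2).b / (P.M 2).a

theorem f_lt_center (P : ThreeHoledSphere) : P.f < P.center := by
  rw [center, lt_div_iff₀ P.M_two_a_pos, M_two_a, M_two_b]
  have h1 := P.f_lt_c
  have h2 := P.c_lt_d
  nlinarith [mul_pos (sub_pos.2 h1) (sub_pos.2 (h1.trans h2))]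

theorem center_lt_c (P : ThreeHoledSphere) : P.center < P.c := by
  rw [center, div_lt_iff₀ P.M_two_a_pos, M_two_a, M_two_b]
  have h1 := P.f_lt_c
  have h2 := P.e_lt_f
  nlinarith [mul_pos (sub_pos.2 h1) (sub_pos.2 (h2.trans h1))]

theorem center_pos (P : ThreeHoledSphere) : 0 < P.center := P.f_pos.trans P.f_lt_center

theorem denomSq_R_two (z : ℍ) : denomSq (P.R 2) z =
    (P.M 2).a ^ 2 * ((z.re - P.center) ^ 2 + z.im ^ 2) := by
  have ha := P.M_two_a_pos.ne'
  rw [R, denomSq, Wall.reflection_10, Wall.reflection_11, center]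
  field_simp
  ring

theorem R_two_re (z : ℍ) : ((P.R 2 • z).re - P.center) * denomSq (P.R 2) z =
    (z.re - P.center) * (P.M 2).disc := by
  have ha := P.M_two_a_pos.ne'
  rw [sub_mul, smul_re_mul, denomSq_R_two, R, Wall.reflection_10, Wall.reflection_11,
    Wall.reflection_00, Wall.reflection_01, center, Wall.disc]
  field_simp
  ring

theorem R_two_re_lt {z : ℍ} : (P.R 2 • z).re < P.center ↔ z.re < P.center := by
  have h1 := P.R_two_re z
  have h2 := denomSq_pos (P.R 2) z
  have h3 := P.disc_M_pos 2
  constructor <;> intro h <;> by_contra! h4 <;> nlinarith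

theorem R_two_re_gt {z : ℍ} : P.center < (P.R 2 • z).re ↔ P.center < z.re := by
  have h1 := P.R_two_re z
  have h2 := denomSq_pos (P.R 2) z
  have h3 := P.disc_M_pos 2
  constructor <;> intro h <;> by_contra! h4 <;> nlinarith

/-- The half plane over `[0, e]` has bounded distance from the center of inversion, so its image
keeps a definite horizontal distance from the center. -/
theorem exists_R_two_re_le (P : ThreeHoledSphere) :
    ∃ p < P.center, ∀ z ∈ P.playground 1, (P.R 2 • z).re ≤ p := by
  have h3 := P.disc_M_pos 2
  have ha := P.M_two_a_pos
  have hm := P.center_pos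
  have hem : P.e < P.center := P.e_lt_f.trans P.f_lt_center
  have hA : 0 < (P.M 2).a ^ 2 * P.center ^ 2 := by positivity
  refine ⟨P.center - (P.center - P.e) * (P.M 2).disc / ((P.M 2).a ^ 2 * P.center ^ 2), ?_,
    fun z hz => ?_⟩
  · have : 0 < (P.center - P.e) * (P.M 2).disc / ((P.M 2).a ^ 2 * P.center ^ 2) :=
      div_pos (mul_pos (by linarith) h3) hA
    linarith
  · change arcSide 0 P.e z < 0 at hz
    obtain ⟨h4, h5⟩ := arcSide_re hz.le P.e_pos.le
    have h1 := P.R_two_re z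
    have h2 := denomSq_pos (P.R 2) z
    have h6 : denomSq (P.R 2) z ≤ (P.M 2).a ^ 2 * P.center ^ 2 := by
      rw [denomSq_R_two]
      refine mul_le_mul_of_nonneg_left ?_ (by positivity)
      rw [arcSide] at hz
      nlinarith
    have h7 : (P.center - P.e) * (P.M 2).disc ≤
        (P.center - (P.R 2 • z).re) * ((P.M 2).a ^ 2 * P.center ^ 2) := by
      have h8 : 0 ≤ P.center - (P.R 2 • z).re := by
        have := P.R_two_re_lt.2 (show z.re < P.center by linarith)
        linarith
      calc (P.center - P.e) * (P.M 2).disc ≤ (P.center - z.re) * (P.M 2).disc :=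
            mul_le_mul_of_nonneg_right (by linarith) h3.le
        _ = (P.center - (P.R 2 • z).re) * denomSq (P.R 2) z := by linarith
        _ ≤ _ := mul_le_mul_of_nonneg_left h6 h8
    have h9 := (div_le_iff₀ hA).2 h7
    linarith

/-! ### The position of the lifts of `L₁` -/

/-- The half plane beyond `L̃₁` goes under the arc over `[1, d/c]` by the leading letter `1`, read
backwards. The remaining letters play ping-pong and end with `i`. -/
theorem mem_playground_of_side (hd : P.e * P.f = P.d) {v : List (ZMod 3)} {i : ZMod 3}
    (hv : Reduced (v ++ [i])) (hh : (v ++ [i]).head? = some 1) {z : ℍ}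
    (hz : (P.L 1).side (P.word (v ++ [i]) • z) ≤ 0) : z ∈ P.playground i := by
  have hc := P.c_pos
  have hd0 := P.d_pos
  obtain ⟨m, hm⟩ : ∃ m, v ++ [i] = 1 :: m := by
    cases hvi : v ++ [i] with
    | nil => simp at hvi
    | cons a m => rw [hvi] at hh; exact ⟨m, by simpa using hh⟩
  have hrev : i :: v.reverse = m.reverse ++ [1] := by
    have := congrArg List.reverse hm
    simpa using this
  set u := P.word (v ++ [i]) • z with hu
  have hz' : z = P.word m.reverse • P.R 1 • u := by
    have := word_reverse_smul_word_smul (P := P) (v ++ [i]) z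
    rw [← hu, hm, List.reverse_cons, word_append, mul_smul, word_cons, word_nil, mul_one] at this
    exact this.symm
  have h1 : P.R 1 • u ∈ P.playground 1 := by
    change arcSide 0 P.e _ < 0
    rw [P.L_one_side] at hz
    have e := arcSide_R_one hd (α := 1) (β := P.d / P.c) (α' := P.d) (β' := P.c) (one_mul _)
      (div_mul_cancel₀ _ hc.ne') u
    rw [arcSide_comm P.d] at e
    have h2 : arcSide 1 (P.d / P.c) (P.R 1 • u) ≤ 0 := by
      by_contra! h2
      have h3 := mul_pos h2 (normSq_pos u)
      rw [e] at h3
      have h4 : 0 < 1 * (P.d / P.c) := by positivity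
      nlinarith
    exact arcSide_mono_lt h2 P.one_lt_d_div_c.le zero_le_one (d_div_c_lt_e hd).le (Or.inl one_pos)
  have h2 : Reduced (m.reverse ++ [1]) := by
    rw [← hrev]
    have h3 : List.IsChain (fun a b => b ≠ a) (v ++ [i]) := List.IsChain.imp (fun _ _ h => h.symm) hv
    have := List.isChain_reverse.2 h3
    simpa [Reduced] using this
  have h3 := word_smul_mem_playground hd h2 h1
  rw [hz']
  convert h3 using 2
  cases hmr : m.reverse with
  | nil => rw [hmr] at hrev; simpa using (List.cons.inj hrev).1
  | cons a b => rw [hmr] at hrev; simpa using (List.cons.inj hrev).1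

theorem re_gt_center_of_side (hd : P.e * P.f = P.d) {v : List (ZMod 3)} (hv : Reduced (v ++ [0, 2]))
    (hh : (v ++ [0]).head? = some 1) {z : ℍ} (hz : (P.L 1).side (P.word (v ++ [0, 2]) • z) ≤ 0) :
    P.center < z.re := by
  have e : v ++ [0, 2] = (v ++ [0]) ++ [2] := by simp
  rw [e] at hv hz
  rw [word_append, mul_smul, word_cons, word_nil, mul_one] at hz
  have h1 : P.d < (P.R 2 • z).re :=
    mem_playground_of_side hd (List.isChain_append.1 hv).1 hh hz
  exact P.R_two_re_gt.1 (by linarith [P.center_lt_c, P.c_lt_d])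

theorem re_lt_center_of_side (hd : P.e * P.f = P.d) {v : List (ZMod 3)} (hv : Reduced (v ++ [1, 2]))
    (hh : (v ++ [1]).head? = some 1) {z : ℍ} (hz : (P.L 1).side (P.word (v ++ [1, 2]) • z) ≤ 0) :
    z.re < P.center := by
  have e : v ++ [1, 2] = (v ++ [1]) ++ [2] := by simp
  rw [e] at hv hz
  rw [word_append, mul_smul, word_cons, word_nil, mul_one] at hz
  have h1 : arcSide 0 P.e (P.R 2 • z) < 0 :=
    mem_playground_of_side hd (List.isChain_append.1 hv).1 hh hz
  have h2 := (arcSide_re h1.le P.e_pos.le).2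
  exact P.R_two_re_lt.1 (by linarith [P.f_lt_center, P.e_lt_f])

/-- The trailing pairs `1, 2` of the word are stripped off one by one, each costing one factor `k`.
What remains is empty or ends with `0` or with `0, 2`, and in each case the lift is to the right of
the center. -/
theorem exists_pow_re_gt_center (hd : P.e * P.f = P.d) {k : GL (Fin 2) ℝ}
    (hk : ∀ z : ℍ, k • z = P.R 1 • P.R 2 • z) {v : List (ZMod 3)} (hv : Reduced v)
    (hh : v = [] ∨ v.head? = some 1) (hl : v.getLast? ≠ some 1) :
    ∃ n : ℕ, ∀ z : ℍ, (P.L 1).side (P.word v • z) ≤ 0 → P.center < (k ^ n • z).re := by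
  induction hn : v.length using Nat.strong_induction_on generalizing v with
  | _ n ih =>
  rcases List.eq_nil_or_concat v with rfl | ⟨v, b, rfl⟩
  · refine ⟨0, fun z hz => ?_⟩
    rw [word_nil, one_smul, P.L_one_side] at hz
    rw [pow_zero, one_smul]
    linarith [(arcSide_re hz P.c_lt_d.le).1, P.center_lt_c]
  · rw [List.concat_eq_append] at *
    have hh' : (v ++ [b]).head? = some 1 := hh.resolve_left (by simp)
    rcases zmod3_cases b with rfl | rfl | rfl
    · refine ⟨0, fun z hz => ?_⟩
      have h1 : P.d < z.re := mem_playground_of_side hd hv hh' hz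
      rw [pow_zero, one_smul]
      linarith [P.center_lt_c, P.c_lt_d]
    · simp at hl
    · rcases List.eq_nil_or_concat v with rfl | ⟨v, b, rfl⟩
      · simp at hh'; exact absurd hh' (by decide)
      · rw [List.concat_eq_append, List.append_assoc] at *
        simp only [List.cons_append, List.nil_append] at *
        rcases zmod3_cases b with rfl | rfl | rfl
        · refine ⟨0, fun z hz => ?_⟩
          rw [pow_zero, one_smul]
          refine re_gt_center_of_side hd hv ?_ hz
          cases v with
          | nil => simp at hh'
          | cons a v => simpa using hh'
        · have e : ∀ z : ℍ, P.word (v ++ [1, 2]) • z = P.word v • k • z := fun z => by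
            rw [hk, word_append, mul_smul]; simp [mul_smul]
          have hv' := List.isChain_append.1 hv
          obtain ⟨n, hn⟩ := ih v.length (by rw [← hn]; simp) hv'.1 (by
            cases v with
            | nil => exact Or.inl rfl
            | cons a v => right; simpa using hh')
            (fun h => hv'.2.2 1 h 1 rfl rfl) rfl
          exact ⟨n + 1, fun z hz => by
            rw [pow_succ, mul_smul]
            exact hn _ (e z ▸ hz)⟩
        · exact absurd rfl (Reduced.ne (List.isChain_append.1 hv).2.1)

/-! ### Points of the lasso near `0` -/

/-- Contractions take `z` to `0` along a ray that is not vertical, and such a ray eventually enters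
every half plane over `[0, b]`. -/
theorem exists_arcSide_zero_neg (hd : P.e * P.f = P.d) {z : ℍ} (hz : 0 < z.re) {b : ℝ} (hb : 0 < b) :
    ∃ i₀ : ℕ, ∀ i : ℕ, i₀ ≤ i → arcSide 0 b (P.deck 2 ^ (i : ℤ) • z) < 0 := by
  have hc1 := one_lt_c hd
  obtain ⟨i₀, h0⟩ := pow_unbounded_of_one_lt ((z.re ^ 2 + z.im ^ 2) / (b * z.re)) hc1
  refine ⟨i₀, fun i hi => ?_⟩
  have h1 : (z.re ^ 2 + z.im ^ 2) / (b * z.re) < P.c ^ i :=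
    h0.trans_le (pow_le_pow_right₀ hc1.le hi)
  rw [div_lt_iff₀ (by positivity)] at h1
  obtain ⟨h2, h3⟩ := deck_two_zpow_smul hd i z
  rw [arcSide_eq, h2, h3, zpow_neg, zpow_natCast]
  have h4 : 0 < P.c ^ i := pow_pos P.c_pos i
  have h5 : (z.re * (P.c ^ i)⁻¹) ^ 2 + (z.im * (P.c ^ i)⁻¹) ^ 2 - (0 + b) * (z.re * (P.c ^ i)⁻¹) +
      0 * b = ((P.c ^ i)⁻¹) ^ 2 * (z.re ^ 2 + z.im ^ 2 - P.c ^ i * (b * z.re)) := by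
    field_simp
    ring
  rw [h5]
  exact mul_neg_of_pos_of_neg (by positivity) (by linarith)

/-- The part of the wedge with real part at most `p < y` has heights bounded above and below, hence
bounded hyperbolic diameter. The points `γ₂ⁱ z` are at unbounded mutual distances. -/
theorem not_forall_mem_wedge (hd : P.e * P.f = P.d) {x y p : ℝ} (hx : 0 < x) (hxy : x < y)
    (hp : p < y) (k : GL (Fin 2) ℝ) (z : ℍ) (i₀ : ℕ) (h : ∀ i : ℕ, i₀ ≤ i →
      k • P.deck 2 ^ (i : ℤ) • z ∈ P.wedge x y ∧ (k • P.deck 2 ^ (i : ℤ) • z).re ≤ p) : False := by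
  have hc1 := one_lt_c hd
  have hc := P.c_pos
  set D := P.c * y - P.c * x with hD
  set δ := (P.c * x - x) * (y - p) with hδ
  have hδ0 : 0 < δ := mul_pos (by nlinarith) (by linarith)
  have hD0 : 0 < D := by rw [hD]; nlinarith
  have key : ∀ i : ℕ, i₀ ≤ i → P.c * x < (k • P.deck 2 ^ (i : ℤ) • z).re ∧
      (k • P.deck 2 ^ (i : ℤ) • z).re < P.c * y ∧ δ < (k • P.deck 2 ^ (i : ℤ) • z).im ^ 2 ∧
      (k • P.deck 2 ^ (i : ℤ) • z).im ^ 2 ≤ D ^ 2 := by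
    intro i hi
    obtain ⟨⟨h1, h2⟩, h3⟩ := h i hi
    set w := k • P.deck 2 ^ (i : ℤ) • z
    obtain ⟨h4, h5⟩ := arcSide_re h2.le (by nlinarith)
    rw [arcSide] at h1 h2
    refine ⟨h4, h5, ?_, ?_⟩
    · have : (P.c * x - x) * (y - p) ≤ (w.re - x) * (y - w.re) :=
        mul_le_mul (by linarith) (by linarith) (by linarith) (by nlinarith)
      rw [hδ]
      nlinarith
    · rw [hD]
      nlinarith
  -- The bound `3 D² / (2 δ)` for `cosh` of the distance comes from `Im² ≤ D²`, `δ < Im²` and a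
  -- horizontal difference of at most `D`.
  obtain ⟨n, hn⟩ := exists_nat_gt (3 * D ^ 2 / (2 * δ) / Real.log P.c)
  have hlog := Real.log_pos hc1
  rw [div_lt_iff₀ hlog] at hn
  set u := k • P.deck 2 ^ (i₀ : ℤ) • z with hu
  set w := k • P.deck 2 ^ ((i₀ + n : ℕ) : ℤ) • z with hw
  obtain ⟨a1, a2, a3, a4⟩ := key i₀ le_rfl
  obtain ⟨b1, b2, b3, b4⟩ := key (i₀ + n) (by omega)
  rw [← hu] at a1 a2 a3 a4
  rw [← hw] at b1 b2 b3 b4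
  have h1 : Real.cosh (dist u w) ≤ 3 * D ^ 2 / (2 * δ) := by
    rw [cosh_dist']
    have hi := u.im_pos
    have hi' := w.im_pos
    have h2 : δ ≤ u.im * w.im := by
      rw [← sq_le_sq₀ hδ0.le (by positivity), mul_pow]
      nlinarith
    have h3 : (u.re - w.re) ^ 2 ≤ D ^ 2 := sq_le_sq' (by linarith) (by linarith)
    rw [div_le_div_iff₀ (by positivity) (by positivity)]
    have h4 : (u.re - w.re) ^ 2 + u.im ^ 2 + w.im ^ 2 ≤ 3 * D ^ 2 := by linarith
    calc _ ≤ 3 * D ^ 2 * (2 * δ) := mul_le_mul_of_nonneg_right h4 (by positivity)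
      _ ≤ 3 * D ^ 2 * (2 * u.im * w.im) := mul_le_mul_of_nonneg_left (by linarith) (by positivity)
  have h2 : (n : ℝ) * Real.log P.c ≤ dist u w := by
    rw [hu, hw, dist_smul_smul]
    refine le_trans ?_ (dist_log_im_le _ _)
    rw [(deck_two_zpow_smul hd _ _).2, (deck_two_zpow_smul hd _ _).2,
      Real.log_mul z.im_pos.ne' (zpow_pos hc _).ne', Real.log_mul z.im_pos.ne' (zpow_pos hc _).ne',
      Real.log_zpow, Real.log_zpow, Real.dist_eq]
    refine le_trans (le_of_eq ?_) (le_abs_self _)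
    push_cast
    ring
  have h3 : dist u w ≤ Real.cosh (dist u w) :=
    (Real.self_le_sinh_iff.2 dist_nonneg).trans (Real.sinh_lt_cosh _).le
  linarith

theorem mem_wedge_of_L_one {x y : ℝ} (h1 : P.c * x < y) (h2 : y ≤ P.c) (h3 : P.d ≤ P.c * y)
    (hxy : x < y) {w : ℍ} (hw : arcSide P.c P.d w = 0) : w ∈ P.wedge x y := by
  have h4 := (arcSide_re hw.le P.c_lt_d.le).1
  exact ⟨arcSide_pos_of_le_re (by linarith) hxy.le,
    arcSide_mono_lt hw.le P.c_lt_d.le (by linarith) h3 (Or.inl (by linarith))⟩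

theorem deck_two_inv_mem_wedge_iff (hd : P.e * P.f = P.d) {x y : ℝ} {w : ℍ} :
    P.deck 2 ^ (-1 : ℤ) • w ∈ P.wedge x y ↔
      0 < arcSide (x / P.c) (y / P.c) w ∧ arcSide x y w < 0 := by
  have hc := P.c_pos
  rw [wedge, Set.mem_ofPred_eq, arcSide_deck_two_zpow hd, arcSide_deck_two_zpow hd, neg_neg, zpow_one,
    zpow_neg_one, inv_mul_eq_div, inv_mul_eq_div, inv_mul_cancel_left₀ hc.ne',
    inv_mul_cancel_left₀ hc.ne']
  have hc2 : 0 < P.c ^ 2 := by positivity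
  exact and_congr (mul_pos_iff_of_pos_left hc2) (by
    constructor <;> intro h <;> by_contra! h' <;> nlinarith)

end ThreeHoledSphere


namespace ThreeHoledSphere

variable {P : ThreeHoledSphere}

/-! ### Excluded positions of the base point. -/

namespace IsSimpleLasso

variable {x y κ : ℝ} {g : ℝ → ℍ} {q s t : ℝ}

theorem q_mem (h : P.IsSimpleLasso x y κ g q s t) : q ∈ Icc q t :=
  ⟨le_rfl, by linarith [h.q_le, h.lt]⟩

theorem re_pos (h : P.IsSimpleLasso x y κ g q s t) (r : ℝ) : 0 < (g r).re :=
  h.x_pos.trans (arcSide_re (h.arc.arcSide_self r).le h.arc.lt.le).1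

theorem y_le_of_forall (h : P.IsSimpleLasso x y κ g q s t) {b : ℝ} (hb : ∀ r < q, (g r).re ≤ b) :
    y ≤ b :=
  le_of_tendsto h.arc.tendsto_re ((eventually_lt_atBot q).mono hb)

theorem le_y_of_forall (h : P.IsSimpleLasso x y κ g q s t) {b : ℝ} (hb : ∀ r < q, b ≤ (g r).re) :
    b ≤ y :=
  ge_of_tendsto h.arc.tendsto_re ((eventually_lt_atBot q).mono hb)

theorem tendsto_R_one_re (h : P.IsSimpleLasso x y κ g q s t) :
    Tendsto (fun r => (P.R 1 • g r).re) atBot (𝓝 (P.d / y)) := by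
  have hy := h.y_pos
  have h1 := (h.arc.tendsto_re.const_mul P.d).div h.arc.tendsto_normSq (by positivity)
  have e : P.d * y / y ^ 2 = P.d / y := by field_simp
  rw [e] at h1
  refine h1.congr fun r => ?_
  rw [Pi.div_apply, eq_comm, eq_div_iff (normSq_pos _).ne', R_one_re h.d_eq]

/-- Here `f ≤ y ≤ center`. With `k = R₁ R₂`, a power `k^(n+1)` takes the base point to the right of
the center, but takes `γ₂ⁱ (g q)`, for large `i`, under the arc over `[d/c, e]`, which is in the
wedge between `γ₂ g` and `g`. By `mem_wedge` the image of the base point would be there too, to the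
left of `y`. -/
theorem base_ne_append_one_two (h : P.IsSimpleLasso x y κ g q s t) {v : List (ZMod 3)}
    (hv : Reduced (v ++ [1, 2])) (hh : v = [] ∨ v.head? = some 1) :
    (P.L 1).side (P.word (v ++ [1, 2]) • g q) ≠ 0 := by
  intro hz
  have hd := h.d_eq
  have hc := P.c_pos
  have hc1 := one_lt_c hd
  have hcx := h.mul_lt
  have h1 : (v ++ [1]).head? = some 1 := by
    cases v with
    | nil => rfl
    | cons a v => simpa using hh
  have h2 : (v ++ [1, 2]).head? = some 1 := by
    cases v with
    | nil => rfl
    | cons a v => simpa using hh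
  have hy1 : y ≤ P.center := h.y_le_of_forall fun r hr =>
    (re_lt_center_of_side hd hv h1 (h.side_base_neg hz hr).le).le
  have hy2 : P.f ≤ y := h.le_y_of_forall fun r hr => by
    have h3 : arcSide P.f P.c (g r) < 0 := by
      have e : v ++ [1, 2] = (v ++ [1]) ++ [2] := by simp
      rw [e] at hv h2
      exact mem_playground_of_side hd hv h2 (e ▸ (h.side_base_neg hz hr).le)
    exact (arcSide_re h3.le P.f_lt_c.le).1.le
  obtain ⟨k, hkΓ, hk⟩ := P.exists_mem_Γ_of_pair 1 2
  have hk' : ∀ z : ℍ, k • z = P.R 1 • P.R 2 • z := fun z => by rw [hk.pt, mul_smul]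
  have hv' := List.isChain_append.1 hv
  have hz' : (P.L 1).side (P.word v • k • g q) = 0 := by
    rw [hk', ← hz, word_append, mul_smul]; simp [mul_smul]
  obtain ⟨n, hn'⟩ := exists_pow_re_gt_center hd hk' hv'.1 hh (fun h => hv'.2.2 1 h 1 rfl rfl)
  have hn := hn' _ hz'.le
  rw [← mul_smul, ← pow_succ] at hn
  have hpow : ∀ (n : ℕ) (z : ℍ), 0 < arcSide P.e P.d z →
      arcSide (P.d / P.c) P.e (k ^ (n + 1) • z) < 0 := by
    have hstep : ∀ z : ℍ, 0 < arcSide P.e P.d z → arcSide (P.d / P.c) P.e (k • z) < 0 := by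
      intro z hz
      rw [hk', arcSide_R_one_neg hd (α' := P.c) (β' := P.f) (div_pos P.d_pos hc) P.e_pos
        (div_mul_cancel₀ _ hc.ne') hd]
      exact P.arcSide_R_two_fc_neg.2 hz
    intro n
    induction n with
    | zero => intro z hz; rw [zero_add, pow_one]; exact hstep z hz
    | succ n ih =>
      intro z hz
      rw [pow_succ', mul_smul]
      refine hstep _ (arcSide_pos_of_re_le (arcSide_re (ih z hz).le (d_div_c_lt_e hd).le).2.le ?_)
      linarith [P.e_lt_f, P.f_lt_c, P.c_lt_d]
  obtain ⟨i, hi⟩ := exists_arcSide_zero_neg hd (h.re_pos q) P.e_pos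
  have hi' := hpow n _ (arcSide_pos_of_re_le (arcSide_re (hi i le_rfl).le P.e_pos.le).2.le
    (by linarith [P.e_lt_f, P.f_lt_c, P.c_lt_d]))
  have hyc : y / P.c ≤ P.d / P.c := by
    gcongr; linarith [P.center_lt_c, P.c_lt_d]
  have hxc : x < y / P.c := by rwa [lt_div_iff₀ hc, mul_comm]
  have hmem : P.deck 2 ^ (-1 : ℤ) • k ^ (n + 1) • P.deck 2 ^ (i : ℤ) • g q ∈ P.wedge x y := by
    rw [deck_two_inv_mem_wedge_iff hd]
    have h5 := (arcSide_re hi'.le (d_div_c_lt_e hd).le).1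
    refine ⟨arcSide_pos_of_le_re (by linarith) (by gcongr; exact h.arc.lt.le), ?_⟩
    exact arcSide_mono_lt hi'.le (d_div_c_lt_e hd).le (by linarith) (by linarith [P.e_lt_f])
      (Or.inl (by linarith))
  rw [← mul_smul] at hmem
  have h6 := h.mem_wedge (mul_mem (zpow_mem (P.deck_mem_Γ 2) _) (pow_mem hkΓ _)) h.q_mem h.q_mem
    hmem 0
  rw [zpow_zero, one_smul, mul_smul, deck_two_inv_mem_wedge_iff hd] at h6
  have h7 := (arcSide_re h6.2.le h.arc.lt.le).2
  linarith

/-- Here `center ≤ y ≤ c`, and `L̃₁` is inside the wedge. The word (preceded by `R₂`, which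
preserves `L̃₁`, if its length is odd) moves the base point to `L̃₁`, so all translates stay in the
wedge; but for large `i` they have real parts bounded by a number less than `y`, contrary to
`not_forall_mem_wedge`. -/
theorem base_ne_append_zero_two (h : P.IsSimpleLasso x y κ g q s t) {v : List (ZMod 3)}
    (hv : Reduced (1 :: v ++ [0, 2])) : (P.L 1).side (P.word (1 :: v ++ [0, 2]) • g q) ≠ 0 := by
  intro hz
  have hd := h.d_eq
  have hc := P.c_pos
  have hc1 := one_lt_c hd
  have hcx := h.mul_lt
  have hy1 : P.center ≤ y := h.le_y_of_forall fun r hr =>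
    (re_gt_center_of_side hd hv rfl (h.side_base_neg hz hr).le).le
  have e : 1 :: v ++ [0, 2] = (1 :: v ++ [0]) ++ [2] := by simp
  have hy2 : y ≤ P.c := h.y_le_of_forall fun r hr => by
    have h3 : arcSide P.f P.c (g r) < 0 :=
      mem_playground_of_side hd (e ▸ hv) rfl (e ▸ (h.side_base_neg hz hr).le)
    exact (arcSide_re h3.le P.f_lt_c.le).2.le
  have hcy : P.d ≤ P.c * y := by
    nlinarith [P.f_lt_center, P.e_lt_f, P.f_lt_c, P.f_pos]
  set V := 1 :: v ++ [0, 2] with hV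
  have hplay : ∃ i₀ : ℕ, ∀ i : ℕ, i₀ ≤ i →
      P.word V • P.deck 2 ^ (i : ℤ) • g q ∈ P.playground 1 := by
    obtain ⟨i₀, hi⟩ := exists_arcSide_zero_neg hd (h.re_pos q) P.e_pos
    refine ⟨i₀, fun i hi' => ?_⟩
    refine word_smul_mem_playground hd (l := V) (j := 1) ?_ (hi i hi')
    refine List.isChain_append.2 ⟨hv, List.isChain_singleton _, ?_⟩
    rw [e]
    intro a ha b hb
    rw [List.getLast?_append, List.getLast?_singleton] at ha
    simp at ha hb
    subst ha hb
    decide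
  obtain ⟨i₀, hi⟩ := hplay
  clear_value V
  rcases Nat.even_or_odd V.length with hev | hodd
  · obtain ⟨k, hkΓ, hk⟩ := exists_mem_Γ_of_even P hev
    have hmem : k • P.deck 2 ^ (0 : ℤ) • g q ∈ P.wedge x y := by
      rw [zpow_zero, one_smul, hk.pt]
      exact mem_wedge_of_L_one hcx hy2 hcy h.arc.lt (by rw [← P.L_one_side]; exact hz)
    refine not_forall_mem_wedge hd h.x_pos h.arc.lt
      (show P.e < y by linarith [P.f_lt_center, P.e_lt_f]) k (g q) i₀ fun i hii =>
      ⟨h.mem_wedge hkΓ h.q_mem h.q_mem hmem i, ?_⟩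
    rw [hk.pt]
    exact (arcSide_re (show arcSide 0 P.e _ < 0 from hi i hii).le P.e_pos.le).2.le
  · have hev : Even (2 :: V).length := by
      rw [List.length_cons]
      exact hodd.add_one
    obtain ⟨k, hkΓ, hk⟩ := exists_mem_Γ_of_even P hev
    have hmem : k • P.deck 2 ^ (0 : ℤ) • g q ∈ P.wedge x y := by
      rw [zpow_zero, one_smul, hk.pt]
      refine mem_wedge_of_L_one hcx hy2 hcy h.arc.lt ?_
      rw [← P.L_one_side, word_cons, mul_smul]
      exact (side_L_R_eq_zero (P := P) (i := 2) (j := 1) (by decide) _).2 hz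
    obtain ⟨p, hp, hp'⟩ := P.exists_R_two_re_le
    refine not_forall_mem_wedge hd h.x_pos h.arc.lt (hp.trans_le hy1) k (g q) i₀ fun i hii =>
      ⟨h.mem_wedge hkΓ h.q_mem h.q_mem hmem i, ?_⟩
    rw [hk.pt, word_cons, mul_smul]
    exact hp' _ (hi i hii)

end IsSimpleLasso

end ThreeHoledSphere


namespace ThreeHoledSphere

variable {P : ThreeHoledSphere}

/-- The lifts of a boundary component below a bound `b ≤ y` do not meet the wedge. -/
theorem not_mem_wedge_of_lift (hd : P.e * P.f = P.d) {x y b : ℝ} (hx : 0 < x) (hxy : x < y)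
    (hb : b ≤ y) {i : ZMod 3} {l : List (ZMod 3)}
    (hl : ∀ u : ℍ, (P.L i).side (P.word l • u) = 0 → arcSide 0 b u < 0) {u : ℍ}
    (hu : (P.L i).side (P.word l • u) = 0) : u ∉ P.wedge x y := by
  rintro ⟨w1, w2⟩
  have hb0 : 0 ≤ b := by
    by_contra! h0
    have h1 := hl u hu
    rw [arcSide_comm] at h1
    obtain ⟨h2, h3⟩ := arcSide_re h1.le h0.le
    have h4 := arcSide_re w2.le (by nlinarith [P.c_pos])
    nlinarith [P.c_pos, h4.1]
  obtain ⟨ha, hc0⟩ := P.pull_coeff_nonneg i l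
  set w := (P.L i).pull (P.word l) with hw
  have hl' : ∀ u : ℍ, w.side u = 0 → arcSide 0 b u < 0 := fun u hu =>
    hl u (by rwa [Wall.side_smul_eq_zero_iff])
  have hu' : w.side u = 0 := by rwa [hw, ← Wall.side_smul_eq_zero_iff]
  obtain ⟨p1, p2⟩ := arcSide_re (hl u hu).le hb0
  rcases ha.eq_or_lt with ha | ha
  · have h1 := hl' ⟨⟨u.re, b + 1⟩, by change 0 < b + 1; linarith⟩ (by
      rw [Wall.side_eq, ← ha] at hu' ⊢
      change 0 * (u.re ^ 2 + (b + 1) ^ 2) - 2 * w.b * u.re + w.c = 0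
      linarith)
    rw [arcSide] at h1
    change (u.re - 0) * (u.re - b) + (b + 1) ^ 2 < 0 at h1
    nlinarith
  -- The lift is over `[α, β]` with `0 ≤ α` and `β ≤ c α`. If `x ≤ α`, it is under `g`; if `α < x`,
  -- it is to the left of `c x`. Neither meets the wedge.
  · obtain ⟨α, β, hαβ, hs, he⟩ := w.exists_roots ha
    have hu0 : arcSide α β u = 0 := by
      rw [hs] at hu'
      exact (mul_eq_zero.1 hu').resolve_left ha.ne'
    obtain ⟨r1, r2⟩ := arcSide_re hu0.le hαβ.le
    have k0 : 0 ≤ α * β := by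
      have : w.eval 0 = w.c := by rw [Wall.eval]; ring
      rw [← this, he] at hc0
      have := nonneg_of_mul_nonneg_right hc0 ha
      linarith
    have hα : 0 ≤ α := nonneg_of_mul_nonneg_left k0 (by linarith)
    have hβ : β ≤ b := by
      by_contra! h1
      have hm : max α b < β := max_lt hαβ h1
      have hm1 := le_max_left α b
      have hm2 := le_max_right α b
      set ξ := (max α b + β) / 2 with hξ
      have hp : 0 < (ξ - α) * (β - ξ) := mul_pos (by linarith) (by linarith)
      have h2 := hl' ⟨⟨ξ, Real.sqrt ((ξ - α) * (β - ξ))⟩, Real.sqrt_pos.2 hp⟩ (by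
        rw [hs, arcSide]
        change w.a * ((ξ - α) * (ξ - β) + Real.sqrt ((ξ - α) * (β - ξ)) ^ 2) = 0
        rw [Real.sq_sqrt hp.le]
        ring)
      have h3 := (arcSide_re h2.le hb0).2
      change ξ < b at h3
      linarith
    have hcβ := roots_le_mul hd ha hαβ hs he hα
    rcases le_or_gt x α with h1 | h1
    · have := arcSide_mono_le hu0.le hαβ.le h1 (hβ.trans hb)
      linarith
    · have h2 : P.c * α < P.c * x := mul_lt_mul_of_pos_left h1 P.c_pos
      have := arcSide_pos_of_re_le (z := u) (show u.re ≤ P.c * x by linarith)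
        (mul_le_mul_of_nonneg_left hxy.le P.c_pos.le)
      linarith

theorem R_one_smul_mem_playground_zero (hd : P.e * P.f = P.d) {z : ℍ} (hz : arcSide 0 1 z < 0) :
    P.R 1 • z ∈ P.playground 0 := by
  change P.d < _
  have h1 := R_one_re hd z
  have h2 := normSq_pos z
  rw [arcSide_eq] at hz
  by_contra! h3
  have h4 := mul_le_mul_of_nonneg_right h3 h2.le
  rw [h1] at h4
  have := le_of_mul_le_mul_left h4 P.d_pos
  linarith

namespace IsSimpleLasso

variable {x y κ : ℝ} {g : ℝ → ℍ} {q s t : ℝ}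

theorem side_R_one_base_neg (h : P.IsSimpleLasso x y κ g q s t) {l : List (ZMod 3)}
    (hl : (P.L 1).side (P.word l • P.R 1 • g q) = 0) {r : ℝ} (hr : r < q) :
    (P.L 1).side (P.word l • P.R 1 • g r) < 0 := by
  have e : ∀ z : ℍ, P.word (l ++ [1]) • z = P.word l • P.R 1 • z := fun z => by
    rw [word_append, mul_smul, word_cons, word_nil, mul_one]
  rw [← e] at hl ⊢
  exact h.side_base_neg hl hr

theorem d_div_le_of_forall (h : P.IsSimpleLasso x y κ g q s t) {b : ℝ}
    (hb : ∀ r < q, (P.R 1 • g r).re ≤ b) : P.d / y ≤ b :=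
  le_of_tendsto h.tendsto_R_one_re ((eventually_lt_atBot q).mono hb)

theorem le_d_div_of_forall (h : P.IsSimpleLasso x y κ g q s t) {b : ℝ}
    (hb : ∀ r < q, b ≤ (P.R 1 • g r).re) : b ≤ P.d / y :=
  ge_of_tendsto h.tendsto_R_one_re ((eventually_lt_atBot q).mono hb)

/-- The end point of `R₁ g` is `d / y`, so `d / center ≤ y ≤ e`. For `k' = R₂ R₁` the points
`k'^(n+1) γ₂ⁱ (g q)` with large `i` are under the arc over `[f, c]`, inside the wedge. But `k'^(n+1)
(g q)` is on a lift under the arc over `[0, d / center]`, which does not meet the wedge by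
`not_mem_wedge_of_lift`. -/
theorem R_one_base_ne_append_one_two (h : P.IsSimpleLasso x y κ g q s t) {v : List (ZMod 3)}
    (hv : Reduced (v ++ [1, 2])) (hh : v = [] ∨ v.head? = some 1) :
    (P.L 1).side (P.word (v ++ [1, 2]) • P.R 1 • g q) ≠ 0 := by
  intro hz
  have hd := h.d_eq
  have hc := P.c_pos
  have hc1 := one_lt_c hd
  have hcx := h.mul_lt
  have hy := h.y_pos
  have h1 : (v ++ [1]).head? = some 1 := by
    cases v with
    | nil => rfl
    | cons a v => simpa using hh
  have e : v ++ [1, 2] = (v ++ [1]) ++ [2] := by simp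
  have h2 : ((v ++ [1]) ++ [2]).head? = some 1 := by
    cases v with
    | nil => rfl
    | cons a v => simpa using hh
  have hy1 : P.d / y ≤ P.center := h.d_div_le_of_forall fun r hr =>
    (re_lt_center_of_side hd hv h1 (h.side_R_one_base_neg hz hr).le).le
  have hy2 : P.f ≤ P.d / y := h.le_d_div_of_forall fun r hr => by
    have h3 : arcSide P.f P.c (P.R 1 • g r) < 0 :=
      mem_playground_of_side hd (e ▸ hv) h2 (e ▸ (h.side_R_one_base_neg hz hr).le)
    exact (arcSide_re h3.le P.f_lt_c.le).1.le
  rw [le_div_iff₀ hy] at hy2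
  have hye : y ≤ P.e := by nlinarith [P.f_pos]
  have hby : P.d / P.center ≤ y := by
    rw [div_le_iff₀ hy] at hy1
    rw [div_le_iff₀ P.center_pos]
    linarith
  have hy1' : 1 < y := by
    refine lt_of_lt_of_le ?_ hby
    rw [lt_div_iff₀ P.center_pos]
    linarith [P.center_lt_c, P.c_lt_d]
  obtain ⟨k, -, hk⟩ := P.exists_mem_Γ_of_pair 1 2
  obtain ⟨k', hkΓ, hk'⟩ := P.exists_mem_Γ_of_pair 2 1
  have hk1 : ∀ z : ℍ, k • z = P.R 1 • P.R 2 • z := fun z => by rw [hk.pt, mul_smul]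
  have hk2 : ∀ z : ℍ, k' • z = P.R 2 • P.R 1 • z := fun z => by rw [hk'.pt, mul_smul]
  have hconj : ∀ (n : ℕ) (z : ℍ), k ^ n • P.R 1 • z = P.R 1 • k' ^ n • z := by
    intro n
    induction n with
    | zero => simp
    | succ n ih => intro z; rw [pow_succ', pow_succ', mul_smul, mul_smul, ih, hk1, hk2]
  have hv' := List.isChain_append.1 hv
  obtain ⟨n, hn⟩ := exists_pow_re_gt_center hd hk1 hv'.1 hh (fun h => hv'.2.2 1 h 1 rfl rfl)
  obtain ⟨i, hi⟩ := exists_arcSide_zero_neg hd (h.re_pos q) one_pos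
  have hpow : ∀ n : ℕ, k' ^ (n + 1) • P.deck 2 ^ (i : ℤ) • g q ∈ P.playground 2 := by
    intro n
    induction n with
    | zero =>
      rw [zero_add, pow_one, hk2]
      exact R_smul_mem_playground hd (j := 0) (by decide)
        (R_one_smul_mem_playground_zero hd (hi i le_rfl))
    | succ n ih =>
      rw [pow_succ', mul_smul, hk2]
      exact R_smul_mem_playground hd (j := 1) (by decide)
        (R_smul_mem_playground hd (j := 2) (by decide) ih)
  have hmem : k' ^ (n + 1) • P.deck 2 ^ (i : ℤ) • g q ∈ P.wedge x y := by
    have h5 : arcSide P.f P.c _ < 0 := hpow n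
    refine ⟨arcSide_pos_of_le_re ?_ h.arc.lt.le, ?_⟩
    · linarith [(arcSide_re h5.le P.f_lt_c.le).1, P.e_lt_f]
    · refine arcSide_mono_lt h5.le P.f_lt_c.le (by linarith [P.e_lt_f]) (by nlinarith)
        (Or.inr (Or.inr h5))
  have h6 := h.mem_wedge (pow_mem hkΓ _) h.q_mem h.q_mem hmem 0
  rw [zpow_zero, one_smul] at h6
  have hcl : P.word (v ++ [1, 2]) * P.R 1 * (k' ^ (n + 1))⁻¹ ∈ Subgroup.closure (range P.R) :=
    mul_mem (mul_mem (word_mem_closure P _) (Subgroup.subset_closure ⟨1, rfl⟩))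
      (inv_mem (P.Γ_le_closure (pow_mem hkΓ _)))
  obtain ⟨l, hl, -⟩ := exists_word_of_mem_closure hcl
  have hl' : ∀ z : ℍ, P.word l • z = P.word (v ++ [1, 2]) • P.R 1 • (k' ^ (n + 1))⁻¹ • z :=
    fun z => by rw [← hl.pt, mul_smul, mul_smul]
  refine not_mem_wedge_of_lift hd h.x_pos h.arc.lt hby (i := 1) (l := l) (fun u hu => ?_) ?_ h6
  · set u' := (k' ^ (n + 1))⁻¹ • u with hu'
    have hu1 : u = k' ^ (n + 1) • u' := by rw [hu', smul_inv_smul]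
    rw [hl', ← hu', word_append, mul_smul] at hu
    have h7 := hn (k • P.R 1 • u') (by rw [hk1, ← hu]; simp [mul_smul])
    rw [← mul_smul, ← pow_succ, hconj, ← hu1] at h7
    have h8 := R_one_re hd u
    have h9 := normSq_pos u
    have h10 : P.center * (u.re ^ 2 + u.im ^ 2) < P.d * u.re := by
      rw [← h8]
      exact mul_lt_mul_of_pos_right h7 h9
    rw [arcSide_eq]
    have h11 : u.re ^ 2 + u.im ^ 2 < P.d / P.center * u.re := by
      rw [div_mul_eq_mul_div, lt_div_iff₀ P.center_pos]
      linarith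
    linarith
  · rw [hl', inv_smul_smul]
    exact hz

/-- Here `center ≤ d / y ≤ c`, and `L̃₁` is in the wedge. After correcting the parity by letters
that preserve `L̃₁`, the translate of the base point is in the wedge. The same element takes `γ₂ⁱ (g
q)`, for large `i`, to a point outside the geodesic over `[c x, c y]`. -/
theorem R_one_base_ne_append_zero_two (h : P.IsSimpleLasso x y κ g q s t) {v : List (ZMod 3)}
    (hv : Reduced (1 :: v ++ [0, 2])) :
    (P.L 1).side (P.word (1 :: v ++ [0, 2]) • P.R 1 • g q) ≠ 0 := by
  intro hz
  have hd := h.d_eq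
  have hc := P.c_pos
  have hc1 := one_lt_c hd
  have hcx := h.mul_lt
  have hy := h.y_pos
  have hy1 : P.center ≤ P.d / y := h.le_d_div_of_forall fun r hr =>
    (re_gt_center_of_side hd hv rfl (h.side_R_one_base_neg hz hr).le).le
  have e : 1 :: v ++ [0, 2] = (1 :: v ++ [0]) ++ [2] := by simp
  have hy2 : P.d / y ≤ P.c := h.d_div_le_of_forall fun r hr => by
    have h3 : arcSide P.f P.c (P.R 1 • g r) < 0 :=
      mem_playground_of_side hd (e ▸ hv) rfl (e ▸ (h.side_R_one_base_neg hz hr).le)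
    exact (arcSide_re h3.le P.f_lt_c.le).2.le
  rw [le_div_iff₀ hy] at hy1
  rw [div_le_iff₀ hy] at hy2
  have hye : y < P.e := by nlinarith [P.f_lt_center, P.f_pos]
  have hyc : y ≤ P.c := by linarith [P.e_lt_f, P.f_lt_c]
  set V := 1 :: v ++ [0, 2] with hV
  obtain ⟨i, hi⟩ := exists_arcSide_zero_neg hd (h.re_pos q) one_pos
  set z := P.deck 2 ^ (i : ℤ) • g q with hzdef
  have hplay : P.word V • P.R 1 • z ∈ P.playground 1 := by
    refine word_smul_mem_playground hd (l := V) (j := 0) ?_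
      (R_one_smul_mem_playground_zero hd (hi i le_rfl))
    refine List.isChain_append.2 ⟨hv, List.isChain_singleton _, ?_⟩
    rw [e]
    intro a ha b hb
    rw [List.getLast?_append, List.getLast?_singleton] at ha
    simp at ha hb
    subst ha hb
    decide
  clear_value V
  set u := P.word V • P.R 1 • z with hu
  have hu' : arcSide 0 P.e u < 0 := hplay
  have hpair : ∀ w : ℍ, P.word (V ++ [1]) • w = P.word V • P.R 1 • w := fun w => by
    rw [word_append, mul_smul, word_cons, word_nil, mul_one]
  have key : ∀ l : List (ZMod 3), (∀ j ∈ l, j ≠ 1) → Even (l ++ (V ++ [1])).length →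
      P.word l • u ∈ P.wedge x y := by
    intro l hl hev
    obtain ⟨k, hkΓ, hk⟩ := exists_mem_Γ_of_even P hev
    have hk' : ∀ w : ℍ, k • w = P.word l • P.word V • P.R 1 • w := fun w => by
      rw [hk.pt, word_append, mul_smul, hpair]
    have hmem : k • P.deck 2 ^ (0 : ℤ) • g q ∈ P.wedge x y := by
      rw [zpow_zero, one_smul, hk']
      refine mem_wedge_of_L_one hcx hyc (by linarith) h.arc.lt ?_
      rw [← P.L_one_side]
      exact (side_L_word_eq_zero hl _).2 hz
    have := h.mem_wedge hkΓ h.q_mem h.q_mem hmem i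
    rwa [hk'] at this
  have hupos := normSq_pos u
  rcases Nat.even_or_odd V.length with hev | hodd
  · have h1 := key [0] (by decide) (by
      simp only [List.length_append, List.length_cons, List.length_nil]
      obtain ⟨m, hm⟩ := hev
      exact ⟨m + 1, by omega⟩)
    rw [word_cons, word_nil, mul_one] at h1
    have h2 := (arcSide_re h1.2.le (mul_le_mul_of_nonneg_left h.arc.lt.le hc.le)).2
    have h3 := P.R_zero_re u
    rw [arcSide_eq] at hu'
    have h4 : P.c * P.d * u.re < P.c * y * (u.re ^ 2 + u.im ^ 2) := by
      rw [← h3]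
      exact mul_lt_mul_of_pos_right h2 hupos
    have h5 : P.d * u.re < y * (u.re ^ 2 + u.im ^ 2) := by
      by_contra! h6
      nlinarith
    have h6 : 0 < u.re := by nlinarith [P.e_pos]
    have h7 : y * (u.re ^ 2 + u.im ^ 2) ≤ P.e * (P.e * u.re) :=
      mul_le_mul hye.le (by linarith) hupos.le P.e_pos.le
    have h8 : P.d < P.e * P.e := by nlinarith
    nlinarith [P.e_lt_f, P.e_pos]
  · have h1 := key [0, 2] (by decide) (by
      simp only [List.length_append, List.length_cons, List.length_nil]
      obtain ⟨m, hm⟩ := hodd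
      exact ⟨m + 2, by omega⟩)
    rw [word_cons, word_cons, word_nil, mul_one, mul_smul] at h1
    have h2 : (P.R 2 • u).re < P.center := P.R_two_re_lt.2 (by
      linarith [(arcSide_re hu'.le P.e_pos.le).2, P.e_lt_f, P.f_lt_center])
    set w := P.R 2 • u with hw
    have hx := h.x_pos
    have h3 : arcSide 0 (P.c * P.d / P.center) (P.R 0 • w) < 0 := by
      refine arcSide_mono_lt h1.2.le (mul_le_mul_of_nonneg_left h.arc.lt.le hc.le) (by positivity)
        ?_ (Or.inl (by positivity))
      rw [le_div_iff₀ P.center_pos]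
      nlinarith
    have h4 := P.R_zero_re w
    have h5 := P.R_zero_normSq w
    have hwp := normSq_pos w
    have h6 : arcSide 0 (P.c * P.d / P.center) (P.R 0 • w) * (w.re ^ 2 + w.im ^ 2) =
        (P.c * P.d) ^ 2 / P.center * (P.center - w.re) := by
      rw [arcSide_eq]
      have hcen := P.center_pos.ne'
      have h7 : ((P.R 0 • w).re ^ 2 + (P.R 0 • w).im ^ 2 -
          (0 + P.c * P.d / P.center) * (P.R 0 • w).re + 0 * (P.c * P.d / P.center)) *
          (w.re ^ 2 + w.im ^ 2) = ((P.R 0 • w).re ^ 2 + (P.R 0 • w).im ^ 2) *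
          (w.re ^ 2 + w.im ^ 2) - P.c * P.d / P.center * ((P.R 0 • w).re *
          (w.re ^ 2 + w.im ^ 2)) := by ring
      rw [h7, h4, h5]
      field_simp
    have h7 : 0 < (P.c * P.d) ^ 2 / P.center * (P.center - w.re) :=
      mul_pos (div_pos (by have := P.d_pos; positivity) P.center_pos) (by linarith)
    have h8 := mul_neg_of_neg_of_pos h3 hwp
    linarith

theorem base_ne (h : P.IsSimpleLasso x y κ g q s t) {v : List (ZMod 3)}
    (hv : Reduced (1 :: v ++ [2])) :
    (P.L 1).side (P.word (1 :: v ++ [2]) • g q) ≠ 0 ∧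
      (P.L 1).side (P.word (1 :: v ++ [2]) • P.R 1 • g q) ≠ 0 := by
  rcases List.eq_nil_or_concat v with rfl | ⟨v, b, rfl⟩
  · exact ⟨h.base_ne_append_one_two (v := []) hv (Or.inl rfl),
      h.R_one_base_ne_append_one_two (v := []) hv (Or.inl rfl)⟩
  · have e : 1 :: v.concat b ++ [2] = 1 :: v ++ [b, 2] := by simp
    rw [e] at hv ⊢
    rcases zmod3_cases b with rfl | rfl | rfl
    · exact ⟨h.base_ne_append_zero_two hv, h.R_one_base_ne_append_zero_two hv⟩
    · exact ⟨h.base_ne_append_one_two hv (Or.inr rfl),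
        h.R_one_base_ne_append_one_two hv (Or.inr rfl)⟩
    · exact absurd rfl (Reduced.ne (List.isChain_append.1 hv).2.1)

end IsSimpleLasso

/-- The dihedral normal form with the reflection on the left, obtained by inverting the one for the
reversed word. -/
theorem exists_word_smul_eq {l : List (ZMod 3)} (hl : ∀ i ∈ l, i ≠ 2) :
    ∃ n : ℤ, (∀ z : ℍ, P.word l • z = P.deck 2 ^ n • z) ∨
      ∀ z : ℍ, P.word l • z = P.R 0 • P.deck 2 ^ n • z := by
  obtain ⟨n, hn⟩ := exists_actEq_zpow_two (P := P) (l := l.reverse) (by simpa using hl)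
  have hpow : ∀ N : ℕ, (∀ z : ℍ, P.R 0 ^ N • z = z) ∨ ∀ z : ℍ, P.R 0 ^ N • z = P.R 0 • z := by
    intro N
    induction N with
    | zero => left; intro z; rw [pow_zero, one_smul]
    | succ N ih =>
      rcases ih with ih | ih
      · right; intro z; rw [pow_succ', mul_smul, ih]
      · left; intro z; rw [pow_succ', mul_smul, ih, R_smul_R_smul_pt]
  have key : ∀ z : ℍ, P.R 0 ^ l.reverse.length • P.word l • z = P.deck 2 ^ (-n) • z := fun z => by
    have h1 := word_reverse_smul_word_smul (P := P) l z
    rw [hn.pt, mul_smul] at h1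
    rw [zpow_neg, eq_inv_smul_iff]
    exact h1
  refine ⟨-n, ?_⟩
  rcases hpow l.reverse.length with h | h
  · left; intro z; rw [← key z, h]
  · right; intro z; rw [← key z, h, R_smul_R_smul_pt]

/-- The base point of the lasso is on a translate of `L̃₁` by a power of `γ₂`. -/
theorem IsSimpleLasso.exists_base {x y κ : ℝ} {g : ℝ → ℍ} {q s t : ℝ}
    (h : P.IsSimpleLasso x y κ g q s t) :
    ∃ n : ℤ, (P.L 1).side (P.deck 2 ^ n • g q) = 0 := by
  obtain ⟨l₀, hl₀⟩ := h.base
  obtain ⟨l, hl, hact, -, -⟩ := P.exists_reduced l₀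
  rw [hact.pt] at hl₀
  have hR0 : ∀ z : ℍ, (P.L 1).side (P.R 0 • z) = 0 ↔ (P.L 1).side z = 0 := fun z =>
    side_L_R_eq_zero (P := P) (i := 0) (j := 1) (by decide) z
  by_cases h2 : (2 : ZMod 3) ∈ l
  · obtain ⟨s', t', rfl, ht'⟩ := exists_append_cons_not_mem h2
    have e : s' ++ 2 :: t' = (s' ++ [2]) ++ t' := by simp
    obtain ⟨n, hn⟩ := exists_word_smul_eq (P := P) (l := t') (fun i hi h => ht' (h ▸ hi))
    have hl₁ := hl₀
    rw [e, word_append, mul_smul] at hl₁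
    by_cases h1 : (1 : ZMod 3) ∈ s'
    · exfalso
      obtain ⟨p, s'', rfl, hp⟩ := List.eq_append_cons_of_mem h1
      have hred : Reduced (1 :: s'' ++ [2]) := by
        have hl' : Reduced (p ++ (1 :: s'' ++ [2]) ++ t') := by simpa using hl
        exact hl'.left_of_append.right_of_append
      have e' : (p ++ 1 :: s'') ++ [2] = p ++ (1 :: s'' ++ [2]) := by simp
      rw [e', word_append, mul_smul, side_L_word_eq_zero (i := 1) (fun j hj h => hp (h ▸ hj))] at hl₁
      rcases hn with hn | hn
      · rw [hn] at hl₁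
        exact ((h.zpow_smul n).base_ne hred).1 hl₁
      -- From `γ₂ = R₁ R₀`; in this form the case is covered by the second half of `base_ne`.
      · have e2 : P.R 0 • P.deck 2 ^ n • g q = P.R 1 • P.deck 2 ^ (n + 1) • g q := by
          rw [add_comm, zpow_add, zpow_one, mul_smul, deck_two_eq, mul_smul, R_smul_R_smul_pt]
        rw [hn, e2] at hl₁
        exact ((h.zpow_smul (n + 1)).base_ne hred).2 hl₁
    · rw [side_L_word_eq_zero (i := 1) (fun j hj h => by
        rcases List.mem_append.1 hj with h3 | h3
        · exact h1 (h ▸ h3)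
        · rw [List.mem_singleton, h] at h3
          exact absurd h3 (by decide))] at hl₁
      rcases hn with hn | hn
      · exact ⟨n, by rw [← hn]; exact hl₁⟩
      · exact ⟨n, by rw [← hR0, ← hn]; exact hl₁⟩
  · obtain ⟨n, hn | hn⟩ := exists_word_smul_eq (P := P) (l := l) (fun i hi h => h2 (h ▸ hi))
    · exact ⟨n, by rw [← hn]; exact hl₀⟩
    · exact ⟨n, by rw [← hR0, ← hn]; exact hl₀⟩

end ThreeHoledSphere


/-! ### Geodesics through two points -/

theorem isometry_eq_of_two_points {g g' : ℝ → ℍ} (hg : Isometry g) (hg' : Isometry g') {s t : ℝ}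
    (hst : s ≠ t) (h1 : g s = g' s) (h2 : g t = g' t) : g = g' := by
  obtain ⟨A, hA, hAg⟩ := exists_smul_expI hg
  have hf : Isometry fun r => A⁻¹ • g' r := isometry_smul_comp _ hg'
  obtain ⟨B, hB, hBf⟩ := exists_smul_expI hf
  have hs : expI s = B • expI s := by rw [← hBf, ← h1, hAg, inv_smul_smul]
  have ht : expI t = B • expI t := by rw [← hBf, ← h2, hAg, inv_smul_smul]
  rw [eq_smul_expI_iff] at hs ht
  have hdet := det_pos_of_eq hB
  rw [abs_of_pos hdet] at hs ht
  simp only [expI_re, expI_im, zero_mul] at hs ht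
  have hE := Real.exp_pos s
  have hE' := Real.exp_pos t
  have hne : Real.exp s ^ 2 - Real.exp t ^ 2 ≠ 0 := by
    rw [sub_ne_zero]
    intro h
    have := (sq_eq_sq₀ hE.le hE'.le).1 h
    exact hst (Real.exp_injective this)
  have e1 : B 0 0 * B 1 0 = 0 := by
    have : B 0 0 * B 1 0 * (Real.exp s ^ 2 - Real.exp t ^ 2) = 0 := by
      linear_combination ht.1 - hs.1
    exact (mul_eq_zero.1 this).resolve_right hne
  have f1 : B 1 1 ^ 2 + B 1 0 ^ 2 * Real.exp s ^ 2 = B 0 0 * B 1 1 - B 0 1 * B 1 0 :=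
    mul_left_cancel₀ hE.ne' (by linarith [hs.2])
  have f2 : B 1 1 ^ 2 + B 1 0 ^ 2 * Real.exp t ^ 2 = B 0 0 * B 1 1 - B 0 1 * B 1 0 :=
    mul_left_cancel₀ hE'.ne' (by linarith [ht.2])
  have e2 : B 1 0 = 0 := by
    have : B 1 0 ^ 2 * (Real.exp s ^ 2 - Real.exp t ^ 2) = 0 := by linear_combination f1 - f2
    exact pow_eq_zero_iff two_ne_zero |>.1 ((mul_eq_zero.1 this).resolve_right hne)
  rw [e2] at f1 hdet
  have h11 : B 1 1 ≠ 0 := by rintro h; rw [h] at hdet; simp at hdet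
  have e3 : B 0 0 = B 1 1 := by
    have : B 1 1 * (B 0 0 - B 1 1) = 0 := by linear_combination -f1
    linarith [(mul_eq_zero.1 this).resolve_left h11]
  have e4 : B 0 1 = 0 := by
    have := hs.1
    rw [e2] at this
    simp only [mul_zero, zero_mul, add_zero] at this
    exact (mul_eq_zero.1 this.symm).resolve_right h11
  funext r
  have hr : expI r = B • expI r := by
    rw [eq_smul_expI_iff, e2, e3, e4]
    simp only [expI_re, expI_im]
    have : 0 < B 1 1 * B 1 1 := mul_self_pos.2 h11
    refine ⟨by ring, ?_⟩
    rw [zero_mul, sub_zero, abs_of_pos this]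
    ring
  have := hBf r
  rw [← hr, inv_smul_eq_iff] at this
  rw [hAg, this]

theorem exists_isometry_through (z w : ℍ) :
    ∃ h : ℝ → ℍ, Isometry h ∧ h 0 = z ∧ h (dist z w) = w := by
  obtain ⟨A, -, s, t, rfl, rfl⟩ := exists_gl_two_points z w
  rw [dist_smul_smul, isometry_expI.dist_eq, Real.dist_eq]
  have hg := isometry_smul_comp A isometry_expI
  rcases le_total s t with h | h
  · refine ⟨_, isometry_comp_add hg s, by simp, ?_⟩
    rw [abs_of_nonpos (by linarith)]
    simp
  · refine ⟨_, isometry_comp_sub hg s, by simp, ?_⟩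
    rw [abs_of_nonneg (by linarith)]
    simp

/-- A geodesic through `z` and `z / c`. -/
theorem exists_isArc_of_scale {g : ℝ → ℍ} (hg : Isometry g) {c : ℝ} (hc : 1 < c) {s t : ℝ}
    (hst : s < t) (hpos : 0 < (g s).re) (hre : (g t).re = (g s).re / c)
    (him : (g t).im = (g s).im / c) : ∃ x y κ, 0 < x ∧ IsArc g y x κ := by
  have hc0 : 0 < c := by linarith
  set X := (g s).re with hX
  set S := X ^ 2 + (g s).im ^ 2 with hS
  have hip := (g s).im_pos
  have hSX : X ^ 2 < S := by rw [hS]; nlinarith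
  have hS0 : 0 < S := by positivity
  -- The circle over `[x, y]` contains both points exactly when `x + y = σ` and `x y = S / c`. So
  -- `x` and `y` are the roots of a quadratic equation.
  set σ := S * (1 + 1 / c) / X with hσ
  have hσ0 : 0 < σ := by positivity
  have hdisc : 0 < σ ^ 2 - 4 * (S / c) := by
    have h1 : S * (1 + 1 / c) ^ 2 ≤ σ ^ 2 := by
      rw [hσ, div_pow, le_div_iff₀ (by positivity), mul_pow]
      nlinarith [mul_le_mul_of_nonneg_left hSX.le (show 0 ≤ S * (1 + 1 / c) ^ 2 by positivity)]
    have h2 : S * (1 + 1 / c) ^ 2 - 4 * (S / c) = S * (1 - 1 / c) ^ 2 := by ring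
    have h3 : 0 < S * (1 - 1 / c) ^ 2 := by
      have : 1 / c < 1 := by rw [div_lt_one hc0]; exact hc
      have : 0 < 1 - 1 / c := by linarith
      positivity
    linarith
  set D := Real.sqrt (σ ^ 2 - 4 * (S / c)) with hD
  have hD0 : 0 < D := Real.sqrt_pos.2 hdisc
  have hD2 : D ^ 2 = σ ^ 2 - 4 * (S / c) := Real.sq_sqrt hdisc.le
  have hSc : 0 < S / c := by positivity
  have hDσ : D < σ := by nlinarith
  set x := (σ - D) / 2 with hx
  set y := (σ + D) / 2 with hy
  have hxy : x * y = S / c := by rw [hx, hy]; linear_combination (-1 / 4) * hD2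
  have hsum : x + y = σ := by rw [hx, hy]; ring
  have hσX : σ * X = S + S / c := by rw [hσ]; field_simp
  obtain ⟨g', hg'⟩ := exists_isArc (y := y) (x := x) (κ := 1) (by linarith) one_pos
  have hz1 : arcSide x y (g s) = 0 := by
    rw [arcSide_eq, ← hX, ← hS, hsum, hσX, hxy]; ring
  have hz2 : arcSide x y (g t) = 0 := by
    rw [arcSide_eq, hre, him, hsum, hxy]
    have : (X / c) ^ 2 + ((g s).im / c) ^ 2 = S / c ^ 2 := by rw [hS]; ring
    rw [this]
    have : σ * (X / c) = (S + S / c) / c := by rw [← hσX]; ring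
    rw [this]
    field_simp
    ring
  obtain ⟨t₁, h1⟩ := hg'.exists_eq hz1
  obtain ⟨t₂, h2⟩ := hg'.exists_eq hz2
  have hx0 : 0 < x := by rw [hx]; linarith
  have hlt : t₁ < t₂ := by
    rw [← hg'.normSq_lt_iff hx0, h1, h2, hre, him, ← hX, ← hS]
    have : (X / c) ^ 2 + ((g s).im / c) ^ 2 = S / c ^ 2 := by rw [hS]; ring
    rw [this]
    exact div_lt_self hS0 (by nlinarith)
  have hdist : t₂ - t₁ = t - s := by
    have e1 := hg'.isometry.dist_eq t₁ t₂
    rw [h1, h2, hg.dist_eq, Real.dist_eq, Real.dist_eq, abs_of_neg (by linarith),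
      abs_of_neg (by linarith)] at e1
    linarith
  have harc := hg'.comp_add (t₁ - s)
  have heq : (fun r => g' (r + (t₁ - s))) = g :=
    isometry_eq_of_two_points harc.isometry hg hst.ne (by rw [add_sub_cancel, h1])
      (by rw [show t + (t₁ - s) = t₂ by linarith, h2])
  rw [heq] at harc
  exact ⟨x, y, _, hx0, harc⟩

/-! ### From a vector of `W` to a lasso around `γ₂`. -/

namespace ThreeHoledSphere

variable {P : ThreeHoledSphere}

/-- The free homotopy makes the loop correspond to a conjugate of `γ₂`; moving `g` by the conjugator
makes it `γ₂` itself. A further power of `γ₂` puts the base point on `L̃₁`. -/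
theorem exists_isSimpleLasso (hd : P.e * P.f = P.d) {ν : P.UnitTangentBundle} (hν : ν ∈ P.W 2 3) :
    ∃ x y κ g q s t v, P.IsSimpleLasso x y κ g q s t ∧ arcSide P.c P.d (g q) = 0 ∧
      HasVelocity g 0 v ∧ P.projTangent v = ν ∧ q ≤ 0 ∧ 0 ≤ t ∧ (q < s → 0 ≤ s + t) := by
  obtain ⟨⟨v, g, -, hvν, hg, hgv, a, b, T, hG, hL, hB, h, hh, H⟩, -⟩ := hν
  have hb0 : 0 ≤ b ∧ 0 ≤ a := by
    rcases hG with hG | hG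
    · exact ⟨hG.nonneg.trans hG.le, hG.nonneg⟩
    · exact ⟨hG.nonneg, hG.nonneg.trans hG.le⟩
  -- If the forward ray stops first and `T + a < 0`, the backward ray would meet the drawn tip at
  -- the time `-T`, before its end. If the backward ray stops first, `b ≤ a` suffices.
  have hsum : -b < T → 0 ≤ T + a := by
    intro hT
    rcases hG with hG | hG
    · by_contra! hlt
      exact hG.simple' (-T) (by linarith) (by linarith)
        ⟨a, ⟨by linarith [hL.lt], le_rfl, by linarith⟩, by simpa using hL.knot.symm⟩
    · linarith [hG.le]
  have hh' : h (P.l 2) = P.deck 2 • h 0 := by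
    have := hh.2.2 0
    rwa [zero_add] at this
  obtain ⟨k, hk, hka⟩ := LoopHomotopic.exists_conj hg.continuous hh.1.continuous H
    (P.deck_mem_Γ 2) hh'
  have hki := inv_mem hk
  set g₁ : ℝ → ℍ := fun r => k⁻¹ • g r with hg₁
  have hg₁i : Isometry g₁ := isometry_smul_comp _ hg
  have hproj : ∀ r, P.proj (g₁ r) = P.proj (g r) := fun r => proj_smul hki _
  have hknot : g₁ a = P.deck 2 • g₁ T := by rw [hg₁]; simp only; rw [hka, inv_smul_smul]
  have hmem : ∀ r ∈ Icc (-b) a, g₁ r ∈ P.cover := fun r hr => by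
    rw [← mem_carrier_iff, hproj]; exact hL.mem r hr
  have hbase : ∃ l, (P.L 1).side (P.word l • g₁ (-b)) = 0 := by
    rw [← mem_boundaryComponent_iff, hproj]
    have e : (-(2 + 3) : ZMod 3) = 1 := by decide
    rwa [e] at hB
  have hre0 : 0 ≤ (g₁ T).re := by
    have := mem_cover_iff.1 (hmem T ⟨hL.le, hL.lt.le⟩) [] 2
    rw [word_nil, one_smul, P.L_two_side] at this
    linarith
  -- Two points on `L̃₂` would put the whole geodesic there, but its base point is on a lift of
  -- `L₁`.
  have hpos : 0 < (g₁ T).re := by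
    refine lt_of_le_of_ne hre0 fun h0 => ?_
    obtain ⟨α, β, hαβ⟩ := (P.L 2).side_isometry hg₁i
    have h1 := hαβ T
    have h2 := hαβ a
    rw [P.L_two_side, ← h0, mul_zero, eq_comm, mul_eq_zero] at h1
    rw [P.L_two_side, hknot, deck_two_smul_re hd, ← h0, zero_div, mul_zero, ← hknot, eq_comm,
      mul_eq_zero] at h2
    have h1' := h1.resolve_left (g₁ T).im_pos.ne'
    have h2' := h2.resolve_left (g₁ a).im_pos.ne'
    have hT := Real.exp_pos T
    have ha := Real.exp_pos a
    have hlt := Real.exp_lt_exp.2 hL.lt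
    rw [Real.exp_neg] at h1' h2'
    field_simp at h1' h2'
    have hα : α = 0 := by
      have : α * (Real.exp a ^ 2 - Real.exp T ^ 2) = 0 := by linear_combination h2' - h1'
      refine (mul_eq_zero.1 this).resolve_right ?_
      nlinarith
    subst hα
    have hβ : β = 0 := by linarith
    subst hβ
    obtain ⟨l, hl⟩ := hbase
    have h3 : (P.L 2).side (g₁ (-b)) = 0 := by rw [hαβ]; ring
    exact absurd (eq_of_lines h3 hl) (by decide)
  obtain ⟨x, y, κ, hx, harc⟩ := exists_isArc_of_scale hg₁i (one_lt_c hd) hL.lt hpos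
    (by rw [hknot, deck_two_smul_re hd]) (by rw [hknot, deck_two_smul_im hd])
  have hS : P.IsSimpleLasso x y κ g₁ (-b) T a :=
    ⟨hd, hx, harc, hL.le, hL.lt, hknot, hmem, hbase, by simp only [hproj]; exact hL.injOn⟩
  obtain ⟨n, hn⟩ := hS.exists_base
  have hz : P.deck 2 ^ n ∈ P.Γ := zpow_mem (P.deck_mem_Γ 2) n
  refine ⟨_, _, _, _, _, _, _, P.deck 2 ^ n • k⁻¹ • v, hS.zpow_smul n, ?_,
    hasVelocity_smul _ _ _ _ (hasVelocity_smul _ _ _ _ hgv), ?_, by linarith [hb0.1], hb0.2, hsum⟩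
  · rw [← P.L_one_side]; exact hn
  · rw [projTangent_smul hz, projTangent_smul hki, hvν]

namespace IsSimpleLasso

variable {x y κ : ℝ} {g : ℝ → ℍ} {q s t : ℝ}

/-- Before `q` the geodesic is beyond `L̃₁` and at `q` it crosses it, so the form of `L̃₁` is
negative at the initial end point. -/
theorem y_mem (h : P.IsSimpleLasso x y κ g q s t) (hq : arcSide P.c P.d (g q) = 0) :
    P.c < y ∧ y < P.d := by
  have hr : q - 1 < q := by linarith
  have h1 := h.side_base_neg (l := []) (by rw [word_nil, one_smul, P.L_one_side, hq]) hr
  rw [word_nil, one_smul, P.L_one_side] at h1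
  have e1 := h.arc.arcSide_mul P.c P.d q
  have e2 := h.arc.arcSide_mul P.c P.d (q - 1)
  rw [hq, zero_mul] at e1
  have h2 := h.arc.param_lt_iff.2 hr
  have h3 := mul_neg_of_neg_of_pos h1 (show 0 < 1 + (κ * Real.exp (q - 1)) ^ 2 by positivity)
  rw [e2] at h3
  have h4 : 0 < (x - P.c) * (x - P.d) := by by_contra! h4; nlinarith
  have h5 : 0 < (κ * Real.exp (q - 1)) ^ 2 := by have := h.arc.pos; positivity
  have h6 : (y - P.c) * (y - P.d) < 0 := by nlinarith
  have := P.c_lt_d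
  constructor <;> by_contra! h7 <;> nlinarith

theorem x_lt (h : P.IsSimpleLasso x y κ g q s t) (hq : arcSide P.c P.d (g q) = 0) :
    x < P.d / P.c := by
  rw [lt_div_iff₀ P.c_pos]
  linarith [h.mul_lt, (h.y_mem hq).2]

theorem isLassoArc (h : P.IsSimpleLasso x y κ g q s t) (hq : arcSide P.c P.d (g q) = 0)
    (hx : x < 1) : P.IsLassoArc x y κ g q s t := by
  obtain ⟨h1, h2⟩ := h.y_mem hq
  obtain ⟨q', s', t', hL⟩ := IsParam.exists_isLassoArc ⟨h.d_eq, h.x_pos, hx, h1, h2⟩ h.arc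
  have e1 : q' = q := by
    refine le_antisymm ((hL.cross_iff q).1 hq.ge) ?_
    by_contra! h3
    have := h.side_base_neg (l := []) (by rw [word_nil, one_smul, P.L_one_side, hq]) h3
    rw [word_nil, one_smul, P.L_one_side, hL.cross] at this
    exact lt_irrefl _ this
  have e2 : s' = s := le_antisymm
    ((h.arc.normSq_le_iff h.x_pos).1 (by rw [h.normSq_s, hL.normSq_s]))
    ((h.arc.normSq_le_iff h.x_pos).1 (by rw [h.normSq_s, hL.normSq_s]))
  have e3 : t' = t := le_antisymm
    ((h.arc.normSq_le_iff h.x_pos).1 (by rw [h.normSq_t, hL.normSq_t]))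
    ((h.arc.normSq_le_iff h.x_pos).1 (by rw [h.normSq_t, hL.normSq_t]))
  subst e1 e2 e3
  exact hL

end IsSimpleLasso

/-- A geodesic that ends at `1`, the common end point of two lifts of `L₁`, does not leave the
universal cover. -/
theorem mem_cover_of_isArc_one (hd : P.e * P.f = P.d) {y κ : ℝ} {g : ℝ → ℍ} (hg : IsArc g y 1 κ)
    {q r : ℝ} (hq : g q ∈ P.cover) (hr : q ≤ r) : g r ∈ P.cover := by
  rw [mem_cover_iff] at hq ⊢
  intro l i
  have h1 := hq l i
  rw [Wall.side_smul_nonneg_iff] at h1 ⊢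
  have h2 := (eval_pull_nonneg P.one_lt_d_div_c
    (fun z hz => mem_cover_of_arcSide_one hd hz) i l).1
  have e1 := hg.side_mul ((P.L i).pull (P.word l)) q
  have e2 := hg.side_mul ((P.L i).pull (P.word l)) r
  have h3 := hg.param_le_iff.2 hr
  have h4 := mul_nonneg h1 (show 0 ≤ 1 + (κ * Real.exp q) ^ 2 by positivity)
  have h5 : 0 ≤ ((P.L i).pull (P.word l)).side (g r) * (1 + (κ * Real.exp r) ^ 2) := by
    rw [e2]; rw [e1] at h4; nlinarith
  exact nonneg_of_mul_nonneg_left h5 (by positivity)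

theorem not_mem_generic (hd : P.e * P.f = P.d) {y κ : ℝ} {g : ℝ → ℍ} (hg : IsArc g y 1 κ) {q : ℝ}
    (hq : g q ∈ P.cover) (hq0 : q ≤ 0) {v : UnitTangent} (hv : HasVelocity g 0 v) :
    P.projTangent v ∉ P.generic := by
  rintro ⟨v', g', -, he, hg', hv', ⟨t, ht, h1⟩, -⟩
  obtain ⟨k, hk, rfl⟩ := projTangent_eq_iff.1 he
  have h2 := isometry_eq_of_hasVelocity hg' (isometry_smul_comp k hg.isometry) hv'
    (hasVelocity_smul _ _ _ _ hv)
  subst h2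
  rw [proj_smul hk, mem_carrier_iff] at h1
  exact h1 (mem_cover_of_isArc_one hd hg hq (by linarith))

end ThreeHoledSphere


namespace ThreeHoledSphere

variable {P : ThreeHoledSphere}

/-! ### The shortest essential path from `L₁` to itself -/

theorem cosh_dist_R_one (hd : P.e * P.f = P.d) (z w : ℍ) :
    Real.cosh (dist z (P.R 1 • w)) * (2 * P.d * z.im * w.im) =
      (z.re ^ 2 + z.im ^ 2) * (w.re ^ 2 + w.im ^ 2) + P.d ^ 2 - 2 * P.d * z.re * w.re := by
  have hS := normSq_pos w
  have h1 := R_one_re hd w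
  have h2 := R_one_normSq hd w
  have hz := z.im_pos
  have hw := w.im_pos
  have hu := (P.R 1 • w).im_pos
  have hd0 := P.d_pos
  have h3 : (P.R 1 • w).im * (w.re ^ 2 + w.im ^ 2) = P.d * w.im := by
    refine (sq_eq_sq₀ (by positivity) (by positivity)).1 ?_
    have : ((P.R 1 • w).re * (w.re ^ 2 + w.im ^ 2)) ^ 2 +
        ((P.R 1 • w).im * (w.re ^ 2 + w.im ^ 2)) ^ 2 = P.d ^ 2 * (w.re ^ 2 + w.im ^ 2) := by
      rw [← h2]; ring
    rw [h1] at this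
    linear_combination this
  rw [cosh_dist']
  set u := P.R 1 • w
  have e : (z.re - u.re) ^ 2 + z.im ^ 2 + u.im ^ 2 =
      (z.re ^ 2 + z.im ^ 2) + (u.re ^ 2 + u.im ^ 2) - 2 * z.re * u.re := by ring
  rw [e, div_mul_eq_mul_div, div_eq_iff (by positivity)]
  have e2 : 2 * P.d * z.im * w.im = 2 * z.im * u.im * (w.re ^ 2 + w.im ^ 2) := by
    linear_combination (-2 * z.im) * h3
  rw [e2]
  linear_combination (2 * z.im * u.im) * h2 - (2 * z.im * u.im) * (2 * z.re) * h1

/-- `H(B₁)` is defined by a segment whose length is the infimum of the distances, so the infimum has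
to be attained. Parametrized by `τ, τ'` on `L̃₁`, `cosh` of the distance is a constant times `(B² +
C (τ² + τ'²) + A² (τ τ')²) / (τ τ')`, which is least for `τ = τ' = √(B / A)`. -/
theorem exists_setDist_eq (hd : P.e * P.f = P.d) :
    ∃ z ∈ (P.L 1).line, ∃ w ∈ (fun z => P.R 1 • z) '' (P.L 1).line,
      setDist (P.L 1).line ((fun z => P.R 1 • z) '' (P.L 1).line) = dist z w := by
  have hc1 := one_lt_c hd
  have hc := P.c_pos
  have hd0 := P.d_pos
  have hcd := P.c_lt_d
  have hcc : P.d < P.c ^ 2 := by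
    have h1 := d_div_c_lt_e hd
    rw [div_lt_iff₀ hc] at h1
    nlinarith [P.e_lt_f, P.f_lt_c]
  obtain ⟨α, hα⟩ := exists_isArc hcd one_pos
  have hline : ∀ r, α r ∈ (P.L 1).line := fun r => by
    change (P.L 1).side _ = 0
    rw [P.L_one_side]
    exact hα.arcSide_self r
  set A := P.c ^ 2 - P.d with hA
  set B := P.d * (P.d - 1) with hB
  set C := P.d ^ 2 * (P.c - 1) ^ 2 with hC
  have hA0 : 0 < A := by linarith
  have hB0 : 0 < B := mul_pos hd0 (by linarith)
  have key : ∀ r r' : ℝ, Real.cosh (dist (α r) (P.R 1 • α r')) *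
      (2 * P.d * (P.d - P.c) ^ 2 * (Real.exp r * Real.exp r')) =
      B ^ 2 + C * (Real.exp r ^ 2 + Real.exp r' ^ 2) + A ^ 2 * (Real.exp r * Real.exp r') ^ 2 := by
    intro r r'
    have h1 := cosh_dist_R_one hd (α r) (α r')
    have n1 := hα.normSq_mul r
    have n2 := hα.normSq_mul r'
    have i1 := hα.im_eq r
    have i2 := hα.im_eq r'
    have r1 := hα.re_eq r
    have r2 := hα.re_eq r'
    simp only [one_mul] at n1 n2 i1 i2 r1 r2
    set τ := Real.exp r
    set τ' := Real.exp r'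
    have p1 : 0 < 1 + τ ^ 2 := by positivity
    have p2 : 0 < 1 + τ' ^ 2 := by positivity
    rw [eq_div_iff p1.ne'] at i1 r1
    rw [eq_div_iff p2.ne'] at i2 r2
    have e : Real.cosh (dist (α r) (P.R 1 • α r')) *
        (2 * P.d * (P.d - P.c) ^ 2 * (τ * τ')) =
        (Real.cosh (dist (α r) (P.R 1 • α r')) * (2 * P.d * (α r).im * (α r').im)) *
          ((1 + τ ^ 2) * (1 + τ' ^ 2)) := by
      have : (α r).im * (α r').im * ((1 + τ ^ 2) * (1 + τ' ^ 2)) =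
          τ * (P.d - P.c) * (τ' * (P.d - P.c)) := by rw [← i1, ← i2]; ring
      linear_combination (-2 * P.d * Real.cosh (dist (α r) (P.R 1 • α r'))) * this
    rw [e, h1]
    have e1 : ((α r).re ^ 2 + (α r).im ^ 2) * ((α r').re ^ 2 + (α r').im ^ 2) *
        ((1 + τ ^ 2) * (1 + τ' ^ 2)) =
        (P.d ^ 2 + P.c ^ 2 * τ ^ 2) * (P.d ^ 2 + P.c ^ 2 * τ' ^ 2) := by rw [← n1, ← n2]; ring
    have e2 : (α r).re * (α r').re * ((1 + τ ^ 2) * (1 + τ' ^ 2)) =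
        (P.d + P.c * τ ^ 2) * (P.d + P.c * τ' ^ 2) := by rw [← r1, ← r2]; ring
    rw [hA, hB, hC]
    linear_combination e1 - 2 * P.d * e2
  set r₀ := Real.log (B / A) / 2 with hr₀
  have hr₀' : Real.exp r₀ ^ 2 = B / A := by
    rw [← Real.exp_nat_mul, hr₀]
    push_cast
    rw [mul_div_cancel₀ _ two_ne_zero, Real.exp_log (by positivity)]
  have hBA : B = A * Real.exp r₀ ^ 2 := by rw [hr₀']; field_simp
  refine ⟨α r₀, hline r₀, P.R 1 • α r₀, ⟨_, hline r₀, rfl⟩, ?_⟩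
  rw [setDist]
  refine IsLeast.csInf_eq ⟨⟨_, hline r₀, _, ⟨_, hline r₀, rfl⟩, rfl⟩, ?_⟩
  rintro _ ⟨z, hz, _, ⟨w, hw, rfl⟩, rfl⟩
  have hz' : arcSide P.c P.d z = 0 := by rw [← P.L_one_side]; exact hz
  have hw' : arcSide P.c P.d w = 0 := by rw [← P.L_one_side]; exact hw
  obtain ⟨r, rfl⟩ := hα.exists_eq hz'
  obtain ⟨r', rfl⟩ := hα.exists_eq hw'
  have hle : Real.cosh (dist (α r₀) (P.R 1 • α r₀)) ≤ Real.cosh (dist (α r) (P.R 1 • α r')) := by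
    have k0 := key r₀ r₀
    have k1 := key r r'
    have hK : 0 < 2 * P.d * (P.d - P.c) ^ 2 := by
      have : 0 < P.d - P.c := by linarith
      positivity
    set K := 2 * P.d * (P.d - P.c) ^ 2
    set X := Real.cosh (dist (α r₀) (P.R 1 • α r₀))
    set Y := Real.cosh (dist (α r) (P.R 1 • α r'))
    have h0 : X * K = 2 * A * B + 2 * C := by
      have hp : 0 < Real.exp r₀ ^ 2 := by positivity
      refine mul_right_cancel₀ hp.ne' ?_
      have : B ^ 2 = A * B * Real.exp r₀ ^ 2 := by rw [pow_two]; nth_rewrite 1 [hBA]; ring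
      have h2 : A ^ 2 * (Real.exp r₀ * Real.exp r₀) ^ 2 = A * B * Real.exp r₀ ^ 2 := by
        rw [hBA]; ring
      linear_combination k0 + this + h2
    have hp : 0 < Real.exp r * Real.exp r' := by positivity
    have h1 : X * K * (Real.exp r * Real.exp r') ≤ Y * K * (Real.exp r * Real.exp r') := by
      have hC0 : 0 ≤ C := by positivity
      have e1 : Y * K * (Real.exp r * Real.exp r') = B ^ 2 + C * (Real.exp r ^ 2 + Real.exp r' ^ 2)
          + A ^ 2 * (Real.exp r * Real.exp r') ^ 2 := by rw [← k1]; ring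
      rw [e1, h0]
      nlinarith [sq_nonneg (B - A * (Real.exp r * Real.exp r')),
        mul_nonneg hC0 (sq_nonneg (Real.exp r - Real.exp r'))]
    exact le_of_mul_le_mul_right (le_of_mul_le_mul_right h1 hp) hK
  rwa [Real.cosh_le_cosh, abs_of_nonneg dist_nonneg, abs_of_nonneg dist_nonneg] at hle

theorem side_L_one_R_one (hd : P.e * P.f = P.d) (z : ℍ) :
    (P.L 1).side (P.word [1] • z) * (z.re ^ 2 + z.im ^ 2) =
      P.c * P.d * arcSide 1 (P.d / P.c) z := by
  rw [word_cons, word_nil, mul_one, P.L_one_side, arcSide_comm 1]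
  exact arcSide_R_one hd (mul_div_cancel₀ _ P.c_pos.ne') (mul_one _) z

theorem mem_cover_between {g : ℝ → ℍ} (hg : Isometry g) {r₁ r₂ r : ℝ} (h1 : g r₁ ∈ P.cover)
    (h2 : g r₂ ∈ P.cover) (hr1 : r₁ ≤ r) (hr2 : r ≤ r₂) : g r ∈ P.cover := by
  rw [mem_cover_iff] at *
  intro l i
  have n1 := h1 l i
  have n2 := h2 l i
  rw [Wall.side_smul_nonneg_iff] at *
  exact Wall.side_nonneg_between hg _ n1 n2 hr1 hr2

theorem pathHomotopic_of_lines {g h : ℝ → ℍ} (hg : Isometry g) (hh : Isometry h) {b b' : ℝ}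
    (hb : 0 ≤ b) (hb' : 0 ≤ b') {i j : ZMod 3} {l l' : List (ZMod 3)}
    (h1 : (P.L i).side (P.word l • g 0) = 0) (h2 : (P.L i).side (P.word l • h 0) = 0)
    (h3 : (P.L j).side (P.word l' • g b) = 0) (h4 : (P.L j).side (P.word l' • h b') = 0) :
    P.PathHomotopic (fun t => P.proj (g t)) 0 b (fun t => P.proj (h t)) 0 b' := by
  have hgc := hg.continuous
  have hhc := hh.continuous
  refine ⟨fun p => P.proj (mix p.2 (g (0 + p.1 * (b - 0))) (h (0 + p.1 * (b' - 0)))),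
    ?_, fun p => ?_, fun r => ⟨?_, ?_⟩, fun u => ?_, fun u => ?_⟩
  · have hc : Continuous fun p : unitInterval × unitInterval =>
        (p.2, g (0 + p.1 * (b - 0)), h (0 + p.1 * (b' - 0))) := by fun_prop
    exact continuous_proj.comp (continuous_mix.comp hc)
  · have p1 := p.1.2.1
    have p2 := p.1.2.2
    refine mem_carrier_iff.2 (mix_mem_cover ?_ ?_ _)
    · exact mem_cover_between hg (mem_cover_of_word_line h1) (mem_cover_of_word_line h3)
        (by nlinarith) (by nlinarith)
    · exact mem_cover_between hh (mem_cover_of_word_line h2) (mem_cover_of_word_line h4)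
        (by nlinarith) (by nlinarith)
  · refine mem_boundary_iff.2 ⟨i, l, ?_⟩
    simp only [Set.Icc.coe_zero, zero_mul, add_zero]
    exact side_L_word_mix_eq_zero h1 h2 r
  · refine mem_boundary_iff.2 ⟨j, l', ?_⟩
    simp only [Set.Icc.coe_one, one_mul, sub_zero, zero_add]
    exact side_L_word_mix_eq_zero h3 h4 r
  · simp only [mix_zero]
  · simp only [mix_one]

/-- With `1 < x < d/c` the geodesic crosses the arc over `[1, d/c]`, which is `R₁(L̃₁)`, not before
the time `t`. So it runs from `L̃₁` to `R₁(L̃₁)`, and straight homotopies relate all such paths. -/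
theorem IsSimpleLasso.mem_HB {x y κ : ℝ} {g : ℝ → ℍ} {q s t : ℝ}
    (h : P.IsSimpleLasso x y κ g q s t) (hq : arcSide P.c P.d (g q) = 0) (hq0 : q ≤ 0)
    (ht0 : 0 ≤ t) (hx : 1 < x) {v : UnitTangent} (hv : HasVelocity g 0 v) :
    P.projTangent v ∈ P.HB 1 := by
  have hd := h.d_eq
  have hc := P.c_pos
  have hd0 := P.d_pos
  obtain ⟨hy1, -⟩ := h.y_mem hq
  have hx2 := h.x_lt hq
  have hdc : P.d / P.c < P.c := (d_div_c_lt_e hd).trans (P.e_lt_f.trans P.f_lt_c)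
  have hB : (x - 1) * (x - P.d / P.c) < 0 := mul_neg_of_pos_of_neg (by linarith) (by linarith)
  have hA : 0 < (y - 1) * (y - P.d / P.c) :=
    mul_pos (by linarith [one_lt_c hd]) (by linarith)
  obtain ⟨T, hT⟩ := h.arc.exists_param (s := (y - 1) * (y - P.d / P.c) /
    -((x - 1) * (x - P.d / P.c))) (div_pos hA (by linarith))
  have hcross : arcSide 1 (P.d / P.c) (g T) = 0 := by
    have e := h.arc.arcSide_mul 1 (P.d / P.c) T
    rw [hT] at e
    have e2 : (x - 1) * (x - P.d / P.c) * ((y - 1) * (y - P.d / P.c) /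
        -((x - 1) * (x - P.d / P.c))) = -((y - 1) * (y - P.d / P.c)) := by
      rw [div_neg, mul_neg, mul_div_cancel₀ _ hB.ne]
    rw [e2, add_neg_cancel] at e
    refine (mul_eq_zero.1 e).resolve_right (ne_of_gt ?_)
    have : 0 < (y - 1) * (y - P.d / P.c) / -((x - 1) * (x - P.d / P.c)) :=
      div_pos hA (by linarith)
    linarith
  have htT : t ≤ T := by
    have h1 := mem_cover_iff.1 (h.mem t ⟨by linarith [h.q_le, h.lt], le_rfl⟩) [1] 1
    have h2 := mul_nonneg h1 (normSq_pos (g t)).le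
    rw [side_L_one_R_one hd] at h2
    have h3 := nonneg_of_mul_nonneg_right h2 (by positivity)
    rw [← h.arc.param_le_iff, hT, le_div_iff₀ (by linarith)]
    have e := h.arc.arcSide_mul 1 (P.d / P.c) t
    have h4 := mul_nonneg h3 (show 0 ≤ 1 + (κ * Real.exp t) ^ 2 by positivity)
    rw [e] at h4
    linarith
  have hT1 : (P.L 1).side (P.word [1] • g T) = 0 := by
    have h2 := side_L_one_R_one hd (g T)
    rw [hcross, mul_zero] at h2
    exact (mul_eq_zero.1 h2).resolve_right (normSq_pos _).ne'
  have hq1 : (P.L 1).side (P.word [] • g q) = 0 := by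
    rw [word_nil, one_smul, P.L_one_side, hq]
  obtain ⟨z, hz, w, hw, hdist⟩ := exists_setDist_eq hd
  obtain ⟨k, hk, hk0, hk1⟩ := exists_isometry_through z w
  have hw1 : (P.L 1).side (P.word [1] • w) = 0 := by
    obtain ⟨w', hw', rfl⟩ := hw
    rw [word_cons, word_nil, mul_one, R_smul_R_smul_pt]
    exact hw'
  have hz1 : (P.L 1).side (P.word [] • z) = 0 := by rw [word_nil, one_smul]; exact hz
  have hqT : q ≤ T := by linarith
  refine ⟨k, hk, hk0 ▸ hz, by rw [hdist, hk1]; exact hw, Or.inl ?_⟩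
  refine ⟨fun r => g (r + q), T - q, isometry_comp_add h.arc.isometry q, by linarith,
    fun r hr => ?_, ?_, ?_, ?_, -q, ⟨by linarith, by linarith⟩, v, ?_, rfl⟩
  · exact mem_cover_between h.arc.isometry (mem_cover_of_word_line hq1)
      (mem_cover_of_word_line hT1) (by linarith [hr.1]) (by linarith [hr.2])
  · simp only [zero_add]; exact mem_boundary_iff.2 ⟨1, _, hq1⟩
  · simp only [sub_add_cancel]; exact mem_boundary_iff.2 ⟨1, _, hT1⟩
  · rw [hdist]
    refine pathHomotopic_of_lines (i := 1) (j := 1) (l := []) (l' := [1])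
      (isometry_comp_add h.arc.isometry q) hk (by linarith) dist_nonneg ?_ ?_ ?_ ?_
    · rw [zero_add]; exact hq1
    · rw [hk0]; exact hz1
    · rw [sub_add_cancel]; exact hT1
    · rw [hk1]; exact hw1
  · exact HasVelocity.comp_add (by rwa [neg_add_cancel])

/-! ### The set `W` and the set `Ω` -/

theorem exists_of_mem_W (hd : P.e * P.f = P.d) {ν : P.UnitTangentBundle} (hν : ν ∈ P.W 2 3) :
    (∃ v ∈ Omega (P.l 2) (P.m 3), P.projTangent v = ν) ∨
      ∃ (v : UnitTangent) (g : ℝ → ℍ) (y κ q : ℝ), IsArc g y 1 κ ∧ g q ∈ P.cover ∧ q ≤ 0 ∧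
        HasVelocity g 0 v ∧ P.projTangent v = ν := by
  obtain ⟨x, y, κ, g, q, s, t, v, h, hq, hv, hvν, hq0, ht0, hst⟩ := exists_isSimpleLasso hd hν
  rcases lt_trichotomy x 1 with hx | rfl | hx
  · left
    have hL := h.isLassoArc hq hx
    exact ⟨v, (mem_omega_iff hd).2 ⟨x, y, κ, g, q, s, t, hL, hq0, hst hL.q_lt, hv⟩, hvν⟩
  · exact Or.inr ⟨v, g, y, κ, q, h.arc, h.mem q h.q_mem, hq0, hv, hvν⟩
  · exact absurd (hvν ▸ h.mem_HB hq hq0 ht0 hx hv) (hν.2 1).2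

theorem bijOn_omega (hd : P.e * P.f = P.d) :
    BijOn P.projTangent (Omega (P.l 2) (P.m 3) ∩ P.projTangent ⁻¹' P.generic)
      (P.W 2 3 ∩ P.generic) := by
  refine ⟨fun v hv => ⟨mapsTo_omega hd hv.1, hv.2⟩, (injOn_omega hd).mono inter_subset_left, ?_⟩
  rintro ν ⟨hW, hg⟩
  rcases exists_of_mem_W hd hW with ⟨v, hv, rfl⟩ | ⟨v, g, y, κ, q, h1, h2, h3, h4, rfl⟩
  · exact ⟨v, ⟨hv, hg⟩, rfl⟩
  · exact absurd hg (not_mem_generic hd h1 h2 h3 h4)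

end ThreeHoledSphere


/-! ### Measurability and invariance of the volume on the unit tangent bundle -/

theorem measurable_pt : Measurable UnitTangent.pt :=
  measurable_fst.comp (comap_measurable fun v : UnitTangent => (v.pt, v.vec))

theorem measurable_vec : Measurable UnitTangent.vec :=
  measurable_snd.comp (comap_measurable fun v : UnitTangent => (v.pt, v.vec))

theorem measurable_unitTangent {α : Type*} [MeasurableSpace α] {f : α → UnitTangent}
    (h1 : Measurable fun a => (f a).pt) (h2 : Measurable fun a => (f a).vec) : Measurable f :=
  measurable_comap_iff.2 (h1.prodMk h2)

theorem measurable_ofAngle : Measurable ofAngle := by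
  refine measurable_unitTangent measurable_fst ?_
  change Measurable fun p : ℍ × ℝ => (p.1.im : ℂ) * Complex.exp (p.2 * Complex.I)
  have h : Continuous fun p : ℍ × ℝ => (p.1.im : ℂ) * Complex.exp (p.2 * Complex.I) := by
    have := UpperHalfPlane.continuous_im
    fun_prop
  exact h.measurable

theorem measurable_smul_unitTangent (g : GL (Fin 2) ℝ) : Measurable fun v : UnitTangent => g • v := by
  refine measurable_unitTangent ?_ ?_
  · exact (continuous_smul_gl g).measurable.comp measurable_pt
  · simp only [smul_vec, denom]
    have h1 : Measurable fun v : UnitTangent => (v.pt : ℂ) := measurable_coe.comp measurable_pt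
    have h2 := measurable_vec
    refine (σ g).continuous.measurable.comp ?_
    fun_prop

/-- On each fibre an orientation preserving isometry is a rotation by the argument of its
derivative. -/
theorem smul_ofAngle {g : GL (Fin 2) ℝ} (hg : 0 < g.det.val) (z : ℍ) (θ : ℝ) :
    g • ofAngle (z, θ) =
      ofAngle (g • z, θ + Complex.arg ((g.det.val : ℂ) / denom g z ^ 2)) := by
  ext
  · rfl
  · rw [smul_vec]
    have hσ : σ g = ContinuousAlgEquiv.refl ℝ ℂ := if_pos hg
    rw [hσ]
    simp only [ofAngle, ContinuousAlgEquiv.refl_apply]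
    push_cast
    rw [add_mul, Complex.exp_add]
    have h := Complex.norm_mul_exp_arg_mul_I ((g.det.val : ℂ) / denom g z ^ 2)
    have h2 : (((g • z : ℍ).im : ℝ) : ℂ) = ‖(g.det.val : ℂ) / denom g z ^ 2‖ * (z.im : ℂ) := by
      rw [norm_div, norm_pow, im_smul_eq_div_normSq, Complex.norm_real, Real.norm_eq_abs,
        Complex.normSq_eq_norm_sq]
      push_cast
      ring
    rw [h2]
    nth_rewrite 1 [← h]
    ring

theorem ofAngle_add_two_pi (z : ℍ) (θ : ℝ) (n : ℤ) :
    ofAngle (z, n • (2 * Real.pi) + θ) = ofAngle (z, θ) := by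
  ext
  · rfl
  · simp only [ofAngle]
    congr 1
    rw [Complex.exp_eq_exp_iff_exists_int]
    refine ⟨n, ?_⟩
    simp
    ring

theorem volume_preimage_add_of_periodic {A : Set ℝ} (hA : MeasurableSet A)
    (hp : ∀ (n : ℤ) (θ : ℝ), n • (2 * Real.pi) + θ ∈ A ↔ θ ∈ A) (φ : ℝ) :
    (volume.restrict (Ioc 0 (2 * Real.pi))) ((fun θ => θ + φ) ⁻¹' A) =
      (volume.restrict (Ioc 0 (2 * Real.pi))) A := by
  have h2 : (0 : ℝ) < 2 * Real.pi := by positivity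
  rw [Measure.restrict_apply hA, Measure.restrict_apply (measurable_add_const φ hA)]
  have h3 : (fun θ => θ + φ) ⁻¹' A ∩ Ioc 0 (2 * Real.pi) =
      (fun θ => θ + φ) ⁻¹' (A ∩ Ioc φ (φ + 2 * Real.pi)) := by
    ext θ
    simp only [mem_inter_iff, mem_preimage, mem_Ioc]
    constructor
    · rintro ⟨h, h', h''⟩
      exact ⟨h, by linarith, by linarith⟩
    · rintro ⟨h, h', h''⟩
      exact ⟨h, by linarith, by linarith⟩
  rw [h3, measure_preimage_add_right]
  have h4 := isAddFundamentalDomain_Ioc h2 φ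
  have h5 := isAddFundamentalDomain_Ioc h2 0
  rw [zero_add] at h5
  refine h4.measure_set_eq h5 hA ?_
  rintro ⟨_, n, rfl⟩
  ext θ
  exact hp n θ

theorem liouville_apply {s : Set UnitTangent} (hs : MeasurableSet s) :
    liouville s = ∫⁻ z : ℍ, (volume.restrict (Ioc 0 (2 * Real.pi))) {θ | ofAngle (z, θ) ∈ s} := by
  rw [liouville, Measure.map_apply measurable_ofAngle hs,
    Measure.prod_apply (measurable_ofAngle hs)]
  rfl

/-- Integrate over the fibres: rotations preserve the measure of periodic sets of angles, and the
isometry preserves the hyperbolic area. -/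
theorem liouville_preimage_smul {g : GL (Fin 2) ℝ} (hg : 0 < g.det.val) {s : Set UnitTangent}
    (hs : MeasurableSet s) : liouville ((fun v => g • v) ⁻¹' s) = liouville s := by
  rw [liouville_apply hs, liouville_apply (measurable_smul_unitTangent g hs)]
  have hm : ∀ z : ℍ, MeasurableSet {θ : ℝ | ofAngle (z, θ) ∈ s} := fun z =>
    (measurable_ofAngle.comp measurable_prodMk_left) hs
  have h : ∀ z : ℍ, (volume.restrict (Ioc 0 (2 * Real.pi)))
      {θ | ofAngle (z, θ) ∈ (fun v => g • v) ⁻¹' s} =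
      (volume.restrict (Ioc 0 (2 * Real.pi))) {θ | ofAngle (g • z, θ) ∈ s} := by
    intro z
    rw [← volume_preimage_add_of_periodic (hm (g • z)) (fun n θ => ?_)
      (Complex.arg ((g.det.val : ℂ) / denom g z ^ 2))]
    · congr 1
      ext θ
      simp only [mem_preimage, mem_ofPred_eq, smul_ofAngle hg]
    · simp only [mem_ofPred_eq, ofAngle_add_two_pi]
  simp_rw [h]
  exact (measurePreserving_smul g (volume : Measure ℍ)).lintegral_comp
    (f := fun z => (volume.restrict (Ioc 0 (2 * Real.pi))) {θ | ofAngle (z, θ) ∈ s})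
    (measurable_measure_prodMk_left (measurable_ofAngle hs))

theorem liouville_eq_zero_of_forall {s : Set UnitTangent} (hs : MeasurableSet s)
    (h : ∀ z : ℍ, {θ : ℝ | ofAngle (z, θ) ∈ s}.Countable) : liouville s = 0 := by
  rw [liouville_apply hs, lintegral_eq_zero_of_ae_eq_zero]
  exact Eventually.of_forall fun z => (h z).measure_zero _

theorem liouville_preimage_pt_eq_zero {A : Set ℍ} (hA : MeasurableSet A) (h : volume A = 0) :
    liouville (UnitTangent.pt ⁻¹' A) = 0 := by
  rw [liouville_apply (measurable_pt hA), lintegral_eq_zero_of_ae_eq_zero]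
  have h0 : ∀ᵐ z : ℍ, z ∉ A := measure_eq_zero_iff_ae_notMem.1 h
  filter_upwards [h0] with z hz
  have : {θ : ℝ | ofAngle (z, θ) ∈ UnitTangent.pt ⁻¹' A} = ∅ :=
    eq_empty_of_forall_notMem fun θ hθ => hz hθ
  rw [this]
  simp

theorem Wall.volume_line_eq_zero (w : Wall) (ha : w.a ≠ 0) : volume w.line = 0 := by
  have h0 : volume (((↑) : ℍ → ℂ) '' w.line) = 0 := by
    refine measure_mono_null ?_ (Measure.addHaar_sphere (volume : Measure ℂ) ((w.b / w.a : ℝ) : ℂ)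
      (Real.sqrt (w.b ^ 2 - w.a * w.c) / |w.a|))
    rintro _ ⟨z, hz, rfl⟩
    have hz' : w.a * Complex.normSq z - 2 * w.b * z.re + w.c = 0 := hz
    rw [mem_sphere_iff_norm, ← Real.sqrt_sq (norm_nonneg _), ← Complex.normSq_eq_norm_sq,
      ← Real.sqrt_sq_eq_abs, ← Real.sqrt_div w.disc_pos.le]
    congr 1
    rw [eq_div_iff (pow_ne_zero 2 ha)]
    simp only [Complex.normSq_apply, Complex.sub_re, Complex.sub_im, Complex.ofReal_re,
      Complex.ofReal_im, coe_re, coe_im] at hz' ⊢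
    have h1 : w.b / w.a * w.a = w.b := div_mul_cancel₀ _ ha
    linear_combination w.a * hz' + (w.b / w.a * w.a + w.b - 2 * w.a * z.re) * h1
  rw [volume_eq_lintegral]
  exact setLIntegral_measure_zero _ _ h0


namespace ThreeHoledSphere

open scoped Pointwise

variable {P : ThreeHoledSphere}

/-! ### The volume on `S(P)` -/

/-- The group of deck transformations, acting faithfully on the unit tangent bundle. -/
def deckPerm (P : ThreeHoledSphere) : Subgroup (Equiv.Perm UnitTangent) :=
  P.Γ.map (MulAction.toPermHom (GL (Fin 2) ℝ) UnitTangent)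

theorem exists_smul_eq_of_deckPerm (g : P.deckPerm) :
    ∃ k ∈ P.Γ, ∀ v : UnitTangent, g • v = k • v := by
  obtain ⟨_, k, hk, rfl⟩ := g
  exact ⟨k, hk, fun _ => rfl⟩

theorem exists_deckPerm_smul_eq {k : GL (Fin 2) ℝ} (hk : k ∈ P.Γ) :
    ∃ g : P.deckPerm, ∀ v : UnitTangent, g • v = k • v :=
  ⟨⟨_, k, hk, rfl⟩, fun _ => rfl⟩

theorem deckPerm_eq_one {g : P.deckPerm} {k : GL (Fin 2) ℝ} (hk : ∀ v : UnitTangent, g • v = k • v)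
    (h : ActEq k 1) : g = 1 := by
  ext1
  refine Equiv.ext fun v => ?_
  exact (hk v).trans ((h v).trans (one_smul _ v))

instance countable_deckPerm : Countable P.deckPerm := by
  have h : ∀ g : P.deckPerm, ∃ l : List (ZMod 3), ∀ v : UnitTangent, g • v = P.word l • v := by
    intro g
    obtain ⟨k, hk, h⟩ := exists_smul_eq_of_deckPerm g
    obtain ⟨l, -, -, hl⟩ := exists_word_of_mem_Γ hk
    exact ⟨l, fun v => (h v).trans (hl v)⟩
  choose f hf using h
  refine Function.Injective.countable (f := f) fun g g' hgg => ?_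
  ext1
  refine Equiv.ext fun v => ?_
  exact (hf g v).trans ((by rw [hgg] : P.word (f g) • v = P.word (f g') • v).trans (hf g' v).symm)

instance measurableConstSMul_deckPerm : MeasurableConstSMul P.deckPerm UnitTangent where
  measurable_const_smul g := by
    obtain ⟨k, -, h⟩ := exists_smul_eq_of_deckPerm g
    rw [funext h]
    exact measurable_smul_unitTangent k

/-- The unit tangent bundle of `P̃`. -/
def tangentCover (P : ThreeHoledSphere) : Set UnitTangent := {v | v.pt ∈ P.cover}

/-- The unit tangent vectors at the points of the two hexagons `Q` and `R₃(Q)`. -/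
def tangentHexagons (P : ThreeHoledSphere) : Set UnitTangent :=
  {v | v.pt ∈ P.Q ∨ P.R 3 • v.pt ∈ P.Q}

theorem measurableSet_tangentCover : MeasurableSet P.tangentCover := by
  have h : P.tangentCover = ⋂ (l : List (ZMod 3)) (i : ZMod 3),
      UnitTangent.pt ⁻¹' {z | 0 ≤ (P.L i).side (P.word l • z)} := by
    ext v
    simp only [tangentCover, mem_ofPred_eq, mem_cover_iff, mem_iInter, mem_preimage]
  rw [h]
  refine MeasurableSet.iInter fun l => MeasurableSet.iInter fun i => measurable_pt ?_
  exact (isClosed_le continuous_const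
    ((P.L i).continuous_side.comp (continuous_smul_gl _))).measurableSet

theorem isClosed_Q (P : ThreeHoledSphere) : IsClosed P.Q := by
  have h : P.Q = ⋂ i, ({z | 0 ≤ (P.L i).side z} ∩ {z | 0 ≤ (P.M i).side z}) := by
    ext z
    simp [Q]
  rw [h]
  exact isClosed_iInter fun i => (isClosed_le continuous_const (P.L i).continuous_side).inter
    (isClosed_le continuous_const (P.M i).continuous_side)

theorem measurableSet_tangentHexagons : MeasurableSet P.tangentHexagons :=
  (measurable_pt P.isClosed_Q.measurableSet).union
    (measurable_pt (P.isClosed_Q.preimage (continuous_smul_gl (P.R 3))).measurableSet)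

theorem tangentHexagons_subset : P.tangentHexagons ⊆ P.tangentCover := by
  rintro v (h | h)
  · exact ⟨1, one_mem _, by rwa [one_smul]⟩
  · exact ⟨P.R 3, Subgroup.subset_closure ⟨3, rfl⟩, h⟩

theorem smul_mem_tangentCover_iff (g : P.deckPerm) (v : UnitTangent) :
    g • v ∈ P.tangentCover ↔ v ∈ P.tangentCover := by
  obtain ⟨k, hk, h⟩ := exists_smul_eq_of_deckPerm g
  rw [h]
  exact smul_mem_cover_iff hk

instance smulInvariantMeasure_deckPerm :
    SMulInvariantMeasure P.deckPerm UnitTangent (liouville.restrict P.tangentCover) where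
  measure_preimage_smul g s hs := by
    obtain ⟨k, hk, h⟩ := exists_smul_eq_of_deckPerm g
    rw [Measure.restrict_apply hs, Measure.restrict_apply (measurable_const_smul g hs),
      ← liouville_preimage_smul (det_pos_of_mem_Γ hk) (hs.inter measurableSet_tangentCover)]
    congr 1
    ext v
    simp only [mem_inter_iff, mem_preimage, ← h, smul_mem_tangentCover_iff]

theorem M_a_ne_zero (P : ThreeHoledSphere) (i : ZMod 3) : (P.M i).a ≠ 0 := by
  rcases zmod3_cases i with rfl | rfl | rfl
  · norm_num [M]
  · norm_num [M]
  · exact P.M_two_a_pos.ne'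

theorem liouville_M_line (P : ThreeHoledSphere) (i : ZMod 3) (k : GL (Fin 2) ℝ) :
    liouville {v | (P.M i).side (k • v.pt) = 0} = 0 := by
  have h1 : MeasurableSet (P.M i).line :=
    (isClosed_eq (P.M i).continuous_side continuous_const).measurableSet
  refine liouville_preimage_pt_eq_zero (A := (fun z => k • z) ⁻¹' (P.M i).line)
    ((continuous_smul_gl k).measurable h1) ?_
  rw [(measurePreserving_smul k (volume : Measure ℍ)).measure_preimage h1.nullMeasurableSet]
  exact (P.M i).volume_line_eq_zero (P.M_a_ne_zero i)

theorem exists_word_mem_Q_of_tangentHexagons {v : UnitTangent} (hv : v ∈ P.tangentHexagons) :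
    ∃ l : List (ZMod 3), (l = [] ∨ l = [0]) ∧ P.word l • v.pt ∈ P.Q := by
  rcases hv with h | h
  · exact ⟨[], Or.inl rfl, by simpa using h⟩
  · exact ⟨[0], Or.inr rfl, by simpa [show (3 : ZMod 3) = 0 from rfl] using h⟩

/-- Folding by `R₀` moves both base points into `Q`, so the reduced word between them is empty or
one reflection whose wall contains the point. An empty word forces, by parity, the same folding on
both sides, and hence a trivial action. -/
theorem exists_side_eq_zero_of_tangentHexagons {v : UnitTangent} (hv : v ∈ P.tangentHexagons)
    {k : GL (Fin 2) ℝ} (hk : k ∈ P.Γ) (hkv : k • v ∈ P.tangentHexagons) (h1 : ¬ ActEq k 1) :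
    ∃ i, (P.M i).side v.pt = 0 ∨ (P.M i).side (P.R 0 • v.pt) = 0 := by
  obtain ⟨δ, hδ, hz⟩ := exists_word_mem_Q_of_tangentHexagons hv
  obtain ⟨δ', hδ', hz'⟩ := exists_word_mem_Q_of_tangentHexagons hkv
  obtain ⟨l, -, l2, l3⟩ := exists_word_of_mem_Γ hk
  obtain ⟨m, m1, m2, m3, -⟩ := P.exists_reduced (δ' ++ l ++ δ)
  have hinv : ∀ z : ℍ, P.word δ • P.word δ • z = z := by
    intro z
    rcases hδ with rfl | rfl
    · simp
    · simpa using P.R_smul_R_smul_pt 0 z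
  have e1 : P.word m • P.word δ • v.pt = P.word δ' • k • v.pt := by
    rw [← m2.pt, word_append, word_append, mul_smul, mul_smul, hinv, l3.pt]
  rcases word_eq_of_mem_E m1 (fun i => (hz i).2)
    (show P.word m • P.word δ • v.pt ∈ P.E from e1 ▸ fun i => (hz' i).2) with rfl | ⟨i, -, hi⟩
  · exfalso
    rw [List.length_append, List.length_append] at m3
    have h4 := m3.1 (by simp)
    have hδδ : δ = δ' := by
      rcases hδ with rfl | rfl <;> rcases hδ' with rfl | rfl <;> simp [Nat.even_add, l2] at h4 ⊢
    subst hδδ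
    apply h1
    intro w
    rw [l3 w, one_smul]
    have h5 := m2 (P.word δ • w)
    rw [word_append, word_append, mul_smul, mul_smul, word_nil, one_smul] at h5
    rcases hδ with rfl | rfl
    · simpa using h5
    · simp only [word_cons, word_nil, mul_one, R_smul_R_smul] at h5
      exact MulAction.injective (P.R 0) h5
  · refine ⟨i, ?_⟩
    rcases hδ with rfl | rfl
    · left; simpa using hi
    · right; simpa using hi

theorem exists_deckPerm_smul_mem {v : UnitTangent} (hv : v ∈ P.tangentCover) :
    ∃ g : P.deckPerm, g • v ∈ P.tangentHexagons := by
  obtain ⟨r, hr, hQ⟩ := hv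
  obtain ⟨l, hl, -⟩ := exists_word_of_mem_closure hr
  rw [hl.pt] at hQ
  rcases Nat.even_or_odd l.length with he | ho
  · obtain ⟨k, hk, h⟩ := P.exists_mem_Γ_of_even he
    obtain ⟨g, hg⟩ := exists_deckPerm_smul_eq hk
    refine ⟨g, Or.inl ?_⟩
    rwa [hg, smul_pt, h.pt]
  · obtain ⟨k, hk, h⟩ := P.exists_mem_Γ_of_even (l := 0 :: l) (by
      rw [List.length_cons]; exact ho.add_one)
    obtain ⟨g, hg⟩ := exists_deckPerm_smul_eq hk
    refine ⟨g, Or.inr ?_⟩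
    rw [hg, smul_pt, h.pt, word_cons, mul_smul]
    rwa [show (3 : ZMod 3) = 0 from rfl, R_smul_R_smul_pt]

theorem isFundamentalDomain_tangentHexagons :
    IsFundamentalDomain P.deckPerm P.tangentHexagons (liouville.restrict P.tangentCover) := by
  refine IsFundamentalDomain.mk'' measurableSet_tangentHexagons.nullMeasurableSet ?_ ?_
    fun g => (measurePreserving_smul g _).quasiMeasurePreserving
  · filter_upwards [ae_restrict_mem measurableSet_tangentCover] with v hv
    exact exists_deckPerm_smul_mem hv
  · intro g hg
    refine Measure.absolutelyContinuous_of_le Measure.restrict_le_self ?_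
    refine measure_mono_null (t := ⋃ i, ({v | (P.M i).side ((1 : GL (Fin 2) ℝ) • v.pt) = 0} ∪
      {v | (P.M i).side (P.R 0 • v.pt) = 0})) ?_ ?_
    · rintro v ⟨h1, h2⟩
      rw [mem_smul_set_iff_inv_smul_mem] at h1
      obtain ⟨k, hk, h⟩ := exists_smul_eq_of_deckPerm g⁻¹
      rw [h] at h1
      obtain ⟨i, hi⟩ := exists_side_eq_zero_of_tangentHexagons h2 hk h1
        fun h3 => hg (inv_eq_one.1 (deckPerm_eq_one h h3))
      rw [mem_iUnion]
      exact ⟨i, by simpa using hi⟩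
    · exact measure_iUnion_null fun i =>
        measure_union_null (P.liouville_M_line i 1) (P.liouville_M_line i _)

theorem measurable_projTangent : Measurable P.projTangent := measurable_quotient_mk''

theorem preimage_image_projTangent (A : Set UnitTangent) :
    P.projTangent ⁻¹' (P.projTangent '' A) = ⋃ g : P.deckPerm, g • A := by
  ext v
  simp only [mem_preimage, mem_image, mem_iUnion, mem_smul_set]
  constructor
  · rintro ⟨a, ha, h⟩
    obtain ⟨k, hk, rfl⟩ := projTangent_eq_iff.1 h.symm
    obtain ⟨g, hg⟩ := exists_deckPerm_smul_eq hk
    exact ⟨g, a, ha, hg a⟩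
  · rintro ⟨g, a, ha, rfl⟩
    obtain ⟨k, hk, h⟩ := exists_smul_eq_of_deckPerm g
    exact ⟨a, ha, by rw [h, projTangent_smul hk]⟩

theorem volumeSP_image {A : Set UnitTangent} (hA : MeasurableSet A) :
    P.volumeSP (P.projTangent '' A) = liouville ((⋃ g : P.deckPerm, g • A) ∩ P.tangentHexagons) := by
  have h1 : MeasurableSet (⋃ g : P.deckPerm, g • A) :=
    MeasurableSet.iUnion fun g => hA.const_smul g
  have h2 : MeasurableSet (P.projTangent '' A) := by
    refine measurableSet_quotient.2 ?_
    change MeasurableSet (P.projTangent ⁻¹' _)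
    rwa [preimage_image_projTangent]
  rw [volumeSP, Measure.map_apply measurable_projTangent h2, preimage_image_projTangent,
    Measure.restrict_apply h1]
  rfl

theorem volumeSP_image_eq_zero {A : Set UnitTangent} (hA : MeasurableSet A) (h : liouville A = 0) :
    P.volumeSP (P.projTangent '' A) = 0 := by
  rw [volumeSP_image hA]
  refine measure_mono_null inter_subset_left (measure_iUnion_null fun g => ?_)
  obtain ⟨k, hk, hg⟩ := exists_smul_eq_of_deckPerm g⁻¹
  rw [← liouville_preimage_smul (det_pos_of_mem_Γ hk) hA] at h
  rw [← h]
  congr 1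
  ext v
  rw [mem_smul_set_iff_inv_smul_mem, hg, mem_preimage]

/-- Injectivity and freeness make the translates of `A` pairwise disjoint. Summing the volumes of
their parts in the fundamental domain gives the volume of `A`. -/
theorem volumeSP_image_of_injOn {A : Set UnitTangent} (hA : MeasurableSet A)
    (hAC : A ⊆ P.tangentCover) (hinj : InjOn P.projTangent A) :
    P.volumeSP (P.projTangent '' A) = liouville A := by
  have hdisj : Pairwise (Function.onFun Disjoint fun g : P.deckPerm => g • A ∩ P.tangentHexagons) := by
    intro g g' hgg
    refine (disjoint_left.2 ?_).mono inter_subset_left inter_subset_left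
    rintro _ ⟨a, ha, rfl⟩ ⟨a', ha', h⟩
    apply hgg
    have e1 : a' = (g'⁻¹ * g) • a := by
      simp only at h
      rw [mul_smul, ← h, inv_smul_smul]
    obtain ⟨k, hk, hk'⟩ := exists_smul_eq_of_deckPerm (g'⁻¹ * g)
    have e2 : a' = a := hinj ha' ha (by rw [e1, hk', projTangent_smul hk])
    have e3 : k • a.pt = a.pt := by
      rw [← smul_pt, ← hk', ← e1, e2]
    exact (inv_mul_eq_one.1 (deckPerm_eq_one hk' (actEq_one_of_smul_eq hk e3))).symm
  have hm : ∀ g : P.deckPerm, MeasurableSet (g • A ∩ P.tangentHexagons) := fun g =>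
    (hA.const_smul g).inter measurableSet_tangentHexagons
  rw [volumeSP_image hA, iUnion_inter, measure_iUnion hdisj hm]
  have h1 := (isFundamentalDomain_tangentHexagons (P := P)).measure_eq_tsum A
  rw [Measure.restrict_apply hA, inter_eq_left.2 hAC] at h1
  rw [h1]
  refine tsum_congr fun g => ?_
  rw [Measure.restrict_apply (hm g),
    inter_eq_left.2 (inter_subset_right.trans tangentHexagons_subset)]

end ThreeHoledSphere


/-! ### End points of the geodesic of a unit tangent vector -/

/-- The end point at `+∞` of the geodesic of a unit tangent vector that points to the left. -/
def forwardEnd (v : UnitTangent) : ℝ := v.pt.re + v.pt.im * (v.vec.im + v.pt.im) / v.vec.re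

/-- The end point at `-∞` of the geodesic of a unit tangent vector that points to the left. -/
def backwardEnd (v : UnitTangent) : ℝ := v.pt.re + v.pt.im * (v.vec.im - v.pt.im) / v.vec.re

theorem IsArc.vec_re_neg {g : ℝ → ℍ} {y x κ : ℝ} (h : IsArc g y x κ) {v : UnitTangent}
    (hv : HasVelocity g 0 v) : v.vec.re < 0 := by
  rw [hv.2.unique (h.hasDerivAt_coe 0)]
  have h1 := h.pos
  have h2 := sub_pos.2 h.lt
  simp only [Real.exp_zero, mul_one]
  rw [neg_div]
  exact neg_neg_of_pos (by positivity)

theorem IsArc.ends_eq {g : ℝ → ℍ} {y x κ : ℝ} (h : IsArc g y x κ) {v : UnitTangent}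
    (hv : HasVelocity g 0 v) : forwardEnd v = x ∧ backwardEnd v = y := by
  have hneg := h.vec_re_neg hv
  have hne := hneg.ne
  have h1 := h.pos
  have h4 : (1 + κ ^ 2) ≠ 0 := by positivity
  have e1 := h.re_eq 0
  have e2 := h.im_eq 0
  rw [hv.1] at e1 e2
  have e3 := hv.2.unique (h.hasDerivAt_coe 0)
  have e4 := congrArg Complex.re e3
  have e5 := congrArg Complex.im e3
  simp only [Real.exp_zero, mul_one] at e1 e2 e4 e5
  have f1 : (x - v.pt.re) * v.vec.re = v.pt.im * (v.vec.im + v.pt.im) := by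
    rw [e1, e2, e4, e5]; field_simp; ring
  have f2 : (y - v.pt.re) * v.vec.re = v.pt.im * (v.vec.im - v.pt.im) := by
    rw [e1, e2, e4, e5]; field_simp; ring
  rw [forwardEnd, backwardEnd, ← f1, ← f2, mul_div_cancel_right₀ _ hne, mul_div_cancel_right₀ _ hne]
  constructor <;> ring

/-- The parameter `κ` at time `0` is the tangent of half an angle determined by the direction; then
the end points are `Re z + κ Im z` and `Re z - Im z / κ`. -/
theorem exists_isArc_of_vec_re_neg {v : UnitTangent} (hv : v.vec.re < 0) :
    ∃ (g : ℝ → ℍ) (y x κ : ℝ), IsArc g y x κ ∧ HasVelocity g 0 v := by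
  obtain ⟨z, w, hw⟩ := v
  simp only at hv
  have hY := z.im_pos
  have hsq : w.re ^ 2 + w.im ^ 2 = z.im ^ 2 := by
    rw [← hw, Complex.sq_norm, Complex.normSq_apply]; ring
  have h1 : 0 < z.im - w.im := by nlinarith [mul_pos_of_neg_of_neg hv hv]
  obtain ⟨κ, hκ⟩ : ∃ κ, κ = (z.im - w.im) / (-w.re) := ⟨_, rfl⟩
  have hκ0 : 0 < κ := by rw [hκ]; exact div_pos h1 (by linarith)
  have k1 : κ * w.re = w.im - z.im := by
    rw [hκ, div_mul_eq_mul_div, div_eq_iff (by linarith)]; ring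
  have k2 : (1 + κ ^ 2) * w.re = -(2 * κ * z.im) := by
    have : w.re * ((1 + κ ^ 2) * w.re + 2 * κ * z.im) = 0 := by
      linear_combination (κ * w.re + (w.im - z.im) + 2 * z.im) * k1 + hsq
    have := (mul_eq_zero.1 this).resolve_left hv.ne
    linarith
  have k3 : (1 + κ ^ 2) * w.im = z.im * (1 - κ ^ 2) := by
    linear_combination κ * k2 - (1 + κ ^ 2) * k1
  have hlt : z.re - z.im / κ < z.re + z.im * κ := by
    have : 0 < z.im / κ := by positivity
    have : 0 < z.im * κ := by positivity
    linarith
  obtain ⟨g, hg⟩ := exists_isArc hlt hκ0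
  have hκne := hκ0.ne'
  have h4 : (1 + κ ^ 2) ≠ 0 := by positivity
  have hsub : z.re + z.im * κ - (z.re - z.im / κ) = z.im * (1 + κ ^ 2) / κ := by
    field_simp; ring
  have hpt : g 0 = z := by
    apply UpperHalfPlane.ext_re_im
    · rw [hg.re_eq, Real.exp_zero, mul_one]; field_simp; ring
    · rw [hg.im_eq, Real.exp_zero, mul_one, hsub]; field_simp
  refine ⟨g, _, _, κ, hg, hpt, (hg.hasDerivAt_coe 0).congr_deriv ?_⟩
  rw [hsub, Real.exp_zero, mul_one]
  apply Complex.ext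
  · simp only
    field_simp
    linarith
  · simp only
    field_simp
    linarith

theorem measurable_im_pt : Measurable fun v : UnitTangent => v.pt.im :=
  UpperHalfPlane.continuous_im.measurable.comp measurable_pt

theorem measurable_re_pt : Measurable fun v : UnitTangent => v.pt.re :=
  UpperHalfPlane.continuous_re.measurable.comp measurable_pt

theorem measurable_re_vec : Measurable fun v : UnitTangent => v.vec.re :=
  Complex.measurable_re.comp measurable_vec

theorem measurable_im_vec : Measurable fun v : UnitTangent => v.vec.im :=
  Complex.measurable_im.comp measurable_vec

theorem measurable_forwardEnd : Measurable forwardEnd :=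
  measurable_re_pt.add ((measurable_im_pt.mul (measurable_im_vec.add measurable_im_pt)).div
    measurable_re_vec)

theorem measurable_backwardEnd : Measurable backwardEnd :=
  measurable_re_pt.add ((measurable_im_pt.mul (measurable_im_vec.sub measurable_im_pt)).div
    measurable_re_vec)

theorem countable_cos_sin (a b : ℝ) : {θ : ℝ | Real.cos θ = a ∧ Real.sin θ = b}.Countable := by
  rcases eq_empty_or_nonempty {θ : ℝ | Real.cos θ = a ∧ Real.sin θ = b} with h | ⟨θ, h1, h2⟩
  · rw [h]; exact countable_empty
  · refine (countable_range fun n : ℤ => θ + 2 * Real.pi * n).mono ?_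
    rintro ψ ⟨h3, h4⟩
    have := Real.Angle.cos_sin_inj (h3.trans h1.symm) (h4.trans h2.symm)
    obtain ⟨n, hn⟩ := Real.Angle.angle_eq_iff_two_pi_dvd_sub.1 this
    exact ⟨n, by simp only; linarith⟩

/-- At each base point the condition reads `b cos θ = sin θ + 1` with `b` fixed. Together with `cos
θ ≠ 0` this determines `cos θ` and `sin θ`, so only countably many angles remain. -/
theorem liouville_forwardEnd_eq (a : ℝ) :
    liouville {v | v.vec.re < 0 ∧ forwardEnd v = a} = 0 := by
  refine liouville_eq_zero_of_forall ((measurableSet_lt measurable_re_vec measurable_const).inter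
    (measurableSet_eq_fun measurable_forwardEnd measurable_const)) fun z => ?_
  have hY := z.im_pos
  obtain ⟨b, hb⟩ : ∃ b, b = (a - z.re) / z.im := ⟨_, rfl⟩
  have hb' : b * z.im = a - z.re := by rw [hb, div_mul_cancel₀ _ hY.ne']
  refine (countable_cos_sin (2 * b / (1 + b ^ 2)) (b * (2 * b / (1 + b ^ 2)) - 1)).mono ?_
  rintro θ ⟨h1, h2⟩
  have e1 : (ofAngle (z, θ)).vec.re = z.im * Real.cos θ := by
    simp [ofAngle, Complex.exp_ofReal_mul_I_re]
  have e2 : (ofAngle (z, θ)).vec.im = z.im * Real.sin θ := by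
    simp [ofAngle, Complex.exp_ofReal_mul_I_im]
  have e3 : (ofAngle (z, θ)).pt = z := rfl
  rw [e1] at h1
  rw [forwardEnd, e1, e2, e3] at h2
  have hcos : Real.cos θ < 0 := by
    by_contra! h
    have := mul_nonneg hY.le h
    linarith
  have h3 : b * Real.cos θ = Real.sin θ + 1 := by
    have e4 : z.im * (z.im * Real.sin θ + z.im) / (z.im * Real.cos θ) = b * z.im := by linarith
    rw [div_eq_iff h1.ne] at e4
    have hne : z.im * z.im ≠ 0 := by positivity
    apply mul_left_cancel₀ hne
    linear_combination -e4
  have h4 : Real.cos θ = 2 * b / (1 + b ^ 2) := by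
    rw [eq_div_iff (by positivity)]
    apply mul_left_cancel₀ hcos.ne
    linear_combination (b * Real.cos θ + Real.sin θ - 1) * h3 + Real.sin_sq_add_cos_sq θ
  refine ⟨h4, ?_⟩
  rw [← h4]
  linarith

/-! ### Measurability of `Ω` and the volumes. -/

namespace ThreeHoledSphere

variable {P : ThreeHoledSphere}

theorem IsLassoArc.nonneg_iff {x y κ : ℝ} {g : ℝ → ℍ} {q s t : ℝ}
    (h : P.IsLassoArc x y κ g q s t) :
    0 ≤ s + t ↔ x * y ≤ (g 0).re ^ 2 + (g 0).im ^ 2 := by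
  obtain ⟨p, hp, hst⟩ := h.exists_tangent_time
  rw [← h.normSq_tangent hp, h.arc.normSq_le_iff h.param.x_pos, hst]
  constructor <;> intro <;> linarith

/-- This removes the quantifiers over geodesics and times, so that `Ω` is visibly measurable. -/
theorem mem_omega_iff_ends (hd : P.e * P.f = P.d) {v : UnitTangent} :
    v ∈ Omega (P.l 2) (P.m 3) ↔ v.vec.re < 0 ∧ (0 < forwardEnd v ∧ forwardEnd v < 1) ∧
      (P.c < backwardEnd v ∧ backwardEnd v < P.d) ∧ 0 ≤ arcSide P.c P.d v.pt ∧
      forwardEnd v * backwardEnd v ≤ v.pt.re ^ 2 + v.pt.im ^ 2 := by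
  rw [mem_omega_iff hd]
  constructor
  · rintro ⟨x, y, κ, g, q, s, t, h, hq, hst, hv⟩
    obtain ⟨rfl, rfl⟩ := h.arc.ends_eq hv
    refine ⟨h.arc.vec_re_neg hv, ⟨h.param.x_pos, h.param.x_lt⟩, ⟨h.param.c_lt, h.param.lt_d⟩, ?_, ?_⟩
    · rw [← hv.1]; exact (h.cross_iff 0).2 hq
    · rw [← hv.1]; exact h.nonneg_iff.1 hst
  · rintro ⟨h1, ⟨h2, h3⟩, ⟨h4, h5⟩, h6, h7⟩
    obtain ⟨g, y, x, κ, hg, hv⟩ := exists_isArc_of_vec_re_neg h1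
    obtain ⟨rfl, rfl⟩ := hg.ends_eq hv
    obtain ⟨q, s, t, h⟩ := IsParam.exists_isLassoArc ⟨hd, h2, h3, h4, h5⟩ hg
    rw [← hv.1] at h6 h7
    exact ⟨_, _, κ, g, q, s, t, h, (h.cross_iff 0).1 h6, h.nonneg_iff.2 h7, hv⟩

theorem measurableSet_omega (hd : P.e * P.f = P.d) : MeasurableSet (Omega (P.l 2) (P.m 3)) := by
  have h : Omega (P.l 2) (P.m 3) = {v | v.vec.re < 0} ∩ ({v | 0 < forwardEnd v ∧ forwardEnd v < 1} ∩
      ({v | P.c < backwardEnd v ∧ backwardEnd v < P.d} ∩ ({v | 0 ≤ arcSide P.c P.d v.pt} ∩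
      {v | forwardEnd v * backwardEnd v ≤ v.pt.re ^ 2 + v.pt.im ^ 2}))) := by
    ext v
    exact mem_omega_iff_ends hd
  rw [h]
  have h1 := measurable_re_pt
  have h2 := measurable_im_pt
  have h3 := measurable_forwardEnd
  have h4 := measurable_backwardEnd
  refine (measurableSet_lt measurable_re_vec measurable_const).inter
    (((measurableSet_lt measurable_const h3).inter (measurableSet_lt h3 measurable_const)).inter
    (((measurableSet_lt measurable_const h4).inter (measurableSet_lt h4 measurable_const)).inter
    (MeasurableSet.inter (measurableSet_le measurable_const ?_) (measurableSet_le (h3.mul h4) ?_))))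
  · unfold arcSide
    fun_prop
  · fun_prop

/-- What `Ω` misses are geodesics that end at `1`, and these form a null set. -/
theorem volumeSP_W_diff (hd : P.e * P.f = P.d) :
    P.volumeSP (P.W 2 3 \ P.projTangent '' Omega (P.l 2) (P.m 3)) = 0 := by
  refine measure_mono_null (t := P.projTangent '' {v | v.vec.re < 0 ∧ forwardEnd v = 1}) ?_
    (volumeSP_image_eq_zero ((measurableSet_lt measurable_re_vec measurable_const).inter
      (measurableSet_eq_fun measurable_forwardEnd measurable_const)) (liouville_forwardEnd_eq 1))
  rintro ν ⟨h1, h2⟩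
  rcases exists_of_mem_W hd h1 with ⟨v, hv, h⟩ | ⟨v, g, y, κ, q, hg, -, -, hv, h⟩
  · exact (h2 ⟨v, hv, h⟩).elim
  · exact ⟨v, ⟨hg.vec_re_neg hv, (hg.ends_eq hv).1⟩, h⟩

theorem volumeSP_W (hd : P.e * P.f = P.d) :
    P.volumeSP (P.W 2 3) = liouville (Omega (P.l 2) (P.m 3)) := by
  rw [← volumeSP_image_of_injOn (measurableSet_omega hd) (fun v hv => omega_mem_cover hd hv)
    (injOn_omega hd)]
  refine le_antisymm ?_ (measure_mono (mapsTo_omega hd).image_subset)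
  calc P.volumeSP (P.W 2 3) ≤ P.volumeSP (P.projTangent '' Omega (P.l 2) (P.m 3) ∪
        P.W 2 3 \ P.projTangent '' Omega (P.l 2) (P.m 3)) := measure_mono (by
          rw [union_sdiff_self]; exact subset_union_right)
    _ ≤ _ := (measure_union_le _ _).trans_eq (by rw [volumeSP_W_diff hd, add_zero])

end ThreeHoledSphere

end LassoSet

end

theorem proposition4p8 (P : LassoSet.ThreeHoledSphere)
    (hP : P.deck 2 • ((P.c : ℝ) : OnePoint ℝ) = ((1 : ℝ) : OnePoint ℝ)) :
    (∀ v ∈ LassoSet.Omega (P.l 2) (P.m 3), v.pt ∈ P.cover) ∧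
    Set.InjOn P.projTangent (LassoSet.Omega (P.l 2) (P.m 3)) ∧
    Set.MapsTo P.projTangent (LassoSet.Omega (P.l 2) (P.m 3)) (P.W 2 3) ∧
    Set.BijOn P.projTangent (LassoSet.Omega (P.l 2) (P.m 3) ∩ P.projTangent ⁻¹' P.generic)
      (P.W 2 3 ∩ P.generic) ∧
    P.volumeSP (P.W 2 3 \ P.projTangent '' LassoSet.Omega (P.l 2) (P.m 3)) = 0 ∧
    P.volumeSP (P.W 2 3) = LassoSet.liouville (LassoSet.Omega (P.l 2) (P.m 3)) := by
  have hd := LassoSet.ThreeHoledSphere.mul_eq_d_of_deck hP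
  exact ⟨fun v hv => LassoSet.ThreeHoledSphere.omega_mem_cover hd hv,
    LassoSet.ThreeHoledSphere.injOn_omega hd, LassoSet.ThreeHoledSphere.mapsTo_omega hd,
    LassoSet.ThreeHoledSphere.bijOn_omega hd, LassoSet.ThreeHoledSphere.volumeSP_W_diff hd,
    LassoSet.ThreeHoledSphere.volumeSP_W hd⟩
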